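/- **Setting.** Let $\Sigma=S^2=\mathbb C\cup\{\infty\}$ be the Riemann sphere with affine coordinate $z$, and let $\hat\Sigma=\Sigma_+\sqcup\Sigma_-\to\Sigma$ be its double, $\Sigma_-$ being $\Sigma$ with the opposite complex structure. Fix one of the following. * *Kac–Moody case*: $\mathfrak a=\mathfrak g$ is a finite-dimensional complex Lie algebra with an invariant symmetric bilinear form $\kappa$, $\Delta=1$, $L$ is the trivial bundle with fibre $\mathfrak g$, with brackets $[X\otimes f,Y\otimes\eta]=[X,Y]\otimes f\eta$, and $\alpha(X f,Y\eta)=-\frac{\kappa(X,Y)}{2\pi i}\int\partial f\wedge\eta$. * *Virasoro case*: $\mathfrak a=\mathbb C\,\Omega$, $c\in\mathbb R$, $\Delta=2$, $L=T^{1,0}$ with $\Omega\leftrightarrow-\partial_z$, the Lie bracket of vector fields, and $\alpha(f\partial_z,\eta\,\partial_z)=\frac{c}{24\pi i}\int\partial(\partial_zf)\wedge\partial_z\eta$, extended to $S^2$ by Möbius invariance. For an open set $U\subset\Sigma$ let $\mathcal L_\alpha(U)=\Omega^{0,\bullet}_c(\hat U,L)\oplus\mathbb C\,\mathbf 1$ ($\hat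 U\subset\hat\Sigma$ the preimage of $U$, $\mathbf 1$ central of degree $1$), with differential $\bar\partial$ and bracket $[a,b]_\alpha=[a,b]+\alpha(a,b)\mathbf 1$, and let $\mathcal U\mathcal L_\alpha(U)$ be the degree $0$ cohomology of its Chevalley–Eilenberg chain complex $\mathrm{Sym}(\mathcal L_\alpha(U)[1])$ modulo $s\mathbf 1=1$. For disjoint open sets $U,V\subset W$ the factorisation product is $m_{(U,V),W}([A]\otimes[B])=[AB]$. Let $\hat{\mathfrak l}$ be the Lie algebra with basis-free generators $a_{(n)}$ ($a\in\mathfrak a$, $n\in\mathbb Z$, linear in $a$) and central $\mathsf k$, with $[X_{(m)},Y_{(n)}]=[X,Y]_{(m+n)}+m\,\kappa(X,Y)\delta_{m+n,0}\mathsf k$, respectively $[\Omega_{(m)},\Omega_{(n)}]=(m-n)\Omega_{(m+n-1)}+\frac{m(m-1)(m-2)}{12}c\,\delta_{m+n,2}\mathsf k$. Let $\mathbb F$ be the module over $\hat{\mathfrak l}\oplus\bar{\hat{\mathfrak l}}$ (two copies, modes $a_{(n)}$ and $\bar a_{(n)}$) induced from the vacuum $|0\rangle$ on which all modes with $n\ge0$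 act by $0$ and both central elements act by $1$. It is graded by $\mathbb F_{h,\bar h}$, spanned by the monomials $a^r_{(-m_r)}\cdots a^1_{(-m_1)}\bar b^{s}_{(-n_{s})}\cdots\bar b^1_{(-n_1)}|0\rangle$ ($m_i,n_j\ge1$) with $h=\sum_i(\Delta+m_i-1)$, $\bar h=\sum_j(\Delta+n_j-1)$. *Preparation.* For $p\in\mathbb C$ and an open $U\ni p$, the state above is prepared at $p$ as the class in $\mathcal U\mathcal L_\alpha(U)$ of the product of the $s\big(a^i\otimes(-(z-p)^{-m_i}\bar\partial\rho_i)\big)$ on $\Sigma_+$ and the $s\big(b^j\otimes(-(\bar z-\bar p)^{-n_j}\partial\rho'_j)\big)$ on $\Sigma_-$, where $\rho_1,\dots,\rho_r$ are compactly supported cutoff functions in $U\cap\mathbb C$ equal to $1$ near $p$, and $\rho_{i+1}=1$ near the support of $\rho_i$; similarly for the $\rho'_j$. *Vertex operator map.* $Y(A,\zeta)=\sum_{n,\bar n\in\mathbb Z}A_{(n,\bar n)}\zeta^{-n-1}\bar\zeta^{-\bar n-1}$ is the map which sends the monomial above to the product of the right-nested normally ordered product $:\tfrac{\partial^{m_r-1}a^r(\zeta)}{(m_r-1)!}\cdots\tfrac{\partial^{m_1-1}a^1(\zeta)}{(m_1-1)!}:$,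 $a(\zeta)=\sum_na_{(n)}\zeta^{-n-1}$, with its anti-chiral analogue, and it is required to give the expansion of factorisation products: for $p\ne q$ in $\mathbb C$, $|q-p|<R$, disjoint open neighbourhoods $V_q\ni q$, $V_p\ni p$ in the disc $D$ of radius $R$ around $p$, $$m_{(V_q,V_p),D}(A_q\otimes B_p)=\sum_{n,\bar n}(A_{(n,\bar n)}B)_p\,(q-p)^{-n-1}\,\overline{(q-p)}^{\,-\bar n-1},$$ as an absolutely convergent expansion after applying any continuous linear functional on $\mathcal U\mathcal L_\alpha(D)$ (one that is bounded by $C^k$ norms on products of forms with supports in a fixed compact subset of $D$). **Theorem.** In the Kac–Moody and in the Virasoro case the preparation map exists and is unique, the vertex operator map $Y$ exists and is unique, and $(\mathbb F,Y,|0\rangle)$ is a full vertex algebra. That is, $\mathbb F=\bigoplus_{h,\bar h\in\mathbb R}\mathbb F_{h,\bar h}$, $0\ne|0\rangle\in\mathbb F_{0,0}$, and with modes $A_{(r,s)}$, $r,s\in\mathbb R$ (zero unless $r,s\in\mathbb Z$): * FV1: for $A,B\in\mathbb F$, (a) there is $N\in\mathbb R$ with $A_{(r,s)}B=0$ if $r\ge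 N$ or $s\ge N$; (b) for all $H\in\mathbb R$ the set of $(r,s)$ with $A_{(r,s)}B\neq0$ and $r+s\ge H$ is finite. * FV2: $\mathbb F_{h,\bar h}\ne0$ implies $h-\bar h\in\mathbb Z$. * FV3: $Y(A,z)|0\rangle\in\mathbb F[[z,\bar z]]$ and $A_{(-1,-1)}|0\rangle=A$. * FV4: $Y(|0\rangle,z)=\mathrm{id}$. * FV5: for $A,B,C\in\mathbb F$ and $u\in\bigoplus_{h,\bar h}\mathbb F_{h,\bar h}^*$ there is a single-valued real analytic function on $\{(z_1,z_2)\in\mathbb C^2: z_1\ne0,\ z_2\neq0,\ z_1\ne z_2\}$ to which the series $u(Y(A,z_1)Y(B,z_2)C)$, $u(Y(B,z_2)Y(A,z_1)C)$ and $u(Y(Y(A,z_1-z_2)B,z_2)C)$ converge absolutely in the regions $|z_1|>|z_2|$, $|z_2|>|z_1|$ and $|z_2|>|z_1-z_2|$, respectively. * FV6: $(\mathbb F_{h,\bar h})_{(r,s)}\mathbb F_{h',\bar h'}\subset\mathbb F_{h+h'-r-1,\bar h+\bar h'-s-1}$. -/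

import Mathlib

open TopologicalSpace MeasureTheory
open scoped ContDiff TensorProduct Topology ComplexConjugate

noncomputable section

namespace SphereVA

/-! ### Calculus on the plane -/

/-- The Wirtinger derivative `∂f = ∂f/∂z`. -/
def dz (f : ℂ → ℂ) (z : ℂ) : ℂ := (fderiv ℝ f z 1 - Complex.I * fderiv ℝ f z Complex.I) / 2

/-- The Wirtinger derivative `∂̄f = ∂f/∂z̄`. -/
def dbar (f : ℂ → ℂ) (z : ℂ) : ℂ := (fderiv ℝ f z 1 + Complex.I * fderiv ℝ f z Complex.I) / 2

section calculus

variable {f g : ℂ → ℂ} {z : ℂ}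

theorem dz_smooth (hf : ContDiff ℝ ∞ f) : ContDiff ℝ ∞ (dz f) := by
  have h : ContDiff ℝ ∞ (fderiv ℝ f) := hf.fderiv_right (by simp)
  unfold dz
  fun_prop

theorem dbar_smooth (hf : ContDiff ℝ ∞ f) : ContDiff ℝ ∞ (dbar f) := by
  have h : ContDiff ℝ ∞ (fderiv ℝ f) := hf.fderiv_right (by simp)
  unfold dbar
  fun_prop

theorem dz_congr (h : f =ᶠ[𝓝 z] g) : dz f z = dz g z := by
  simp only [dz, h.fderiv_eq]

theorem dbar_congr (h : f =ᶠ[𝓝 z] g) : dbar f z = dbar g z := by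
  simp only [dbar, h.fderiv_eq]

theorem dz_add (hf : DifferentiableAt ℝ f z) (hg : DifferentiableAt ℝ g z) :
    dz (f + g) z = dz f z + dz g z := by
  simp only [dz, fderiv_add hf hg, add_apply]; ring

theorem dbar_add (hf : DifferentiableAt ℝ f z) (hg : DifferentiableAt ℝ g z) :
    dbar (f + g) z = dbar f z + dbar g z := by
  simp only [dbar, fderiv_add hf hg, add_apply]; ring

theorem dz_smul (c : ℂ) (hf : DifferentiableAt ℝ f z) : dz (c • f) z = c * dz f z := by
  simp only [dz, fderiv_const_smul hf c, smul_apply, smul_eq_mul]; ring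

theorem dbar_smul (c : ℂ) (hf : DifferentiableAt ℝ f z) : dbar (c • f) z = c * dbar f z := by
  simp only [dbar, fderiv_const_smul hf c, smul_apply, smul_eq_mul]; ring

theorem dz_mul (hf : DifferentiableAt ℝ f z) (hg : DifferentiableAt ℝ g z) :
    dz (fun w => f w * g w) z = dz f z * g z + f z * dz g z := by
  simp only [dz]
  rw [fderiv_fun_mul hf hg]
  simp only [add_apply, smul_apply, smul_eq_mul]; ring

theorem dbar_mul (hf : DifferentiableAt ℝ f z) (hg : DifferentiableAt ℝ g z) :
    dbar (fun w => f w * g w) z = dbar f z * g z + f z * dbar g z := by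
  simp only [dbar]
  rw [fderiv_fun_mul hf hg]
  simp only [add_apply, smul_apply, smul_eq_mul]; ring

theorem fderiv_of_hasDerivAt {h : ℂ → ℂ} {c : ℂ} (hh : HasDerivAt h c z) (v : ℂ) :
    fderiv ℝ h z v = v * c := by
  have := (hh.hasFDerivAt.restrictScalars ℝ).fderiv
  rw [this]
  simp

theorem dz_of_hasDerivAt {h : ℂ → ℂ} {c : ℂ} (hh : HasDerivAt h c z) : dz h z = c := by
  simp only [dz, fderiv_of_hasDerivAt hh]
  linear_combination (-(c / 2)) * Complex.I_mul_I

theorem dbar_of_hasDerivAt {h : ℂ → ℂ} {c : ℂ} (hh : HasDerivAt h c z) : dbar h z = 0 := by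
  simp only [dbar, fderiv_of_hasDerivAt hh]
  linear_combination (c / 2) * Complex.I_mul_I

theorem fderiv_eq_dz_dbar (f : ℂ → ℂ) (z v : ℂ) :
    fderiv ℝ f z v = dz f z * v + dbar f z * conj v := by
  have hv : v = v.re • (1 : ℂ) + v.im • Complex.I := by
    simp [Complex.re_add_im]
  have h1 : fderiv ℝ f z v = v.re * fderiv ℝ f z 1 + v.im * fderiv ℝ f z Complex.I := by
    conv_lhs => rw [hv]
    rw [map_add, map_smul, map_smul]
    simp only [Complex.real_smul]
  have h2 : conj v = v.re - v.im * Complex.I := by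
    apply Complex.ext <;> simp
  have h3 : v = v.re + v.im * Complex.I := by simp
  rw [h1, h2]
  simp only [dz, dbar]
  conv_rhs => rw [h3]
  simp only [Complex.add_re, Complex.ofReal_re, Complex.mul_re, Complex.I_re, Complex.ofReal_im,
    Complex.add_im, Complex.mul_im, Complex.I_im]
  push_cast
  linear_combination (v.im * fderiv ℝ f z Complex.I) * Complex.I_mul_I

theorem dz_comp {h : ℂ → ℂ} {c : ℂ} (hh : HasDerivAt h c z) (hf : DifferentiableAt ℝ f (h z)) :
    dz (fun w => f (h w)) z = c * dz f (h z) := by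
  have hd : DifferentiableAt ℝ h z := (hh.hasFDerivAt.restrictScalars ℝ).differentiableAt
  have : ∀ v, fderiv ℝ (fun w => f (h w)) z v = fderiv ℝ f (h z) (v * c) := by
    intro v
    rw [fderiv_fun_comp z hf hd]
    simp [fderiv_of_hasDerivAt hh]
  rw [dz, this, this, fderiv_eq_dz_dbar, fderiv_eq_dz_dbar]
  simp only [map_mul, Complex.conj_I, one_mul]
  linear_combination (-(dz f (h z) * c / 2) + dbar f (h z) * conj c / 2) * Complex.I_mul_I

theorem dbar_comp {h : ℂ → ℂ} {c : ℂ} (hh : HasDerivAt h c z) (hf : DifferentiableAt ℝ f (h z)) :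
    dbar (fun w => f (h w)) z = conj c * dbar f (h z) := by
  have hd : DifferentiableAt ℝ h z := (hh.hasFDerivAt.restrictScalars ℝ).differentiableAt
  have : ∀ v, fderiv ℝ (fun w => f (h w)) z v = fderiv ℝ f (h z) (v * c) := by
    intro v
    rw [fderiv_fun_comp z hf hd]
    simp [fderiv_of_hasDerivAt hh]
  rw [dbar, this, this, fderiv_eq_dz_dbar, fderiv_eq_dz_dbar]
  simp only [map_mul, Complex.conj_I, one_mul]
  linear_combination ((dz f (h z) * c / 2) - dbar f (h z) * conj c / 2) * Complex.I_mul_I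

theorem dz_conj_comp {h : ℂ → ℂ} {c : ℂ} (hh : HasDerivAt h c z) :
    dz (fun w => conj (h w)) z = 0 := by
  have hd : DifferentiableAt ℝ h z := (hh.hasFDerivAt.restrictScalars ℝ).differentiableAt
  have : ∀ v, fderiv ℝ (fun w => conj (h w)) z v = conj (v * c) := by
    intro v
    have := (Complex.conjCLE.toContinuousLinearMap.hasFDerivAt.comp z hd.hasFDerivAt).fderiv
    have e : fderiv ℝ (fun w => conj (h w)) z
        = Complex.conjCLE.toContinuousLinearMap.comp (fderiv ℝ h z) := this
    rw [e]
    simp [fderiv_of_hasDerivAt hh]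
  rw [dz, this, this]
  simp only [map_mul, Complex.conj_I, one_mul]
  linear_combination (conj c / 2) * Complex.I_mul_I

end calculus

/-! ### Compactly supported sections over open subsets of the Riemann sphere -/

/-- The Riemann sphere, with its standard affine coordinate `z` on `ℂ`. -/
abbrev Sphere : Type := OnePoint ℂ

/-- Complex conjugation of the Riemann sphere. -/
def conjSphere : Sphere ≃ₜ Sphere := Complex.conjCLE.toHomeomorph.onePointCongr

/-- The complex conjugate of an open subset of the sphere. A section over `U` of a bundle on the
sphere with the opposite complex structure is described by a section over `conjOpen U`, through
the holomorphic coordinate `z̄`. -/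
def conjOpen (U : Opens Sphere) : Opens Sphere := conjSphere.opensCongr U

theorem conjOpen_mono {U V : Opens Sphere} (h : U ≤ V) : conjOpen U ≤ conjOpen V :=
  conjSphere.opensCongr.monotone h

theorem conjOpen_disjoint {U V : Opens Sphere} (h : Disjoint U V) :
    Disjoint (conjOpen U) (conjOpen V) :=
  h.map_orderIso conjSphere.opensCongr

/-- The closed support in the sphere of a section whose coefficient in the coordinate `z` is
`f`. -/
def sphereSupport (f : ℂ → ℂ) : Set Sphere := closure ((↑) '' Function.support f)

/-- The transition function at `z ≠ 0` of `(T^{1,0})^{⊗ w} ⊗ (Λ^{0,1})^{⊗ i}` from the coordinate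
`1/z` to the coordinate `z`; recall `∂_{1/z} = -z² ∂_z` and `d(1/z)⁻ = -z̄⁻² dz̄`. -/
def transition (w i : ℕ) (z : ℂ) : ℂ := (-z ^ 2) ^ w * (-(conj z ^ 2)⁻¹) ^ i

/-- `Form w i U` is the space of smooth sections of `(T^{1,0})^{⊗ w} ⊗ (Λ^{0,1})^{⊗ i}` over the
Riemann sphere with compact support in the open subset `U`. A section is given by its coefficient
`f` in the coordinate `z`, that is, it is `f (∂_z)^w (dz̄)^i`. Smoothness at infinity is smoothness
of the coefficient in the coordinate `1/z`. -/
def Form (w i : ℕ) (U : Opens Sphere) : Submodule ℂ (ℂ → ℂ) where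
  carrier := {f | ContDiff ℝ ∞ f ∧
    (∃ g : ℂ → ℂ, ContDiff ℝ ∞ g ∧ ∀ z, z ≠ 0 → g z = transition w i z * f z⁻¹) ∧
    sphereSupport f ⊆ U}
  zero_mem' := by
    refine ⟨contDiff_const, ⟨0, contDiff_const, ?_⟩, ?_⟩
    · intro z _; simp
    · simp [sphereSupport]
  add_mem' := by
    rintro f₁ f₂ ⟨h1, ⟨g1, hg1, e1⟩, s1⟩ ⟨h2, ⟨g2, hg2, e2⟩, s2⟩
    refine ⟨h1.add h2, ⟨g1 + g2, hg1.add hg2, ?_⟩, ?_⟩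
    · intro z hz
      simp only [Pi.add_apply, e1 z hz, e2 z hz]; ring
    · refine subset_trans ?_ (Set.union_subset s1 s2)
      rw [sphereSupport, sphereSupport, sphereSupport, ← closure_union, ← Set.image_union]
      exact closure_mono (Set.image_mono (Function.support_add f₁ f₂))
  smul_mem' := by
    rintro c f ⟨h, ⟨g, hg, e⟩, s⟩
    refine ⟨h.const_smul c, ⟨c • g, hg.const_smul c, ?_⟩, ?_⟩
    · intro z hz
      simp only [Pi.smul_apply, smul_eq_mul, e z hz]; ring
    · refine subset_trans (closure_mono (Set.image_mono ?_)) s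
      exact Function.support_const_smul_subset c f

namespace Form

variable {w i : ℕ} {U V : Opens Sphere}

theorem smooth (f : Form w i U) : ContDiff ℝ ∞ (f : ℂ → ℂ) := f.2.1

theorem diff (f : Form w i U) (z : ℂ) : DifferentiableAt ℝ (f : ℂ → ℂ) z :=
  ((smooth f).differentiable (by simp)) z

/-- Extension by zero. -/
def ext (h : U ≤ V) : Form w i U →ₗ[ℂ] Form w i V :=
  Submodule.inclusion fun _ hf => ⟨hf.1, hf.2.1, hf.2.2.trans h⟩

@[simp] theorem ext_coe (h : U ≤ V) (f : Form w i U) : (ext h f : ℂ → ℂ) = f := rfl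

end Form

theorem sphereSupport_mono {f g : ℂ → ℂ} (h : Function.support g ⊆ tsupport f) :
    sphereSupport g ⊆ sphereSupport f := by
  refine closure_minimal ?_ isClosed_closure
  rintro _ ⟨z, hz, rfl⟩
  have : (z : Sphere) ∈ (↑) '' tsupport f := ⟨z, h hz, rfl⟩
  exact image_closure_subset_closure_image OnePoint.continuous_coe this

theorem dz_support (f : ℂ → ℂ) : Function.support (dz f) ⊆ tsupport f := by
  intro z hz
  by_contra hn
  apply hz
  have : f =ᶠ[𝓝 z] fun _ => 0 := notMem_tsupport_iff_eventuallyEq.1 hn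
  rw [dz_congr this]; simp [dz]

theorem dbar_support (f : ℂ → ℂ) : Function.support (dbar f) ⊆ tsupport f := by
  intro z hz
  by_contra hn
  apply hz
  have : f =ᶠ[𝓝 z] fun _ => 0 := notMem_tsupport_iff_eventuallyEq.1 hn
  rw [dbar_congr this]; simp [dbar]

section transition

variable {z : ℂ}

theorem hasDerivAt_neg_sq_pow (w : ℕ) (z : ℂ) :
    DifferentiableAt ℂ (fun z : ℂ => (-z ^ 2) ^ w) z := by fun_prop

theorem hasDerivAt_inv' (hz : z ≠ 0) : HasDerivAt (fun z : ℂ => z⁻¹) (-(z ^ 2)⁻¹) z :=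
  hasDerivAt_inv hz

/-- `∂̄` preserves smoothness at infinity. -/
theorem transition_dbar {w : ℕ} {f g : ℂ → ℂ} (hf : ContDiff ℝ ∞ f)
    (e : ∀ z, z ≠ 0 → g z = transition w 0 z * f z⁻¹) (hz : z ≠ 0) :
    dbar g z = transition w 1 z * dbar f z⁻¹ := by
  have hfd := hf.differentiable (by simp)
  have e' : g =ᶠ[𝓝 z] fun z => (-z ^ 2) ^ w * f z⁻¹ := by
    filter_upwards [isOpen_ne.mem_nhds hz] with y hy
    rw [e y hy]; simp [transition]
  have hp := (hasDerivAt_neg_sq_pow w z)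
  have hi := hasDerivAt_inv' hz
  have hc : DifferentiableAt ℝ (fun z => f z⁻¹) z :=
    DifferentiableAt.comp z (hfd z⁻¹) (hi.differentiableAt.restrictScalars ℝ)
  rw [dbar_congr e', dbar_mul (hp.restrictScalars ℝ) hc, dbar_comp hi (hfd _),
    dbar_of_hasDerivAt hp.hasDerivAt]
  simp [transition, mul_assoc]

end transition

/-- The Dolbeault operator `∂̄`. -/
def dolbeault (w : ℕ) (U : Opens Sphere) : Form w 0 U →ₗ[ℂ] Form w 1 U where
  toFun f := ⟨dbar f, dbar_smooth (Form.smooth f), by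
      obtain ⟨g, hg, e⟩ := f.2.2.1
      exact ⟨dbar g, dbar_smooth hg, fun z hz => transition_dbar (Form.smooth f) e hz⟩,
    (sphereSupport_mono (dbar_support _)).trans f.2.2.2⟩
  map_add' f g := by
    apply Subtype.ext; funext z
    exact dbar_add (Form.diff f z) (Form.diff g z)
  map_smul' c f := by
    apply Subtype.ext; funext z
    exact dbar_smul c (Form.diff f z)

/-- The pairing `(f, η) ↦ f η` of functions and `(0,1)`-forms. -/
def mulForm (U : Opens Sphere) : Form 0 0 U →ₗ[ℂ] Form 0 1 U →ₗ[ℂ] Form 0 1 U :=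
  LinearMap.mk₂ ℂ (fun f η => ⟨fun z => (f : ℂ → ℂ) z * (η : ℂ → ℂ) z, (Form.smooth f).mul (Form.smooth η), by
      obtain ⟨g1, hg1, e1⟩ := f.2.2.1
      obtain ⟨g2, hg2, e2⟩ := η.2.2.1
      refine ⟨fun z => g1 z * g2 z, hg1.mul hg2, fun z hz => ?_⟩
      simp only [e1 z hz, e2 z hz, transition]; ring,
      (sphereSupport_mono (fun z hz => subset_tsupport _ (left_ne_zero_of_mul hz))).trans
        f.2.2.2⟩)
    (fun _ _ _ => by apply Subtype.ext; funext z; simp [add_mul])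
    (fun _ _ _ => by apply Subtype.ext; funext z; simp [mul_assoc])
    (fun _ _ _ => by apply Subtype.ext; funext z; simp [mul_add])
    (fun _ _ _ => by apply Subtype.ext; funext z; simp [mul_left_comm])

theorem transition_dz_zero {f g : ℂ → ℂ} {z : ℂ} (hf : ContDiff ℝ ∞ f)
    (e : ∀ z, z ≠ 0 → g z = transition 0 0 z * f z⁻¹) (hz : z ≠ 0) :
    dz g z = -(z ^ 2)⁻¹ * dz f z⁻¹ := by
  have e' : g =ᶠ[𝓝 z] fun z => f z⁻¹ := by
    filter_upwards [isOpen_ne.mem_nhds hz] with y hy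
    rw [e y hy]; simp [transition]
  rw [dz_congr e', dz_comp (hasDerivAt_inv' hz) (hf.differentiable (by simp) _)]

theorem dz_inv_comp {f : ℂ → ℂ} {z : ℂ} (hf : ContDiff ℝ ∞ f) (hz : z ≠ 0) :
    dz (fun z => f z⁻¹) z = -(z ^ 2)⁻¹ * dz f z⁻¹ :=
  dz_comp (hasDerivAt_inv' hz) (hf.differentiable (by simp) _)

theorem diff_inv_comp {f : ℂ → ℂ} {z : ℂ} (hf : ContDiff ℝ ∞ f) (hz : z ≠ 0) :
    DifferentiableAt ℝ (fun z => f z⁻¹) z :=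
  DifferentiableAt.comp z (hf.differentiable (by simp) z⁻¹)
    ((hasDerivAt_inv' hz).differentiableAt.restrictScalars ℝ)

theorem dz_hol_mul {h f : ℂ → ℂ} {c z : ℂ} (hh : HasDerivAt h c z)
    (hf : DifferentiableAt ℝ f z) :
    dz (fun w => h w * f w) z = c * f z + h z * dz f z := by
  rw [dz_mul (hh.differentiableAt.restrictScalars ℝ) hf, dz_of_hasDerivAt hh]

theorem transition_dz_vec {f g : ℂ → ℂ} {z : ℂ} (hf : ContDiff ℝ ∞ f)
    (e : ∀ z, z ≠ 0 → g z = transition 1 0 z * f z⁻¹) (hz : z ≠ 0) :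
    dz g z = -2 * z * f z⁻¹ + dz f z⁻¹ := by
  have e' : g =ᶠ[𝓝 z] fun z => (-z ^ 2) * f z⁻¹ := by
    filter_upwards [isOpen_ne.mem_nhds hz] with y hy
    rw [e y hy]; simp [transition]
  have hd : HasDerivAt (fun z : ℂ => -z ^ 2) (-2 * z) z := by
    have := (hasDerivAt_pow 2 z).neg
    refine (this.congr_deriv ?_)
    simp
  rw [dz_congr e', dz_hol_mul hd (diff_inv_comp hf hz), dz_inv_comp hf hz]
  field_simp

theorem transition_dz_vecForm {f g : ℂ → ℂ} {z : ℂ} (hf : ContDiff ℝ ∞ f)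
    (e : ∀ z, z ≠ 0 → g z = transition 1 1 z * f z⁻¹) (hz : z ≠ 0) :
    dz g z = (conj z ^ 2)⁻¹ * (2 * z * f z⁻¹ - dz f z⁻¹) := by
  have e' : g =ᶠ[𝓝 z] fun z => conj ((z ^ 2)⁻¹) * (z ^ 2 * f z⁻¹) := by
    filter_upwards [isOpen_ne.mem_nhds hz] with y hy
    rw [e y hy]; simp [transition]; ring
  have hd : HasDerivAt (fun z : ℂ => z ^ 2) (2 * z) z := by
    simpa using hasDerivAt_pow 2 z
  have hq : DifferentiableAt ℂ (fun z : ℂ => (z ^ 2)⁻¹) z :=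
    hd.differentiableAt.inv (pow_ne_zero 2 hz)
  have hqc : DifferentiableAt ℝ (fun z : ℂ => conj ((z ^ 2)⁻¹)) z :=
    Complex.conjCLE.toContinuousLinearMap.differentiableAt.comp z (hq.restrictScalars ℝ)
  rw [dz_congr e', dz_mul hqc ((hd.differentiableAt.restrictScalars ℝ).fun_mul
    (diff_inv_comp hf hz)), dz_conj_comp hq.hasDerivAt, dz_hol_mul hd (diff_inv_comp hf hz),
    dz_inv_comp hf hz]
  simp only [map_inv₀, map_pow, zero_mul, zero_add]
  have : conj z ≠ 0 := by simpa using hz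
  field_simp
  ring

/-- The bilinear operation `(f, η) ↦ η ∂f - f ∂η`, i.e. minus the coefficient of the Lie bracket
of the vector field `f ∂_z` with the vector field valued form `η ∂_z dz̄`. -/
def vecBracket (U : Opens Sphere) : Form 1 0 U →ₗ[ℂ] Form 1 1 U →ₗ[ℂ] Form 1 1 U :=
  LinearMap.mk₂ ℂ (fun f η => ⟨fun z => (η : ℂ → ℂ) z * dz f z - (f : ℂ → ℂ) z * dz η z,
      ((Form.smooth η).mul (dz_smooth (Form.smooth f))).sub ((Form.smooth f).mul (dz_smooth (Form.smooth η))), by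
      obtain ⟨g1, hg1, e1⟩ := f.2.2.1
      obtain ⟨g2, hg2, e2⟩ := η.2.2.1
      refine ⟨fun z => g2 z * dz g1 z - g1 z * dz g2 z,
        (hg2.mul (dz_smooth hg1)).sub (hg1.mul (dz_smooth hg2)), fun z hz => ?_⟩
      have hc : conj z ≠ 0 := by simpa using hz
      simp only [transition_dz_vec (Form.smooth f) e1 hz, transition_dz_vecForm (Form.smooth η) e2 hz,
        e1 z hz, e2 z hz, transition]
      field_simp
      ring,
      (sphereSupport_mono (f := (f : ℂ → ℂ)) (fun z hz => by
        by_contra hn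
        apply hz
        have h1 : (f : ℂ → ℂ) z = 0 := image_eq_zero_of_notMem_tsupport hn
        have h2 : dz f z = 0 := by
          by_contra h; exact hn (dz_support _ h)
        simp [h1, h2])).trans f.2.2.2⟩)
    (fun f g η => by
      apply Subtype.ext; funext z
      have := dz_add (Form.diff f z) (Form.diff g z)
      simp only [Submodule.coe_add, Pi.add_apply, this]; ring)
    (fun c f η => by
      apply Subtype.ext; funext z
      have := dz_smul c (Form.diff f z)
      simp only [Submodule.coe_smul, Pi.smul_apply, smul_eq_mul, this]; ring)
    (fun f η η' => by
      apply Subtype.ext; funext z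
      have := dz_add (Form.diff η z) (Form.diff η' z)
      simp only [Submodule.coe_add, Pi.add_apply, this]; ring)
    (fun c f η => by
      apply Subtype.ext; funext z
      have := dz_smul c (Form.diff η z)
      simp only [Submodule.coe_smul, Pi.smul_apply, smul_eq_mul, this]; ring)

/-! ### The cocycle integrals -/

theorem integrable_of_inversion {F G : ℂ → ℂ} (hF : Continuous F) (hG : Continuous G)
    (h : ∀ z, z ≠ 0 → ‖G z⁻¹‖ = ‖z‖ ^ 4 * ‖F z‖) : Integrable F := by
  have hint : Integrable (fun z : ℂ => (1 + ‖z‖) ^ (-4 : ℝ)) := by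
    apply integrable_one_add_norm
    rw [Complex.finrank_real_complex]; norm_num
  refine hF.locallyIntegrable.integrable_of_isBigO_cocompact (g := fun z : ℂ => (1 + ‖z‖) ^ (-4 : ℝ))
    ?_ (hint.integrableAtFilter _)
  obtain ⟨C, hC⟩ := (isCompact_closedBall (0 : ℂ) 1).exists_bound_of_continuousOn hG.continuousOn
  refine Asymptotics.IsBigO.of_bound (16 * C) ?_
  have hev : ∀ᶠ z : ℂ in Filter.cocompact ℂ, 1 ≤ ‖z‖ :=
    (tendsto_norm_cocompact_atTop (E := ℂ)).eventually_ge_atTop 1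
  filter_upwards [hev] with z hz
  have hz0 : 0 < ‖z‖ := by linarith
  have hz' : z ≠ 0 := norm_pos_iff.1 hz0
  have h1 : ‖z‖ ^ 4 * ‖F z‖ ≤ C := by
    rw [← h z hz']
    apply hC
    simp only [Metric.mem_closedBall, dist_zero_right, norm_inv]
    exact inv_le_one_of_one_le₀ hz
  have hpos : (0 : ℝ) < (1 + ‖z‖) ^ 4 := by positivity
  have e : (1 + ‖z‖) ^ (-4 : ℝ) = ((1 + ‖z‖) ^ 4)⁻¹ := by
    rw [Real.rpow_neg (by positivity)]; norm_num
  rw [e, Real.norm_of_nonneg (by positivity), ← div_eq_mul_inv, le_div_iff₀ hpos]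
  have h2 : (1 + ‖z‖) ^ 4 ≤ (2 * ‖z‖) ^ 4 := by gcongr; linarith
  calc ‖F z‖ * (1 + ‖z‖) ^ 4 ≤ ‖F z‖ * (2 * ‖z‖) ^ 4 := by gcongr
    _ = 16 * (‖z‖ ^ 4 * ‖F z‖) := by ring
    _ ≤ 16 * C := by gcongr

theorem transition_dz_three {f g : ℂ → ℂ} (hg : ContDiff ℝ ∞ g)
    (e : ∀ z, z ≠ 0 → g z = transition 1 0 z * f z⁻¹) {z : ℂ} (hz : z ≠ 0) :
    dz (dz (dz g)) z⁻¹ = z ^ 4 * dz (dz (dz f)) z := by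
  have e0 : ∀ z, z ≠ 0 → f z = transition 1 0 z * g z⁻¹ := by
    intro z hz
    rw [e _ (inv_ne_zero hz)]
    simp [transition]
    field_simp
  have e1 : ∀ z, z ≠ 0 → dz f z = -2 * z * g z⁻¹ + dz g z⁻¹ := fun z hz =>
    transition_dz_vec hg e0 hz
  have hg1 := dz_smooth hg
  have hg2 := dz_smooth hg1
  have hlin : ∀ z : ℂ, HasDerivAt (fun z : ℂ => -2 * z) (-2) z := fun z => by
    simpa using (hasDerivAt_id z).const_mul (-2)
  have hz2 : ∀ z : ℂ, z ≠ 0 → HasDerivAt (fun z : ℂ => 2 * z⁻¹) (-2 * (z ^ 2)⁻¹) z :=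
    fun z hz => ((hasDerivAt_inv' hz).const_mul 2).congr_deriv (by ring)
  have hz3 : ∀ z : ℂ, z ≠ 0 → HasDerivAt (fun z : ℂ => -(z ^ 2)⁻¹) (2 * (z ^ 3)⁻¹) z := by
    intro z hz
    have := ((hasDerivAt_pow 2 z).inv (pow_ne_zero 2 hz)).neg
    refine this.congr_deriv ?_
    field_simp
    norm_num
    ring
  have hzc : HasDerivAt (fun _ : ℂ => (-2 : ℂ)) 0 z := hasDerivAt_const _ _
  have e2 : ∀ z, z ≠ 0 → dz (dz f) z
      = -2 * g z⁻¹ + 2 * z⁻¹ * dz g z⁻¹ + -(z ^ 2)⁻¹ * dz (dz g) z⁻¹ := by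
    intro z hz
    have ev : dz f =ᶠ[𝓝 z] (fun z => -2 * z * g z⁻¹) + fun z => dz g z⁻¹ := by
      filter_upwards [isOpen_ne.mem_nhds hz] with y hy
      rw [e1 y hy]; rfl
    rw [dz_congr ev, dz_add (((hlin z).differentiableAt.restrictScalars ℝ).fun_mul
      (diff_inv_comp hg hz)) (diff_inv_comp hg1 hz), dz_hol_mul (hlin z) (diff_inv_comp hg hz),
      dz_inv_comp hg hz, dz_inv_comp hg1 hz]
    field_simp
  have ev : dz (dz f) =ᶠ[𝓝 z] ((fun z => -2 * g z⁻¹) + fun z => 2 * z⁻¹ * dz g z⁻¹)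
      + fun z => -(z ^ 2)⁻¹ * dz (dz g) z⁻¹ := by
    filter_upwards [isOpen_ne.mem_nhds hz] with y hy
    rw [e2 y hy]; rfl
  have d1 : DifferentiableAt ℝ (fun z => -2 * g z⁻¹) z :=
    (hzc.differentiableAt.restrictScalars ℝ).fun_mul (diff_inv_comp hg hz)
  have d2 : DifferentiableAt ℝ (fun z => 2 * z⁻¹ * dz g z⁻¹) z :=
    ((hz2 z hz).differentiableAt.restrictScalars ℝ).fun_mul (diff_inv_comp hg1 hz)
  have d3 : DifferentiableAt ℝ (fun z => -(z ^ 2)⁻¹ * dz (dz g) z⁻¹) z :=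
    ((hz3 z hz).differentiableAt.restrictScalars ℝ).fun_mul (diff_inv_comp hg2 hz)
  rw [dz_congr ev, dz_add (d1.add d2) d3, dz_add d1 d2, dz_hol_mul hzc (diff_inv_comp hg hz),
    dz_hol_mul (hz2 z hz) (diff_inv_comp hg1 hz), dz_hol_mul (hz3 z hz) (diff_inv_comp hg2 hz),
    dz_inv_comp hg hz, dz_inv_comp hg1 hz, dz_inv_comp hg2 hz]
  field_simp
  ring

theorem current_integrable {U : Opens Sphere} (f : Form 0 0 U) (η : Form 0 1 U) :
    Integrable fun z => dz f z * (η : ℂ → ℂ) z := by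
  obtain ⟨g1, hg1, e1⟩ := f.2.2.1
  obtain ⟨g2, hg2, e2⟩ := η.2.2.1
  refine integrable_of_inversion (G := fun z => dz g1 z * g2 z)
    ((dz_smooth (Form.smooth f)).continuous.mul (Form.smooth η).continuous)
    ((dz_smooth hg1).continuous.mul hg2.continuous) fun z hz => ?_
  rw [transition_dz_zero (Form.smooth f) e1 (inv_ne_zero hz), e2 _ (inv_ne_zero hz)]
  simp [transition]
  ring

theorem vec_integrable {U : Opens Sphere} (f : Form 1 0 U) (η : Form 1 1 U) :
    Integrable fun z => dz (dz (dz f)) z * (η : ℂ → ℂ) z := by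
  obtain ⟨g1, hg1, e1⟩ := f.2.2.1
  obtain ⟨g2, hg2, e2⟩ := η.2.2.1
  refine integrable_of_inversion (G := fun z => dz (dz (dz g1)) z * g2 z)
    ((dz_smooth (dz_smooth (dz_smooth (Form.smooth f)))).continuous.mul (Form.smooth η).continuous)
    ((dz_smooth (dz_smooth (dz_smooth hg1))).continuous.mul hg2.continuous) fun z hz => ?_
  rw [transition_dz_three hg1 e1 hz, e2 _ (inv_ne_zero hz)]
  have : ‖z‖ ≠ 0 := by simpa using hz
  simp [transition]
  field_simp

/-- The pairing `(1/π) ∫ ∂f η dA`, that is, `-(1/2πi) ∫ ∂f ∧ η` with `∂f = (∂f/∂z) dz` and the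
form `η dz̄`, since `dz ∧ dz̄ = -2i dA`. -/
def currentPairing (U : Opens Sphere) : Form 0 0 U →ₗ[ℂ] Form 0 1 U →ₗ[ℂ] ℂ :=
  LinearMap.mk₂ ℂ (fun f η => (1 / Real.pi : ℂ) * ∫ z, dz f z * (η : ℂ → ℂ) z)
    (fun f g η => by
      rw [← mul_add, ← integral_add (current_integrable f η) (current_integrable g η)]
      congr 2; funext z
      have := dz_add (Form.diff f z) (Form.diff g z)
      simp only [Submodule.coe_add, this]; ring)
    (fun c f η => by
      rw [smul_eq_mul, mul_left_comm, ← integral_const_mul c]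
      congr 2; funext z
      have := dz_smul c (Form.diff f z)
      simp only [Submodule.coe_smul, this]; ring)
    (fun f η η' => by
      rw [← mul_add, ← integral_add (current_integrable f η) (current_integrable f η')]
      congr 2; funext z
      simp only [Submodule.coe_add, Pi.add_apply]; ring)
    (fun c f η => by
      rw [smul_eq_mul, mul_left_comm, ← integral_const_mul c]
      congr 2; funext z
      simp only [Submodule.coe_smul, Pi.smul_apply, smul_eq_mul]; ring)

theorem dz_three_add {f g : ℂ → ℂ} (hf : ContDiff ℝ ∞ f) (hg : ContDiff ℝ ∞ g) :
    dz (dz (dz (f + g))) = dz (dz (dz f)) + dz (dz (dz g)) := by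
  have key : ∀ {f g : ℂ → ℂ}, ContDiff ℝ ∞ f → ContDiff ℝ ∞ g → dz (f + g) = dz f + dz g := by
    intro f g hf hg; funext z
    exact dz_add (hf.differentiable (by simp) z) (hg.differentiable (by simp) z)
  rw [key hf hg, key (dz_smooth hf) (dz_smooth hg),
    key (dz_smooth (dz_smooth hf)) (dz_smooth (dz_smooth hg))]

theorem dz_three_smul {f : ℂ → ℂ} (c : ℂ) (hf : ContDiff ℝ ∞ f) :
    dz (dz (dz (c • f))) = c • dz (dz (dz f)) := by
  have key : ∀ {f : ℂ → ℂ}, ContDiff ℝ ∞ f → dz (c • f) = c • dz f := by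
    intro f hf; funext z
    exact dz_smul c (hf.differentiable (by simp) z)
  rw [key hf, key (dz_smooth hf), key (dz_smooth (dz_smooth hf))]

/-- The pairing `(1/12π) ∫ ∂³f η dA` of the vector field `-f ∂_z` with the vector field valued
form `-η ∂_z dz̄`. For sections supported in the plane one has, on integrating by parts,
`(1/12π) ∫ ∂³f η dA = -(1/12π) ∫ ∂²f ∂η dA = (1/24πi) ∫ ∂(∂_z f) ∧ ∂_z η`, the
Gelfand-Fuchs type cocycle in the coordinate `z`. The form used here is invariant under
Möbius transformations, so it is this cocycle in each of the two charts of the sphere. -/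
def vecPairing (U : Opens Sphere) : Form 1 0 U →ₗ[ℂ] Form 1 1 U →ₗ[ℂ] ℂ :=
  LinearMap.mk₂ ℂ (fun f η => (1 / (12 * Real.pi) : ℂ) * ∫ z, dz (dz (dz f)) z * (η : ℂ → ℂ) z)
    (fun f g η => by
      rw [← mul_add, ← integral_add (vec_integrable f η) (vec_integrable g η)]
      congr 2; funext z
      simp only [Submodule.coe_add, dz_three_add (Form.smooth f) (Form.smooth g), Pi.add_apply]
      ring)
    (fun c f η => by
      rw [smul_eq_mul, mul_left_comm, ← integral_const_mul c]
      congr 2; funext z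
      simp only [Submodule.coe_smul, dz_three_smul c (Form.smooth f), Pi.smul_apply, smul_eq_mul]
      ring)
    (fun f η η' => by
      rw [← mul_add, ← integral_add (vec_integrable f η) (vec_integrable f η')]
      congr 2; funext z
      simp only [Submodule.coe_add, Pi.add_apply]; ring)
    (fun c f η => by
      rw [smul_eq_mul, mul_left_comm, ← integral_const_mul c]
      congr 2; funext z
      simp only [Submodule.coe_smul, Pi.smul_apply, smul_eq_mul]; ring)

/-! ### The two families of local Lie algebras -/

/-- The data shared by the Kac-Moody and the Virasoro case. The first group of fields describes
the Lie algebra of formal modes, with brackets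
`[x_(m), y_(n)] = e m n [x,y]_(m + n - wt) + e' m n ⟨x,y⟩ k`, and the second group describes the
twisted bracket `(x ⊗ f, y ⊗ η) ↦ [x,y] ⊗ op f η + ⟨x,y⟩ pair f η · 1` of a function-like with a
form-like section. It is only used for `kacMoody` and `virasoro` below. -/
structure Datum (𝔞 : Type*) [AddCommGroup 𝔞] [Module ℂ 𝔞] where
  wt : ℕ
  bracket : 𝔞 →ₗ[ℂ] 𝔞 →ₗ[ℂ] 𝔞
  form : 𝔞 →ₗ[ℂ] 𝔞 →ₗ[ℂ] ℂ
  e : ℤ → ℤ → ℂ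
  e' : ℤ → ℤ → ℂ
  skew : ∀ m n x y, e m n • bracket x y = -(e n m • bracket y x)
  skew' : ∀ m n x y, e' m n * form x y = -(e' n m * form y x)
  jacobi : ∀ m n p x y z, (e m (n + p - wt) * e n p) • bracket x (bracket y z) =
    (e (m + n - wt) p * e m n) • bracket (bracket x y) z +
      (e n (m + p - wt) * e m p) • bracket y (bracket x z)
  jacobi' : ∀ m n p x y z, e' m (n + p - wt) * e n p * form x (bracket y z) =
    e' (m + n - wt) p * e m n * form (bracket x y) z +
      e' n (m + p - wt) * e m p * form y (bracket x z)
  op : ∀ U, Form wt 0 U →ₗ[ℂ] Form wt 1 U →ₗ[ℂ] Form wt 1 U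
  pair : ∀ U, Form wt 0 U →ₗ[ℂ] Form wt 1 U →ₗ[ℂ] ℂ
  op_ext : ∀ {U V} (h : U ≤ V) f η, Form.ext h (op U f η) = op V (Form.ext h f) (Form.ext h η)
  pair_ext : ∀ {U V} (h : U ≤ V) f η, pair V (Form.ext h f) (Form.ext h η) = pair U f η
  op_local : ∀ {U V W} (hU : U ≤ W) (hV : V ≤ W) f η, Disjoint U V →
    op W (Form.ext hU f) (Form.ext hV η) = 0
  pair_local : ∀ {U V W} (hU : U ≤ W) (hV : V ≤ W) f η, Disjoint U V →
    pair W (Form.ext hU f) (Form.ext hV η) = 0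

theorem Form.tsupport_mem {w i : ℕ} {U : Opens Sphere} (f : Form w i U) {z : ℂ}
    (hz : z ∈ tsupport (f : ℂ → ℂ)) : (z : Sphere) ∈ U := by
  apply f.2.2.2
  exact image_closure_subset_closure_image OnePoint.continuous_coe ⟨z, hz, rfl⟩

theorem Form.notMem_of_disjoint {w i w' i' : ℕ} {U V : Opens Sphere} (h : Disjoint U V)
    (f : Form w i U) (g : Form w' i' V) (z : ℂ) :
    z ∉ tsupport (f : ℂ → ℂ) ∨ z ∉ tsupport (g : ℂ → ℂ) := by
  by_contra! hn
  have : (z : Sphere) ∈ (U ⊓ V : Opens Sphere) := ⟨Form.tsupport_mem f hn.1, Form.tsupport_mem g hn.2⟩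
  rw [h.eq_bot] at this
  exact this

theorem dz_eq_zero {f : ℂ → ℂ} {z : ℂ} (h : z ∉ tsupport f) : dz f z = 0 := by
  by_contra hn; exact h (dz_support f hn)

theorem dz_three_eq_zero {f : ℂ → ℂ} {z : ℂ} (h : z ∉ tsupport f) : dz (dz (dz f)) z = 0 := by
  have key : ∀ f, tsupport (dz f) ⊆ tsupport f := fun f =>
    closure_minimal (dz_support f) (isClosed_tsupport f)
  exact dz_eq_zero fun h' => h (key _ (key _ h'))

/-- The Kac-Moody case, for a Lie algebra `𝔤` with an invariant symmetric bilinear form `κ`. -/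
def kacMoody (𝔤 : Type*) [LieRing 𝔤] [LieAlgebra ℂ 𝔤] (κ : LinearMap.BilinForm ℂ 𝔤)
    (hsymm : ∀ x y, κ x y = κ y x) (hinv : ∀ x y z, κ ⁅x, y⁆ z = κ x ⁅y, z⁆) : Datum 𝔤 where
  wt := 0
  bracket := LinearMap.mk₂ ℂ (fun x y => ⁅x, y⁆) add_lie smul_lie lie_add
    (fun c x y => lie_smul c x y)
  form := κ
  e _ _ := 1
  e' m n := if m + n = 0 then (m : ℂ) else 0
  skew m n x y := by simp
  skew' m n x y := by
    rw [hsymm x y, add_comm n m]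
    split_ifs with h
    · have : (n : ℂ) = -m := by
        have : n = -m := by omega
        exact_mod_cast this
      rw [this]; ring
    · simp
  jacobi m n p x y z := by simp
  jacobi' m n p x y z := by
    simp only [CharP.cast_eq_zero, sub_zero, mul_one, LinearMap.mk₂_apply, hinv]
    have e1 : m + (n + p) = m + n + p := by ring
    have e2 : n + (m + p) = m + n + p := by ring
    have e3 : κ y ⁅x, z⁆ = -κ x ⁅y, z⁆ := by
      rw [← hinv, ← hinv x y z, ← lie_skew x y, map_neg, LinearMap.neg_apply, neg_neg]
    rw [e1, e2, e3]
    split_ifs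
    · push_cast; ring
    · simp
  op U := mulForm U
  pair U := currentPairing U
  op_ext _ _ _ := rfl
  pair_ext _ _ _ := rfl
  op_local hU hV f η h := by
    apply Subtype.ext; funext z
    change (f : ℂ → ℂ) z * (η : ℂ → ℂ) z = 0
    rcases Form.notMem_of_disjoint h f η z with h | h <;>
      simp [image_eq_zero_of_notMem_tsupport h]
  pair_local hU hV f η h := by
    change (1 / Real.pi : ℂ) * ∫ z, dz f z * (η : ℂ → ℂ) z = 0
    rw [integral_eq_zero_of_ae, mul_zero]
    refine Filter.Eventually.of_forall fun z => ?_
    rcases Form.notMem_of_disjoint h f η z with h | h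
    · simp [dz_eq_zero h]
    · simp [image_eq_zero_of_notMem_tsupport h]

/-- The Virasoro case with central charge `c`. The one-dimensional space `ℂ Ω` is identified with
`ℂ`, and `Ω ⊗ f` stands for the vector field `-f ∂_z`. -/
def virasoro (c : ℝ) : Datum ℂ where
  wt := 1
  bracket := LinearMap.mul ℂ ℂ
  form := (c : ℂ) • LinearMap.mul ℂ ℂ
  e m n := (m : ℂ) - n
  e' m n := if m + n = 2 then (m : ℂ) * (m - 1) * (m - 2) / 12 else 0
  skew m n x y := by simp; ring
  skew' m n x y := by
    rw [add_comm n m]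
    split_ifs with h
    · have : (n : ℂ) = 2 - m := by
        have : n = 2 - m := by omega
        exact_mod_cast this
      rw [this]; simp; ring
    · simp
  jacobi m n p x y z := by simp; ring
  jacobi' m n p x y z := by
    have e1 : m + (n + p - ((1 : ℕ) : ℤ)) = 2 ↔ m + n + p = 3 := by
      constructor <;> intro h <;> push_cast at * <;> linarith
    have e2 : m + n - ((1 : ℕ) : ℤ) + p = 2 ↔ m + n + p = 3 := by
      constructor <;> intro h <;> push_cast at * <;> linarith
    have e3 : n + (m + p - ((1 : ℕ) : ℤ)) = 2 ↔ m + n + p = 3 := by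
      constructor <;> intro h <;> push_cast at * <;> linarith
    simp only [e1, e2, e3]
    split_ifs with h
    · have : (p : ℂ) = 3 - m - n := by
        have : p = 3 - m - n := by omega
        exact_mod_cast this
      simp [this]; ring
    · simp
  op U := vecBracket U
  pair U := vecPairing U
  op_ext _ _ _ := rfl
  pair_ext _ _ _ := rfl
  op_local hU hV f η h := by
    apply Subtype.ext; funext z
    change (η : ℂ → ℂ) z * dz f z - (f : ℂ → ℂ) z * dz η z = 0
    rcases Form.notMem_of_disjoint h f η z with h | h <;>
      simp [image_eq_zero_of_notMem_tsupport h, dz_eq_zero h]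
  pair_local hU hV f η h := by
    change (1 / (12 * Real.pi) : ℂ) * ∫ z, dz (dz (dz f)) z * (η : ℂ → ℂ) z = 0
    rw [integral_eq_zero_of_ae, mul_zero]
    refine Filter.Eventually.of_forall fun z => ?_
    rcases Form.notMem_of_disjoint h f η z with h | h
    · simp [dz_three_eq_zero h]
    · simp [image_eq_zero_of_notMem_tsupport h]

/-! ### The Lie algebra of modes and the space of states -/

section modes

variable {𝔞 : Type*} [AddCommGroup 𝔞] [Module ℂ 𝔞]

/-- The Lie algebra of formal modes: finite sums of elements `x_(n)`, `x ∈ 𝔞`, `n ∈ ℤ`, and of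
multiples of a central element `k`. -/
def Datum.Modes (_ : Datum 𝔞) : Type _ := (ℤ →₀ 𝔞) × ℂ

namespace Datum

variable (D : Datum 𝔞)

instance : AddCommGroup D.Modes := inferInstanceAs (AddCommGroup ((ℤ →₀ 𝔞) × ℂ))

instance : Module ℂ D.Modes := inferInstanceAs (Module ℂ ((ℤ →₀ 𝔞) × ℂ))

/-- The mode `x_(n)`, linear in `x`. -/
def gen (n : ℤ) : 𝔞 →ₗ[ℂ] D.Modes := LinearMap.inl ℂ (ℤ →₀ 𝔞) ℂ ∘ₗ Finsupp.lsingle n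

/-- The central element, as a linear map `t ↦ t k`. -/
def cent : ℂ →ₗ[ℂ] D.Modes := LinearMap.inr ℂ (ℤ →₀ 𝔞) ℂ

/-- The projection to the part without central term. -/
def strip : D.Modes →ₗ[ℂ] (ℤ →₀ 𝔞) := LinearMap.fst ℂ (ℤ →₀ 𝔞) ℂ

theorem strip_gen (n : ℤ) (x : 𝔞) : D.strip (D.gen n x) = Finsupp.single n x := rfl

theorem strip_cent (t : ℂ) : D.strip (D.cent t) = 0 := rfl

/-- The bracket of two modes. -/
def genBracket (m n : ℤ) : 𝔞 →ₗ[ℂ] 𝔞 →ₗ[ℂ] D.Modes :=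
  D.e m n • D.bracket.compr₂ (D.gen (m + n - D.wt)) + D.e' m n • D.form.compr₂ D.cent

/-- The bracket of the Lie algebra of modes, as a bilinear map. -/
def modeBracket : D.Modes →ₗ[ℂ] D.Modes →ₗ[ℂ] D.Modes :=
  (Finsupp.lsum ℂ fun m => (LinearMap.flip (Finsupp.lsum ℂ fun n =>
    (D.genBracket m n).flip))).compl₁₂ D.strip D.strip

theorem modeBracket_gen_gen (m n : ℤ) (x y : 𝔞) :
    D.modeBracket (D.gen m x) (D.gen n y) =
      D.e m n • D.gen (m + n - D.wt) (D.bracket x y) + D.e' m n • D.cent (D.form x y) := by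
  simp [modeBracket, strip_gen, genBracket]

theorem modeBracket_cent_left (t : ℂ) (Y : D.Modes) : D.modeBracket (D.cent t) Y = 0 := by
  simp [modeBracket, strip_cent]

theorem modeBracket_cent_right (t : ℂ) (X : D.Modes) : D.modeBracket X (D.cent t) = 0 := by
  simp [modeBracket, strip_cent]

theorem modes_induction {P : D.Modes → Prop} (hg : ∀ n x, P (D.gen n x)) (hc : ∀ t, P (D.cent t))
    (ha : ∀ X Y, P X → P Y → P (X + Y)) (X : D.Modes) : P X := by
  obtain ⟨f, t⟩ := X
  have e : ((f, t) : (ℤ →₀ 𝔞) × ℂ) = (f, 0) + (0, t) := by simp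
  have hf : P ((f, 0) : (ℤ →₀ 𝔞) × ℂ) := by
    clear e
    induction f using Finsupp.induction_linear with
    | zero => have := hc 0; rwa [map_zero] at this
    | add f g hf hg' =>
      have := ha _ _ hf hg'
      have e : ((f + g, 0) : (ℤ →₀ 𝔞) × ℂ) = (f, 0) + (g, 0) := by simp
      rw [e]; exact this
    | single n x => exact hg n x
  rw [e]; exact ha _ _ hf (hc t)

theorem modeBracket_skew (X Y : D.Modes) : D.modeBracket X Y = -D.modeBracket Y X := by
  induction X using D.modes_induction with
  | hc t => rw [modeBracket_cent_left, modeBracket_cent_right, neg_zero]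
  | ha X X' h h' => rw [map_add, map_add, LinearMap.add_apply, h, h', neg_add]
  | hg m x =>
    induction Y using D.modes_induction with
    | hc t => rw [modeBracket_cent_left, modeBracket_cent_right, neg_zero]
    | ha X X' h h' => rw [map_add, map_add, LinearMap.add_apply, h, h', neg_add]
    | hg n y =>
      rw [modeBracket_gen_gen, modeBracket_gen_gen, ← map_smul, D.skew, ← map_smul D.cent,
        smul_eq_mul, D.skew', map_neg, map_neg, add_comm n m, map_smul, ← smul_eq_mul, map_smul,
        neg_add]

theorem modeBracket_jacobi (X Y Z : D.Modes) : D.modeBracket X (D.modeBracket Y Z) =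
    D.modeBracket (D.modeBracket X Y) Z + D.modeBracket Y (D.modeBracket X Z) := by
  induction X using D.modes_induction with
  | hc t => simp [modeBracket_cent_left]
  | ha X X' h h' => simp only [map_add, LinearMap.add_apply, h, h']; abel
  | hg m x =>
    induction Y using D.modes_induction with
    | hc t => simp [modeBracket_cent_left, modeBracket_cent_right]
    | ha Y Y' h h' => simp only [map_add, LinearMap.add_apply, h, h']; abel
    | hg n y =>
      induction Z using D.modes_induction with
      | hc t => simp [modeBracket_cent_right]
      | ha Y Y' h h' => simp only [map_add, h, h']; abel
      | hg p z =>
        have h1 := congrArg (D.gen (m + n + p - D.wt - D.wt)) (D.jacobi m n p x y z)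
        have h2 := congrArg D.cent (D.jacobi' m n p x y z)
        have e1 : m + (n + p - D.wt) - D.wt = m + n + p - D.wt - D.wt := by ring
        have e2 : m + n - D.wt + p - D.wt = m + n + p - D.wt - D.wt := by ring
        have e3 : n + (m + p - D.wt) - D.wt = m + n + p - D.wt - D.wt := by ring
        simp only [map_add, map_smul] at h1
        simp only [map_add, ← smul_eq_mul, map_smul] at h2
        simp only [modeBracket_gen_gen, map_add, map_smul, LinearMap.add_apply,
          LinearMap.smul_apply, modeBracket_cent_left, modeBracket_cent_right, smul_zero, add_zero,
          e1, e2, e3, smul_add, smul_smul]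
        simp only [smul_eq_mul, mul_comm (D.e' _ _) (D.e _ _)] at h1 h2
        simp only [mul_comm (D.e n p) (D.e _ _), mul_comm (D.e m n) (D.e _ _),
          mul_comm (D.e m p) (D.e _ _)]
        linear_combination (norm := module) h1 + h2

instance : LieRing D.Modes where
  bracket X Y := D.modeBracket X Y
  add_lie X Y Z := by
    change D.modeBracket (X + Y) Z = _
    rw [map_add]; rfl
  lie_add X Y Z := by
    change D.modeBracket X (Y + Z) = _
    rw [map_add]
  lie_self X := by
    change D.modeBracket X X = 0
    have h := D.modeBracket_skew X X
    have h2 : (2 : ℂ) • D.modeBracket X X = 0 := by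
      rw [two_smul]; nth_rewrite 2 [h]; simp
    exact (smul_eq_zero.1 h2).resolve_left two_ne_zero
  leibniz_lie X Y Z := D.modeBracket_jacobi X Y Z

instance : LieAlgebra ℂ D.Modes where
  lie_smul c X Y := by
    change D.modeBracket X (c • Y) = _
    exact map_smul _ _ _

/-- The enveloping algebra of the direct sum of the chiral and the anti-chiral Lie algebras of
modes. -/
abbrev Env : Type _ := UniversalEnvelopingAlgebra ℂ (D.Modes × D.Modes)

/-- The chiral mode `a_(n)` in the enveloping algebra. -/
def chiralMode (n : ℤ) (a : 𝔞) : D.Env := UniversalEnvelopingAlgebra.ι ℂ (D.gen n a, 0)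

/-- The anti-chiral mode `ā_(n)` in the enveloping algebra. -/
def antiMode (n : ℤ) (a : 𝔞) : D.Env := UniversalEnvelopingAlgebra.ι ℂ (0, D.gen n a)

/-- The left ideal of the enveloping algebra generated by the relations which hold on the vacuum:
all non-negative modes vanish, both central elements act as the identity. -/
def vacuumIdeal : Submodule D.Env D.Env :=
  Submodule.span D.Env
    ({x | ∃ n : ℕ, ∃ a : 𝔞, x = D.chiralMode n a ∨ x = D.antiMode n a} ∪
      {UniversalEnvelopingAlgebra.ι ℂ (D.cent 1, 0) - 1,
        UniversalEnvelopingAlgebra.ι ℂ (0, D.cent 1) - 1})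

/-- The space of states: the module over the direct sum of the chiral and the anti-chiral Lie
algebras of modes which is induced from the one-dimensional vacuum representation. -/
abbrev State : Type _ := D.Env ⧸ D.vacuumIdeal

/-- The vacuum state. -/
def vacuum : D.State := Submodule.Quotient.mk 1

/-- The monomial `a¹_(-m₁-1) a²_(-m₂-1) … b¹_(-n₁-1) b²_(-n₂-1) … |0⟩`, with barred (anti-chiral)
modes for the entries of the second list. -/
def monomial (la lb : List (𝔞 × ℕ)) : D.State :=
  ((la.map fun x => D.chiralMode (-x.2 - 1) x.1).prod *
    (lb.map fun x => D.antiMode (-x.2 - 1) x.1).prod) • D.vacuum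

/-- The conformal dimension of a string of creation operators: `a_(-m-1)` contributes
`Δ + m`, where `Δ = wt + 1`. -/
def weight (l : List (𝔞 × ℕ)) : ℕ := (l.map fun x => D.wt + 1 + x.2).sum

/-- The `ℝ²`-grading of the space of states by chiral and anti-chiral conformal dimensions. -/
def grading (h : ℝ × ℝ) : Submodule ℂ D.State :=
  Submodule.span ℂ {v | ∃ la lb : List (𝔞 × ℕ),
    h = ((D.weight la : ℝ), (D.weight lb : ℝ)) ∧ v = D.monomial la lb}

end Datum

end modes

/-! ### The prefactorisation algebra -/

section factorisation

variable {𝔞 : Type*} [AddCommGroup 𝔞] [Module ℂ 𝔞]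

namespace Datum

variable (D : Datum 𝔞)

/-- Degree `0` of the local Lie algebra over `U`: chiral and anti-chiral sections. -/
abbrev L0 (U : Opens Sphere) : Type _ :=
  (𝔞 ⊗[ℂ] Form D.wt 0 U) × (𝔞 ⊗[ℂ] Form D.wt 0 (conjOpen U))

/-- Degree `1` of the centrally extended local Lie algebra over `U`: chiral and anti-chiral
`(0,1)`-forms, and multiples of the central element `1`, which has degree `1`. -/
abbrev L1 (U : Opens Sphere) : Type _ :=
  ((𝔞 ⊗[ℂ] Form D.wt 1 U) × (𝔞 ⊗[ℂ] Form D.wt 1 (conjOpen U))) × ℂ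

/-- The differential `∂̄` from degree `0` to degree `1`. -/
def diffL (U : Opens Sphere) : D.L0 U →ₗ[ℂ] D.L1 U :=
  LinearMap.inl ℂ _ ℂ ∘ₗ LinearMap.prodMap (TensorProduct.map LinearMap.id (dolbeault D.wt U))
    (TensorProduct.map LinearMap.id (dolbeault D.wt (conjOpen U)))

/-- The untwisted bracket of a degree `0` with a degree `1` section of one chirality. -/
def secBracket (U : Opens Sphere) :
    𝔞 ⊗[ℂ] Form D.wt 0 U →ₗ[ℂ] 𝔞 ⊗[ℂ] Form D.wt 1 U →ₗ[ℂ] 𝔞 ⊗[ℂ] Form D.wt 1 U :=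
  TensorProduct.map₂ D.bracket (D.op U)

/-- The cocycle on sections of one chirality. -/
def secCocycle (U : Opens Sphere) :
    𝔞 ⊗[ℂ] Form D.wt 0 U →ₗ[ℂ] 𝔞 ⊗[ℂ] Form D.wt 1 U →ₗ[ℂ] ℂ :=
  (TensorProduct.map₂ D.form (D.pair U)).compr₂ (TensorProduct.lid ℂ ℂ).toLinearMap

/-- The bracket of degree `0` with degree `1` in the central extension. -/
def bracketL (U : Opens Sphere) : D.L0 U →ₗ[ℂ] D.L1 U →ₗ[ℂ] D.L1 U :=
  LinearMap.mk₂ ℂ (fun f ω' => ((D.secBracket U f.1 ω'.1.1, D.secBracket (conjOpen U) f.2 ω'.1.2),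
      D.secCocycle U f.1 ω'.1.1 + D.secCocycle (conjOpen U) f.2 ω'.1.2))
    (fun f g η => by ext <;> simp; ring)
    (fun c f η => by ext <;> simp; ring)
    (fun f η η' => by ext <;> simp; ring)
    (fun c f η => by ext <;> simp; ring)

variable {U V W : Opens Sphere}

/-- Extension by zero in degree `0`. -/
def extL0 (h : U ≤ V) : D.L0 U →ₗ[ℂ] D.L0 V :=
  LinearMap.prodMap (TensorProduct.map LinearMap.id (Form.ext h))
    (TensorProduct.map LinearMap.id (Form.ext (conjOpen_mono h)))

/-- Extension by zero in degree `1`. -/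
def extL1 (h : U ≤ V) : D.L1 U →ₗ[ℂ] D.L1 V :=
  LinearMap.prodMap (LinearMap.prodMap (TensorProduct.map LinearMap.id (Form.ext h))
    (TensorProduct.map LinearMap.id (Form.ext (conjOpen_mono h)))) LinearMap.id

theorem diffL_ext (h : U ≤ V) (f : D.L0 U) :
    D.extL1 h (D.diffL U f) = D.diffL V (D.extL0 h f) := by
  have key : ∀ {U V : Opens Sphere} (h : U ≤ V) (t : 𝔞 ⊗[ℂ] Form D.wt 0 U),
      TensorProduct.map LinearMap.id (Form.ext h)
        (TensorProduct.map LinearMap.id (dolbeault D.wt U) t) =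
      TensorProduct.map (LinearMap.id : 𝔞 →ₗ[ℂ] 𝔞) (dolbeault D.wt V)
        (TensorProduct.map LinearMap.id (Form.ext h) t) := by
    intro U V h t
    rw [← LinearMap.comp_apply, ← LinearMap.comp_apply, ← TensorProduct.map_comp,
      ← TensorProduct.map_comp]
    rfl
  simp only [diffL, extL0, extL1, LinearMap.comp_apply, LinearMap.inl_apply,
    LinearMap.prodMap_apply, key, LinearMap.id_apply]

theorem secBracket_ext (h : U ≤ V) (f : 𝔞 ⊗[ℂ] Form D.wt 0 U) (η : 𝔞 ⊗[ℂ] Form D.wt 1 U) :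
    TensorProduct.map LinearMap.id (Form.ext h) (D.secBracket U f η) =
      D.secBracket V (TensorProduct.map LinearMap.id (Form.ext h) f)
        (TensorProduct.map LinearMap.id (Form.ext h) η) := by
  induction f using TensorProduct.induction_on with
  | zero => simp
  | add f g hf hg => simp only [map_add, LinearMap.add_apply, hf, hg]
  | tmul x f =>
    induction η using TensorProduct.induction_on with
    | zero => simp
    | add f g hf hg => simp only [map_add, hf, hg]
    | tmul y η => simp [secBracket, D.op_ext]

theorem secCocycle_ext (h : U ≤ V) (f : 𝔞 ⊗[ℂ] Form D.wt 0 U) (η : 𝔞 ⊗[ℂ] Form D.wt 1 U) :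
    D.secCocycle V (TensorProduct.map LinearMap.id (Form.ext h) f)
        (TensorProduct.map LinearMap.id (Form.ext h) η) = D.secCocycle U f η := by
  induction f using TensorProduct.induction_on with
  | zero => simp
  | add f g hf hg => simp only [map_add, LinearMap.add_apply, hf, hg]
  | tmul x f =>
    induction η using TensorProduct.induction_on with
    | zero => simp
    | add f g hf hg => simp only [map_add, hf, hg]
    | tmul y η => simp [secCocycle, D.pair_ext]

theorem secBracket_local (hU : U ≤ W) (hV : V ≤ W) (h : Disjoint U V)
    (f : 𝔞 ⊗[ℂ] Form D.wt 0 U) (η : 𝔞 ⊗[ℂ] Form D.wt 1 V) :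
    D.secBracket W (TensorProduct.map LinearMap.id (Form.ext hU) f)
        (TensorProduct.map LinearMap.id (Form.ext hV) η) = 0 := by
  induction f using TensorProduct.induction_on with
  | zero => simp
  | add f g hf hg => simp only [map_add, LinearMap.add_apply, hf, hg, add_zero]
  | tmul x f =>
    induction η using TensorProduct.induction_on with
    | zero => simp
    | add f g hf hg => simp only [map_add, hf, hg, add_zero]
    | tmul y η => simp [secBracket, D.op_local hU hV f η h]

theorem secCocycle_local (hU : U ≤ W) (hV : V ≤ W) (h : Disjoint U V)
    (f : 𝔞 ⊗[ℂ] Form D.wt 0 U) (η : 𝔞 ⊗[ℂ] Form D.wt 1 V) :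
    D.secCocycle W (TensorProduct.map LinearMap.id (Form.ext hU) f)
        (TensorProduct.map LinearMap.id (Form.ext hV) η) = 0 := by
  induction f using TensorProduct.induction_on with
  | zero => simp
  | add f g hf hg => simp only [map_add, LinearMap.add_apply, hf, hg, add_zero]
  | tmul x f =>
    induction η using TensorProduct.induction_on with
    | zero => simp
    | add f g hf hg => simp only [map_add, hf, hg, add_zero]
    | tmul y η => simp [secCocycle, D.pair_local hU hV f η h]

theorem bracketL_ext (h : U ≤ V) (f : D.L0 U) (η : D.L1 U) :
    D.extL1 h (D.bracketL U f η) = D.bracketL V (D.extL0 h f) (D.extL1 h η) := by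
  simp only [bracketL, extL0, extL1, LinearMap.mk₂_apply, LinearMap.prodMap_apply,
    secBracket_ext, secCocycle_ext, LinearMap.id_apply]

theorem bracketL_local (hU : U ≤ W) (hV : V ≤ W) (h : Disjoint U V) (f : D.L0 U) (η : D.L1 V) :
    D.bracketL W (D.extL0 hU f) (D.extL1 hV η) = 0 := by
  simp only [bracketL, extL0, extL1, LinearMap.mk₂_apply, LinearMap.prodMap_apply,
    D.secBracket_local hU hV h, D.secCocycle_local hU hV h,
    D.secBracket_local (conjOpen_mono hU) (conjOpen_mono hV) (conjOpen_disjoint h),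
    D.secCocycle_local (conjOpen_mono hU) (conjOpen_mono hV) (conjOpen_disjoint h), add_zero]
  rfl

/-- Degree `0` of the Chevalley-Eilenberg complex: the suspended `(0,1)`-forms have degree `0`. -/
abbrev CE (U : Opens Sphere) : Type _ := SymmetricAlgebra ℂ (D.L1 U)

/-- The inclusion of (suspended) forms in the Chevalley-Eilenberg complex. -/
abbrev sus (U : Opens Sphere) : D.L1 U →ₗ[ℂ] D.CE U := SymmetricAlgebra.ι ℂ (D.L1 U)

/-- The quadratic part of the Chevalley-Eilenberg differential: it sends `sf · sη₁ ⋯ sηₙ` to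
`-∑ i, sη₁ ⋯ s[f, ηᵢ] ⋯ sηₙ`, and this is the sum on the right. -/
def bracketTerm (U : Opens Sphere) (f : D.L0 U) : List (D.L1 U) → D.CE U
  | [] => 0
  | η :: l => D.sus U (D.bracketL U f η) * (l.map (D.sus U)).prod +
      D.sus U η * bracketTerm U f l

/-- The subspace of exact elements in degree `0`, enlarged by the relation that the suspension of
the central element `1` is the unit of the symmetric algebra. Degree `-1` of the
Chevalley-Eilenberg complex is spanned by the elements `sf · sη₁ ⋯ sηₙ`, whose differential is
`-(s∂̄f · sη₁ ⋯ sηₙ + ∑ i, sη₁ ⋯ s[f, ηᵢ] ⋯ sηₙ)`. -/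
def boundaries (U : Opens Sphere) : Submodule ℂ (D.CE U) :=
  Submodule.span ℂ
    ({x | ∃ (f : D.L0 U) (l : List (D.L1 U)),
        x = D.sus U (D.diffL U f) * (l.map (D.sus U)).prod + D.bracketTerm U f l} ∪
      {x | ∃ P : D.CE U, x = P * D.sus U (0, 1) - P})

/-- The degree `0` cohomology of the reduced Chevalley-Eilenberg complex of the local Lie algebra
over `U`; every element of the symmetric algebra is closed, since the local Lie algebra
lives in degrees `0` and `1`. -/
abbrev UL (U : Opens Sphere) : Type _ := D.CE U ⧸ D.boundaries U

/-- Extension by zero on Chevalley-Eilenberg chains. -/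
def extCE (h : U ≤ V) : D.CE U →ₐ[ℂ] D.CE V :=
  SymmetricAlgebra.lift (D.sus V ∘ₗ D.extL1 h)

theorem extL1_one (h : U ≤ V) : D.extL1 h (0, 1) = (0, 1) := by
  refine Prod.ext ?_ rfl
  exact map_zero (LinearMap.prodMap (TensorProduct.map LinearMap.id (Form.ext h))
    (TensorProduct.map LinearMap.id (Form.ext (conjOpen_mono h))))

theorem extCE_sus (h : U ≤ V) (η : D.L1 U) : D.extCE h (D.sus U η) = D.sus V (D.extL1 h η) := by
  simp [extCE]

theorem extCE_prod (h : U ≤ V) (l : List (D.L1 U)) :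
    D.extCE h (l.map (D.sus U)).prod = ((l.map (D.extL1 h)).map (D.sus V)).prod := by
  rw [map_list_prod, List.map_map, List.map_map]
  congr 2
  funext η
  exact D.extCE_sus h η

theorem bracketTerm_ext (h : U ≤ V) (f : D.L0 U) (l : List (D.L1 U)) :
    D.extCE h (D.bracketTerm U f l) = D.bracketTerm V (D.extL0 h f) (l.map (D.extL1 h)) := by
  induction l with
  | nil => simp [bracketTerm]
  | cons η l ih =>
    simp only [bracketTerm, map_add, map_mul, ih, extCE_sus, extCE_prod, bracketL_ext,
      List.map_cons]

theorem bracketTerm_local (hU : U ≤ W) (hV : V ≤ W) (h : Disjoint U V) (f : D.L0 U)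
    (l : List (D.L1 V)) : D.bracketTerm W (D.extL0 hU f) (l.map (D.extL1 hV)) = 0 := by
  induction l with
  | nil => simp [bracketTerm]
  | cons η l ih =>
    simp only [bracketTerm, ih, D.bracketL_local hU hV h, List.map_cons, map_zero, zero_mul,
      mul_zero, add_zero]

theorem bracketTerm_append (f : D.L0 U) (l l' : List (D.L1 U)) :
    D.bracketTerm U f (l ++ l') = D.bracketTerm U f l * (l'.map (D.sus U)).prod +
      (l.map (D.sus U)).prod * D.bracketTerm U f l' := by
  induction l with
  | nil => simp [bracketTerm]
  | cons η l ih =>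
    simp only [List.cons_append, bracketTerm, ih, List.map_append, List.prod_append,
      List.map_cons, List.prod_cons]
    ring

theorem extCE_boundaries (h : U ≤ V) : D.boundaries U ≤ (D.boundaries V).comap (D.extCE h).toLinearMap := by
  refine Submodule.span_le.2 ?_
  rintro _ (⟨f, l, rfl⟩ | ⟨P, rfl⟩)
  · refine Submodule.subset_span (Or.inl ⟨D.extL0 h f, l.map (D.extL1 h), ?_⟩)
    simp only [AlgHom.toLinearMap_apply, map_add, map_mul, extCE_sus, extCE_prod,
      bracketTerm_ext, diffL_ext]
  · refine Submodule.subset_span (Or.inr ⟨D.extCE h P, ?_⟩)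
    simp only [AlgHom.toLinearMap_apply, map_sub, map_mul, extCE_sus, extL1_one]

/-- The unary factorisation product, i.e. extension by zero. -/
def extUL (h : U ≤ V) : D.UL U →ₗ[ℂ] D.UL V :=
  Submodule.mapQ _ _ (D.extCE h).toLinearMap (D.extCE_boundaries h)

theorem span_lists (U : Opens Sphere) :
    Submodule.span ℂ (Set.range fun l : List (D.L1 U) => (l.map (D.sus U)).prod) = ⊤ := by
  rw [eq_top_iff]
  rintro x -
  induction x using SymmetricAlgebra.induction with
  | algebraMap r =>
    rw [Algebra.algebraMap_eq_smul_one]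
    exact Submodule.smul_mem _ _ (Submodule.subset_span ⟨[], by simp⟩)
  | ι x => exact Submodule.subset_span ⟨[x], by simp⟩
  | add a b ha hb => exact Submodule.add_mem _ ha hb
  | mul a b ha hb =>
    have := Submodule.mul_mem_mul ha hb
    rw [Submodule.span_mul_span] at this
    refine Submodule.span_mono ?_ this
    rintro _ ⟨_, ⟨l, rfl⟩, _, ⟨l', rfl⟩, rfl⟩
    exact ⟨l ++ l', by simp⟩

theorem boundary_mul (hU : U ≤ W) (hV : V ≤ W) (h : Disjoint U V) {P : D.CE U} (hP : P ∈ D.boundaries U)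
    (Q : D.CE V) : D.extCE hU P * D.extCE hV Q ∈ D.boundaries W := by
  have hQ : Q ∈ Submodule.span ℂ (Set.range fun l : List (D.L1 V) => (l.map (D.sus V)).prod) := by
    rw [span_lists]; trivial
  induction hP using Submodule.span_induction with
  | zero => simp
  | add a b _ _ ha hb => rw [map_add, add_mul]; exact Submodule.add_mem _ ha hb
  | smul c a _ ha => rw [map_smul, smul_mul_assoc]; exact Submodule.smul_mem _ _ ha
  | mem a ha =>
    rcases ha with ⟨f, l, rfl⟩ | ⟨P, rfl⟩
    · induction hQ using Submodule.span_induction with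
      | zero => simp
      | add a b _ _ ha hb => rw [map_add (D.extCE hV), mul_add]; exact Submodule.add_mem _ ha hb
      | smul c a _ ha => rw [map_smul (D.extCE hV), mul_smul_comm]; exact Submodule.smul_mem _ _ ha
      | mem a ha =>
        obtain ⟨l', rfl⟩ := ha
        refine Submodule.subset_span (Or.inl
          ⟨D.extL0 hU f, l.map (D.extL1 hU) ++ l'.map (D.extL1 hV), ?_⟩)
        simp only [map_add, map_mul, extCE_sus, extCE_prod, bracketTerm_ext, diffL_ext,
          bracketTerm_append, D.bracketTerm_local hU hV h, List.map_append, List.prod_append]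
        ring
    · refine Submodule.subset_span (Or.inr ⟨D.extCE hU P * D.extCE hV Q, ?_⟩)
      simp only [map_sub, map_mul, extCE_sus, extL1_one]
      ring

theorem boundary_mul' (hU : U ≤ W) (hV : V ≤ W) (h : Disjoint U V) (P : D.CE U) {Q : D.CE V}
    (hQ : Q ∈ D.boundaries V) : D.extCE hU P * D.extCE hV Q ∈ D.boundaries W := by
  rw [mul_comm]; exact D.boundary_mul hV hU h.symm hQ P

/-- The product of two chains over open subsets of `W`, as a class over `W`. -/
def mulCE (hU : U ≤ W) (hV : V ≤ W) : D.CE U →ₗ[ℂ] D.CE V →ₗ[ℂ] D.UL W :=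
  LinearMap.mk₂ ℂ (fun P Q => Submodule.Quotient.mk (D.extCE hU P * D.extCE hV Q))
    (fun P P' Q => by rw [map_add, add_mul, Submodule.Quotient.mk_add])
    (fun c P Q => by rw [map_smul, smul_mul_assoc, Submodule.Quotient.mk_smul])
    (fun P Q Q' => by rw [map_add, mul_add, Submodule.Quotient.mk_add])
    (fun c P Q => by rw [map_smul, mul_smul_comm, Submodule.Quotient.mk_smul])

/-- The product of a chain over `U` with a class over `V`. -/
def mulCEUL (hU : U ≤ W) (hV : V ≤ W) (h : Disjoint U V) : D.CE U →ₗ[ℂ] D.UL V →ₗ[ℂ] D.UL W :=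
  LinearMap.flip ((D.boundaries V).liftQ (D.mulCE hU hV).flip fun _ hQ =>
    LinearMap.ext fun P => (Submodule.Quotient.mk_eq_zero _).2 (D.boundary_mul' hU hV h P hQ))

/-- The factorisation product of two classes over disjoint open subsets of `W`:
`[A] ⊗ [B] ↦ [A B]`. -/
def facProd (hU : U ≤ W) (hV : V ≤ W) (h : Disjoint U V) :
    D.UL U →ₗ[ℂ] D.UL V →ₗ[ℂ] D.UL W :=
  (D.boundaries U).liftQ (D.mulCEUL hU hV h) fun _ hP =>
    LinearMap.ext fun Q => Submodule.Quotient.induction_on _ Q fun Q =>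
      (Submodule.Quotient.mk_eq_zero _).2 (D.boundary_mul hU hV h hP Q)

theorem facProd_mk (hU : U ≤ W) (hV : V ≤ W) (h : Disjoint U V) (P : D.CE U) (Q : D.CE V) :
    D.facProd hU hV h (Submodule.Quotient.mk P) (Submodule.Quotient.mk Q) =
      Submodule.Quotient.mk (D.extCE hU P * D.extCE hV Q) := rfl

end Datum

end factorisation

/-! ### Preparation of states -/

/-- A compactly supported smooth function in the planar part of `U` which equals `1` near `p`. -/
structure Bump (p : ℂ) (U : Opens Sphere) where
  toFun : ℂ → ℂ
  smooth : ContDiff ℝ ∞ toFun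
  compact : HasCompactSupport toFun
  subset : ∀ z ∈ tsupport toFun, (z : Sphere) ∈ U
  eq_one : toFun =ᶠ[𝓝 p] fun _ => 1

theorem transition_smoothAt (w i : ℕ) {z : ℂ} (hz : z ≠ 0) :
    ContDiffAt ℝ ∞ (transition w i) z := by
  have h1 : ContDiffAt ℝ ∞ (fun z : ℂ => (-z ^ 2) ^ w) z := by fun_prop
  have h2 : ContDiffAt ℝ ∞ (fun z : ℂ => conj z ^ 2) z :=
    (Complex.conjCLE.toContinuousLinearMap.contDiff.contDiffAt).pow 2
  have h3 : conj z ^ 2 ≠ 0 := pow_ne_zero 2 (by simpa using hz)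
  exact h1.mul ((h2.inv h3).neg.pow i)

/-- A smooth function with compact support in the planar part of `U` is the coefficient of a
section. -/
theorem mem_form_of_compact {w i : ℕ} {U : Opens Sphere} {f : ℂ → ℂ} (hf : ContDiff ℝ ∞ f)
    (hc : HasCompactSupport f) (hU : ∀ z ∈ tsupport f, (z : Sphere) ∈ U) : f ∈ Form w i U := by
  refine ⟨hf, ⟨fun z => if z = 0 then 0 else transition w i z * f z⁻¹, ?_, ?_⟩, ?_⟩
  · rw [contDiff_iff_contDiffAt]
    intro z
    by_cases hz : z = 0
    · subst hz
      obtain ⟨R, hR⟩ := hc.isCompact.isBounded.subset_ball 0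
      have hR' : (0 : ℝ) < max R 1 := by positivity
      have ev : (fun z => if z = 0 then 0 else transition w i z * f z⁻¹) =ᶠ[𝓝 (0 : ℂ)]
          fun _ => 0 := by
        filter_upwards [Metric.ball_mem_nhds (0 : ℂ) (inv_pos.2 hR')] with y hy
        split_ifs with h
        · rfl
        · have hy' : ‖y‖ < (max R 1)⁻¹ := by simpa using hy
          have : y⁻¹ ∉ tsupport f := fun hn => by
            have h1 := hR hn
            simp only [Metric.mem_ball, dist_zero_right, norm_inv] at h1
            have h2 : max R 1 < ‖y‖⁻¹ := by
              rw [lt_inv_comm₀ hR' (norm_pos_iff.2 h)]; exact hy'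
            exact absurd (h1.trans_le (le_max_left R 1)) (not_lt.2 h2.le)
          rw [image_eq_zero_of_notMem_tsupport this, mul_zero]
      exact contDiffAt_const.congr_of_eventuallyEq ev
    · have ev : (fun z => if z = 0 then 0 else transition w i z * f z⁻¹) =ᶠ[𝓝 z]
          fun z => transition w i z * f z⁻¹ := by
        filter_upwards [isOpen_ne.mem_nhds hz] with y hy
        simp [show y ≠ 0 from hy]
      refine ContDiffAt.congr_of_eventuallyEq ?_ ev
      exact (transition_smoothAt w i hz).mul
        (hf.contDiffAt.comp z (contDiffAt_inv ℝ hz))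
  · intro z hz; simp [hz]
  · have hcl : IsClosed ((↑) '' tsupport f : Set Sphere) :=
      (hc.isCompact.image OnePoint.continuous_coe).isClosed
    refine (closure_minimal (Set.image_mono subset_closure) hcl).trans ?_
    rintro _ ⟨z, hz, rfl⟩
    exact hU z hz

/-- The form `-(z - p)^n ∂̄ρ`, with the power extended by zero to the points where `ρ` is locally
constant. -/
def shell (w : ℕ) (p : ℂ) {U : Opens Sphere} (n : ℤ) (ρ : Bump p U) : Form w 1 U :=
  ⟨fun z => -((z - p) ^ n * dbar ρ.toFun z), by
    have hts : tsupport (fun z => -((z - p) ^ n * dbar ρ.toFun z)) ⊆ tsupport ρ.toFun := by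
      refine closure_minimal (fun z hz => ?_) (isClosed_tsupport _)
      by_contra hn
      have : dbar ρ.toFun z = 0 := by
        by_contra h; exact hn (dbar_support _ h)
      exact hz (by simp [this])
    refine mem_form_of_compact ?_ (ρ.compact.mono' (subset_closure.trans hts))
      fun z hz => ρ.subset z (hts hz)
    rw [contDiff_iff_contDiffAt]
    intro z
    by_cases hz : z = p
    · subst hz
      have ev : (fun y => -((y - z) ^ n * dbar ρ.toFun y)) =ᶠ[𝓝 z] fun _ => 0 := by
        filter_upwards [ρ.eq_one.eventuallyEq_nhds] with y hy
        rw [dbar_congr hy]; simp [dbar]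
      exact contDiffAt_const.congr_of_eventuallyEq ev
    · have h1 : ContDiffAt ℝ ∞ (fun y : ℂ => (y - p) ^ n) z := by
        have ha : AnalyticAt ℂ (fun y : ℂ => (y - p) ^ n) z :=
          (analyticAt_id.sub analyticAt_const).zpow (sub_ne_zero.2 hz)
        exact ha.contDiffAt.restrict_scalars ℝ
      exact (h1.mul (dbar_smooth ρ.smooth).contDiffAt).neg⟩

/-- A list of bump functions at `p` is nested if each of them, except for the first, is supported
in the interior of the region where its predecessor is equal to `1`. -/
def Nested {p : ℂ} {U : Opens Sphere} (l : List (Bump p U)) : Prop :=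
  l.IsChain fun ρ ρ' => tsupport ρ'.toFun ⊆ interior {z | ρ.toFun z = 1}

/-- The disc of radius `R` around `p`, as an open subset of the sphere. -/
def disc (p : ℂ) (R : ℝ) : Opens Sphere :=
  ⟨(↑) '' Metric.ball p R, OnePoint.isOpenEmbedding_coe.isOpenMap _ Metric.isOpen_ball⟩

theorem mem_disc {p : ℂ} {R : ℝ} (hR : 0 < R) : (p : Sphere) ∈ disc p R :=
  ⟨p, Metric.mem_ball_self hR, rfl⟩

section states

variable {𝔞 : Type*} [AddCommGroup 𝔞] [Module ℂ 𝔞]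

namespace Datum

variable (D : Datum 𝔞)

/-- The suspended chiral form `s(a ⊗ η)`. -/
def chiralForm {U : Opens Sphere} (a : 𝔞) (η : Form D.wt 1 U) : D.CE U :=
  D.sus U ((a ⊗ₜ[ℂ] η, 0), 0)

/-- The suspended anti-chiral form `s(b ⊗ η)`. -/
def antiForm {U : Opens Sphere} (b : 𝔞) (η : Form D.wt 1 (conjOpen U)) : D.CE U :=
  D.sus U ((0, b ⊗ₜ[ℂ] η), 0)

/-- A family of linear maps, for every point `p` of the plane and every open neighbourhood `U` of
`p` in the sphere, from states to `UL U`. -/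
abbrev Preparation : Type _ :=
  ∀ (p : ℂ) (U : Opens Sphere), (p : Sphere) ∈ U → D.State →ₗ[ℂ] D.UL U

/-- The preparation `A ↦ A_p` of states at points: the monomial with creation operators
`a_(-m-1)` and `b̄_(-n-1)` goes to the class of the product of the forms
`-a ⊗ (z - p)^(-m-1) ∂̄ρ` and `-b ⊗ (z̄ - p̄)^(-n-1) ∂ρ'`, with nested cutoff functions, the
outermost one belonging to the leftmost operator. -/
def IsPreparation (prep : D.Preparation) : Prop :=
  ∀ (p : ℂ) (U : Opens Sphere) (hp : (p : Sphere) ∈ U) (la : List ((𝔞 × ℕ) × Bump p U))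
    (lb : List ((𝔞 × ℕ) × Bump (conj p) (conjOpen U))),
    Nested (la.map Prod.snd) → Nested (lb.map Prod.snd) →
    prep p U hp (D.monomial (la.map Prod.fst) (lb.map Prod.fst)) = Submodule.Quotient.mk
      ((la.map fun x => D.chiralForm x.1.1 (shell D.wt p (-x.1.2 - 1) x.2)).prod *
        (lb.map fun x => D.antiForm x.1.1 (shell D.wt (conj p) (-x.1.2 - 1) x.2)).prod)

/-- Continuity of a linear functional on `UL U`, for `U` contained in the plane: as a function of
`(0,1)`-forms with supports in a fixed compact set, the functional is bounded, on products of
fixed length and with fixed coefficients in `𝔞`, by a `C^k` norm. -/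
def IsContinuousFunctional {U : Opens Sphere} (φ : D.UL U →ₗ[ℂ] ℂ) : Prop :=
  ∀ K : Set ℂ, IsCompact K → (∀ z ∈ K, (z : Sphere) ∈ U) → ∀ (m n : ℕ) (a : Fin m → 𝔞)
    (b : Fin n → 𝔞), ∃ (C : ℝ) (k : ℕ), ∀ (η : Fin m → Form D.wt 1 U)
    (θ : Fin n → Form D.wt 1 (conjOpen U)) (M : Fin m → ℝ) (N : Fin n → ℝ),
    (∀ i, ∀ z ∉ K, (η i : ℂ → ℂ) z = 0) → (∀ i, ∀ z ∉ K, (θ i : ℂ → ℂ) (conj z) = 0) →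
    (∀ i, ∀ j ≤ k, ∀ z, ‖iteratedFDeriv ℝ j (η i : ℂ → ℂ) z‖ ≤ M i) →
    (∀ i, ∀ j ≤ k, ∀ z, ‖iteratedFDeriv ℝ j (θ i : ℂ → ℂ) z‖ ≤ N i) →
    ‖φ (Submodule.Quotient.mk
      ((∏ i, D.chiralForm (a i) (η i)) * ∏ i, D.antiForm (b i) (θ i)))‖ ≤
      C * (∏ i, M i) * ∏ i, N i

/-! ### The vertex operator map -/

/-- The coefficient of `ζ^(-N-1)` in the normally ordered product
`:(1/m₁!) ∂^m₁ a¹(ζ) … (1/m_r!) ∂^m_r a^r(ζ):` (nested from the right) of the fields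
`a(ζ) = ∑ₙ a_(n) ζ^(-n-1)`, applied to a state. The first sum is the contribution of the creation
modes `a_(-k-1)`, the second one is that of the annihilation modes `a_(k)`. -/
def normalOrdered (act : ℤ → 𝔞 → D.State → D.State) :
    List (𝔞 × ℕ) → ℤ → D.State → D.State
  | [], N, B => if N = -1 then B else 0
  | (a, m) :: l, N, B =>
      (∑ᶠ k : ℕ, (Nat.choose k m) • act (-k - 1) a (normalOrdered act l (N + k - m) B)) +
      ∑ᶠ k : ℕ, (Ring.choose (-k - 1 : ℤ) m) • normalOrdered act l (N - k - m - 1) (act k a B)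

/-- The vertex operator map determined by the factorisation products, given through its modes:
`Y n n' A` is the coefficient `A_(n,n')` of `ζ^(-n-1) ζ̄^(-n'-1)` in `Y(A, ζ)`. It is the product
of the normally ordered products of the chiral and of the anti-chiral fields, and
it describes the expansion, as `q` approaches `p`, of the factorisation product of `A` prepared
at `q` with `B` prepared at `p`. -/
structure IsVertexOperator (prep : D.Preparation)
    (Y : ℤ → ℤ → D.State →ₗ[ℂ] D.State →ₗ[ℂ] D.State) : Prop where
  normal_ordering : ∀ (n n' : ℤ) (la lb : List (𝔞 × ℕ)) (B : D.State),
    Y n n' (D.monomial la lb) B =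
      D.normalOrdered (fun k a v => D.chiralMode k a • v) la n
        (D.normalOrdered (fun k a v => D.antiMode k a • v) lb n' B)
  factorisation : ∀ (p q : ℂ) (R : ℝ) (hR : 0 < R), q ≠ p → ‖q - p‖ < R →
    ∀ (Vq Vp : Opens Sphere) (hq : (q : Sphere) ∈ Vq) (hp : (p : Sphere) ∈ Vp)
      (hVq : Vq ≤ disc p R) (hVp : Vp ≤ disc p R) (hV : Disjoint Vq Vp) (A B : D.State)
      (φ : D.UL (disc p R) →ₗ[ℂ] ℂ), D.IsContinuousFunctional φ →
      HasSum (fun n : ℤ × ℤ => (q - p) ^ (-n.1 - 1) * (conj (q - p)) ^ (-n.2 - 1) *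
          φ (prep p (disc p R) (mem_disc hR) (Y n.1 n.2 A B)))
        (φ (D.facProd hVq hVp hV (prep q Vq hq A) (prep p Vp hp B)))

end Datum

end states

end SphereVA

/-! ### Full vertex algebras -/

/-- `z^a z̄^b` for real numbers `a`, `b` with integral difference, which is single valued. -/
def twoPow (z : ℂ) (a b : ℝ) : ℂ := ((‖z‖ ^ (2 * b) : ℝ) : ℂ) * z ^ ⌊a - b⌋

/-- A full vertex algebra: an `ℝ²`-graded complex vector space `F` with a vertex operator map
`Y(A, z) = ∑ A_(r,s) z^(-r-1) z̄^(-s-1)`, given by its modes `A_(r,s) = Y r s A`, and a vacuum. -/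
structure IsFullVertexAlgebra {F : Type*} [AddCommGroup F] [Module ℂ F]
    (𝒢 : ℝ × ℝ → Submodule ℂ F) (Y : ℝ → ℝ → F →ₗ[ℂ] F →ₗ[ℂ] F) (vac : F) : Prop where
  internal : DirectSum.IsInternal 𝒢
  integral_spin : ∀ r s : ℝ, (¬ ∃ n : ℤ, r - s = n) → Y r s = 0
  vac_ne_zero : vac ≠ 0
  vac_mem : vac ∈ 𝒢 (0, 0)
  fv1a : ∀ A B, ∃ N : ℝ, ∀ r s, N ≤ r ∨ N ≤ s → Y r s A B = 0
  fv1b : ∀ A B, ∀ H : ℝ, {x : ℝ × ℝ | Y x.1 x.2 A B ≠ 0 ∧ H ≤ x.1 + x.2}.Finite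
  fv2 : ∀ h h' : ℝ, 𝒢 (h, h') ≠ ⊥ → ∃ n : ℤ, h - h' = n
  fv3_regular : ∀ A r s, Y r s A vac ≠ 0 → ∃ m n : ℕ, -r - 1 = m ∧ -s - 1 = n
  fv3_creation : ∀ A, Y (-1) (-1) A vac = A
  fv4 : ∀ r s, Y r s vac = if r = -1 ∧ s = -1 then LinearMap.id else 0
  fv5 : ∀ (A B C : F) (u : F →ₗ[ℂ] ℂ), {h | ∃ v ∈ 𝒢 h, u v ≠ 0}.Finite →
    ∃ μ : ℂ × ℂ → ℂ, AnalyticOnNhd ℝ μ {z | z.1 ≠ 0 ∧ z.2 ≠ 0 ∧ z.1 ≠ z.2} ∧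
      (∀ z₁ z₂ : ℂ, z₁ ≠ 0 → z₂ ≠ 0 → z₁ ≠ z₂ →
        (‖z₂‖ < ‖z₁‖ → HasSum (fun x : (ℝ × ℝ) × (ℝ × ℝ) =>
          u (Y x.1.1 x.1.2 A (Y x.2.1 x.2.2 B C)) *
            (twoPow z₁ (-x.1.1 - 1) (-x.1.2 - 1) * twoPow z₂ (-x.2.1 - 1) (-x.2.2 - 1)))
          (μ (z₁, z₂))) ∧
        (‖z₁‖ < ‖z₂‖ → HasSum (fun x : (ℝ × ℝ) × (ℝ × ℝ) =>
          u (Y x.2.1 x.2.2 B (Y x.1.1 x.1.2 A C)) *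
            (twoPow z₁ (-x.1.1 - 1) (-x.1.2 - 1) * twoPow z₂ (-x.2.1 - 1) (-x.2.2 - 1)))
          (μ (z₁, z₂))) ∧
        (‖z₁ - z₂‖ < ‖z₂‖ → HasSum (fun x : (ℝ × ℝ) × (ℝ × ℝ) =>
          u (Y x.2.1 x.2.2 (Y x.1.1 x.1.2 A B) C) *
            (twoPow (z₁ - z₂) (-x.1.1 - 1) (-x.1.2 - 1) *
              twoPow z₂ (-x.2.1 - 1) (-x.2.2 - 1)))
          (μ (z₁, z₂))))
  fv6 : ∀ (h h' k k' r s : ℝ), ∀ A ∈ 𝒢 (h, h'), ∀ B ∈ 𝒢 (k, k'),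
    Y r s A B ∈ 𝒢 (h + k - r - 1, h' + k' - s - 1)

open Classical in
/-- Modes with integral indices, as modes indexed by pairs of real numbers. -/
def realModes {F : Type*} [AddCommGroup F] [Module ℂ F] (Y : ℤ → ℤ → F →ₗ[ℂ] F →ₗ[ℂ] F)
    (r s : ℝ) : F →ₗ[ℂ] F →ₗ[ℂ] F :=
  if r = ⌊r⌋ ∧ s = ⌊s⌋ then Y ⌊r⌋ ⌊s⌋ else 0

end

noncomputable section

namespace SphereVA

open Finset.HasAntidiagonal (antidiagonal)

/-! ### Binomial coefficients with integral upper entry -/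

/-- The binomial coefficient `n choose i`, as a complex number. -/
def bin (n : ℤ) (i : ℕ) : ℂ := ((Ring.choose n i : ℤ) : ℂ)

@[simp] theorem bin_zero_right (n : ℤ) : bin n 0 = 1 := by simp [bin]

theorem bin_succ (n : ℤ) (i : ℕ) : bin (n + 1) (i + 1) = bin n i + bin n (i + 1) := by
  simp [bin, Ring.choose_succ_succ]

theorem bin_natCast (m i : ℕ) : bin m i = (Nat.choose m i : ℂ) := by
  simp [bin, Ring.choose_natCast]

theorem bin_zero_left (i : ℕ) : bin 0 i = if i = 0 then 1 else 0 := by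
  have := bin_natCast 0 i
  simp only [Nat.cast_zero] at this
  rw [this]
  cases i <;> simp

theorem bin_neg (m i : ℕ) : bin (-m - 1) i = (-1) ^ i * (Nat.choose (m + i) i : ℂ) := by
  have h : Ring.choose (-(m + 1 : ℤ)) i = (-1) ^ i * (Nat.choose (m + i) i : ℤ) := by
    rw [Ring.choose_neg]
    have : ((m : ℤ) + 1 + i - 1) = ((m + i : ℕ) : ℤ) := by push_cast; ring
    rw [this, Ring.choose_natCast, Int.negOnePow_def]
    simp [Units.smul_def]
  rw [bin, show (-m - 1 : ℤ) = -(m + 1 : ℤ) by ring, h]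
  push_cast; ring

theorem bin_vandermonde (m n : ℤ) (k : ℕ) :
    ∑ p ∈ antidiagonal k, bin m p.1 * bin n p.2 = bin (m + n) k := by
  rw [bin, Ring.add_choose_eq k (Commute.all m n)]
  push_cast
  rfl

theorem factorial_mul_bin (n : ℤ) (i : ℕ) :
    (i.factorial : ℂ) * bin n i = (((descPochhammer ℤ i).eval n : ℤ) : ℂ) := by
  have h := Ring.descPochhammer_eq_factorial_smul_choose n i
  rw [← Polynomial.eval_eq_smeval] at h
  rw [h, bin]; simp

theorem succ_mul_bin (n : ℤ) (i : ℕ) : (i + 1) * bin n (i + 1) = (n - i) * bin n i := by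
  have h0 : (i.factorial : ℂ) ≠ 0 := by exact_mod_cast i.factorial_ne_zero
  have h1 := factorial_mul_bin n (i + 1)
  rw [descPochhammer_succ_right] at h1
  have h2 := factorial_mul_bin n i
  apply mul_left_cancel₀ h0
  rw [Nat.factorial_succ] at h1
  simp only [Polynomial.eval_mul, Polynomial.eval_sub, Polynomial.eval_X,
    Polynomial.eval_natCast] at h1
  push_cast at h1 h2
  linear_combination h1 - (n - i) * h2

theorem succ_mul_bin' (n : ℤ) (i : ℕ) : (i + 1) * bin n (i + 1) = n * bin (n - 1) i := by
  have h := succ_mul_bin (n - 1) i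
  have h' := succ_mul_bin n i
  have p := bin_succ (n - 1) i
  rw [sub_add_cancel] at p
  push_cast at h
  linear_combination (i + 1) * p + h

theorem sub_mul_bin (n : ℤ) (i : ℕ) : (n - i) * bin n i = n * bin (n - 1) i := by
  rw [← succ_mul_bin, succ_mul_bin']

theorem bin_of_lt {n : ℤ} {i : ℕ} (h0 : 0 ≤ n) (h : n < i) : bin n i = 0 := by
  lift n to ℕ using h0
  rw [bin_natCast, Nat.choose_eq_zero_of_lt (by exact_mod_cast h), Nat.cast_zero]

theorem sum_antidiagonal_shift (k : ℕ) (f : ℕ → ℕ → ℂ) :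
    ∑ p ∈ antidiagonal (k + 1), (p.1 : ℂ) * f p.1 p.2 =
      ∑ p ∈ antidiagonal k, ((p.1 : ℂ) + 1) * f (p.1 + 1) p.2 := by
  rw [Finset.Nat.antidiagonal_succ, Finset.sum_cons, Finset.sum_map]
  simp

theorem vandermonde_fst (m n : ℤ) (k : ℕ) :
    ∑ p ∈ antidiagonal (k + 1), (p.1 : ℂ) * (bin m p.1 * bin n p.2) =
      m * bin (m + n - 1) k := by
  rw [sum_antidiagonal_shift k fun i j => bin m i * bin n j,
    show m + n - 1 = (m - 1) + n by ring, ← bin_vandermonde, Finset.mul_sum]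
  refine Finset.sum_congr rfl fun p _ => ?_
  rw [← mul_assoc, succ_mul_bin']; ring

theorem vandermonde_snd (m n : ℤ) (k : ℕ) :
    ∑ p ∈ antidiagonal (k + 1), (p.2 : ℂ) * (bin m p.1 * bin n p.2) =
      n * bin (m + n - 1) k := by
  rw [← Finset.Nat.sum_antidiagonal_swap, add_comm m n, ← vandermonde_fst]
  refine Finset.sum_congr rfl fun p _ => ?_
  simp only [Prod.fst_swap, Prod.snd_swap]; ring

theorem vandermonde_sub_fst (m n : ℤ) (k : ℕ) :
    ∑ p ∈ antidiagonal k, ((m : ℂ) - p.1) * (bin m p.1 * bin n p.2) =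
      m * bin (m + n - 1) k := by
  rw [show m + n - 1 = (m - 1) + n by ring, ← bin_vandermonde, Finset.mul_sum]
  refine Finset.sum_congr rfl fun p _ => ?_
  rw [← mul_assoc, sub_mul_bin]; ring

theorem vandermonde_sub_snd (m n : ℤ) (k : ℕ) :
    ∑ p ∈ antidiagonal k, ((n : ℂ) - p.2) * (bin m p.1 * bin n p.2) =
      n * bin (m + n - 1) k := by
  rw [← Finset.Nat.sum_antidiagonal_swap, add_comm m n, ← vandermonde_sub_fst]
  refine Finset.sum_congr rfl fun p _ => ?_
  simp only [Prod.fst_swap, Prod.snd_swap]; ring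

/-! ### Functions on the integers which are annihilated by a power of the difference operator -/

/-- The difference operator on functions of an integer. -/
def diffOp : (ℤ → ℂ) →ₗ[ℂ] (ℤ → ℂ) where
  toFun f s := f (s + 1) - f s
  map_add' f g := by funext s; simp; ring
  map_smul' c f := by funext s; simp; ring

theorem diffOp_apply (f : ℤ → ℂ) (s : ℤ) : diffOp f s = f (s + 1) - f s := rfl

/-- Polynomial functions on the integers, as functions annihilated by a power of the difference
operator. -/
def IsPoly (f : ℤ → ℂ) : Prop := ∃ N : ℕ, (diffOp ^ N) f = 0

theorem diffOp_pow_mono {f : ℤ → ℂ} {N M : ℕ} (h : N ≤ M) (hf : (diffOp ^ N) f = 0) :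
    (diffOp ^ M) f = 0 := by
  obtain ⟨k, rfl⟩ := Nat.exists_eq_add_of_le' h
  rw [pow_add, Module.End.mul_apply, hf, map_zero]

namespace IsPoly

variable {f g : ℤ → ℂ}

theorem zero : IsPoly 0 := ⟨0, by simp⟩

theorem add (hf : IsPoly f) (hg : IsPoly g) : IsPoly (f + g) := by
  obtain ⟨N, hN⟩ := hf
  obtain ⟨M, hM⟩ := hg
  exact ⟨max N M, by rw [map_add, diffOp_pow_mono (le_max_left N M) hN,
    diffOp_pow_mono (le_max_right N M) hM, add_zero]⟩

theorem smul (c : ℂ) (hf : IsPoly f) : IsPoly (c • f) := by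
  obtain ⟨N, hN⟩ := hf
  exact ⟨N, by rw [map_smul, hN, smul_zero]⟩

theorem sub (hf : IsPoly f) (hg : IsPoly g) : IsPoly (f - g) := by
  have := hf.add (hg.smul (-1))
  simpa [sub_eq_add_neg] using this

theorem sum {ι : Type*} (s : Finset ι) {f : ι → ℤ → ℂ} (h : ∀ i ∈ s, IsPoly (f i)) :
    IsPoly (∑ i ∈ s, f i) := by
  classical
  induction s using Finset.induction_on with
  | empty => simpa using zero
  | insert i s hi ih =>
    rw [Finset.sum_insert hi]
    exact (h i (by simp)).add (ih fun j hj => h j (by simp [hj]))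

theorem of_diffOp (h : IsPoly (diffOp f)) : IsPoly f := by
  obtain ⟨N, hN⟩ := h
  exact ⟨N + 1, by rw [pow_succ, Module.End.mul_apply, hN]⟩

theorem shift_pow (k : ℤ) (f : ℤ → ℂ) (N : ℕ) :
    (diffOp ^ N) (fun s => f (s + k)) = fun s => (diffOp ^ N) f (s + k) := by
  induction N with
  | zero => rfl
  | succ N ih =>
    rw [pow_succ', Module.End.mul_apply, ih]
    funext s
    rw [Module.End.mul_apply, diffOp_apply, diffOp_apply, show s + 1 + k = s + k + 1 by ring]

theorem shift (k : ℤ) (hf : IsPoly f) : IsPoly fun s => f (s + k) := by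
  obtain ⟨N, hN⟩ := hf
  exact ⟨N, by rw [shift_pow, hN]; rfl⟩

theorem const (c : ℂ) : IsPoly fun _ => c :=
  of_diffOp ⟨0, by funext s; simp [diffOp_apply]⟩

theorem id_mul (hf : IsPoly f) : IsPoly fun s => (s : ℂ) * f s := by
  obtain ⟨N, hN⟩ := hf
  induction N generalizing f with
  | zero =>
    have : f = 0 := by simpa using hN
    subst this
    simpa using const 0
  | succ N ih =>
    apply of_diffOp
    have e : (diffOp fun s : ℤ => (s : ℂ) * f s) =
        (fun s : ℤ => (s : ℂ) * diffOp f s) + fun s : ℤ => f (s + 1) := by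
      funext s
      simp only [diffOp_apply, Pi.add_apply]; push_cast; ring
    rw [e]
    have h1 : (diffOp ^ N) (diffOp f) = 0 := by rwa [pow_succ, Module.End.mul_apply] at hN
    exact (ih h1).add (shift 1 ⟨N + 1, hN⟩)

theorem affine_mul (a b : ℂ) (hf : IsPoly f) : IsPoly fun s => (a * s + b) * f s := by
  have := (hf.id_mul.smul a).add (hf.smul b)
  convert this using 1
  funext s
  simp; ring

theorem bin (j : ℕ) : IsPoly fun s => bin s j := by
  induction j with
  | zero => simpa using const 1
  | succ j ih =>
    apply of_diffOp
    convert ih using 1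
    funext s
    rw [diffOp_apply, bin_succ]; ring

/-- Newton's interpolation: a polynomial function all of whose differences vanish at `0`
vanishes. -/
theorem eq_zero (hf : IsPoly f) (h : ∀ k : ℕ, (diffOp ^ k) f 0 = 0) : f = 0 := by
  obtain ⟨N, hN⟩ := hf
  induction N generalizing f with
  | zero => simpa using hN
  | succ N ih =>
    have h1 : diffOp f = 0 := by
      apply ih
      · intro k
        have := h (k + 1)
        rwa [pow_succ, Module.End.mul_apply] at this
      · rwa [pow_succ, Module.End.mul_apply] at hN
    have h2 : ∀ s, f (s + 1) = f s := fun s => by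
      have := congrFun h1 s
      rw [diffOp_apply] at this
      simpa [sub_eq_zero] using this
    have h0 : f 0 = 0 := by simpa using h 0
    funext s
    induction s with
    | zero => exact h0
    | succ n hn => rw [h2]; exact hn
    | pred n hn =>
      have := h2 (-n - 1)
      rw [sub_add_cancel] at this
      rw [← this]; exact hn

end IsPoly

theorem diffOp_pow_bin (j k : ℕ) : (diffOp ^ k) (fun s => bin s j) 0 = if k = j then 1 else 0 := by
  induction k generalizing j with
  | zero => simp [bin_zero_left, eq_comm]
  | succ k ih =>
    rw [pow_succ, Module.End.mul_apply]
    cases j with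
    | zero =>
      have : (diffOp fun s => bin s 0) = 0 := by funext s; simp [diffOp_apply]
      rw [this, map_zero]; simp
    | succ j =>
      have : (diffOp fun s => bin s (j + 1)) = fun s => bin s j := by
        funext s; rw [diffOp_apply, bin_succ]; ring
      rw [this, ih]; simp

theorem diffOp_pow_apply_zero (k : ℕ) (f : ℤ → ℂ) : (diffOp ^ k) f 0 =
    ∑ i ∈ Finset.range (k + 1), (-1) ^ i * bin k i * f (k - i) := by
  suffices h : ∀ s : ℤ, (diffOp ^ k) f s =
      ∑ i ∈ Finset.range (k + 1), (-1) ^ i * bin k i * f (s + k - i) by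
    simpa using h 0
  induction k generalizing f with
  | zero => intro s; simp
  | succ k ih =>
    intro s
    rw [pow_succ, Module.End.mul_apply, ih, Finset.sum_range_succ' _ (k + 1)]
    have e : ∀ i : ℕ, (-1) ^ (i + 1) * bin ((k + 1 : ℕ) : ℤ) (i + 1) * f (s + ((k + 1 : ℕ) : ℤ) - ((i + 1 : ℕ) : ℤ)) =
        -((-1) ^ i * bin k i * f (s + k - i)) +
          (-1) ^ (i + 1) * bin k (i + 1) * f (s + k - i) := by
      intro i
      have : s + ((k + 1 : ℕ) : ℤ) - ((i + 1 : ℕ) : ℤ) = s + k - i := by push_cast; ring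
      rw [this, Nat.cast_succ, bin_succ]; ring
    simp only [e, Finset.sum_add_distrib, diffOp_apply, mul_sub, Finset.sum_sub_distrib]
    have h5 : bin k (k + 1) = 0 := bin_of_lt (by positivity) (by push_cast; omega)
    have h3 : ∑ i ∈ Finset.range (k + 1), (-1) ^ i * bin k i * f (s + k - i + 1) =
        ∑ i ∈ Finset.range (k + 1), (-1) ^ (i + 1) * bin k (i + 1) * f (s + k - i) +
        (-1) ^ 0 * bin ((k + 1 : ℕ) : ℤ) 0 * f (s + ((k + 1 : ℕ) : ℤ) - ((0 : ℕ) : ℤ)) := by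
      rw [Finset.sum_range_succ' _ k, Finset.sum_range_succ (n := k) (f := fun i =>
        (-1) ^ (i + 1) * bin k (i + 1) * f (s + k - i)), h5]
      simp only [mul_zero, zero_mul, add_zero]
      congr 1
      · refine Finset.sum_congr rfl fun i _ => ?_
        congr 2; push_cast; ring
      · simp; congr 1; ring
    rw [h3, Finset.sum_neg_distrib]
    ring

end SphereVA

end

noncomputable section

namespace SphereVA

namespace Datum

variable {𝔞 : Type*} [AddCommGroup 𝔞] [Module ℂ 𝔞] (D : Datum 𝔞)

/-! ### Representations of the two copies of the Lie algebra of modes -/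

/-- The inclusion of one of the two copies of the Lie algebra of modes: the chiral one for `true`,
the anti-chiral one for `false`. -/
def inj (σ : Bool) : D.Modes →ₗ[ℂ] D.Modes × D.Modes :=
  match σ with
  | true => LinearMap.inl ℂ _ _
  | false => LinearMap.inr ℂ _ _

theorem inj_lie (σ : Bool) (X Y : D.Modes) : ⁅D.inj σ X, D.inj σ Y⁆ = D.inj σ ⁅X, Y⁆ := by
  cases σ <;> simp [inj]

theorem inj_lie_of_ne {σ τ : Bool} (h : σ ≠ τ) (X Y : D.Modes) : ⁅D.inj σ X, D.inj τ Y⁆ = 0 := by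
  cases σ <;> cases τ <;> simp at h <;> simp [inj]

theorem lie_gen_gen (m n : ℤ) (x y : 𝔞) : ⁅D.gen m x, D.gen n y⁆ =
    D.e m n • D.gen (m + n - D.wt) (D.bracket x y) + D.e' m n • D.cent (D.form x y) :=
  D.modeBracket_gen_gen m n x y

theorem lie_cent (t : ℂ) (X : D.Modes) : ⁅X, D.cent t⁆ = 0 := D.modeBracket_cent_right t X

theorem cent_lie (t : ℂ) (X : D.Modes) : ⁅D.cent t, X⁆ = 0 := D.modeBracket_cent_left t X

/-- The mode `a_(n)` of chirality `σ`, in the enveloping algebra. -/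
def mode (σ : Bool) (n : ℤ) (a : 𝔞) : D.Env :=
  UniversalEnvelopingAlgebra.ι ℂ (D.inj σ (D.gen n a))

theorem mode_true (n : ℤ) (a : 𝔞) : D.mode true n a = D.chiralMode n a := rfl

theorem mode_false (n : ℤ) (a : 𝔞) : D.mode false n a = D.antiMode n a := rfl

/-- Operators satisfying the commutation relations of the modes, with both central elements acting
as the identity. -/
structure ModeRep (E : Type*) [AddCommGroup E] [Module ℂ E] where
  op : Bool → ℤ → 𝔞 →ₗ[ℂ] E →ₗ[ℂ] E
  same : ∀ σ m n a b v, op σ m a (op σ n b v) - op σ n b (op σ m a v) =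
    D.e m n • op σ (m + n - D.wt) (D.bracket a b) v + (D.e' m n * D.form a b) • v
  diff : ∀ σ τ, σ ≠ τ → ∀ m n a b v, op σ m a (op τ n b v) = op τ n b (op σ m a v)

namespace ModeRep

variable {D} {E : Type*} [AddCommGroup E] [Module ℂ E] (R : D.ModeRep E)

/-- The action of one copy of the Lie algebra of modes. -/
def side (σ : Bool) : D.Modes →ₗ[ℂ] Module.End ℂ E :=
  LinearMap.coprod (Finsupp.lsum ℂ (R.op σ)) (LinearMap.toSpanSingleton ℂ (Module.End ℂ E) 1)

theorem side_gen (σ : Bool) (n : ℤ) (a : 𝔞) : R.side σ (D.gen n a) = R.op σ n a := by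
  change Finsupp.lsum ℂ (R.op σ) (Finsupp.single n a) + (0 : ℂ) • (1 : Module.End ℂ E) = _
  simp

theorem side_cent (σ : Bool) (t : ℂ) : R.side σ (D.cent t) = t • 1 := by
  change Finsupp.lsum ℂ (R.op σ) 0 + t • (1 : Module.End ℂ E) = _
  simp

theorem side_lie (σ : Bool) (X Y : D.Modes) :
    R.side σ ⁅X, Y⁆ = R.side σ X * R.side σ Y - R.side σ Y * R.side σ X := by
  induction X using D.modes_induction with
  | hc t => rw [cent_lie, side_cent]; simp
  | ha X X' h h' => rw [add_lie, map_add, map_add, h, h']; noncomm_ring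
  | hg m x =>
    induction Y using D.modes_induction with
    | hc t => rw [lie_cent, side_cent]; simp
    | ha X X' h h' => rw [lie_add, map_add, map_add, h, h']; noncomm_ring
    | hg n y =>
      rw [lie_gen_gen, map_add, map_smul, map_smul, side_gen, side_gen, side_gen, side_cent]
      ext v
      have := R.same σ m n x y v
      simp only [LinearMap.sub_apply, Module.End.mul_apply, this, LinearMap.add_apply,
        LinearMap.smul_apply, Module.End.one_apply, smul_smul]

theorem side_comm {σ τ : Bool} (h : σ ≠ τ) (X Y : D.Modes) :
    R.side σ X * R.side τ Y = R.side τ Y * R.side σ X := by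
  induction X using D.modes_induction with
  | hc t => rw [side_cent]; simp
  | ha X X' h h' => rw [map_add, add_mul, mul_add, h, h']
  | hg m x =>
    induction Y using D.modes_induction with
    | hc t => rw [side_cent]; simp
    | ha X X' h h' => rw [map_add, add_mul, mul_add, h, h']
    | hg n y =>
      rw [side_gen, side_gen]
      ext v
      exact R.diff σ τ h m n x y v

attribute [local instance 100] LieRing.ofAssociativeRing

/-- The action of both copies of the Lie algebra of modes. -/
def lieHom : (D.Modes × D.Modes) →ₗ⁅ℂ⁆ Module.End ℂ E :=
  { LinearMap.coprod (R.side true) (R.side false) with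
    map_lie' := by
      rintro ⟨X, X'⟩ ⟨Y, Y'⟩
      change R.side true ⁅X, Y⁆ + R.side false ⁅X', Y'⁆ =
        (R.side true X + R.side false X') * (R.side true Y + R.side false Y') -
          (R.side true Y + R.side false Y') * (R.side true X + R.side false X')
      have h1 := R.side_comm (σ := true) (τ := false) (by simp) X Y'
      have h2 := R.side_comm (σ := true) (τ := false) (by simp) Y X'
      rw [side_lie, side_lie]
      simp only [add_mul, mul_add, h1, h2]
      abel }

/-- The action of the enveloping algebra. -/
def envHom : D.Env →ₐ[ℂ] Module.End ℂ E := UniversalEnvelopingAlgebra.lift ℂ R.lieHom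

theorem envHom_ι (X : D.Modes × D.Modes) : R.envHom (UniversalEnvelopingAlgebra.ι ℂ X) =
    R.side true X.1 + R.side false X.2 :=
  UniversalEnvelopingAlgebra.lift_ι_apply ℂ R.lieHom X

theorem envHom_inj (σ : Bool) (X : D.Modes) :
    R.envHom (UniversalEnvelopingAlgebra.ι ℂ (D.inj σ X)) = R.side σ X := by
  rw [envHom_ι]
  cases σ <;> simp [inj]

theorem envHom_mode (σ : Bool) (n : ℤ) (a : 𝔞) : R.envHom (D.mode σ n a) = R.op σ n a := by
  rw [mode, envHom_inj, side_gen]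

/-- The universal property of the space of states. -/
theorem exists_map {v₀ : E} (h : ∀ σ (n : ℕ) a, R.op σ n a v₀ = 0) :
    ∃ F : D.State →ₗ[ℂ] E, F D.vacuum = v₀ ∧ ∀ σ n a s, F (D.mode σ n a • s) = R.op σ n a (F s) := by
  have hker : ∀ x ∈ D.vacuumIdeal, R.envHom x v₀ = 0 := by
    intro x hx
    induction hx using Submodule.span_induction with
    | zero => simp
    | add a b _ _ ha hb => simp [ha, hb]
    | smul c a _ ha => simp [ha]
    | mem a ha =>
      rcases ha with ⟨n, a, rfl | rfl⟩ | rfl | rfl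
      · rw [← mode_true, envHom_mode, h]
      · rw [← mode_false, envHom_mode, h]
      · have := R.envHom_inj true (D.cent 1)
        simp only [inj, LinearMap.inl_apply] at this
        rw [map_sub, this, side_cent]; simp
      · have := R.envHom_inj false (D.cent 1)
        simp only [inj, LinearMap.inr_apply] at this
        rw [map_sub, this, side_cent]; simp
  let F₀ : D.Env →+ E :=
    { toFun := fun x => R.envHom x v₀, map_zero' := by simp, map_add' := by simp }
  let F : D.State →+ E := QuotientAddGroup.lift D.vacuumIdeal.toAddSubgroup F₀ hker
  have hF : ∀ x : D.Env, F (Submodule.Quotient.mk x) = R.envHom x v₀ := fun x => rfl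
  refine ⟨{ F with map_smul' := ?_ }, ?_, ?_⟩
  · intro c s
    induction s using Submodule.Quotient.induction_on with
    | H x =>
      change F (c • Submodule.Quotient.mk x) = c • F (Submodule.Quotient.mk x)
      rw [← Submodule.Quotient.mk_smul, hF, hF, map_smul, LinearMap.smul_apply]
  · change F (Submodule.Quotient.mk 1) = v₀
    rw [hF]; simp
  · intro σ n a s
    induction s using Submodule.Quotient.induction_on with
    | H x =>
      change F (D.mode σ n a • Submodule.Quotient.mk x) = R.op σ n a (F (Submodule.Quotient.mk x))
      rw [← Submodule.Quotient.mk_smul, hF, hF, smul_eq_mul, map_mul, envHom_mode]; rfl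

end ModeRep

/-! ### Modes acting on states -/

attribute [local instance 100] LieRing.ofAssociativeRing

theorem ι_lie (X Y : D.Modes × D.Modes) :
    UniversalEnvelopingAlgebra.ι ℂ X * UniversalEnvelopingAlgebra.ι ℂ Y -
      UniversalEnvelopingAlgebra.ι ℂ Y * UniversalEnvelopingAlgebra.ι ℂ X =
      (UniversalEnvelopingAlgebra.ι ℂ ⁅X, Y⁆ : D.Env) := by
  rw [LieHom.map_lie]; rfl

theorem cent_smul (σ : Bool) (s : D.State) :
    (UniversalEnvelopingAlgebra.ι ℂ (D.inj σ (D.cent 1)) : D.Env) • s = s := by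
  induction s using Submodule.Quotient.induction_on with
  | H x =>
    rw [← Submodule.Quotient.mk_smul, Submodule.Quotient.eq]
    have key : ∀ x : D.Env, (UniversalEnvelopingAlgebra.ι ℂ (D.inj σ (D.cent 1)) : D.Env) * x =
        x * UniversalEnvelopingAlgebra.ι ℂ (D.inj σ (D.cent 1)) := by
      intro x
      have hz : ∀ X : D.Modes × D.Modes, ⁅D.inj σ (D.cent 1), X⁆ = 0 := by
        rintro ⟨X, Y⟩
        have e : ((X, Y) : D.Modes × D.Modes) = D.inj true X + D.inj false Y := by
          simp [inj]
        rw [e, lie_add]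
        cases σ
        · rw [inj_lie_of_ne _ (by simp), inj_lie, cent_lie, map_zero, add_zero]
        · rw [inj_lie, inj_lie_of_ne _ (by simp), cent_lie, map_zero, add_zero]
      let S : Subalgebra ℂ D.Env :=
        Subalgebra.centralizer ℂ {UniversalEnvelopingAlgebra.ι ℂ (D.inj σ (D.cent 1))}
      let f : (D.Modes × D.Modes) →ₗ⁅ℂ⁆ S :=
        { toFun := fun X => ⟨UniversalEnvelopingAlgebra.ι ℂ X, by
            rw [Subalgebra.mem_centralizer_iff]
            rintro _ rfl
            rw [← sub_eq_zero, ι_lie, hz, map_zero]⟩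
          map_add' := fun X Y => by apply Subtype.ext; simp
          map_smul' := fun c X => by apply Subtype.ext; simp
          map_lie' := fun {X Y} => by
            apply Subtype.ext
            change UniversalEnvelopingAlgebra.ι ℂ ⁅X, Y⁆ = _
            rw [← ι_lie]; rfl }
      have hf : S.val.comp (UniversalEnvelopingAlgebra.lift ℂ f) = AlgHom.id ℂ D.Env := by
        apply UniversalEnvelopingAlgebra.hom_ext
        refine LieHom.ext fun X => ?_
        change S.val (UniversalEnvelopingAlgebra.lift ℂ f (UniversalEnvelopingAlgebra.ι ℂ X)) = _
        rw [UniversalEnvelopingAlgebra.lift_ι_apply]; rfl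
      have hx := DFunLike.congr_fun hf x
      have h2 := (UniversalEnvelopingAlgebra.lift ℂ f x).2
      rw [Subalgebra.mem_centralizer_iff] at h2
      have h3 := h2 _ rfl
      have h4 : ((UniversalEnvelopingAlgebra.lift ℂ f x : S) : D.Env) = x := hx
      rwa [h4] at h3
    rw [smul_eq_mul, key x]
    have : x * UniversalEnvelopingAlgebra.ι ℂ (D.inj σ (D.cent 1)) - x =
        x • (UniversalEnvelopingAlgebra.ι ℂ (D.inj σ (D.cent 1)) - 1 : D.Env) := by
      rw [smul_eq_mul, mul_sub, mul_one]
    rw [this]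
    refine Submodule.smul_mem _ _ (Submodule.subset_span (Or.inr ?_))
    cases σ
    · exact Or.inr rfl
    · exact Or.inl rfl

theorem mode_add (σ : Bool) (n : ℤ) (a b : 𝔞) :
    D.mode σ n (a + b) = D.mode σ n a + D.mode σ n b := by
  rw [mode, map_add, map_add, map_add]; rfl

theorem mode_smul (σ : Bool) (n : ℤ) (c : ℂ) (a : 𝔞) :
    D.mode σ n (c • a) = c • D.mode σ n a := by
  rw [mode, map_smul, map_smul, map_smul]; rfl

theorem mode_comm (σ : Bool) (m n : ℤ) (a b : 𝔞) :
    D.mode σ m a * D.mode σ n b - D.mode σ n b * D.mode σ m a =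
      UniversalEnvelopingAlgebra.ι ℂ (D.inj σ (D.e m n • D.gen (m + n - D.wt) (D.bracket a b) +
        D.e' m n • D.cent (D.form a b))) := by
  rw [mode, mode, ι_lie, inj_lie, lie_gen_gen]

theorem mode_comm_of_ne {σ τ : Bool} (h : σ ≠ τ) (m n : ℤ) (a b : 𝔞) :
    D.mode σ m a * D.mode τ n b = D.mode τ n b * D.mode σ m a := by
  rw [← sub_eq_zero, mode, mode, ι_lie, inj_lie_of_ne _ h, map_zero]

/-- The action of the modes on the space of states. -/
def stateRep : D.ModeRep D.State where
  op σ n := LinearMap.mk₂ ℂ (fun a s => D.mode σ n a • s)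
    (fun a b s => by rw [mode_add, add_smul])
    (fun c a s => by rw [mode_smul, smul_assoc])
    (fun a s t => smul_add _ _ _)
    (fun c a s => smul_comm _ _ _)
  same σ m n a b v := by
    change D.mode σ m a • D.mode σ n b • v - D.mode σ n b • D.mode σ m a • v = _
    rw [smul_smul, smul_smul, ← sub_smul, mode_comm]
    have e : D.cent (D.form a b) = D.form a b • D.cent 1 := by
      rw [← map_smul, smul_eq_mul, mul_one]
    rw [e, smul_smul, map_add, map_smul, map_smul, map_add, map_smul, map_smul, add_smul]
    refine congrArg₂ (· + ·) (smul_assoc _ _ _) ((smul_assoc _ _ _).trans ?_)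
    rw [cent_smul]
  diff σ τ h m n a b v := by
    change D.mode σ m a • D.mode τ n b • v = D.mode τ n b • D.mode σ m a • v
    rw [smul_smul, smul_smul, mode_comm_of_ne _ h]

/-- The operator `a_(n)` of chirality `σ` on the space of states. -/
def act (σ : Bool) (n : ℤ) : 𝔞 →ₗ[ℂ] D.State →ₗ[ℂ] D.State := D.stateRep.op σ n

theorem act_apply (σ : Bool) (n : ℤ) (a : 𝔞) (s : D.State) : D.act σ n a s = D.mode σ n a • s :=
  rfl

theorem act_same (σ : Bool) (m n : ℤ) (a b : 𝔞) (v : D.State) :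
    D.act σ m a (D.act σ n b v) - D.act σ n b (D.act σ m a v) =
      D.e m n • D.act σ (m + n - D.wt) (D.bracket a b) v + (D.e' m n * D.form a b) • v :=
  D.stateRep.same σ m n a b v

theorem act_diff {σ τ : Bool} (h : σ ≠ τ) (m n : ℤ) (a b : 𝔞) (v : D.State) :
    D.act σ m a (D.act τ n b v) = D.act τ n b (D.act σ m a v) :=
  D.stateRep.diff σ τ h m n a b v

theorem act_vacuum (σ : Bool) (n : ℕ) (a : 𝔞) : D.act σ n a D.vacuum = 0 := by
  rw [act_apply, vacuum, ← Submodule.Quotient.mk_smul, smul_eq_mul, mul_one,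
    Submodule.Quotient.mk_eq_zero]
  refine Submodule.subset_span (Or.inl ⟨n, a, ?_⟩)
  cases σ
  · exact Or.inr rfl
  · exact Or.inl rfl

theorem exists_equivariant {E : Type*} [AddCommGroup E] [Module ℂ E] (R : D.ModeRep E) {v₀ : E}
    (h : ∀ σ (n : ℕ) a, R.op σ n a v₀ = 0) :
    ∃ F : D.State →ₗ[ℂ] E, F D.vacuum = v₀ ∧
      ∀ σ n a s, F (D.act σ n a s) = R.op σ n a (F s) :=
  R.exists_map h

end Datum

end SphereVA

end

noncomputable section

namespace SphereVA

open Finset.HasAntidiagonal (antidiagonal)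

namespace Datum

variable {𝔞 : Type*} [AddCommGroup 𝔞] [Module ℂ 𝔞]

/-- Numerical properties of the structure constants of the Lie algebra of modes: compatibility of
the bracket and of the cocycle with translations, and vanishing properties. -/
structure Admissible (D : Datum 𝔞) : Prop where
  affine : ∃ A B : ℂ, ∀ m n : ℤ, D.e m n = A + B * (m - n)
  expand : ∀ (m n : ℤ) (k : ℕ), ∑ p ∈ antidiagonal k,
    bin m p.1 * bin n p.2 * D.e (m - p.1) (n - p.2) = D.e m n * bin (m + n - D.wt) k
  expand' : ∀ (m n : ℤ) (k : ℕ), ∑ p ∈ antidiagonal k,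
    bin m p.1 * bin n p.2 * D.e' (m - p.1) (n - p.2) = if k = 0 then D.e' m n else 0
  regular : ∀ (m n : ℤ) (k : ℕ), ∑ p ∈ antidiagonal k,
    bin m p.1 * bin n p.2 * D.e p.1 p.2 =
      if k < D.wt then 0 else D.e m n * bin (m + n - D.wt) (k - D.wt)
  e_low : ∀ i j : ℕ, i + j < D.wt → D.e i j = 0
  e'_nat : ∀ i j : ℕ, D.e' i j = 0
  e'_ne : ∀ m n, D.e' m n ≠ 0 → m + n = 2 * D.wt
  e'_poly : IsPoly fun s => D.e' s (2 * D.wt - s)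

end Datum

theorem kacMoody_admissible {𝔤 : Type*} [LieRing 𝔤] [LieAlgebra ℂ 𝔤] (κ : LinearMap.BilinForm ℂ 𝔤)
    (hsymm : ∀ x y, κ x y = κ y x) (hinv : ∀ x y z, κ ⁅x, y⁆ z = κ x ⁅y, z⁆) :
    (kacMoody 𝔤 κ hsymm hinv).Admissible where
  affine := ⟨1, 0, fun m n => by simp [kacMoody]⟩
  expand m n k := by simp [kacMoody, bin_vandermonde]
  expand' m n k := by
    simp only [kacMoody]
    have e : ∀ p ∈ antidiagonal k, bin m p.1 * bin n p.2 *
        (if m - (p.1 : ℤ) + (n - (p.2 : ℤ)) = 0 then ((m - (p.1 : ℤ) : ℤ) : ℂ) else 0) =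
        if m + n = k then ((m : ℂ) - p.1) * (bin m p.1 * bin n p.2) else 0 := by
      intro p hp
      have hp' : (p.1 : ℤ) + p.2 = k := by
        exact_mod_cast Finset.HasAntidiagonal.mem_antidiagonal.1 hp
      have : m - (p.1 : ℤ) + (n - (p.2 : ℤ)) = 0 ↔ m + n = k := by
        rw [← hp']; constructor <;> intro h <;> linarith
      simp only [this]
      split_ifs
      · push_cast; ring
      · simp
    rw [Finset.sum_congr rfl e]
    by_cases h : m + n = k
    · simp only [if_pos h]
      rw [vandermonde_sub_fst]
      rcases k with _ | k
      · simp [show m + n = 0 by simpa using h]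
      · rw [bin_of_lt (by omega) (by omega), mul_zero, if_neg (by omega)]
    · simp only [if_neg h, Finset.sum_const_zero]
      rcases k with _ | k
      · simp [show m + n ≠ 0 by simpa using h]
      · simp
  regular m n k := by simp [kacMoody, bin_vandermonde]
  e_low i j h := by simp [kacMoody] at h
  e'_nat i j := by
    simp only [kacMoody]
    split_ifs with h
    · have : i = 0 := by omega
      subst this; simp
    · rfl
  e'_ne m n h := by
    simp only [kacMoody, ne_eq, ite_eq_right_iff, Classical.not_imp] at h ⊢
    simpa using h.1
  e'_poly := by
    simp only [kacMoody]
    convert (IsPoly.const 1).affine_mul 1 0 using 1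
    funext s; simp

theorem virasoro_admissible (c : ℝ) : (virasoro c).Admissible where
  affine := ⟨0, 1, fun m n => by simp [virasoro]⟩
  expand m n k := by
    simp only [virasoro]
    push_cast
    rw [sub_mul, ← vandermonde_sub_fst, ← vandermonde_sub_snd, ← Finset.sum_sub_distrib]
    refine Finset.sum_congr rfl fun p _ => ?_
    ring
  expand' m n k := by
    simp only [virasoro]
    have key : ∀ i : ℕ, bin m i * (((m : ℂ) - i) * ((m : ℂ) - i - 1) * ((m : ℂ) - i - 2)) =
        m * (m - 1) * (m - 2) * bin (m - 3) i := by
      intro i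
      have h1 := sub_mul_bin m i
      have h2 := sub_mul_bin (m - 1) i
      have h3 := sub_mul_bin (m - 1 - 1) i
      rw [show m - 1 - 1 - 1 = m - 3 by ring] at h3
      push_cast at h2 h3
      linear_combination ((m : ℂ) - i - 1) * ((m : ℂ) - i - 2) * h1 +
        m * ((m : ℂ) - i - 2) * h2 + m * (m - 1) * h3
    have e : ∀ p ∈ antidiagonal k, bin m p.1 * bin n p.2 *
        (if m - (p.1 : ℤ) + (n - (p.2 : ℤ)) = 2 then ((m - (p.1 : ℤ) : ℤ) : ℂ) *
          (((m - (p.1 : ℤ) : ℤ) : ℂ) - 1) * (((m - (p.1 : ℤ) : ℤ) : ℂ) - 2) / 12 else 0) =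
        if m + n = k + 2 then (m * (m - 1) * (m - 2) / 12) * (bin (m - 3) p.1 * bin n p.2)
          else 0 := by
      intro p hp
      have hp' : (p.1 : ℤ) + p.2 = k := by
        exact_mod_cast Finset.HasAntidiagonal.mem_antidiagonal.1 hp
      have : m - (p.1 : ℤ) + (n - (p.2 : ℤ)) = 2 ↔ m + n = k + 2 := by
        rw [← hp']; constructor <;> intro h <;> linarith
      simp only [this]
      split_ifs
      · push_cast; linear_combination bin n p.2 / 12 * key p.1
      · simp
    rw [Finset.sum_congr rfl e]
    by_cases h : m + n = k + 2
    · simp only [if_pos h]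
      rw [← Finset.mul_sum, bin_vandermonde]
      rcases k with _ | k
      · simp [show m + n = 2 by simpa using h]
      · rw [bin_of_lt (by omega) (by omega), mul_zero, if_neg (by omega)]
    · simp only [if_neg h, Finset.sum_const_zero]
      rcases k with _ | k
      · simp [show m + n ≠ 2 by simpa using h]
      · simp
  regular m n k := by
    change _ = if k < 1 then (0 : ℂ) else ((m : ℂ) - n) * bin (m + n - ((1 : ℕ) : ℤ)) (k - 1)
    simp only [virasoro]
    cases k with
    | zero => simp
    | succ k =>
      rw [if_neg (by omega), add_tsub_cancel_right, sub_mul]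
      push_cast
      rw [← vandermonde_fst, ← vandermonde_snd, ← Finset.sum_sub_distrib]
      refine Finset.sum_congr rfl fun p _ => ?_
      ring
  e_low i j h := by
    simp only [virasoro] at h ⊢
    have h1 : i = 0 := by omega
    have h2 : j = 0 := by omega
    subst h1 h2; simp
  e'_nat i j := by
    simp only [virasoro]
    split_ifs with h
    · have : i = 0 ∨ i = 1 ∨ i = 2 := by omega
      rcases this with rfl | rfl | rfl <;> simp
    · rfl
  e'_ne m n h := by
    simp only [virasoro, ne_eq, ite_eq_right_iff, Classical.not_imp] at h ⊢
    simpa using h.1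
  e'_poly := by
    simp only [virasoro]
    have := ((((IsPoly.const 1).affine_mul 1 0).affine_mul 1 (-1)).affine_mul 1 (-2)).smul (1 / 12)
    convert this using 1
    funext s
    simp; ring

namespace Datum

variable {𝔞 : Type*} [AddCommGroup 𝔞] [Module ℂ 𝔞] (D : Datum 𝔞)

/-! ### Monomials span the space of states -/

theorem act_monomial_true (m : ℕ) (a : 𝔞) (la lb : List (𝔞 × ℕ)) :
    D.act true (-m - 1) a (D.monomial la lb) = D.monomial ((a, m) :: la) lb := by
  simp only [monomial, List.map_cons, List.prod_cons, act_apply, smul_smul, mode_true, mul_assoc]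

theorem act_monomial_false (m : ℕ) (a : 𝔞) (la lb : List (𝔞 × ℕ)) :
    D.act false (-m - 1) a (D.monomial la lb) = D.monomial la ((a, m) :: lb) := by
  induction la with
  | nil =>
    simp only [monomial, List.map_cons, List.prod_cons, act_apply, smul_smul, mode_false,
      List.map_nil, List.prod_nil, one_mul]
  | cons x la ih =>
    obtain ⟨b, n⟩ := x
    rw [← act_monomial_true, act_diff _ (by simp), ih, act_monomial_true]

theorem monomial_nil : D.monomial [] [] = D.vacuum := by
  simp [monomial]

attribute [local instance 100] LieRing.ofAssociativeRing

theorem env_induction {P : D.Env → Prop} (h1 : P 1) (ha : ∀ x y, P x → P y → P (x + y))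
    (hs : ∀ (c : ℂ) x, P x → P (c • x))
    (hm : ∀ X x, P x → P (UniversalEnvelopingAlgebra.ι ℂ X * x)) (x : D.Env) : P x := by
  let S : Submodule ℂ D.Env :=
    { carrier := {x | P x}
      zero_mem' := by have := hs 0 1 h1; rwa [zero_smul] at this
      add_mem' := fun {a b} => ha a b
      smul_mem' := hs }
  let A : Subalgebra ℂ D.Env :=
    { carrier := {x | ∀ y ∈ S, x * y ∈ S}
      mul_mem' := fun {a b} h h' y hy => by rw [mul_assoc]; exact h _ (h' y hy)
      add_mem' := fun {a b} h h' y hy => by rw [add_mul]; exact S.add_mem (h y hy) (h' y hy)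
      algebraMap_mem' := fun r y hy => by
        rw [← Algebra.smul_def]; exact S.smul_mem r hy }
  let f : (D.Modes × D.Modes) →ₗ⁅ℂ⁆ A :=
    { toFun := fun X => ⟨UniversalEnvelopingAlgebra.ι ℂ X, fun y hy => hm X y hy⟩
      map_add' := fun X Y => by apply Subtype.ext; simp
      map_smul' := fun c X => by apply Subtype.ext; simp
      map_lie' := fun {X Y} => by
        apply Subtype.ext
        change UniversalEnvelopingAlgebra.ι ℂ ⁅X, Y⁆ = _
        rw [← ι_lie]; rfl }
  have hf : A.val.comp (UniversalEnvelopingAlgebra.lift ℂ f) = AlgHom.id ℂ D.Env := by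
    apply UniversalEnvelopingAlgebra.hom_ext
    refine LieHom.ext fun X => ?_
    change A.val (UniversalEnvelopingAlgebra.lift ℂ f (UniversalEnvelopingAlgebra.ι ℂ X)) = _
    rw [UniversalEnvelopingAlgebra.lift_ι_apply]; rfl
  have hx : ((UniversalEnvelopingAlgebra.lift ℂ f x : A) : D.Env) = x := DFunLike.congr_fun hf x
  have := (UniversalEnvelopingAlgebra.lift ℂ f x).2 1 h1
  rw [hx, mul_one] at this
  exact this

theorem ι_smul_eq (X : D.Modes × D.Modes) (s : D.State) :
    (UniversalEnvelopingAlgebra.ι ℂ X : D.Env) • s = D.stateRep.side true X.1 s + D.stateRep.side false X.2 s := by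
  have key : ∀ (σ : Bool) (X : D.Modes),
      (UniversalEnvelopingAlgebra.ι ℂ (D.inj σ X) : D.Env) • s = D.stateRep.side σ X s := by
    intro σ X
    induction X using D.modes_induction with
    | hg n x => rw [ModeRep.side_gen]; rfl
    | hc t =>
      have e : D.cent t = t • D.cent 1 := by rw [← map_smul, smul_eq_mul, mul_one]
      rw [ModeRep.side_cent, e, map_smul, map_smul]
      refine (smul_assoc _ _ _).trans ?_
      rw [cent_smul]; rfl
    | ha X Y hX hY => rw [map_add, map_add, map_add]; exact (add_smul _ _ _).trans (by rw [hX, hY]; rfl)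
  have e : X = D.inj true X.1 + D.inj false X.2 := by simp [inj]
  conv_lhs => rw [e, map_add]
  refine (add_smul _ _ _).trans ?_
  rw [key, key]

/-- A subspace which contains the vacuum and is stable under all modes is everything. -/
theorem eq_top_of_stable {S : Submodule ℂ D.State} (hv : D.vacuum ∈ S)
    (h : ∀ σ n a, ∀ s ∈ S, D.act σ n a s ∈ S) : S = ⊤ := by
  have hside : ∀ σ X, ∀ s ∈ S, D.stateRep.side σ X s ∈ S := by
    intro σ X s hs
    induction X using D.modes_induction with
    | hg n x => rw [ModeRep.side_gen]; exact h σ n x s hs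
    | hc t => rw [ModeRep.side_cent]; exact S.smul_mem t hs
    | ha X Y hX hY => rw [map_add]; exact S.add_mem hX hY
  rw [eq_top_iff]
  rintro s -
  induction s using Submodule.Quotient.induction_on with
  | H x =>
    suffices hx : x • D.vacuum ∈ S by
      rwa [vacuum, ← Submodule.Quotient.mk_smul, smul_eq_mul, mul_one] at hx
    induction x using D.env_induction with
    | h1 => rwa [one_smul]
    | ha x y hx hy => rw [add_smul]; exact S.add_mem hx hy
    | hs c x hx => rw [smul_assoc]; exact S.smul_mem c hx
    | hm X x hx =>
      rw [mul_smul, ι_smul_eq]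
      exact S.add_mem (hside _ _ _ hx) (hside _ _ _ hx)

variable {D}

/-- The unit vector of `ℤ²` in the direction of the chirality `σ`. -/
def dir (σ : Bool) : ℤ × ℤ :=
  match σ with
  | true => (1, 0)
  | false => (0, 1)

/-- The same, as a real vector. -/
def rdir (σ : Bool) : ℝ × ℝ :=
  match σ with
  | true => (1, 0)
  | false => (0, 1)

theorem vacuum_mem_grading : D.vacuum ∈ D.grading (0, 0) :=
  Submodule.subset_span ⟨[], [], by simp [weight], D.monomial_nil.symm⟩

theorem act_neg_mem (σ : Bool) (m : ℕ) (a : 𝔞) {h : ℝ × ℝ} {s : D.State} (hs : s ∈ D.grading h) :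
    D.act σ (-m - 1) a s ∈ D.grading (h + ((D.wt : ℝ) + 1 + m) • rdir σ) := by
  induction hs using Submodule.span_induction with
  | zero => simp
  | add x y _ _ hx hy => rw [map_add]; exact Submodule.add_mem _ hx hy
  | smul c x _ hx => rw [map_smul]; exact Submodule.smul_mem _ c hx
  | mem x hx =>
    obtain ⟨la, lb, rfl, rfl⟩ := hx
    refine Submodule.subset_span ?_
    cases σ
    · exact ⟨la, (a, m) :: lb, by simp [weight, rdir]; ring, D.act_monomial_false m a la lb⟩
    · exact ⟨(a, m) :: la, lb, by simp [weight, rdir]; ring, D.act_monomial_true m a la lb⟩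

/-- The modes are homogeneous. -/
theorem act_mem (hD : D.Admissible) (σ : Bool) (n : ℤ) (a : 𝔞) {h : ℝ × ℝ} {s : D.State}
    (hs : s ∈ D.grading h) : D.act σ n a s ∈ D.grading (h + ((D.wt : ℝ) - n) • rdir σ) := by
  rcases lt_or_ge n 0 with hn | hn
  · obtain ⟨m, rfl⟩ : ∃ m : ℕ, n = -m - 1 := ⟨(-n - 1).toNat, by omega⟩
    have := act_neg_mem σ m a hs
    convert this using 4
    push_cast; ring
  induction hs using Submodule.span_induction with
  | zero => simp
  | add x y _ _ hx hy => rw [map_add]; exact Submodule.add_mem _ hx hy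
  | smul c x _ hx => rw [map_smul]; exact Submodule.smul_mem _ c hx
  | mem x hx =>
    obtain ⟨la, lb, rfl, rfl⟩ := hx
    have main : ∀ (τ : Bool) (m : ℕ) (b : 𝔞) (s : D.State) (h : ℝ × ℝ), s ∈ D.grading h →
        (∀ (n : ℤ) (a : 𝔞), 0 ≤ n → D.act σ n a s ∈ D.grading (h + ((D.wt : ℝ) - n) • rdir σ)) →
        ∀ (n : ℤ) (a : 𝔞), 0 ≤ n → D.act σ n a (D.act τ (-m - 1) b s) ∈
          D.grading (h + ((D.wt : ℝ) + 1 + m) • rdir τ + ((D.wt : ℝ) - n) • rdir σ) := by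
      intro τ m b s h hs ih n a hn
      have h1 : D.act τ (-m - 1) b (D.act σ n a s) ∈
          D.grading (h + ((D.wt : ℝ) + 1 + m) • rdir τ + ((D.wt : ℝ) - n) • rdir σ) := by
        have := act_neg_mem τ m b (ih n a hn)
        rwa [add_right_comm] at this
      by_cases hστ : σ = τ
      · subst hστ
        rw [← sub_add_cancel (D.act σ n a (D.act σ (-m - 1) b s))
          (D.act σ (-m - 1) b (D.act σ n a s)), act_same]
        refine Submodule.add_mem _ (Submodule.add_mem _ (Submodule.smul_mem _ _ ?_) ?_) h1
        · have e : h + ((D.wt : ℝ) + 1 + m) • rdir σ + ((D.wt : ℝ) - n) • rdir σ =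
              h + ((D.wt : ℝ) - ((n + (-m - 1) - D.wt : ℤ) : ℝ)) • rdir σ := by
            rw [add_assoc, ← add_smul]; congr 2; push_cast; ring
          rw [e]
          rcases lt_or_ge (n + (-m - 1) - D.wt : ℤ) 0 with hk | hk
          · obtain ⟨k, hk'⟩ : ∃ k : ℕ, (n + (-m - 1) - D.wt : ℤ) = -k - 1 :=
              ⟨(-(n + (-m - 1) - D.wt : ℤ) - 1).toNat, by omega⟩
            rw [hk']
            have := act_neg_mem σ k (D.bracket a b) hs
            convert this using 4
            push_cast; ring
          · exact ih _ _ hk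
        · by_cases he : D.e' n (-m - 1) = 0
          · rw [he, zero_mul, zero_smul]; exact Submodule.zero_mem _
          · have := hD.e'_ne _ _ he
            have e : h + ((D.wt : ℝ) + 1 + m) • rdir σ + ((D.wt : ℝ) - n) • rdir σ = h := by
              have h2 : (n : ℝ) + (-m - 1) = 2 * D.wt := by exact_mod_cast this
              rw [add_assoc, ← add_smul, show (D.wt : ℝ) + 1 + m + (D.wt - n) = 0 by linarith,
                zero_smul, add_zero]
            rw [e]
            exact Submodule.smul_mem _ _ hs
      · rw [act_diff _ hστ]; exact h1
    have base : ∀ (n : ℤ) (a : 𝔞), 0 ≤ n →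
        D.act σ n a D.vacuum ∈ D.grading ((0, 0) + ((D.wt : ℝ) - n) • rdir σ) := by
      intro n a hn
      lift n to ℕ using hn
      rw [act_vacuum]; exact Submodule.zero_mem _
    have hb : ∀ lb : List (𝔞 × ℕ), ∀ (n : ℤ) (a : 𝔞), 0 ≤ n → D.act σ n a (D.monomial [] lb) ∈
        D.grading ((((D.weight [] : ℕ) : ℝ), ((D.weight lb : ℕ) : ℝ)) +
          ((D.wt : ℝ) - n) • rdir σ) := by
      intro lb
      induction lb with
      | nil => simpa [monomial_nil, weight] using base
      | cons x lb ih =>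
        obtain ⟨b, m⟩ := x
        intro n a hn
        have := main false m b _ _ (Submodule.subset_span ⟨[], lb, rfl, rfl⟩) ih n a hn
        rw [act_monomial_false] at this
        convert this using 3
        simp [weight, rdir]; ring
    have ha : ∀ la : List (𝔞 × ℕ), ∀ (n : ℤ) (a : 𝔞), 0 ≤ n → D.act σ n a (D.monomial la lb) ∈
        D.grading ((((D.weight la : ℕ) : ℝ), ((D.weight lb : ℕ) : ℝ)) +
          ((D.wt : ℝ) - n) • rdir σ) := by
      intro la
      induction la with
      | nil => exact hb lb
      | cons x la ih =>
        obtain ⟨b, m⟩ := x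
        intro n a hn
        have := main true m b _ _ (Submodule.subset_span ⟨la, lb, rfl, rfl⟩) ih n a hn
        rw [act_monomial_true] at this
        convert this using 3
        simp [weight, rdir]; ring
    exact ha la n a hn

theorem iSup_grading (hD : D.Admissible) : ⨆ h, D.grading h = ⊤ := by
  apply D.eq_top_of_stable
  · exact Submodule.mem_iSup_of_mem _ vacuum_mem_grading
  · intro σ n a s hs
    induction hs using Submodule.iSup_induction' with
    | mem h x hx => exact Submodule.mem_iSup_of_mem _ (act_mem hD σ n a hx)
    | zero => simp
    | add x y _ _ hx hy => rw [map_add]; exact Submodule.add_mem _ hx hy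

theorem span_monomial (hD : D.Admissible) :
    Submodule.span ℂ {v | ∃ la lb : List (𝔞 × ℕ), v = D.monomial la lb} = ⊤ := by
  rw [eq_top_iff, ← iSup_grading hD, iSup_le_iff]
  intro h
  refine Submodule.span_mono ?_
  rintro v ⟨la, lb, -, rfl⟩
  exact ⟨la, lb, rfl⟩

/-- Induction on states: they are generated from the vacuum by creation operators. -/
theorem state_induction (hD : D.Admissible) {P : D.State → Prop} (hv : P D.vacuum)
    (ha : ∀ s t, P s → P t → P (s + t)) (hs : ∀ (c : ℂ) s, P s → P (c • s))
    (hm : ∀ σ (m : ℕ) a s, P s → P (D.act σ (-m - 1) a s)) (s : D.State) : P s := by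
  have : s ∈ Submodule.span ℂ {v | ∃ la lb : List (𝔞 × ℕ), v = D.monomial la lb} := by
    rw [span_monomial hD]; trivial
  induction this using Submodule.span_induction with
  | zero => have := hs 0 _ hv; rwa [zero_smul] at this
  | add x y _ _ hx hy => exact ha x y hx hy
  | smul c x _ hx => exact hs c x hx
  | mem x hx =>
    obtain ⟨la, lb, rfl⟩ := hx
    induction la with
    | nil =>
      induction lb with
      | nil => rwa [monomial_nil]
      | cons x lb ih => rw [← act_monomial_false]; exact hm _ _ _ _ ih
    | cons x la ih => rw [← act_monomial_true]; exact hm _ _ _ _ ih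

/-- The grading is concentrated in pairs of natural numbers. -/
theorem exists_nat_of_ne_bot {h : ℝ × ℝ} (hh : D.grading h ≠ ⊥) :
    ∃ m n : ℕ, h = ((m : ℝ), (n : ℝ)) := by
  by_contra hn
  apply hh
  rw [grading, Submodule.span_eq_bot]
  rintro v ⟨la, lb, rfl, -⟩
  exact absurd ⟨_, _, rfl⟩ hn

/-- The rescaling of modes by powers of `2` and of `3`. -/
def scaleBase (σ : Bool) : ℂ := cond σ 2 3

theorem scaleBase_ne_zero (σ : Bool) : scaleBase σ ≠ 0 := by
  cases σ <;> simp [scaleBase]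

/-- The modes, rescaled according to their degree. -/
def scaledRep (hD : D.Admissible) : D.ModeRep D.State where
  op σ n := scaleBase σ ^ ((D.wt : ℤ) - n) • D.act σ n
  same σ m n a b v := by
    have h0 := scaleBase_ne_zero σ
    simp only [LinearMap.smul_apply, map_smul, smul_smul]
    rw [mul_comm (scaleBase σ ^ ((D.wt : ℤ) - n)), ← smul_sub, act_same, smul_add, smul_smul,
      smul_smul, ← zpow_add₀ h0]
    congr 2
    · rw [mul_comm]; congr 2; ring
    · by_cases he : D.e' m n = 0
      · simp [he]
      · have := hD.e'_ne _ _ he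
        rw [show (D.wt : ℤ) - m + (D.wt - n) = 0 by linarith, zpow_zero, one_mul]
  diff σ τ h m n a b v := by
    simp only [LinearMap.smul_apply, map_smul]
    rw [act_diff _ h, smul_comm]

theorem exists_scaling (hD : D.Admissible) : ∃ θ : D.State →ₗ[ℂ] D.State,
    ∀ la lb, θ (D.monomial la lb) = ((2 : ℂ) ^ D.weight la * 3 ^ D.weight lb) • D.monomial la lb := by
  obtain ⟨θ, h0, h1⟩ := D.exists_equivariant (scaledRep hD) (v₀ := D.vacuum) (fun σ n a => by
    simp only [scaledRep, LinearMap.smul_apply, act_vacuum, smul_zero])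
  have h2 : ∀ σ (m : ℕ) a s, θ (D.act σ (-m - 1) a s) =
      scaleBase σ ^ (D.wt + 1 + m) • D.act σ (-m - 1) a (θ s) := by
    intro σ m a s
    rw [h1]
    simp only [scaledRep, LinearMap.smul_apply]
    congr 1
    rw [← zpow_natCast]; congr 1; push_cast; ring
  refine ⟨θ, fun la lb => ?_⟩
  induction la with
  | nil =>
    induction lb with
    | nil => simp [monomial_nil, h0, weight]
    | cons x lb ih =>
      obtain ⟨a, m⟩ := x
      rw [← act_monomial_false, h2, ih, map_smul, smul_smul]
      congr 1
      simp only [scaleBase, weight, List.map_cons, List.sum_cons, pow_add, cond_false]; ring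
  | cons x la ih =>
    obtain ⟨a, m⟩ := x
    rw [← act_monomial_true, h2, ih, map_smul, smul_smul]
    congr 1
    simp only [scaleBase, weight, List.map_cons, List.sum_cons, pow_add, cond_true]; ring

theorem two_pow_mul_three_pow_inj {a b c d : ℕ} (h : (2 : ℂ) ^ a * 3 ^ b = 2 ^ c * 3 ^ d) :
    a = c ∧ b = d := by
  have h' : 2 ^ a * 3 ^ b = 2 ^ c * 3 ^ d := by exact_mod_cast h
  have h2 := congrArg (fun n => n.factorization 2) h'
  have h3 := congrArg (fun n => n.factorization 3) h'
  have e23 : Nat.factorization 3 2 = 0 := Nat.factorization_eq_zero_of_not_dvd (by norm_num)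
  have e32 : Nat.factorization 2 3 = 0 := Nat.factorization_eq_zero_of_not_dvd (by norm_num)
  have e22 : Nat.factorization 2 2 = 1 := Nat.prime_two.factorization_self
  have e33 : Nat.factorization 3 3 = 1 := Nat.prime_three.factorization_self
  simp only [Nat.factorization_mul (pow_ne_zero _ two_ne_zero) (pow_ne_zero _ three_ne_zero),
    Nat.factorization_pow, Finsupp.add_apply, Finsupp.smul_apply, e23, e32, e22, e33,
    smul_eq_mul, mul_zero, mul_one, add_zero, zero_add] at h2 h3
  exact ⟨h2, h3⟩

theorem iSupIndep_grading (hD : D.Admissible) : iSupIndep D.grading := by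
  obtain ⟨θ, hθ⟩ := exists_scaling hD
  rw [← iSupIndep_ne_bot]
  choose f g hfg using fun i : {h // D.grading h ≠ ⊥} => exists_nat_of_ne_bot i.2
  let μ : {h // D.grading h ≠ ⊥} → ℂ := fun i => 2 ^ f i * 3 ^ g i
  have hμ : Function.Injective μ := by
    intro i j hij
    obtain ⟨h1, h2⟩ := two_pow_mul_three_pow_inj hij
    apply Subtype.ext
    rw [hfg, hfg j, h1, h2]
  refine ((Module.End.eigenspaces_iSupIndep θ).comp hμ).mono fun i => ?_
  rw [grading, Submodule.span_le]
  rintro v ⟨la, lb, hh, rfl⟩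
  rw [SetLike.mem_coe, Function.comp_apply, Module.End.mem_eigenspace_iff, hθ]
  rw [hfg] at hh
  have h1 : f i = D.weight la := Nat.cast_injective (congrArg Prod.fst hh)
  have h2 : g i = D.weight lb := Nat.cast_injective (congrArg Prod.snd hh)
  simp only [μ, h1, h2]

theorem grading_internal (hD : D.Admissible) : DirectSum.IsInternal D.grading :=
  DirectSum.isInternal_submodule_of_iSupIndep_of_iSup_eq_top (iSupIndep_grading hD)
    (iSup_grading hD)

end Datum

end SphereVA

end

noncomputable section

namespace SphereVA

/-! ### Modules induced from a complementary subalgebra -/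

section induced

variable {L : Type*} [LieRing L] [LieAlgebra ℂ L]

attribute [local instance 100] LieRing.ofAssociativeRing

/-- A Lie algebra which is the direct sum, as a vector space, of two subalgebras `N` and `H`,
given through the projection `P` to `N` with kernel `H`, together with a character of `H`. -/
structure Splitting (L : Type*) [LieRing L] [LieAlgebra ℂ L] where
  N : LieSubalgebra ℂ L
  H : LieSubalgebra ℂ L
  P : L →ₗ[ℂ] N
  χ : L →ₗ[ℂ] ℂ
  sub_mem : ∀ X, X - P X ∈ H
  P_coe : ∀ y : N, P y = y
  P_H : ∀ x ∈ H, P x = 0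
  χ_lie : ∀ x ∈ H, ∀ x' ∈ H, χ ⁅x, x'⁆ = 0

namespace Splitting

variable (S : Splitting L)

/-- The underlying space of the induced module. -/
abbrev Ind : Type _ := UniversalEnvelopingAlgebra ℂ S.N

/-- The inclusion of `N` in its enveloping algebra. -/
def j : S.N →ₗ[ℂ] S.Ind := (UniversalEnvelopingAlgebra.ι ℂ : S.N →ₗ⁅ℂ⁆ S.Ind).toLinearMap

theorem j_lie (y y' : S.N) : S.j ⁅y, y'⁆ = S.j y * S.j y' - S.j y' * S.j y := by
  change UniversalEnvelopingAlgebra.ι ℂ ⁅y, y'⁆ = _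
  rw [LieHom.map_lie]; rfl

/-- The projection with kernel `N`. -/
def Q : L →ₗ[ℂ] L := LinearMap.id - S.N.subtype ∘ₗ S.P

theorem Q_apply (X : L) : S.Q X = X - S.P X := rfl

theorem Q_coe (y : S.N) : S.Q y = 0 := by rw [Q_apply, P_coe, sub_self]

/-- The operator of `y ∈ N` on pairs consisting of an element `u` of the induced module and of the
values of all elements of the Lie algebra on it. -/
def step (y : S.N) : (S.Ind × (L →ₗ[ℂ] S.Ind)) →ₗ[ℂ] S.Ind × (L →ₗ[ℂ] S.Ind) where
  toFun w := (S.j y * w.1, LinearMap.mulRight ℂ w.1 ∘ₗ S.j ∘ₗ S.P ∘ₗ LieModule.toEnd ℂ L L (-y) +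
    w.2 ∘ₗ S.Q ∘ₗ LieModule.toEnd ℂ L L (-y) + LinearMap.mulLeft ℂ (S.j y) ∘ₗ w.2)
  map_add' w w' := by
    ext x
    · simp [mul_add]
    · simp [mul_add]; abel
  map_smul' c w := by
    ext x <;> simp

theorem step_fst (y : S.N) (w : S.Ind × (L →ₗ[ℂ] S.Ind)) : (S.step y w).1 = S.j y * w.1 := rfl

theorem step_snd (y : S.N) (w : S.Ind × (L →ₗ[ℂ] S.Ind)) (x : L) : (S.step y w).2 x =
    S.j (S.P ⁅x, (y : L)⁆) * w.1 + w.2 (S.Q ⁅x, (y : L)⁆) + S.j y * w.2 x := by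
  have e : ⁅-(y : L), x⁆ = ⁅x, (y : L)⁆ := by rw [neg_lie, lie_skew]
  change S.j (S.P ⁅-(y : L), x⁆) * w.1 + w.2 (S.Q ⁅-(y : L), x⁆) + S.j y * w.2 x = _
  rw [e]

theorem step_lie (y y' : S.N) (w : S.Ind × (L →ₗ[ℂ] S.Ind)) :
    S.step ⁅y, y'⁆ w = S.step y (S.step y' w) - S.step y' (S.step y w) := by
  refine Prod.ext ?_ (LinearMap.ext fun x => ?_)
  · simp only [step_fst, Prod.fst_sub, j_lie, sub_mul, mul_assoc]
  · have hP : ∀ X (y : S.N), S.P ⁅X, (y : L)⁆ = ⁅S.P X, y⁆ + S.P ⁅S.Q X, (y : L)⁆ := by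
      intro X y
      have : ⁅X, (y : L)⁆ = (⁅S.P X, y⁆ : S.N) + ⁅S.Q X, (y : L)⁆ := by
        rw [LieSubalgebra.coe_bracket, ← add_lie, Q_apply, add_sub_cancel]
      rw [this, map_add, P_coe]
    have hQ : ∀ X (y : S.N), S.Q ⁅X, (y : L)⁆ = S.Q ⁅S.Q X, (y : L)⁆ := by
      intro X y
      have : ⁅X, (y : L)⁆ = (⁅S.P X, y⁆ : S.N) + ⁅S.Q X, (y : L)⁆ := by
        rw [LieSubalgebra.coe_bracket, ← add_lie, Q_apply, add_sub_cancel]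
      rw [this, map_add, Q_coe, zero_add]
    have hj : ⁅x, ((⁅y, y'⁆ : S.N) : L)⁆ = ⁅⁅x, (y : L)⁆, (y' : L)⁆ - ⁅⁅x, (y' : L)⁆, (y : L)⁆ := by
      rw [LieSubalgebra.coe_bracket, leibniz_lie, ← lie_skew (y : L) ⁅x, (y' : L)⁆]
      abel
    simp only [Prod.snd_sub, LinearMap.sub_apply, step_snd, step_fst, hj, map_sub]
    rw [hP ⁅x, (y : L)⁆ y', hP ⁅x, (y' : L)⁆ y, hQ ⁅x, (y : L)⁆ y', hQ ⁅x, (y' : L)⁆ y]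
    simp only [map_add, j_lie, sub_mul, add_mul, mul_add, mul_assoc]
    abel

/-- The operators `step` as a representation of `N`. -/
def stepHom : S.N →ₗ⁅ℂ⁆ Module.End ℂ (S.Ind × (L →ₗ[ℂ] S.Ind)) where
  toFun y := S.step y
  map_add' y y' := by
    refine LinearMap.ext fun w => Prod.ext ?_ (LinearMap.ext fun x => ?_)
    · simp only [LinearMap.add_apply, Prod.fst_add, step_fst, map_add, add_mul]
    · have e : ((y + y' : S.N) : L) = y + y' := rfl
      simp only [LinearMap.add_apply, Prod.snd_add, step_snd, e, map_add, add_mul, lie_add]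
      abel
  map_smul' c y := by
    refine LinearMap.ext fun w => Prod.ext ?_ (LinearMap.ext fun x => ?_)
    · simp [LinearMap.smul_apply, step_fst]
    · simp [LinearMap.smul_apply, step_snd]
  map_lie' := fun {y y'} => LinearMap.ext fun w => S.step_lie y y' w

/-- The values of all elements of the Lie algebra on an element of the induced module. -/
def values (u : S.Ind) : S.Ind × (L →ₗ[ℂ] S.Ind) :=
  UniversalEnvelopingAlgebra.lift ℂ S.stepHom u (1, LinearMap.toSpanSingleton ℂ S.Ind 1 ∘ₗ S.χ)

theorem values_one : S.values 1 = (1, LinearMap.toSpanSingleton ℂ S.Ind 1 ∘ₗ S.χ) := by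
  simp [values]

theorem values_j_mul (y : S.N) (u : S.Ind) : S.values (S.j y * u) = S.step y (S.values u) := by
  rw [values, map_mul, Module.End.mul_apply]
  change UniversalEnvelopingAlgebra.lift ℂ S.stepHom (UniversalEnvelopingAlgebra.ι ℂ y) _ = _
  rw [UniversalEnvelopingAlgebra.lift_ι_apply]; rfl

theorem ind_induction {P : S.Ind → Prop} (h1 : P 1) (ha : ∀ x y, P x → P y → P (x + y))
    (hs : ∀ (c : ℂ) x, P x → P (c • x)) (hm : ∀ y x, P x → P (S.j y * x)) (x : S.Ind) : P x := by
  let T : Submodule ℂ S.Ind :=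
    { carrier := {x | P x}
      zero_mem' := by have := hs 0 1 h1; rwa [zero_smul] at this
      add_mem' := fun {a b} => ha a b
      smul_mem' := hs }
  let A : Subalgebra ℂ S.Ind :=
    { carrier := {x | ∀ y ∈ T, x * y ∈ T}
      mul_mem' := fun {a b} h h' y hy => by rw [mul_assoc]; exact h _ (h' y hy)
      add_mem' := fun {a b} h h' y hy => by rw [add_mul]; exact T.add_mem (h y hy) (h' y hy)
      algebraMap_mem' := fun r y hy => by
        rw [← Algebra.smul_def]; exact T.smul_mem r hy }
  let f : S.N →ₗ⁅ℂ⁆ A :=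
    { toFun := fun X => ⟨S.j X, fun y hy => hm X y hy⟩
      map_add' := fun X Y => by apply Subtype.ext; simp
      map_smul' := fun c X => by apply Subtype.ext; simp
      map_lie' := fun {X Y} => by
        apply Subtype.ext
        change S.j ⁅X, Y⁆ = _
        rw [j_lie]; rfl }
  have hf : A.val.comp (UniversalEnvelopingAlgebra.lift ℂ f) = AlgHom.id ℂ S.Ind := by
    apply UniversalEnvelopingAlgebra.hom_ext
    refine LieHom.ext fun X => ?_
    change A.val (UniversalEnvelopingAlgebra.lift ℂ f (UniversalEnvelopingAlgebra.ι ℂ X)) = _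
    rw [UniversalEnvelopingAlgebra.lift_ι_apply]; rfl
  have hx : ((UniversalEnvelopingAlgebra.lift ℂ f x : A) : S.Ind) = x := DFunLike.congr_fun hf x
  have := (UniversalEnvelopingAlgebra.lift ℂ f x).2 1 h1
  rw [hx, mul_one] at this
  exact this

theorem values_add (u v : S.Ind) : S.values (u + v) = S.values u + S.values v := by
  simp [values]

theorem values_smul (c : ℂ) (u : S.Ind) : S.values (c • u) = c • S.values u := by
  simp [values]

theorem values_fst (u : S.Ind) : (S.values u).1 = u := by
  induction u using S.ind_induction with
  | h1 => rw [values_one]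
  | ha x y hx hy => rw [values_add, Prod.fst_add, hx, hy]
  | hs c x hx => rw [values_smul, Prod.smul_fst, hx]
  | hm y x hx => rw [values_j_mul, step_fst, hx]

/-- The action on the induced module. -/
def rho : L →ₗ[ℂ] S.Ind →ₗ[ℂ] S.Ind :=
  LinearMap.mk₂ ℂ (fun X u => S.j (S.P X) * u + (S.values u).2 (S.Q X))
    (fun X Y u => by simp only [map_add, add_mul]; abel)
    (fun c X u => by simp)
    (fun X u v => by simp only [values_add, Prod.snd_add, LinearMap.add_apply, mul_add]; abel)
    (fun c X u => by simp [values_smul])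

theorem rho_apply (X : L) (u : S.Ind) :
    S.rho X u = S.j (S.P X) * u + (S.values u).2 (S.Q X) := rfl

theorem rho_one {x : L} (hx : x ∈ S.H) : S.rho x 1 = S.χ x • 1 := by
  rw [rho_apply, S.P_H x hx, Q_apply, S.P_H x hx, values_one]
  simp

theorem rho_coe (y : S.N) (u : S.Ind) : S.rho y u = S.j y * u := by
  rw [rho_apply, P_coe, Q_coe, map_zero, add_zero]

theorem rho_j_mul (X : L) (y : S.N) (u : S.Ind) :
    S.rho X (S.j y * u) = S.rho ⁅X, (y : L)⁆ u + S.j y * S.rho X u := by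
  have e : X = S.P X + S.Q X := by rw [Q_apply, add_sub_cancel]
  have h1 : S.rho (S.P X) (S.j y * u) = S.rho ⁅(S.P X : L), (y : L)⁆ u +
      S.j y * S.rho (S.P X) u := by
    rw [← LieSubalgebra.coe_bracket, rho_coe, rho_coe, rho_coe, j_lie, sub_mul, mul_assoc,
      mul_assoc, sub_add_cancel]
  have h2 : S.rho (S.Q X) (S.j y * u) = S.rho ⁅S.Q X, (y : L)⁆ u + S.j y * S.rho (S.Q X) u := by
    have hPQ : S.P (S.Q X) = 0 := S.P_H _ (S.sub_mem X)
    have hQQ : S.Q (S.Q X) = S.Q X := by rw [Q_apply, hPQ]; simp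
    rw [rho_apply, rho_apply, rho_apply, hPQ, hQQ, values_j_mul, step_snd, values_fst, map_zero]
    simp
  have h3 : S.rho X = S.rho (S.P X) + S.rho (S.Q X) := by rw [← map_add, ← e]
  have h4 : ⁅X, (y : L)⁆ = ⁅(S.P X : L), (y : L)⁆ + ⁅S.Q X, (y : L)⁆ := by rw [← add_lie, ← e]
  rw [h3, h4, map_add, LinearMap.add_apply, LinearMap.add_apply, LinearMap.add_apply, h1, h2,
    mul_add]
  abel

/-- The action on the induced module is a representation. -/
theorem rho_lie (X Y : L) (u : S.Ind) :
    S.rho ⁅X, Y⁆ u = S.rho X (S.rho Y u) - S.rho Y (S.rho X u) := by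
  have hN : ∀ (X : L) (y : S.N) (u : S.Ind),
      S.rho ⁅X, (y : L)⁆ u = S.rho X (S.rho y u) - S.rho y (S.rho X u) := by
    intro X y u
    rw [rho_coe, rho_coe, rho_j_mul, add_sub_cancel_right]
  have red : ∀ u : S.Ind, (∀ x ∈ S.H, ∀ x' ∈ S.H,
      S.rho ⁅x, x'⁆ u = S.rho x (S.rho x' u) - S.rho x' (S.rho x u)) →
      ∀ X Y : L, S.rho ⁅X, Y⁆ u = S.rho X (S.rho Y u) - S.rho Y (S.rho X u) := by
    intro u hu X Y
    have eX : X = S.P X + S.Q X := by rw [Q_apply, add_sub_cancel]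
    have eY : Y = S.P Y + S.Q Y := by rw [Q_apply, add_sub_cancel]
    have h1 := hN X (S.P Y) u
    have h2 := hN (S.Q Y) (S.P X) u
    have h3 := hu _ (S.sub_mem X) _ (S.sub_mem Y)
    rw [← Q_apply, ← Q_apply] at h3
    have e : ⁅X, Y⁆ = ⁅X, (S.P Y : L)⁆ - ⁅S.Q Y, (S.P X : L)⁆ + ⁅S.Q X, S.Q Y⁆ := by
      conv_lhs => rw [eY, lie_add]
      rw [sub_eq_add_neg, lie_skew, add_assoc, ← add_lie, ← eX]
    have rX : ∀ v, S.rho X v = S.rho (S.P X) v + S.rho (S.Q X) v := fun v => by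
      conv_lhs => rw [eX, map_add, LinearMap.add_apply]
    have rY : ∀ v, S.rho Y v = S.rho (S.P Y) v + S.rho (S.Q Y) v := fun v => by
      conv_lhs => rw [eY, map_add, LinearMap.add_apply]
    rw [e, map_add, map_sub, LinearMap.add_apply, LinearMap.sub_apply, h1, h2, h3, rY u, rY,
      map_add, rX (S.rho (S.Q Y) u), rX u, map_add, map_add]
    abel
  refine red u ?_ X Y
  induction u using S.ind_induction with
  | h1 =>
    intro x hx x' hx'
    rw [rho_one _ hx, rho_one _ hx', map_smul, map_smul, rho_one _ hx, rho_one _ hx',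
      rho_one _ (S.H.lie_mem hx hx'), S.χ_lie x hx x' hx', smul_smul, smul_smul, mul_comm,
      zero_smul, sub_self]
  | ha u v hu hv =>
    intro x hx x' hx'
    simp only [map_add, hu x hx x' hx', hv x hx x' hx']; abel
  | hs c u hu =>
    intro x hx x' hx'
    simp only [map_smul, hu x hx x' hx', smul_sub]
  | hm y u hu =>
    intro x hx x' hx'
    have hL := red u hu
    have e : S.rho ⁅⁅x, x'⁆, (y : L)⁆ u = S.rho ⁅x, ⁅x', (y : L)⁆⁆ u - S.rho ⁅x', ⁅x, (y : L)⁆⁆ u := by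
      rw [← LinearMap.sub_apply, ← map_sub, leibniz_lie x x', add_sub_cancel_right]
    simp only [rho_j_mul, map_add]
    rw [e, hL x ⁅x', (y : L)⁆, hL x' ⁅x, (y : L)⁆, hu x hx x' hx', mul_sub]
    abel

end Splitting

end induced

end SphereVA

end

noncomputable section

namespace SphereVA

namespace Datum

variable {𝔞 : Type*} [AddCommGroup 𝔞] [Module ℂ 𝔞] {D : Datum 𝔞}

/-! ### The vacuum does not vanish -/

/-- The Lie algebra spanned by the creation modes. -/
def creation (hD : D.Admissible) : LieSubalgebra ℂ D.Modes :=
  { Submodule.span ℂ {X | ∃ n : ℤ, n < 0 ∧ ∃ x, X = D.gen n x} with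
    lie_mem' := by
      intro X Y hX hY
      change X ∈ Submodule.span ℂ _ at hX
      change Y ∈ Submodule.span ℂ _ at hY
      change _ ∈ Submodule.span ℂ _
      induction hX, hY using Submodule.span_induction₂ with
      | mem_mem X Y hX hY =>
        obtain ⟨m, hm, x, rfl⟩ := hX
        obtain ⟨n, hn, y, rfl⟩ := hY
        have h0 : D.e' m n = 0 := by
          by_contra h
          have := hD.e'_ne _ _ h
          omega
        rw [lie_gen_gen, h0, zero_smul, add_zero]
        exact Submodule.smul_mem _ _ (Submodule.subset_span ⟨_, by omega, _, rfl⟩)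
      | zero_left Y _ => rw [zero_lie]; exact Submodule.zero_mem _
      | zero_right Y _ => rw [lie_zero]; exact Submodule.zero_mem _
      | add_left X Y Z _ _ _ h h' => rw [add_lie]; exact Submodule.add_mem _ h h'
      | add_right X Y Z _ _ _ h h' => rw [lie_add]; exact Submodule.add_mem _ h h'
      | smul_left r X Y _ _ h => rw [smul_lie]; exact Submodule.smul_mem _ _ h
      | smul_right r X Y _ _ h => rw [lie_smul]; exact Submodule.smul_mem _ _ h }

/-- The Lie algebra spanned by the annihilation modes and the centre. -/
def annihilation (hD : D.Admissible) : LieSubalgebra ℂ D.Modes :=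
  { Submodule.span ℂ {X | (∃ n : ℕ, ∃ x, X = D.gen n x) ∨ ∃ t, X = D.cent t} with
    lie_mem' := by
      intro X Y hX hY
      change X ∈ Submodule.span ℂ _ at hX
      change Y ∈ Submodule.span ℂ _ at hY
      change _ ∈ Submodule.span ℂ _
      induction hX, hY using Submodule.span_induction₂ with
      | mem_mem X Y hX hY =>
        obtain ⟨m, x, rfl⟩ | ⟨t, rfl⟩ := hX
        · obtain ⟨n, y, rfl⟩ | ⟨t, rfl⟩ := hY
          · rw [lie_gen_gen, hD.e'_nat, zero_smul, add_zero]
            rcases lt_or_ge (m + n) D.wt with h | h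
            · rw [hD.e_low m n h, zero_smul]; exact Submodule.zero_mem _
            · refine Submodule.smul_mem _ _ (Submodule.subset_span
                (Or.inl ⟨m + n - D.wt, D.bracket x y, ?_⟩))
              rw [Nat.cast_sub h, Nat.cast_add]
          · rw [lie_cent]; exact Submodule.zero_mem _
        · rw [cent_lie]; exact Submodule.zero_mem _
      | zero_left Y _ => rw [zero_lie]; exact Submodule.zero_mem _
      | zero_right Y _ => rw [lie_zero]; exact Submodule.zero_mem _
      | add_left X Y Z _ _ _ h h' => rw [add_lie]; exact Submodule.add_mem _ h h'
      | add_right X Y Z _ _ _ h h' => rw [lie_add]; exact Submodule.add_mem _ h h'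
      | smul_left r X Y _ _ h => rw [smul_lie]; exact Submodule.smul_mem _ _ h
      | smul_right r X Y _ _ h => rw [lie_smul]; exact Submodule.smul_mem _ _ h }

/-- The projection to the creation modes. -/
def creationPart (D : Datum 𝔞) : D.Modes →ₗ[ℂ] D.Modes :=
  (Finsupp.lsum ℂ fun n : ℤ => if n < 0 then D.gen n else 0) ∘ₗ D.strip

theorem creationPart_gen (n : ℤ) (x : 𝔞) :
    D.creationPart (D.gen n x) = if n < 0 then D.gen n x else 0 := by
  rw [creationPart, LinearMap.comp_apply, strip_gen, Finsupp.lsum_single]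
  split_ifs <;> rfl

theorem creationPart_cent (t : ℂ) : D.creationPart (D.cent t) = 0 := by
  rw [creationPart, LinearMap.comp_apply, strip_cent, map_zero]

theorem creationPart_mem (hD : D.Admissible) (X : D.Modes) :
    D.creationPart X ∈ (creation hD).toSubmodule := by
  induction X using D.modes_induction with
  | hg n x =>
    rw [creationPart_gen]
    split_ifs with h
    · exact Submodule.subset_span ⟨n, h, x, rfl⟩
    · exact Submodule.zero_mem _
  | hc t => rw [creationPart_cent]; exact Submodule.zero_mem _
  | ha X Y hX hY => rw [map_add]; exact Submodule.add_mem _ hX hY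

/-- The coefficient of the central element. -/
def centralPart (D : Datum 𝔞) : D.Modes →ₗ[ℂ] ℂ := LinearMap.snd ℂ (ℤ →₀ 𝔞) ℂ

theorem centralPart_gen (n : ℤ) (x : 𝔞) : D.centralPart (D.gen n x) = 0 := rfl

/-- The decomposition of the Lie algebra of modes into creation and annihilation modes. -/
def splitting (hD : D.Admissible) : Splitting D.Modes where
  N := creation hD
  H := annihilation hD
  P := LinearMap.codRestrict (creation hD).toSubmodule D.creationPart (creationPart_mem hD)
  χ := D.centralPart
  sub_mem X := by
    change X - D.creationPart X ∈ (annihilation hD).toSubmodule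
    induction X using D.modes_induction with
    | hg n x =>
      rw [creationPart_gen]
      split_ifs with h
      · rw [sub_self]; exact Submodule.zero_mem _
      · rw [sub_zero]
        lift n to ℕ using not_lt.1 h
        exact Submodule.subset_span (Or.inl ⟨n, x, rfl⟩)
    | hc t =>
      rw [creationPart_cent, sub_zero]
      exact Submodule.subset_span (Or.inr ⟨t, rfl⟩)
    | ha X Y hX hY => rw [map_add, add_sub_add_comm]; exact Submodule.add_mem _ hX hY
  P_coe := by
    rintro ⟨X, hX⟩
    apply Subtype.ext
    change D.creationPart X = X
    change X ∈ Submodule.span ℂ _ at hX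
    induction hX using Submodule.span_induction with
    | zero => rw [map_zero]
    | add x y _ _ hx hy => rw [map_add, hx, hy]
    | smul c x _ hx => rw [map_smul, hx]
    | mem x hx =>
      obtain ⟨n, hn, x, rfl⟩ := hx
      rw [creationPart_gen, if_pos hn]
  P_H := by
    intro X hX
    apply Subtype.ext
    change D.creationPart X = 0
    change X ∈ Submodule.span ℂ _ at hX
    induction hX using Submodule.span_induction with
    | zero => rw [map_zero]
    | add x y _ _ hx hy => rw [map_add, hx, hy, add_zero]
    | smul c x _ hx => rw [map_smul, hx, smul_zero]
    | mem x hx =>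
      obtain ⟨n, x, rfl⟩ | ⟨t, rfl⟩ := hx
      · rw [creationPart_gen, if_neg (by omega)]
      · rw [creationPart_cent]
  χ_lie := by
    intro X hX Y hY
    change X ∈ Submodule.span ℂ _ at hX
    change Y ∈ Submodule.span ℂ _ at hY
    induction hX, hY using Submodule.span_induction₂ with
    | mem_mem X Y hX hY =>
      obtain ⟨m, x, rfl⟩ | ⟨t, rfl⟩ := hX
      · obtain ⟨n, y, rfl⟩ | ⟨t, rfl⟩ := hY
        · rw [lie_gen_gen, hD.e'_nat, zero_smul, add_zero, map_smul, centralPart_gen,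
            smul_zero]
        · rw [lie_cent, map_zero]
      · rw [cent_lie, map_zero]
    | zero_left Y _ => rw [zero_lie, map_zero]
    | zero_right Y _ => rw [lie_zero, map_zero]
    | add_left X Y Z _ _ _ h h' => rw [add_lie, map_add, h, h', add_zero]
    | add_right X Y Z _ _ _ h h' => rw [lie_add, map_add, h, h', add_zero]
    | smul_left r X Y _ _ h => rw [smul_lie, map_smul, h, smul_zero]
    | smul_right r X Y _ _ h => rw [lie_smul, map_smul, h, smul_zero]

theorem rho_cent (hD : D.Admissible) (t : ℂ) (u : (splitting hD).Ind) :
    (splitting hD).rho (D.cent t) u = t • u := by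
  induction u using (splitting hD).ind_induction with
  | h1 => exact (splitting hD).rho_one (Submodule.subset_span (Or.inr ⟨t, rfl⟩))
  | ha x y hx hy => rw [map_add, hx, hy, smul_add]
  | hs c x hx => rw [map_smul, hx, smul_comm]
  | hm y x hx =>
    rw [Splitting.rho_j_mul, hx, cent_lie, map_zero, LinearMap.zero_apply, zero_add,
      mul_smul_comm]

theorem rho_comm (hD : D.Admissible) (m n : ℤ) (a b : 𝔞) (u : (splitting hD).Ind) :
    (splitting hD).rho (D.gen m a) ((splitting hD).rho (D.gen n b) u) -
      (splitting hD).rho (D.gen n b) ((splitting hD).rho (D.gen m a) u) =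
      D.e m n • (splitting hD).rho (D.gen (m + n - D.wt) (D.bracket a b)) u +
        (D.e' m n * D.form a b) • u := by
  rw [← Splitting.rho_lie, lie_gen_gen, map_add, map_smul, map_smul, LinearMap.add_apply,
    LinearMap.smul_apply, LinearMap.smul_apply, rho_cent, smul_smul]

/-- The tensor product of two copies of the module induced from the vacuum. -/
def inducedRep (hD : D.Admissible) :
    D.ModeRep ((splitting hD).Ind ⊗[ℂ] (splitting hD).Ind) where
  op σ n :=
    match σ with
    | true => LinearMap.rTensorHom _ ∘ₗ (splitting hD).rho ∘ₗ D.gen n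
    | false => LinearMap.lTensorHom _ ∘ₗ (splitting hD).rho ∘ₗ D.gen n
  same σ m n a b v := by
    induction v using TensorProduct.induction_on with
    | zero => simp
    | add x y hx hy =>
      simp only [map_add, smul_add] at *
      rw [add_sub_add_comm, hx, hy]; abel
    | tmul x y =>
      cases σ
      · simp only [LinearMap.comp_apply, LinearMap.coe_lTensorHom, LinearMap.lTensor_tmul,
          ← TensorProduct.tmul_sub, rho_comm, TensorProduct.tmul_add, TensorProduct.tmul_smul]
      · simp only [LinearMap.comp_apply, LinearMap.coe_rTensorHom, LinearMap.rTensor_tmul,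
          ← TensorProduct.sub_tmul, rho_comm, TensorProduct.add_tmul, TensorProduct.smul_tmul']
  diff σ τ h m n a b v := by
    induction v using TensorProduct.induction_on with
    | zero => simp
    | add x y hx hy =>
      simp only [map_add] at *
      rw [hx, hy]
    | tmul x y =>
      cases σ <;> cases τ <;> first | exact absurd rfl h | rfl

theorem vacuum_ne_zero (hD : D.Admissible) : D.vacuum ≠ 0 := by
  obtain ⟨F, hF, -⟩ := D.exists_equivariant (inducedRep hD) (v₀ := 1 ⊗ₜ 1) (by
    intro σ n a
    have h : (splitting hD).rho (D.gen n a) 1 = 0 := by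
      rw [(splitting hD).rho_one (Submodule.subset_span (Or.inl ⟨n, a, rfl⟩))]
      exact zero_smul _ _
    cases σ
    · change (1 : (splitting hD).Ind) ⊗ₜ[ℂ] (splitting hD).rho (D.gen n a) 1 = 0
      rw [h, TensorProduct.tmul_zero]
    · change (splitting hD).rho (D.gen n a) 1 ⊗ₜ[ℂ] (1 : (splitting hD).Ind) = 0
      rw [h, TensorProduct.zero_tmul])
  intro h0
  rw [h0, map_zero] at hF
  let _ : LieRing ℂ := LieRing.ofAssociativeRing
  let ε : (splitting hD).Ind →ₐ[ℂ] ℂ := UniversalEnvelopingAlgebra.lift ℂ (0 : (splitting hD).N →ₗ⁅ℂ⁆ ℂ)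
  have := congrArg ((TensorProduct.lid ℂ ℂ).toLinearMap ∘ₗ TensorProduct.map ε.toLinearMap ε.toLinearMap) hF
  simp at this

end Datum

end SphereVA

end

noncomputable section

namespace SphereVA

open Finset.HasAntidiagonal (antidiagonal)

/-! ### Locally finite sums -/

theorem finsum_eq_sum_range {W : Type*} [AddCommMonoid W] {f : ℕ → W} {N : ℕ}
    (h : ∀ i, N ≤ i → f i = 0) : ∑ᶠ i, f i = ∑ i ∈ Finset.range N, f i :=
  finsum_eq_sum_of_support_subset f fun i hi => by
    by_contra hn
    exact hi (h i (by simpa using hn))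

theorem sum_square_eq_sum_triangle {W : Type*} [AddCommMonoid W] {f : ℕ → ℕ → W} {N : ℕ}
    (h : ∀ i j, N ≤ i + j → f i j = 0) :
    ∑ i ∈ Finset.range N, ∑ j ∈ Finset.range N, f i j =
      ∑ k ∈ Finset.range N, ∑ p ∈ antidiagonal k, f p.1 p.2 := by
  rw [← Finset.sum_product' (Finset.range N) (Finset.range N) f,
    ← Finset.sum_filter_of_ne (p := fun x : ℕ × ℕ => x.1 + x.2 < N) fun x _ hx => by
      by_contra hn; exact hx (h _ _ (not_lt.1 hn)),
    ← Finset.sum_fiberwise_of_maps_to (g := fun x : ℕ × ℕ => x.1 + x.2) (t := Finset.range N)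
      fun x hx => by simpa using (Finset.mem_filter.1 hx).2]
  refine Finset.sum_congr rfl fun k hk => Finset.sum_congr ?_ fun _ _ => rfl
  ext ⟨i, j⟩
  simp only [Finset.mem_filter, Finset.mem_product, Finset.mem_range,
    Finset.HasAntidiagonal.mem_antidiagonal] at hk ⊢
  omega

section locallyFinite

variable {V W : Type*} [AddCommGroup V] [Module ℂ V] [AddCommGroup W] [Module ℂ W]

/-- A sequence of linear maps of which only finitely many do not vanish on any given vector. -/
def LocFin (f : ℕ → V →ₗ[ℂ] W) : Prop := ∀ v, ∃ N, ∀ i, N ≤ i → f i v = 0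

theorem LocFin.hasFiniteSupport {f : ℕ → V →ₗ[ℂ] W} (h : LocFin f) (v : V) :
    (Function.support fun i => f i v).Finite := by
  obtain ⟨N, hN⟩ := h v
  refine (Set.finite_lt_nat N).subset fun i hi => ?_
  by_contra hn
  exact hi (hN i (not_lt.1 hn))

/-- The sum of a locally finite sequence of linear maps. -/
def lsum (f : ℕ → V →ₗ[ℂ] W) (h : LocFin f) : V →ₗ[ℂ] W where
  toFun v := ∑ᶠ i, f i v
  map_add' v w := by
    simp only [map_add]
    exact finsum_add_distrib (h.hasFiniteSupport v) (h.hasFiniteSupport w)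
  map_smul' c v := by
    simp only [map_smul, RingHom.id_apply]
    exact (smul_finsum' c (h.hasFiniteSupport v)).symm

theorem lsum_apply {f : ℕ → V →ₗ[ℂ] W} (h : LocFin f) (v : V) : lsum f h v = ∑ᶠ i, f i v := rfl

end locallyFinite

namespace Datum

variable {𝔞 : Type*} [AddCommGroup 𝔞] [Module ℂ 𝔞] {D : Datum 𝔞}

/-- The coordinate of a pair of integers in the direction of a chirality. -/
def co (σ : Bool) (x : ℤ × ℤ) : ℤ :=
  match σ with
  | true => x.1
  | false => x.2

theorem co_add (σ : Bool) (x y : ℤ × ℤ) : co σ (x + y) = co σ x + co σ y := by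
  cases σ <;> rfl

theorem co_smul_dir (σ τ : Bool) (k : ℤ) : co σ (k • dir τ) = if σ = τ then k else 0 := by
  cases σ <;> cases τ <;> simp [co, dir]

theorem co_add_smul_dir (σ : Bool) (x : ℤ × ℤ) (k : ℤ) : co σ (x + k • dir σ) = co σ x + k := by
  rw [co_add, co_smul_dir, if_pos rfl]

theorem co_le_add (σ τ : Bool) (x : ℤ × ℤ) {k : ℤ} (h : 0 ≤ k) :
    co σ x ≤ co σ (x + k • dir τ) := by
  rw [co_add, co_smul_dir]
  split_ifs <;> omega

/-- Every state is annihilated by all modes of sufficiently large index. -/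
theorem smooth (hD : D.Admissible) (v : D.State) :
    ∃ K : ℕ, ∀ σ (n : ℤ), (K : ℤ) ≤ n → ∀ a, D.act σ n a v = 0 := by
  have hv : v ∈ ⨆ h, D.grading h := by rw [iSup_grading hD]; trivial
  induction hv using Submodule.iSup_induction' with
  | mem h x hx =>
    obtain ⟨K, hK⟩ := exists_nat_gt (max h.1 h.2 + D.wt)
    refine ⟨K, fun σ n hn a => ?_⟩
    have h1 := act_mem hD σ n a hx
    have h2 : D.grading (h + ((D.wt : ℝ) - n) • rdir σ) = ⊥ := by
      by_contra hb
      obtain ⟨i, j, hij⟩ := exists_nat_of_ne_bot hb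
      have hn' : (K : ℝ) ≤ n := by exact_mod_cast hn
      have l1 := le_max_left h.1 h.2
      have l2 := le_max_right h.1 h.2
      cases σ
      · have := congrArg Prod.snd hij
        simp only [rdir, Prod.snd_add, Prod.smul_snd, smul_eq_mul, mul_one] at this
        have : (0 : ℝ) ≤ j := j.cast_nonneg
        linarith
      · have := congrArg Prod.fst hij
        simp only [rdir, Prod.fst_add, Prod.smul_fst, smul_eq_mul, mul_one] at this
        have : (0 : ℝ) ≤ i := i.cast_nonneg
        linarith
    rw [h2] at h1
    simpa using h1
  | zero => exact ⟨0, fun σ n _ a => map_zero _⟩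
  | add x y _ _ hx hy =>
    obtain ⟨K, hK⟩ := hx
    obtain ⟨L, hL⟩ := hy
    refine ⟨max K L, fun σ n hn a => ?_⟩
    rw [map_add, hK σ n (by push_cast at hn; omega), hL σ n (by push_cast at hn; omega), add_zero]

/-! ### Fields -/

section fields

variable {S : Type*} [AddCommGroup S] [Module ℂ S]

/-- A representation of the modes is smooth if every vector is annihilated by all modes of
sufficiently large index. -/
def ModeRep.Smooth (R : D.ModeRep S) : Prop :=
  ∀ v, ∃ K : ℕ, ∀ σ (n : ℤ), (K : ℤ) ≤ n → ∀ a, R.op σ n a v = 0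

/-- Fields in two variables, as families of modes which are bounded above on every state. -/
def fields (S : Type*) [AddCommGroup S] [Module ℂ S] : Submodule ℂ (ℤ × ℤ → Module.End ℂ S) where
  carrier := {X | ∀ v, ∃ N : ℤ, ∀ x σ, N ≤ co σ x → X x v = 0}
  zero_mem' := fun v => ⟨0, fun x σ _ => rfl⟩
  add_mem' := by
    intro X Y hX hY v
    obtain ⟨N, hN⟩ := hX v
    obtain ⟨M, hM⟩ := hY v
    refine ⟨max N M, fun x σ hx => ?_⟩
    rw [Pi.add_apply, LinearMap.add_apply, hN x σ (by omega), hM x σ (by omega), add_zero]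
  smul_mem' := by
    intro c X hX v
    obtain ⟨N, hN⟩ := hX v
    exact ⟨N, fun x σ hx => by rw [Pi.smul_apply, LinearMap.smul_apply, hN x σ hx, smul_zero]⟩

theorem fields_bound (X : fields S) (v : S) (x : ℤ × ℤ) :
    ∃ N : ℕ, ∀ y σ, co σ x + N ≤ co σ y → X.1 y v = 0 := by
  obtain ⟨N, hN⟩ := X.2 v
  refine ⟨(N - co true x).toNat + (N - co false x).toNat, fun y σ hy => hN y σ ?_⟩
  cases σ <;> omega

theorem fields_bound_dir (X : fields S) (v : S) (x : ℤ × ℤ) (σ : Bool) :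
    ∃ N : ℕ, ∀ k : ℤ, N ≤ k → X.1 (x + k • dir σ) v = 0 := by
  obtain ⟨N, hN⟩ := fields_bound X v x
  refine ⟨N, fun k hk => hN _ σ ?_⟩
  rw [co_add_smul_dir]; omega

variable (R : D.ModeRep S)

theorem left_locFin (X : fields S) (σ : Bool) (n : ℤ) (a : 𝔞) (x : ℤ × ℤ) :
    LocFin fun i : ℕ => ((-1) ^ i * bin n i) • (R.op σ (n - i) a ∘ₗ X.1 (x + (i : ℤ) • dir σ)) := by
  intro v
  obtain ⟨N, hN⟩ := fields_bound_dir X v x σ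
  refine ⟨N, fun i hi => ?_⟩
  rw [LinearMap.smul_apply, LinearMap.comp_apply, hN i (by exact_mod_cast hi), map_zero, smul_zero]

theorem right_locFin (hR : R.Smooth) (X : fields S) (σ : Bool) (n : ℤ) (a : 𝔞) (x : ℤ × ℤ) :
    LocFin fun i : ℕ => ((-1) ^ n * (-1) ^ i * bin n i) •
      (X.1 (x + (n - i) • dir σ) ∘ₗ R.op σ i a) := by
  intro v
  obtain ⟨K, hK⟩ := hR v
  refine ⟨K, fun i hi => ?_⟩
  rw [LinearMap.smul_apply, LinearMap.comp_apply, hK σ i (by exact_mod_cast hi), map_zero, smul_zero]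

theorem finsum_add_of_locFin {f g h : ℕ → S →ₗ[ℂ] S} (hf : LocFin f) (hg : LocFin g)
    (e : ∀ i v, h i v = f i v + g i v) (v : S) :
    ∑ᶠ i, h i v = ∑ᶠ i, f i v + ∑ᶠ i, g i v := by
  rw [← finsum_add_distrib (hf.hasFiniteSupport v) (hg.hasFiniteSupport v)]
  exact finsum_congr fun i => e i v

theorem finsum_smul_of_locFin {f h : ℕ → S →ₗ[ℂ] S} (c : ℂ) (hf : LocFin f)
    (e : ∀ i v, h i v = c • f i v) (v : S) : ∑ᶠ i, h i v = c • ∑ᶠ i, f i v := by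
  rw [smul_finsum' c (hf.hasFiniteSupport v)]
  exact finsum_congr fun i => e i v

/-- The part of the `n`-th product of `a(ζ)` with a field in which the modes of `a` act last. -/
def leftField (σ : Bool) (n : ℤ) (a : 𝔞) (X : fields S) : fields S :=
  ⟨fun x => lsum _ (left_locFin R X σ n a x), fun v => by
    obtain ⟨N, hN⟩ := X.2 v
    refine ⟨N, fun x τ hx => ?_⟩
    rw [lsum_apply, finsum_eq_sum_range (N := 0), Finset.sum_range_zero]
    intro i _
    rw [LinearMap.smul_apply, LinearMap.comp_apply,
      hN _ τ (hx.trans (co_le_add τ σ x (by positivity))), map_zero, smul_zero]⟩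

/-- The part of the `n`-th product of `a(ζ)` with a field in which the modes of `a` act first, up
to a sign. -/
def rightField (hR : R.Smooth) (σ : Bool) (n : ℤ) (a : 𝔞) (X : fields S) : fields S :=
  ⟨fun x => lsum _ (right_locFin R hR X σ n a x), fun v => by
    obtain ⟨K, hK⟩ := hR v
    choose N hN using fun i : ℕ => X.2 (R.op σ i a v)
    refine ⟨∑ i ∈ Finset.range K, |N i| + |n| + K, fun x τ hx => ?_⟩
    rw [lsum_apply, finsum_eq_sum_range (N := K)]
    · refine Finset.sum_eq_zero fun i hi => ?_
      have h1 : |N i| ≤ ∑ i ∈ Finset.range K, |N i| :=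
        Finset.single_le_sum (f := fun i => |N i|) (fun _ _ => abs_nonneg _) hi
      rw [Finset.mem_range] at hi
      rw [LinearMap.smul_apply, LinearMap.comp_apply, hN i _ τ, smul_zero]
      rw [co_add, co_smul_dir]
      have h2 := le_abs_self (N i)
      have h3 := neg_abs_le n
      have h4 := abs_nonneg n
      split_ifs <;> omega
    · intro i hi
      rw [LinearMap.smul_apply, LinearMap.comp_apply, hK σ i (by exact_mod_cast hi), map_zero,
        smul_zero]⟩

theorem fields_ext {X Y : fields S} (h : ∀ x v, X.1 x v = Y.1 x v) : X = Y :=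
  Subtype.ext (funext fun x => LinearMap.ext fun v => h x v)

/-- The bilinear map `leftField`. -/
def left (σ : Bool) (n : ℤ) : 𝔞 →ₗ[ℂ] fields S →ₗ[ℂ] fields S :=
  LinearMap.mk₂ ℂ (leftField R σ n)
    (fun a b X => fields_ext fun x v => finsum_add_of_locFin (left_locFin R X σ n a x)
      (left_locFin R X σ n b x) (fun i v => by
        simp only [LinearMap.smul_apply, LinearMap.comp_apply, map_add, LinearMap.add_apply,
          smul_add]) v)
    (fun c a X => fields_ext fun x v => finsum_smul_of_locFin c (left_locFin R X σ n a x)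
      (fun i v => by
        simp only [LinearMap.smul_apply, LinearMap.comp_apply, map_smul, smul_comm c]) v)
    (fun a X Y => fields_ext fun x v => finsum_add_of_locFin (left_locFin R X σ n a x)
      (left_locFin R Y σ n a x) (fun i v => by
        simp only [LinearMap.smul_apply, LinearMap.comp_apply, Submodule.coe_add, Pi.add_apply,
          map_add, LinearMap.add_apply, smul_add]) v)
    (fun c a X => fields_ext fun x v => finsum_smul_of_locFin c (left_locFin R X σ n a x)
      (fun i v => by
        simp only [LinearMap.smul_apply, LinearMap.comp_apply, Submodule.coe_smul, Pi.smul_apply,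
          map_smul, smul_comm c]) v)

/-- The bilinear map `rightField`. -/
def right (hR : R.Smooth) (σ : Bool) (n : ℤ) : 𝔞 →ₗ[ℂ] fields S →ₗ[ℂ] fields S :=
  LinearMap.mk₂ ℂ (rightField R hR σ n)
    (fun a b X => fields_ext fun x v => finsum_add_of_locFin (right_locFin R hR X σ n a x)
      (right_locFin R hR X σ n b x) (fun i v => by
        simp only [LinearMap.smul_apply, LinearMap.comp_apply, map_add, LinearMap.add_apply,
          smul_add]) v)
    (fun c a X => fields_ext fun x v => finsum_smul_of_locFin c (right_locFin R hR X σ n a x)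
      (fun i v => by
        simp only [LinearMap.smul_apply, LinearMap.comp_apply, map_smul, smul_comm c]) v)
    (fun a X Y => fields_ext fun x v => finsum_add_of_locFin (right_locFin R hR X σ n a x)
      (right_locFin R hR Y σ n a x) (fun i v => by
        simp only [LinearMap.smul_apply, LinearMap.comp_apply, Submodule.coe_add, Pi.add_apply,
          LinearMap.add_apply, smul_add]) v)
    (fun c a X => fields_ext fun x v => finsum_smul_of_locFin c (right_locFin R hR X σ n a x)
      (fun i v => by
        simp only [LinearMap.smul_apply, LinearMap.comp_apply, Submodule.coe_smul, Pi.smul_apply,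
          smul_comm c]) v)

theorem left_apply (σ : Bool) (n : ℤ) (a : 𝔞) (X : fields S) (x : ℤ × ℤ) (v : S) :
    (left R σ n a X).1 x v =
      ∑ᶠ i : ℕ, ((-1) ^ i * bin n i) • R.op σ (n - i) a (X.1 (x + (i : ℤ) • dir σ) v) := rfl

theorem right_apply (hR : R.Smooth) (σ : Bool) (n : ℤ) (a : 𝔞) (X : fields S) (x : ℤ × ℤ)
    (v : S) : (right R hR σ n a X).1 x v =
      ∑ᶠ i : ℕ, ((-1) ^ n * (-1) ^ i * bin n i) • X.1 (x + (n - i) • dir σ) (R.op σ i a v) := rfl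

theorem left_eq_sum {σ : Bool} (n : ℤ) (a : 𝔞) {X : fields S} {x : ℤ × ℤ} {v : S} {N : ℕ}
    (h : ∀ i : ℕ, N ≤ i → X.1 (x + (i : ℤ) • dir σ) v = 0) : (left R σ n a X).1 x v =
      ∑ i ∈ Finset.range N, ((-1) ^ i * bin n i) •
        R.op σ (n - i) a (X.1 (x + (i : ℤ) • dir σ) v) := by
  rw [left_apply, finsum_eq_sum_range fun i hi => ?_]
  rw [h i hi, map_zero, smul_zero]

theorem right_eq_sum (hR : R.Smooth) {σ : Bool} (n : ℤ) {a : 𝔞} (X : fields S) (x : ℤ × ℤ)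
    {v : S} {N : ℕ} (h : ∀ i : ℕ, N ≤ i → R.op σ i a v = 0) : (right R hR σ n a X).1 x v =
      ∑ i ∈ Finset.range N, ((-1) ^ n * (-1) ^ i * bin n i) •
        X.1 (x + (n - i) • dir σ) (R.op σ i a v) := by
  rw [right_apply, finsum_eq_sum_range fun i hi => ?_]
  rw [h i hi, map_zero, smul_zero]

theorem left_same (hD : D.Admissible) (σ : Bool) (m n : ℤ) (a b : 𝔞) (X : fields S) :
    left R σ m a (left R σ n b X) - left R σ n b (left R σ m a X) =
      D.e m n • left R σ (m + n - D.wt) (D.bracket a b) X + (D.e' m n * D.form a b) • X := by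
  refine fields_ext fun x v => ?_
  obtain ⟨N, hN⟩ := fields_bound_dir X v x σ
  have hN' : ∀ i j : ℕ, N ≤ i + j → X.1 (x + (i : ℤ) • dir σ + (j : ℤ) • dir σ) v = 0 := by
    intro i j h
    rw [add_assoc, ← add_smul]
    exact hN _ (by exact_mod_cast h)
  have hsq : ∀ (m n : ℤ) (a b : 𝔞), (left R σ m a (left R σ n b X)).1 x v =
      ∑ i ∈ Finset.range (N + 1), ∑ j ∈ Finset.range (N + 1),
        ((-1) ^ (i + j) * (bin m i * bin n j)) • R.op σ (m - i) a (R.op σ (n - j) b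
          (X.1 (x + ((i + j : ℕ) : ℤ) • dir σ) v)) := by
    intro m n a b
    have hin : ∀ i : ℕ, (left R σ n b X).1 (x + (i : ℤ) • dir σ) v =
        ∑ j ∈ Finset.range (N + 1), ((-1) ^ j * bin n j) • R.op σ (n - j) b
          (X.1 (x + ((i + j : ℕ) : ℤ) • dir σ) v) := by
      intro i
      rw [left_eq_sum R (N := N + 1) n b fun j hj => hN' i j (by omega)]
      refine Finset.sum_congr rfl fun j _ => ?_
      rw [add_assoc, ← add_smul]; push_cast; rfl
    rw [left_eq_sum R (N := N + 1)]
    · refine Finset.sum_congr rfl fun i _ => ?_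
      rw [hin, map_sum, Finset.smul_sum]
      refine Finset.sum_congr rfl fun j _ => ?_
      rw [map_smul, smul_smul, pow_add]; congr 1; ring
    · intro i hi
      rw [hin]
      refine Finset.sum_eq_zero fun j _ => ?_
      rw [hN _ (by push_cast; omega), map_zero, smul_zero]
  change (left R σ m a (left R σ n b X)).1 x v - (left R σ n b (left R σ m a X)).1 x v =
    D.e m n • (left R σ (m + n - D.wt) (D.bracket a b) X).1 x v + (D.e' m n * D.form a b) • X.1 x v
  rw [hsq, hsq, Finset.sum_comm (f := fun i j => ((-1) ^ (i + j) * (bin n i * bin m j)) •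
    R.op σ (n - i) b (R.op σ (m - j) a (X.1 (x + ((i + j : ℕ) : ℤ) • dir σ) v))),
    ← Finset.sum_sub_distrib]
  simp only [← Finset.sum_sub_distrib]
  rw [sum_square_eq_sum_triangle]
  · have hk : ∀ k : ℕ, ∑ p ∈ antidiagonal k,
        (((-1 : ℂ) ^ (p.1 + p.2) * (bin m p.1 * bin n p.2)) • R.op σ (m - p.1) a (R.op σ (n - p.2) b
          (X.1 (x + ((p.1 + p.2 : ℕ) : ℤ) • dir σ) v)) -
        ((-1) ^ (p.2 + p.1) * (bin n p.2 * bin m p.1)) • R.op σ (n - p.2) b (R.op σ (m - p.1) a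
          (X.1 (x + ((p.2 + p.1 : ℕ) : ℤ) • dir σ) v))) =
        ((-1) ^ k * (D.e m n * bin (m + n - D.wt) k)) •
          R.op σ (m + n - D.wt - k) (D.bracket a b) (X.1 (x + (k : ℤ) • dir σ) v) +
        ((-1) ^ k * (if k = 0 then D.e' m n else 0) * D.form a b) • X.1 (x + (k : ℤ) • dir σ) v := by
      intro k
      rw [← hD.expand, ← hD.expand', Finset.mul_sum, Finset.mul_sum, Finset.sum_mul,
        Finset.sum_smul, Finset.sum_smul, ← Finset.sum_add_distrib]
      refine Finset.sum_congr rfl fun p hp => ?_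
      have hp' : p.1 + p.2 = k := Finset.HasAntidiagonal.mem_antidiagonal.1 hp
      rw [add_comm p.2 p.1, mul_comm (bin n p.2), ← smul_sub, R.same, hp', smul_add, smul_smul,
        smul_smul, show m - (p.1 : ℤ) + (n - p.2) - D.wt = m + n - D.wt - k by
          rw [← hp']; push_cast; ring]
      congr 2 <;> ring_nf
    rw [Finset.sum_congr rfl fun k _ => hk k, Finset.sum_add_distrib]
    congr 1
    · rw [left_eq_sum R (N := N + 1) _ _ fun i hi => hN _ (by omega), Finset.smul_sum]
      refine Finset.sum_congr rfl fun k _ => ?_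
      rw [smul_smul]; congr 1; ring
    · rw [Finset.sum_eq_single_of_mem 0 (by simp)]
      · simp
      · intro k _ hk0
        rw [if_neg hk0]; simp
  · intro i j hij
    rw [hN _ (by push_cast; omega), hN _ (by push_cast; omega)]
    simp

theorem right_same (hR : R.Smooth) (hD : D.Admissible) (σ : Bool) (m n : ℤ) (a b : 𝔞) (X : fields S) :
    right R hR σ m a (right R hR σ n b X) - right R hR σ n b (right R hR σ m a X) =
      -(D.e m n • right R hR σ (m + n - D.wt) (D.bracket a b) X) := by
  refine fields_ext fun x v => ?_
  obtain ⟨K, hK⟩ := hR v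
  have hK' : ∀ (a b : 𝔞) (i j : ℕ), D.wt + K ≤ i ∨ D.wt + K ≤ j →
      R.op σ i a (R.op σ j b v) = 0 := by
    intro a b i j h
    rcases Nat.lt_or_ge j (D.wt + K) with hj | hj
    · have hi : D.wt + K ≤ i := by omega
      have := R.same σ i j a b v
      rwa [hK σ i (by omega), hD.e'_nat, zero_mul, zero_smul, map_zero, sub_zero, add_zero,
        hK σ (i + j - D.wt) (by omega), smul_zero] at this
    · rw [hK σ j (by omega), map_zero]
  have hsq : ∀ (m n : ℤ) (a b : 𝔞), (right R hR σ m a (right R hR σ n b X)).1 x v =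
      ∑ i ∈ Finset.range (D.wt + K), ∑ j ∈ Finset.range (D.wt + K),
        ((-1) ^ (m + n) * (-1) ^ (i + j) * (bin m i * bin n j)) •
          X.1 (x + (m + n - (i + j : ℕ)) • dir σ) (R.op σ j b (R.op σ i a v)) := by
    intro m n a b
    rw [right_eq_sum R hR (N := D.wt + K) m _ x fun i hi => hK σ i (by omega) a]
    refine Finset.sum_congr rfl fun i _ => ?_
    rw [right_eq_sum R hR (N := D.wt + K) n _ _ fun j hj => hK' b a j i (Or.inl hj), Finset.smul_sum]
    refine Finset.sum_congr rfl fun j _ => ?_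
    rw [smul_smul, add_assoc, ← add_smul, zpow_add₀ (by norm_num), pow_add]
    congr 1
    · ring
    · congr 4; push_cast; ring_nf
  change (right R hR σ m a (right R hR σ n b X)).1 x v - (right R hR σ n b (right R hR σ m a X)).1 x v =
    -(D.e m n • (right R hR σ (m + n - D.wt) (D.bracket a b) X).1 x v)
  rw [hsq, hsq, Finset.sum_comm (f := fun i j => ((-1) ^ (n + m) * (-1) ^ (i + j) *
    (bin n i * bin m j)) • X.1 (x + (n + m - (i + j : ℕ)) • dir σ)
      (R.op σ j a (R.op σ i b v))), ← Finset.sum_sub_distrib]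
  simp only [← Finset.sum_sub_distrib]
  have hterm : ∀ i j : ℕ, ((-1 : ℂ) ^ (m + n) * (-1) ^ (i + j) * (bin m i * bin n j)) •
        X.1 (x + (m + n - (i + j : ℕ)) • dir σ) (R.op σ j b (R.op σ i a v)) -
      ((-1) ^ (n + m) * (-1) ^ (j + i) * (bin n j * bin m i)) •
        X.1 (x + (n + m - (j + i : ℕ)) • dir σ) (R.op σ i a (R.op σ j b v)) =
      -(((-1) ^ (m + n) * (-1) ^ (i + j) * (bin m i * bin n j * D.e i j)) •
        X.1 (x + (m + n - (i + j : ℕ)) • dir σ)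
          (R.op σ ((i + j : ℕ) - D.wt : ℤ) (D.bracket a b) v)) := by
    intro i j
    have h := R.same σ i j a b v
    rw [hD.e'_nat, zero_mul, zero_smul, add_zero] at h
    rw [add_comm j i, add_comm n m, mul_comm (bin n j), ← smul_sub, ← map_sub,
      ← neg_sub (R.op σ i a (R.op σ j b v)), h,
      map_neg, map_smul, smul_neg, smul_smul]
    congr 2
    ring
  simp only [hterm]
  rw [sum_square_eq_sum_triangle]
  · have hk : ∀ k : ℕ, ∑ p ∈ antidiagonal k,
        -(((-1 : ℂ) ^ (m + n) * (-1) ^ (p.1 + p.2) * (bin m p.1 * bin n p.2 * D.e p.1 p.2)) •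
        X.1 (x + (m + n - (p.1 + p.2 : ℕ)) • dir σ)
          (R.op σ ((p.1 + p.2 : ℕ) - D.wt : ℤ) (D.bracket a b) v)) =
        -(((-1) ^ (m + n) * (-1) ^ k *
          (if k < D.wt then 0 else D.e m n * bin (m + n - D.wt) (k - D.wt))) •
          X.1 (x + (m + n - k) • dir σ) (R.op σ (k - D.wt : ℤ) (D.bracket a b) v)) := by
      intro k
      rw [← hD.regular, Finset.mul_sum, Finset.sum_smul, ← Finset.sum_neg_distrib]
      refine Finset.sum_congr rfl fun p hp => ?_
      rw [Finset.HasAntidiagonal.mem_antidiagonal.1 hp]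
    rw [Finset.sum_congr rfl fun k _ => hk k, Finset.sum_range_add,
      Finset.sum_eq_zero fun k hk => ?_, zero_add, right_eq_sum R hR (N := K) _ _ _
      fun i hi => hK σ i (by omega) _, Finset.smul_sum, ← Finset.sum_neg_distrib]
    · refine Finset.sum_congr rfl fun k _ => ?_
      rw [if_neg (by omega), smul_smul, add_tsub_cancel_left]
      have e1 : m + n - ((D.wt + k : ℕ) : ℤ) = m + n - D.wt - k := by push_cast; ring
      have e2 : ((D.wt + k : ℕ) : ℤ) - D.wt = k := by push_cast; ring
      have e3 : (-1 : ℂ) ^ (m + n - D.wt) = (-1) ^ (m + n) * (-1) ^ D.wt := by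
        rw [zpow_sub₀ (by norm_num), zpow_natCast, div_eq_mul_inv, ← inv_pow]; norm_num
      rw [e1, e2, e3, pow_add]
      congr 2
      ring
    · rw [if_pos (Finset.mem_range.1 hk)]; simp
  · intro i j hij
    rw [hK σ _ (by push_cast; omega), map_zero, smul_zero, neg_zero]

theorem left_right_comm (hR : R.Smooth) (σ τ : Bool) (m n : ℤ) (a b : 𝔞) (X : fields S) :
    left R σ m a (right R hR τ n b X) = right R hR τ n b (left R σ m a X) := by
  refine fields_ext fun x v => ?_
  obtain ⟨K, hK⟩ := hR v
  choose N hN using fun j : ℕ => fields_bound_dir X (R.op τ j b v) (x + (n - j) • dir τ) σ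
  have hM : ∀ j ∈ Finset.range K, ∀ i : ℕ, ∑ j ∈ Finset.range K, N j ≤ i →
      X.1 (x + (n - j) • dir τ + (i : ℤ) • dir σ) (R.op τ j b v) = 0 := by
    intro j hj i hi
    have := Finset.single_le_sum (f := N) (fun _ _ => Nat.zero_le _) hj
    exact hN j _ (by omega)
  have hr : ∀ y, (right R hR τ n b X).1 y v = ∑ j ∈ Finset.range K,
      ((-1) ^ n * (-1) ^ j * bin n j) • X.1 (y + (n - j) • dir τ) (R.op τ j b v) := fun y =>
    right_eq_sum R hR n X y fun j hj => hK τ j (by omega) b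
  change (left R σ m a (right R hR τ n b X)).1 x v = (right R hR τ n b (left R σ m a X)).1 x v
  rw [left_eq_sum R (N := ∑ j ∈ Finset.range K, N j), right_eq_sum R hR (N := K) n _ _
    fun j hj => hK τ j (by omega) b]
  · have h1 : ∀ j ∈ Finset.range K, (left R σ m a X).1 (x + (n - j) • dir τ) (R.op τ j b v) = _ :=
      fun j hj => left_eq_sum R m a (hM j hj)
    refine Eq.trans ?_ (Finset.sum_congr rfl fun j hj => by rw [h1 j hj]).symm
    simp only [hr, map_sum, Finset.smul_sum]
    rw [Finset.sum_comm]
    refine Finset.sum_congr rfl fun j _ => Finset.sum_congr rfl fun i _ => ?_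
    rw [map_smul, smul_comm, add_right_comm]
  · intro i hi
    rw [hr]
    refine Finset.sum_eq_zero fun j hj => ?_
    rw [add_right_comm, hM j hj i hi, smul_zero]

theorem left_left_comm {σ τ : Bool} (h : σ ≠ τ) (m n : ℤ) (a b : 𝔞) (X : fields S) :
    left R σ m a (left R τ n b X) = left R τ n b (left R σ m a X) := by
  refine fields_ext fun x v => ?_
  obtain ⟨N, hN⟩ := fields_bound X v x
  have h1 : ∀ (σ : Bool) (y : ℤ × ℤ), (∀ ρ, co ρ x ≤ co ρ y) → ∀ i : ℕ, N ≤ i →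
      X.1 (y + (i : ℤ) • dir σ) v = 0 := by
    intro σ y hy i hi
    refine hN _ σ ?_
    rw [co_add_smul_dir]
    have := hy σ
    omega
  have h2 : ∀ (σ τ : Bool) (m n : ℤ) (a b : 𝔞), (left R σ m a (left R τ n b X)).1 x v =
      ∑ i ∈ Finset.range N, ∑ j ∈ Finset.range N, ((-1) ^ i * bin m i * ((-1) ^ j * bin n j)) •
        R.op σ (m - i) a (R.op τ (n - j) b
          (X.1 (x + (i : ℤ) • dir σ + (j : ℤ) • dir τ) v)) := by
    intro σ τ m n a b
    have h3 : ∀ i : ℕ, (left R τ n b X).1 (x + (i : ℤ) • dir σ) v = _ := fun i =>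
      left_eq_sum R n b fun j hj => h1 τ _ (fun ρ => co_le_add ρ σ x (by positivity)) j hj
    rw [left_eq_sum R (N := N)]
    · simp only [h3, map_sum, Finset.smul_sum, map_smul, smul_smul]
    · intro i hi
      rw [h3]
      refine Finset.sum_eq_zero fun j _ => ?_
      rw [add_right_comm, h1 σ _ (fun ρ => co_le_add ρ τ x (by positivity)) i hi, map_zero,
        smul_zero]
  change (left R σ m a (left R τ n b X)).1 x v = (left R τ n b (left R σ m a X)).1 x v
  rw [h2, h2, Finset.sum_comm]
  refine Finset.sum_congr rfl fun i _ => Finset.sum_congr rfl fun j _ => ?_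
  rw [R.diff _ _ h, mul_comm, add_right_comm]

theorem right_right_comm (hR : R.Smooth) {σ τ : Bool} (h : σ ≠ τ) (m n : ℤ) (a b : 𝔞)
    (X : fields S) : right R hR σ m a (right R hR τ n b X) = right R hR τ n b (right R hR σ m a X) := by
  refine fields_ext fun x v => ?_
  obtain ⟨K, hK⟩ := hR v
  have hK' : ∀ (ρ : Bool) (a : 𝔞) (i : ℕ), K ≤ i → R.op ρ i a v = 0 := fun ρ a i hi =>
    hK ρ i (by omega) a
  have h2 : ∀ {σ τ : Bool} (_ : σ ≠ τ) (m n : ℤ) (a b : 𝔞),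
      (right R hR σ m a (right R hR τ n b X)).1 x v =
      ∑ i ∈ Finset.range K, ∑ j ∈ Finset.range K,
        ((-1) ^ m * (-1) ^ i * bin m i * ((-1) ^ n * (-1) ^ j * bin n j)) •
        X.1 (x + (m - i) • dir σ + (n - j) • dir τ) (R.op τ j b (R.op σ i a v)) := by
    intro σ τ h m n a b
    rw [right_eq_sum R hR m _ _ (hK' σ a)]
    refine Finset.sum_congr rfl fun i _ => ?_
    rw [right_eq_sum R hR (N := K) n, Finset.smul_sum]
    · refine Finset.sum_congr rfl fun j _ => ?_
      rw [smul_smul]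
    · intro j hj
      rw [R.diff _ _ h.symm, hK' τ b j hj, map_zero]
  change (right R hR σ m a (right R hR τ n b X)).1 x v = (right R hR τ n b (right R hR σ m a X)).1 x v
  rw [h2 h, h2 h.symm, Finset.sum_comm]
  refine Finset.sum_congr rfl fun i _ => Finset.sum_congr rfl fun j _ => ?_
  rw [R.diff _ _ h, mul_comm, add_right_comm]

/-- The products of the generating fields with arbitrary fields satisfy the commutation relations
of the modes. -/
def fieldRep (hR : R.Smooth) (hD : D.Admissible) : D.ModeRep (fields S) where
  op σ n := LinearMap.mk₂ ℂ (fun a X => left R σ n a X - right R hR σ n a X)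
    (fun a b X => by simp only [map_add, LinearMap.add_apply]; abel)
    (fun c a X => by simp only [map_smul, LinearMap.smul_apply, smul_sub])
    (fun a X Y => by simp only [map_add]; abel)
    (fun c a X => by simp only [map_smul, smul_sub])
  same σ m n a b X := by
    have h1 := left_same R hD σ m n a b X
    have h2 := right_same R hR hD σ m n a b X
    have h3 := left_right_comm R hR σ σ m n a b X
    have h4 := left_right_comm R hR σ σ n m b a X
    simp only [LinearMap.mk₂_apply, map_sub, smul_sub]
    rw [← h3, ← h4]
    linear_combination (norm := module) h1 + h2
  diff σ τ h m n a b X := by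
    simp only [LinearMap.mk₂_apply, map_sub, left_left_comm R h m n, right_right_comm R hR h m n,
      left_right_comm R hR]
    abel

open Classical in
/-- The identity field. -/
def idField (S : Type*) [AddCommGroup S] [Module ℂ S] : fields S :=
  ⟨fun x => if x = (-1, -1) then LinearMap.id else 0, fun v => ⟨0, fun x σ hx => by
    have : x ≠ (-1, -1) := by
      rintro rfl
      cases σ <;> simp [co] at hx
    simp [this]⟩⟩

theorem op_idField (hR : R.Smooth) (hD : D.Admissible) (σ : Bool) (n : ℕ) (a : 𝔞) :
    (fieldRep R hR hD).op σ n a (idField S) = 0 := by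
  refine fields_ext fun x v => ?_
  change (left R σ n a (idField S)).1 x v - (right R hR σ n a (idField S)).1 x v = 0
  have hb : ∀ i : ℕ, n + 1 ≤ i → bin n i = 0 := fun i hi => bin_of_lt (by positivity) (by omega)
  rw [left_apply, right_apply, finsum_eq_sum_range (N := n + 1), finsum_eq_sum_range (N := n + 1),
    sub_eq_zero, ← Finset.sum_range_reflect]
  · refine Finset.sum_congr rfl fun i hi => ?_
    have hi' : i ≤ n := Nat.lt_succ_iff.1 (Finset.mem_range.1 hi)
    have e : n + 1 - 1 - i = n - i := by omega
    rw [e]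
    have e1 : ((n - i : ℕ) : ℤ) = n - i := by omega
    have e2 : (n : ℤ) - (n - i : ℕ) = i := by omega
    have e3 : bin n (n - i) = bin n i := by rw [bin_natCast, bin_natCast, Nat.choose_symm hi']
    have e4 : (-1 : ℂ) ^ (n - i) = (-1) ^ (n : ℤ) * (-1) ^ i := by
      rw [zpow_natCast, ← pow_add, show n + i = (n - i) + 2 * i by omega, pow_add, pow_mul]
      simp
    rw [e2, e3, e4, e1]
    simp only [idField]
    split_ifs
    · rfl
    · simp
  · intro i hi; rw [hb i hi]; simp
  · intro i hi; rw [hb i hi]; simp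

end fields

theorem exists_vertexMap (hD : D.Admissible) : ∃ F : D.State →ₗ[ℂ] fields D.State,
    F D.vacuum = idField D.State ∧ ∀ σ n a s, F (D.act σ n a s) = (fieldRep D.stateRep (smooth hD) hD).op σ n a (F s) :=
  D.exists_equivariant (fieldRep D.stateRep (smooth hD) hD) (op_idField D.stateRep (smooth hD) hD)

/-- The map which sends a state to its field. -/
def vertexMap (hD : D.Admissible) : D.State →ₗ[ℂ] fields D.State := (exists_vertexMap hD).choose

/-- The modes of the field of a state. -/
def vop (hD : D.Admissible) (x : ℤ × ℤ) : D.State →ₗ[ℂ] D.State →ₗ[ℂ] D.State :=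
  LinearMap.proj x ∘ₗ (fields D.State).subtype ∘ₗ vertexMap hD

variable (hD : D.Admissible)

open Classical in
theorem vop_vacuum (x : ℤ × ℤ) : vop hD x D.vacuum = if x = (-1, -1) then LinearMap.id else 0 := by
  change (vertexMap hD D.vacuum).1 x = _
  rw [vertexMap, (exists_vertexMap hD).choose_spec.1]
  rfl

theorem vop_bound (A v : D.State) : ∃ N : ℤ, ∀ x σ, N ≤ co σ x → vop hD x A v = 0 :=
  (vertexMap hD A).2 v

theorem vop_bound_dir (A v : D.State) (x : ℤ × ℤ) (σ : Bool) :
    ∃ N : ℕ, ∀ k : ℤ, N ≤ k → vop hD (x + k • dir σ) A v = 0 :=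
  fields_bound_dir (vertexMap hD A) v x σ

/-- The modes of the field of `a_(n) A`. -/
theorem vop_act (σ : Bool) (n : ℤ) (a : 𝔞) (A v : D.State) (x : ℤ × ℤ) :
    vop hD x (D.act σ n a A) v =
      (∑ᶠ i : ℕ, ((-1) ^ i * bin n i) • D.act σ (n - i) a (vop hD (x + (i : ℤ) • dir σ) A v)) -
      ∑ᶠ i : ℕ, ((-1) ^ n * (-1) ^ i * bin n i) •
        vop hD (x + (n - i) • dir σ) A (D.act σ i a v) := by
  change (vertexMap hD (D.act σ n a A)).1 x v = _
  rw [vertexMap, (exists_vertexMap hD).choose_spec.2]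
  rfl

end Datum

end SphereVA

end

noncomputable section

namespace SphereVA

namespace Datum

variable {𝔞 : Type*} [AddCommGroup 𝔞] [Module ℂ 𝔞] {D : Datum 𝔞} (hD : D.Admissible)

/-! ### The vertex operator map -/

theorem vop_create_bound (σ : Bool) (m : ℕ) (A v : D.State) (x : ℤ × ℤ) :
    ∃ N : ℕ, ∀ k : ℕ, N ≤ k → vop hD (x + (k - m : ℤ) • dir σ) A v = 0 ∧
      ∀ a, D.act σ k a v = 0 := by
  obtain ⟨N, hN⟩ := vop_bound_dir hD A v x σ
  obtain ⟨K, hK⟩ := smooth hD v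
  exact ⟨N + m + K, fun k hk => ⟨hN _ (by omega), hK σ k (by omega)⟩⟩

theorem vop_create_fst_finite (σ : Bool) (m : ℕ) (a : 𝔞) (A v : D.State) (x : ℤ × ℤ)
    (c : ℕ → ℂ) : (Function.support fun k : ℕ =>
      c k • D.act σ (-k - 1) a (vop hD (x + (k - m : ℤ) • dir σ) A v)).Finite := by
  obtain ⟨N, hN⟩ := vop_create_bound hD σ m A v x
  refine (Set.finite_lt_nat N).subset fun k hk => ?_
  by_contra hn
  exact hk (by simp only [(hN k (not_lt.1 hn)).1, map_zero, smul_zero])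

theorem vop_create_snd_finite (σ : Bool) (m : ℕ) (a : 𝔞) (A v : D.State) (x : ℤ × ℤ)
    (c : ℕ → ℂ) : (Function.support fun k : ℕ =>
      c k • vop hD (x - (k + m + 1 : ℤ) • dir σ) A (D.act σ k a v)).Finite := by
  obtain ⟨N, hN⟩ := vop_create_bound hD σ m A v x
  refine (Set.finite_lt_nat N).subset fun k hk => ?_
  by_contra hn
  exact hk (by simp only [(hN k (not_lt.1 hn)).2, map_zero, smul_zero])

theorem bin_neg_symm (k m : ℕ) : bin (-k - 1) m = (-1) ^ m * (-1) ^ k * bin (-m - 1) k := by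
  rw [bin_neg, bin_neg, add_comm m k, Nat.choose_symm_add]
  have : ((-1 : ℂ) ^ k) * (-1) ^ k = 1 := by rw [← mul_pow]; simp
  linear_combination (-(-1) ^ m * ((k + m).choose m : ℂ)) * this

/-- The field of `a_(-m-1) A` is the normally ordered product of a derivative of the field of `a`
with the field of `A`. -/
theorem vop_create (σ : Bool) (m : ℕ) (a : 𝔞) (A v : D.State) (x : ℤ × ℤ) :
    vop hD x (D.act σ (-m - 1) a A) v =
      (∑ᶠ k : ℕ, (k.choose m : ℂ) • D.act σ (-k - 1) a (vop hD (x + (k - m : ℤ) • dir σ) A v)) +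
      ∑ᶠ k : ℕ, bin (-k - 1) m • vop hD (x - (k + m + 1 : ℤ) • dir σ) A (D.act σ k a v) := by
  obtain ⟨N, hN⟩ := vop_create_bound hD σ m A v x
  rw [vop_act, sub_eq_add_neg]
  congr 1
  · rw [finsum_eq_sum_range (N := N), finsum_eq_sum_range (N := m + N), Finset.sum_range_add]
    · have h0 : ∑ k ∈ Finset.range m, (k.choose m : ℂ) •
          D.act σ (-k - 1) a (vop hD (x + (k - m : ℤ) • dir σ) A v) = 0 :=
        Finset.sum_eq_zero fun k hk => by
          rw [Nat.choose_eq_zero_of_lt (Finset.mem_range.1 hk)]; simp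
      rw [h0, zero_add]
      refine Finset.sum_congr rfl fun i _ => ?_
      rw [bin_neg, ← mul_assoc, ← mul_pow]
      have e1 : ((m + i : ℕ) : ℤ) - m = i := by push_cast; ring
      have e2 : (-m - 1 - i : ℤ) = -((m + i : ℕ) : ℤ) - 1 := by push_cast; ring
      rw [e1, e2, Nat.choose_symm_add]
      simp
    · intro i hi
      rw [(hN i (by omega)).1, map_zero, smul_zero]
    · intro i hi
      have := (hN (m + i) (by omega)).1
      have e1 : ((m + i : ℕ) : ℤ) - m = i := by push_cast; ring
      rw [e1] at this
      rw [this, map_zero, smul_zero]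
  · rw [← finsum_neg_distrib]
    refine finsum_congr fun k => ?_
    rw [bin_neg_symm, ← neg_smul, sub_eq_add_neg x, ← neg_smul,
      show -(k + m + 1 : ℤ) = -m - 1 - k by ring, zpow_sub₀ (by norm_num), zpow_one, zpow_neg,
      zpow_natCast, ← inv_pow, bin_neg_symm]
    congr 1
    have h1 : ((-1 : ℂ) ^ k) * (-1) ^ k = 1 := by rw [← mul_pow]; simp
    norm_num
    have h2 : ((-1 : ℂ) ^ m) * (-1) ^ m = 1 := by rw [← mul_pow]; simp
    linear_combination bin (-m - 1) k * (-1) ^ m * (-1) ^ k * ((-1) ^ m * (-1) ^ m * h1 + h2)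

theorem normalOrdered_anti (lb : List (𝔞 × ℕ)) (n n' : ℤ) (B : D.State) :
    vop hD (n, n') (D.monomial [] lb) B = if n = -1 then
      D.normalOrdered (fun k a v => D.antiMode k a • v) lb n' B else 0 := by
  induction lb generalizing n n' B with
  | nil =>
    rw [monomial_nil, vop_vacuum, normalOrdered]
    by_cases h : n = -1 <;> by_cases h' : n' = -1 <;> simp [h, h']
  | cons x l ih =>
    obtain ⟨a, m⟩ := x
    rw [← act_monomial_false, vop_create, normalOrdered]
    by_cases h : n = -1
    · rw [if_pos h]
      congr 1
      · refine finsum_congr fun k => ?_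
        rw [Nat.cast_smul_eq_nsmul]
        simp only [dir, Prod.smul_mk, Prod.mk_add_mk, smul_zero, add_zero, ih, if_pos h]
        rw [smul_eq_mul, mul_one, show n' + (k - m : ℤ) = n' + k - m by ring]; rfl
      · refine finsum_congr fun k => ?_
        rw [bin, Int.cast_smul_eq_zsmul]
        simp only [dir, Prod.smul_mk, Prod.mk_sub_mk, smul_zero, sub_zero, ih, if_pos h]
        rw [smul_eq_mul, mul_one, show n' - (k + m + 1 : ℤ) = n' - k - m - 1 by ring]; rfl
    · rw [if_neg h]
      simp only [dir, Prod.smul_mk, Prod.mk_add_mk, Prod.mk_sub_mk, smul_zero, add_zero, sub_zero,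
        ih, if_neg h, map_zero, finsum_zero]

theorem vop_anti_comm (lb : List (𝔞 × ℕ)) (x : ℤ × ℤ) (k : ℤ) (a : 𝔞) (B : D.State) :
    vop hD x (D.monomial [] lb) (D.act true k a B) =
      D.act true k a (vop hD x (D.monomial [] lb) B) := by
  induction lb generalizing x B with
  | nil =>
    rw [monomial_nil, vop_vacuum]
    split_ifs <;> simp
  | cons y l ih =>
    obtain ⟨b, m⟩ := y
    rw [← act_monomial_false, vop_create, vop_create, map_add,
      map_finsum _ (vop_create_fst_finite hD _ _ _ _ _ _ _),
      map_finsum _ (vop_create_snd_finite hD _ _ _ _ _ _ _)]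
    congr 1
    · refine finsum_congr fun i => ?_
      rw [ih, map_smul, D.act_diff (by simp)]
    · refine finsum_congr fun i => ?_
      rw [D.act_diff (by simp), ih, map_smul]

theorem normalOrdered_eq (la lb : List (𝔞 × ℕ)) (n n' : ℤ) (B : D.State) :
    vop hD (n, n') (D.monomial la lb) B =
      D.normalOrdered (fun k a v => D.chiralMode k a • v) la n
        (D.normalOrdered (fun k a v => D.antiMode k a • v) lb n' B) := by
  induction la generalizing n B with
  | nil => rw [normalOrdered_anti, normalOrdered]
  | cons x l ih =>
    obtain ⟨a, m⟩ := x
    rw [← act_monomial_true, vop_create, normalOrdered]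
    congr 1
    · refine finsum_congr fun k => ?_
      rw [Nat.cast_smul_eq_nsmul]
      simp only [dir, Prod.smul_mk, Prod.mk_add_mk, smul_zero, add_zero, ih]
      rw [smul_eq_mul, mul_one, show n + (k - m : ℤ) = n + k - m by ring]; rfl
    · refine finsum_congr fun k => ?_
      have h1 := normalOrdered_anti hD lb (-1) n' (D.act true k a B)
      have h2 := normalOrdered_anti hD lb (-1) n' B
      rw [if_pos rfl] at h1 h2
      rw [bin, Int.cast_smul_eq_zsmul]
      simp only [dir, Prod.smul_mk, Prod.mk_sub_mk, smul_zero, sub_zero, ih]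
      rw [smul_eq_mul, mul_one, show n - (k + m + 1 : ℤ) = n - k - m - 1 by ring, ← h1,
        vop_anti_comm, h2]; rfl

theorem finsum_mem_submodule {ι V : Type*} [AddCommGroup V] [Module ℂ V] (W : Submodule ℂ V)
    {f : ι → V} (h : ∀ i, f i ∈ W) : ∑ᶠ i, f i ∈ W :=
  finsum_induction (p := (· ∈ W)) W.zero_mem (fun _ _ => W.add_mem) h

/-- The vertex operator map is homogeneous. -/
theorem vop_mem {h k : ℝ × ℝ} {A B : D.State} (hA : A ∈ D.grading h) (hB : B ∈ D.grading k)
    (x : ℤ × ℤ) : vop hD x A B ∈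
      D.grading (h + k - ((x.1 : ℝ), (x.2 : ℝ)) - (1, 1)) := by
  have main : ∀ (σ : Bool) (m : ℕ) (a : 𝔞) (A : D.State) (h : ℝ × ℝ),
      (∀ x k, ∀ B ∈ D.grading k, vop hD x A B ∈
        D.grading (h + k - ((x.1 : ℝ), (x.2 : ℝ)) - (1, 1))) →
      ∀ x k, ∀ B ∈ D.grading k, vop hD x (D.act σ (-m - 1) a A) B ∈
        D.grading (h + ((D.wt : ℝ) + 1 + m) • rdir σ + k - ((x.1 : ℝ), (x.2 : ℝ)) - (1, 1)) := by
    intro σ m a A h ih x k B hB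
    have hx : ∀ j : ℤ, (((x + j • dir σ).1 : ℝ), ((x + j • dir σ).2 : ℝ)) =
        ((x.1 : ℝ), (x.2 : ℝ)) + (j : ℝ) • rdir σ := by
      intro j
      cases σ <;> simp [dir, rdir]
    rw [vop_create]
    refine Submodule.add_mem _ (finsum_mem_submodule _ fun j => Submodule.smul_mem _ _ ?_)
      (finsum_mem_submodule _ fun j => Submodule.smul_mem _ _ ?_)
    · have := act_neg_mem σ j a (ih (x + (j - m : ℤ) • dir σ) k B hB)
      rw [hx] at this
      convert this using 2
      push_cast
      module
    · have := ih (x - (j + m + 1 : ℤ) • dir σ) _ _ (act_mem hD σ j a hB)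
      rw [sub_eq_add_neg x, ← neg_smul, hx] at this
      rw [sub_eq_add_neg x, ← neg_smul]
      convert this using 2
      push_cast
      module
  induction hA using Submodule.span_induction with
  | zero => rw [map_zero]; exact Submodule.zero_mem _
  | add y z _ _ hy hz => rw [map_add]; exact Submodule.add_mem _ hy hz
  | smul c y _ hy => rw [map_smul]; exact Submodule.smul_mem _ c hy
  | mem y hy =>
    obtain ⟨la, lb, rfl, rfl⟩ := hy
    suffices H : ∀ x k, ∀ B ∈ D.grading k, vop hD x (D.monomial la lb) B ∈
        D.grading (((D.weight la : ℝ), (D.weight lb : ℝ)) + k - ((x.1 : ℝ), (x.2 : ℝ)) - (1, 1)) from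
      H x k B hB
    induction la with
    | nil =>
      induction lb with
      | nil =>
        intro x k B hB
        rw [monomial_nil, vop_vacuum]
        split_ifs with hx
        · subst hx
          have e : (((D.weight [] : ℕ) : ℝ), ((D.weight [] : ℕ) : ℝ)) + k -
              (((-1 : ℤ) : ℝ), ((-1 : ℤ) : ℝ)) - (1, 1) = k := by
            ext <;> simp [weight]
          rw [e]
          exact hB
        · exact Submodule.zero_mem _
      | cons y l ih =>
        obtain ⟨a, m⟩ := y
        intro x k B hB
        have := main false m a _ _ ih x k B hB
        rw [act_monomial_false] at this
        convert this using 5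
        simp [weight, rdir]; ring
    | cons y l ih =>
      obtain ⟨a, m⟩ := y
      intro x k B hB
      have := main true m a _ _ ih x k B hB
      rw [act_monomial_true] at this
      convert this using 5
      simp [weight, rdir]; ring

/-- The creation property. -/
theorem vop_apply_vacuum (A : D.State) : (∀ x : ℤ × ℤ, vop hD x A D.vacuum ≠ 0 → x.1 ≤ -1 ∧ x.2 ≤ -1) ∧
    vop hD (-1, -1) A D.vacuum = A := by
  induction A using state_induction hD with
  | hv =>
    refine ⟨fun x hx => ?_, by rw [vop_vacuum, if_pos rfl]; rfl⟩
    rw [vop_vacuum] at hx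
    split_ifs at hx with h
    · simp [h]
    · exact absurd rfl hx
  | ha A B hA hB =>
    refine ⟨fun x hx => ?_, by rw [map_add, LinearMap.add_apply, hA.2, hB.2]⟩
    by_cases h : vop hD x A D.vacuum = 0
    · refine hB.1 x fun h' => hx ?_
      rw [map_add, LinearMap.add_apply, h, h', add_zero]
    · exact hA.1 x h
  | hs c A hA =>
    refine ⟨fun x hx => hA.1 x fun h => hx ?_, by rw [map_smul, LinearMap.smul_apply, hA.2]⟩
    rw [map_smul, LinearMap.smul_apply, h, smul_zero]
  | hm σ m a A hA =>
    have e : ∀ x, vop hD x (D.act σ (-m - 1) a A) D.vacuum = ∑ᶠ k : ℕ, (k.choose m : ℂ) •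
        D.act σ (-k - 1) a (vop hD (x + (k - m : ℤ) • dir σ) A D.vacuum) := by
      intro x
      rw [vop_create]
      simp only [act_vacuum, map_zero, smul_zero, finsum_zero, add_zero]
    refine ⟨fun x hx => ?_, ?_⟩
    · rw [e] at hx
      obtain ⟨k, hk⟩ : ∃ k : ℕ, (k.choose m : ℂ) •
          D.act σ (-k - 1) a (vop hD (x + (k - m : ℤ) • dir σ) A D.vacuum) ≠ 0 := by
        by_contra! hn
        exact hx (finsum_eq_zero_of_forall_eq_zero hn)
      have hkm : m ≤ k := by
        by_contra hn
        rw [Nat.choose_eq_zero_of_lt (not_le.1 hn)] at hk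
        simp at hk
      have := hA.1 _ fun h => hk (by rw [h, map_zero, smul_zero])
      cases σ <;> simp [dir] at this <;> omega
    · rw [e, finsum_eq_single _ m]
      · simp [hA.2]
      · intro k hk
        rcases lt_or_gt_of_ne hk with h | h
        · rw [Nat.choose_eq_zero_of_lt h]; simp
        · have : vop hD ((-1, -1) + (k - m : ℤ) • dir σ) A D.vacuum = 0 := by
            by_contra hn
            have := hA.1 _ hn
            cases σ <;> simp [dir] at this <;> omega
          rw [this, map_zero, smul_zero]

end Datum

end SphereVA

end

noncomputable section

namespace SphereVA

/-! ### Alternating binomial sums -/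

theorem IsPoly.mul {f g : ℤ → ℂ} (hf : IsPoly f) (hg : IsPoly g) : IsPoly fun s => f s * g s := by
  obtain ⟨N, hN⟩ := hf
  obtain ⟨M, hM⟩ := hg
  induction h : N + M generalizing f g N M with
  | zero =>
    have : f = 0 := by
      have : N = 0 := by omega
      subst this; simpa using hN
    subst this
    simpa using IsPoly.const 0
  | succ K ih =>
    apply IsPoly.of_diffOp
    have e : (diffOp fun s => f s * g s) = (fun s => diffOp f s * g (s + 1)) +
        fun s => f s * diffOp g s := by
      funext s
      simp only [diffOp_apply, Pi.add_apply]; ring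
    rw [e]
    refine IsPoly.add ?_ ?_
    · rcases N with _ | N
      · have : f = 0 := by simpa using hN
        subst this
        simpa using IsPoly.const 0
      · refine ih (g := fun s => g (s + 1)) N ?_ M ?_ (by omega)
        · rwa [pow_succ, Module.End.mul_apply] at hN
        · rw [IsPoly.shift_pow, hM]; rfl
    · rcases M with _ | M
      · have : g = 0 := by simpa using hM
        subst this
        simpa using IsPoly.const 0
      · refine ih N hN M ?_ (by omega)
        rwa [pow_succ, Module.End.mul_apply] at hM

/-- The `n`-th alternating binomial sum of a pair of functions of an integer, of which the first is
supported in a half-line which is bounded below and the second in one which is bounded above. -/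
def alt (n : ℤ) (H H' : ℤ → ℂ) (r : ℤ) : ℂ :=
  ∑ᶠ i : ℕ, (-1) ^ i * bin n i * H (r + n - i) -
    (-1) ^ n * ∑ᶠ i : ℕ, (-1) ^ i * bin n i * H' (r + i)

section alt

variable {H H' : ℤ → ℂ} {N M : ℤ}

theorem alt_eq (hH : ∀ r < N, H r = 0) (hH' : ∀ r, M ≤ r → H' r = 0) {n r : ℤ} {K : ℕ}
    (h1 : r + n - K < N) (h2 : M ≤ r + K) : alt n H H' r =
      ∑ i ∈ Finset.range K, (-1) ^ i * bin n i * H (r + n - i) -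
        (-1) ^ n * ∑ i ∈ Finset.range K, (-1) ^ i * bin n i * H' (r + i) := by
  rw [alt, finsum_eq_sum_range (N := K), finsum_eq_sum_range (N := K)]
  · intro i hi; rw [hH' _ (by omega), mul_zero]
  · intro i hi; rw [hH _ (by omega), mul_zero]

theorem exists_alt_bound (N M n r : ℤ) : ∃ K : ℕ, r + n - K + 2 < N ∧ M + 2 ≤ r + K :=
  ⟨(r + n - N).natAbs + (M - r).natAbs + 3, by omega, by omega⟩

theorem diffOp_alt (hH : ∀ r < N, H r = 0) (hH' : ∀ r, M ≤ r → H' r = 0) (n : ℤ) :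
    diffOp (alt n H H') = alt (n + 1) H H' := by
  funext r
  obtain ⟨K, h1, h2⟩ := exists_alt_bound N M n r
  rw [diffOp_apply, alt_eq hH hH' (K := K + 1) (r := r + 1) (by push_cast; omega) (by push_cast; omega),
    alt_eq hH hH' (n := n) (K := K) (r := r) (by omega) (by omega),
    alt_eq hH hH' (K := K + 1) (r := r) (n := n + 1) (by push_cast; omega) (by push_cast; omega)]
  have e0 : ∀ (f : ℕ → ℂ), ∑ i ∈ Finset.range (K + 1), (-1) ^ i * bin (n + 1) i * f i =
      ∑ i ∈ Finset.range (K + 1), (-1) ^ i * bin n i * f i -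
        ∑ i ∈ Finset.range K, (-1) ^ i * bin n i * f (i + 1) := by
    intro f
    rw [Finset.sum_range_succ', Finset.sum_range_succ' (fun i => (-1) ^ i * bin n i * f i)]
    simp only [bin_succ, bin_zero_right, pow_succ]
    rw [add_sub_right_comm, ← Finset.sum_sub_distrib]
    congr 1
    refine Finset.sum_congr rfl fun i _ => ?_
    ring
  rw [e0 fun i => H (r + (n + 1) - i), e0 fun i => H' (r + i)]
  have e1 : ∀ i : ℕ, r + (n + 1) - ((i + 1 : ℕ) : ℤ) = r + n - i := fun i => by push_cast; ring
  have e2 : ∀ i : ℕ, r + ((i + 1 : ℕ) : ℤ) = r + 1 + i := fun i => by push_cast; ring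
  have e3 : ∀ i : ℕ, r + 1 + n - (i : ℤ) = r + (n + 1) - i := fun i => by ring
  simp only [e1, e2, e3]
  have e4 : ∑ i ∈ Finset.range (K + 1), (-1) ^ i * bin n i * H' (r + 1 + i) =
      ∑ i ∈ Finset.range K, (-1) ^ i * bin n i * H' (r + 1 + i) := by
    rw [Finset.sum_range_succ, hH' _ (by omega), mul_zero, add_zero]
  have e5 : ∑ i ∈ Finset.range (K + 1), (-1) ^ i * bin n i * H' (r + i) =
      ∑ i ∈ Finset.range K, (-1) ^ i * bin n i * H' (r + i) := by
    rw [Finset.sum_range_succ, hH' _ (by omega), mul_zero, add_zero]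
  rw [e4, e5, zpow_add_one₀ (by norm_num)]
  ring

theorem isPoly_alt (hH : ∀ r < N, H r = 0) (hH' : ∀ r, M ≤ r → H' r = 0)
    (h : IsPoly fun r => H r - H' r) (m : ℕ) : IsPoly (alt (-m) H H') := by
  induction m with
  | zero =>
    convert h using 1
    funext r
    rw [alt, finsum_eq_single _ 0, finsum_eq_single _ 0]
    · simp
    · intro i hi
      rw [Nat.cast_zero, neg_zero, bin_zero_left, if_neg hi]; simp
    · intro i hi
      rw [Nat.cast_zero, neg_zero, bin_zero_left, if_neg hi]; simp
  | succ m ih =>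
    apply IsPoly.of_diffOp
    rw [diffOp_alt hH hH']
    convert ih using 2
    push_cast; ring

/-- The variant of `alt` with affine coefficients. -/
theorem alt_affine (hH : ∀ r < N, H r = 0) (hH' : ∀ r, M ≤ r → H' r = 0) (n r : ℤ) (A B s : ℂ) :
    ∑ᶠ i : ℕ, (-1) ^ i * bin n i * ((A + B * (s - (n - i))) * H (r + n - i)) -
      (-1) ^ n * ∑ᶠ i : ℕ, (-1) ^ i * bin n i * ((A + B * (s - i)) * H' (r + i)) =
      (A + B * s) * alt n H H' r - B * n * alt (n - 1) H H' (r + 1) := by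
  obtain ⟨K, h1, h2⟩ := exists_alt_bound N M n r
  rw [alt_eq hH hH' (K := K + 1) (by push_cast; omega) (by push_cast; omega),
    alt_eq hH hH' (n := n - 1) (r := r + 1) (K := K) (by omega) (by omega),
    finsum_eq_sum_range (N := K + 1), finsum_eq_sum_range (N := K + 1)]
  · have e1 : ∑ i ∈ Finset.range (K + 1), (-1 : ℂ) ^ i * bin n i *
        ((A + B * (s - (n - i))) * H (r + n - i)) =
        (A + B * s) * ∑ i ∈ Finset.range (K + 1), (-1) ^ i * bin n i * H (r + n - i) -
        B * n * ∑ i ∈ Finset.range K, (-1) ^ i * bin (n - 1) i * H (r + 1 + (n - 1) - i) := by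
      have : ∑ i ∈ Finset.range K, (-1) ^ i * bin (n - 1) i * H (r + 1 + (n - 1) - i) =
          ∑ i ∈ Finset.range (K + 1), (-1) ^ i * bin (n - 1) i * H (r + n - i) := by
        rw [Finset.sum_range_succ, hH _ (by omega), mul_zero, add_zero]
        refine Finset.sum_congr rfl fun i _ => ?_
        congr 2; ring
      rw [this, Finset.mul_sum, Finset.mul_sum, ← Finset.sum_sub_distrib]
      refine Finset.sum_congr rfl fun i _ => ?_
      linear_combination (-(-1 : ℂ) ^ i * B * H (r + n - i)) * sub_mul_bin n i
    have e2 : ∑ i ∈ Finset.range (K + 1), (-1 : ℂ) ^ i * bin n i *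
        ((A + B * (s - i)) * H' (r + i)) =
        (A + B * s) * ∑ i ∈ Finset.range (K + 1), (-1) ^ i * bin n i * H' (r + i) +
        B * n * ∑ i ∈ Finset.range K, (-1) ^ i * bin (n - 1) i * H' (r + 1 + i) := by
      have : ∑ i ∈ Finset.range (K + 1), (-1 : ℂ) ^ i * bin n i * (i * H' (r + i)) =
          -(n * ∑ i ∈ Finset.range K, (-1) ^ i * bin (n - 1) i * H' (r + 1 + i)) := by
        rw [Finset.sum_range_succ', Finset.mul_sum, ← Finset.sum_neg_distrib]
        simp only [CharP.cast_eq_zero, zero_mul, mul_zero, add_zero]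
        refine Finset.sum_congr rfl fun i _ => ?_
        rw [show r + ((i + 1 : ℕ) : ℤ) = r + 1 + i by push_cast; ring, pow_succ]
        push_cast
        linear_combination (-(-1 : ℂ) ^ i * H' (r + 1 + i)) * succ_mul_bin' n i
      have e3 : ∑ i ∈ Finset.range (K + 1), (-1 : ℂ) ^ i * bin n i *
          ((A + B * (s - i)) * H' (r + i)) =
          (A + B * s) * ∑ i ∈ Finset.range (K + 1), (-1) ^ i * bin n i * H' (r + i) -
          B * ∑ i ∈ Finset.range (K + 1), (-1 : ℂ) ^ i * bin n i * (i * H' (r + i)) := by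
        rw [Finset.mul_sum, Finset.mul_sum, ← Finset.sum_sub_distrib]
        refine Finset.sum_congr rfl fun i _ => ?_
        ring
      rw [e3, this]
      ring
    rw [e1, e2, zpow_sub_one₀ (by norm_num)]
    norm_num
    ring
  · intro i hi; rw [hH' _ (by omega), mul_zero, mul_zero]
  · intro i hi; rw [hH _ (by omega), mul_zero, mul_zero]

end alt

namespace Datum

variable {𝔞 : Type*} [AddCommGroup 𝔞] [Module ℂ 𝔞] {D : Datum 𝔞} (hD : D.Admissible)

/-! ### The commutator formula -/

/-- The matrix coefficients of the commutators of the modes of `a` with those of the field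
of `B`. -/
def comm (σ : Bool) (a : 𝔞) (B : D.State) (t : ℤ × ℤ) (v : D.State) (u : D.State →ₗ[ℂ] ℂ)
    (s : ℤ) : ℂ :=
  u (D.act σ s a (vop hD (t - s • dir σ) B v)) - u (vop hD (t - s • dir σ) B (D.act σ s a v))

variable {hD}

theorem diffOp_pow_comm (σ : Bool) (a : 𝔞) (B : D.State) (t : ℤ × ℤ) (v : D.State)
    (u : D.State →ₗ[ℂ] ℂ) (k : ℕ) : (diffOp ^ k) (comm hD σ a B t v u) 0 =
      u (vop hD (t - (k : ℤ) • dir σ) (D.act σ k a B) v) := by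
  rw [diffOp_pow_apply_zero, vop_act]
  have hb : ∀ i : ℕ, k + 1 ≤ i → bin k i = 0 := fun i hi => bin_of_lt (by positivity) (by omega)
  rw [finsum_eq_sum_range (N := k + 1), finsum_eq_sum_range (N := k + 1),
    ← Finset.sum_range_reflect (n := k + 1) (f := fun i : ℕ => ((-1) ^ (k : ℤ) * (-1) ^ i * bin k i) •
      vop hD (t - (k : ℤ) • dir σ + ((k : ℤ) - i) • dir σ) B (D.act σ i a v)), map_sub, map_sum,
    map_sum, ← Finset.sum_sub_distrib]
  · refine Finset.sum_congr rfl fun i hi => ?_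
    have hi' : i ≤ k := Nat.lt_succ_iff.1 (Finset.mem_range.1 hi)
    have e : k + 1 - 1 - i = k - i := by omega
    have e1 : ((k - i : ℕ) : ℤ) = k - i := by omega
    have e3 : bin k (k - i) = bin k i := by rw [bin_natCast, bin_natCast, Nat.choose_symm hi']
    have e4 : (-1 : ℂ) ^ (k : ℤ) * (-1) ^ (k - i) = (-1) ^ i := by
      rw [zpow_natCast, ← pow_add, show k + (k - i) = i + 2 * (k - i) by omega, pow_add, pow_mul]
      simp
    have e5 : t - (k : ℤ) • dir σ + (i : ℤ) • dir σ = t - ((k : ℤ) - i) • dir σ := by module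
    have e6 : t - (k : ℤ) • dir σ + ((k : ℤ) - (k - i)) • dir σ = t - ((k : ℤ) - i) • dir σ := by
      module
    rw [e, e3, e4, e1, e5, e6, map_smul, map_smul, comm, smul_eq_mul, smul_eq_mul, mul_sub]
  · intro i hi; rw [hb i hi]; simp
  · intro i hi; rw [hb i hi]; simp

theorem comm_eq_of_isPoly (σ : Bool) (a : 𝔞) (B : D.State) (t : ℤ × ℤ) (v : D.State)
    (u : D.State →ₗ[ℂ] ℂ) (h : IsPoly (comm hD σ a B t v u)) {J : ℕ}
    (hJ : ∀ j : ℕ, J ≤ j → D.act σ j a B = 0) (s : ℤ) : comm hD σ a B t v u s =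
      ∑ j ∈ Finset.range J, bin s j * u (vop hD (t - (j : ℤ) • dir σ) (D.act σ j a B) v) := by
  have key : comm hD σ a B t v u - ∑ j ∈ Finset.range J,
      u (vop hD (t - (j : ℤ) • dir σ) (D.act σ j a B) v) • (fun s => bin s j) = 0 := by
    refine IsPoly.eq_zero (h.sub (IsPoly.sum _ fun j _ => (IsPoly.bin j).smul _)) fun k => ?_
    rw [map_sub, map_sum, Pi.sub_apply, diffOp_pow_comm, Finset.sum_apply]
    simp only [map_smul, Pi.smul_apply, diffOp_pow_bin, smul_eq_mul, mul_ite, mul_one, mul_zero]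
    rw [Finset.sum_ite_eq, sub_eq_zero]
    split_ifs with hk
    · rfl
    · rw [hJ k (by simpa using hk)]; simp
  have := congrFun key s
  rw [Pi.sub_apply, Finset.sum_apply, Pi.zero_apply, sub_eq_zero] at this
  rw [this]
  refine Finset.sum_congr rfl fun j _ => ?_
  rw [Pi.smul_apply, smul_eq_mul, mul_comm]

end Datum

end SphereVA

end

noncomputable section

namespace SphereVA

namespace Datum

variable {𝔞 : Type*} [AddCommGroup 𝔞] [Module ℂ 𝔞] {D : Datum 𝔞} {hD : D.Admissible}

theorem comm_zero_of_act_eq_zero {σ : Bool} {a : 𝔞} {B : D.State} {t : ℤ × ℤ}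
    {u : D.State →ₗ[ℂ] ℂ} {s : ℤ} : comm hD σ a B t 0 u s = 0 := by
  simp [comm]

theorem comm_act (σ τ : Bool) (n : ℤ) (a b : 𝔞) (B : D.State) (t : ℤ × ℤ) (v : D.State)
    (u : D.State →ₗ[ℂ] ℂ) (s : ℤ) : comm hD σ a (D.act τ n b B) t v u s =
      ∑ᶠ i : ℕ, (-1) ^ i * bin n i *
        comm hD σ a B (t + (i : ℤ) • dir τ) v (u ∘ₗ D.act τ (n - i) b) s -
      (-1) ^ n * ∑ᶠ i : ℕ, (-1) ^ i * bin n i *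
        comm hD σ a B (t + (n - i) • dir τ) (D.act τ i b v) u s +
      (∑ᶠ i : ℕ, (-1) ^ i * bin n i *
        u (D.act σ s a (D.act τ (n - i) b (vop hD (t - s • dir σ + (i : ℤ) • dir τ) B v)) -
          D.act τ (n - i) b (D.act σ s a (vop hD (t - s • dir σ + (i : ℤ) • dir τ) B v))) -
      (-1) ^ n * ∑ᶠ i : ℕ, (-1) ^ i * bin n i *
        u (vop hD (t - s • dir σ + (n - i) • dir τ) B (D.act σ s a (D.act τ i b v) -
          D.act τ i b (D.act σ s a v)))) := by
  obtain ⟨K1, hK1⟩ := vop_bound_dir hD B v (t - s • dir σ) τ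
  obtain ⟨K2, hK2⟩ := vop_bound_dir hD B (D.act σ s a v) (t - s • dir σ) τ
  obtain ⟨K3, hK3⟩ := smooth hD v
  obtain ⟨K4, hK4⟩ := smooth hD (D.act σ s a v)
  obtain ⟨K, l1, l2, l3, l4⟩ : ∃ K, K1 ≤ K ∧ K2 ≤ K ∧ K3 ≤ K ∧ K4 ≤ K :=
    ⟨K1 + K2 + K3 + K4, by omega, by omega, by omega, by omega⟩
  have g1 : ∀ i : ℕ, K ≤ i → vop hD (t - s • dir σ + (i : ℤ) • dir τ) B v = 0 := fun i hi =>
    hK1 _ (by omega)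
  have g2 : ∀ i : ℕ, K ≤ i → vop hD (t - s • dir σ + (i : ℤ) • dir τ) B (D.act σ s a v) = 0 :=
    fun i hi => hK2 _ (by omega)
  have g3 : ∀ i : ℕ, K ≤ i → D.act τ i b v = 0 := fun i hi => hK3 τ _ (by omega) b
  have g4 : ∀ i : ℕ, K ≤ i → D.act τ i b (D.act σ s a v) = 0 := fun i hi => hK4 τ _ (by omega) b
  have e1 : ∀ k : ℤ, t + k • dir τ - s • dir σ = t - s • dir σ + k • dir τ := fun k => by module
  rw [comm, vop_act, vop_act, finsum_eq_sum_range (N := K), finsum_eq_sum_range (N := K),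
    finsum_eq_sum_range (N := K), finsum_eq_sum_range (N := K), finsum_eq_sum_range (N := K),
    finsum_eq_sum_range (N := K), finsum_eq_sum_range (N := K), finsum_eq_sum_range (N := K)]
  · simp only [map_sub, map_sum, map_smul, smul_eq_mul, comm, LinearMap.comp_apply, e1,
      Finset.mul_sum]
    simp only [← Finset.sum_sub_distrib, ← Finset.sum_add_distrib]
    refine Finset.sum_congr rfl fun i _ => ?_
    ring
  · intro i hi; rw [g3 i hi, g4 i hi]; simp
  · intro i hi; rw [g1 i hi]; simp
  · intro i hi; rw [g3 i hi, comm_zero_of_act_eq_zero, mul_zero]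
  · intro i hi; rw [comm, e1, g1 i hi, g2 i hi]; simp
  · intro i hi; rw [g4 i hi]; simp
  · intro i hi; rw [g2 i hi]; simp
  · intro i hi; rw [g3 i hi]; simp
  · intro i hi; rw [g1 i hi]; simp

theorem isPoly_comm_act_same (σ : Bool) (m : ℕ) (a b : 𝔞) (B : D.State) (t : ℤ × ℤ) (v : D.State)
    (u : D.State →ₗ[ℂ] ℂ) (h : ∀ a t, IsPoly (comm hD σ a B t v u)) {n : ℤ} (hn : n = -m - 1) :
    IsPoly fun s => (∑ᶠ i : ℕ, (-1) ^ i * bin n i *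
        u (D.act σ s a (D.act σ (n - i) b (vop hD (t - s • dir σ + (i : ℤ) • dir σ) B v)) -
          D.act σ (n - i) b (D.act σ s a (vop hD (t - s • dir σ + (i : ℤ) • dir σ) B v))) -
      (-1) ^ n * ∑ᶠ i : ℕ, (-1) ^ i * bin n i *
        u (vop hD (t - s • dir σ + (n - i) • dir σ) B (D.act σ s a (D.act σ i b v) -
          D.act σ i b (D.act σ s a v)))) := by
  obtain ⟨A₀, B₀, hAB⟩ := hD.affine
  let t0 : ℤ × ℤ := t + (n - D.wt) • dir σ
  let H : ℤ → ℂ := fun r => u (D.act σ r (D.bracket a b) (vop hD (t0 - r • dir σ) B v))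
  let H' : ℤ → ℂ := fun r => u (vop hD (t0 - r • dir σ) B (D.act σ r (D.bracket a b) v))
  let δ : ℤ → ℂ := fun r => if r = 2 * D.wt then 1 else 0
  let w : ℂ := u (vop hD (t + (n - 2 * D.wt) • dir σ) B v)
  obtain ⟨N, hN⟩ := vop_bound_dir hD B v t0 σ
  obtain ⟨M, hM⟩ := smooth hD v
  have hH : ∀ r < -(N : ℤ), H r = 0 := fun r hr => by
    simp only [H]
    rw [sub_eq_add_neg, ← neg_smul, hN _ (by omega), map_zero, map_zero]
  have hH' : ∀ r, (M : ℤ) ≤ r → H' r = 0 := fun r hr => by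
    simp only [H']
    rw [hM σ r hr, map_zero, map_zero]
  have hδ : ∀ r < (2 * D.wt : ℤ), δ r = 0 := fun r hr => if_neg (by omega)
  have hδ' : ∀ r, (2 * D.wt + 1 : ℤ) ≤ r → δ r = 0 := fun r hr => if_neg (by omega)
  have hp : IsPoly fun r => H r - H' r := h (D.bracket a b) t0
  have hp1 : IsPoly (alt n H H') := by
    have := isPoly_alt hH hH' hp (m + 1)
    rwa [show -((m + 1 : ℕ) : ℤ) = n by rw [hn]; push_cast; ring] at this
  have hp2 : IsPoly (alt (n - 1) H H') := by
    have := isPoly_alt hH hH' hp (m + 2)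
    rwa [show -((m + 2 : ℕ) : ℤ) = n - 1 by rw [hn]; push_cast; ring] at this
  have hp3 : IsPoly (alt n δ δ) := by
    have := isPoly_alt hδ hδ' (by simpa using IsPoly.const 0) (m + 1)
    rwa [show -((m + 1 : ℕ) : ℤ) = n by rw [hn]; push_cast; ring] at this
  have hq := (((hp1.shift (-D.wt)).affine_mul B₀ A₀).sub ((hp2.shift (-D.wt + 1)).smul (B₀ * n))).add
    ((hD.e'_poly.mul hp3).smul (w * D.form a b))
  convert hq using 1
  funext s
  have hE1 : ∀ i : ℕ, D.e' s (n - i) * u (vop hD (t - s • dir σ + (i : ℤ) • dir σ) B v) =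
      D.e' s (2 * D.wt - s) * w * δ (s + n - i) := by
    intro i
    by_cases hi : s + (n - i) = 2 * D.wt
    · have e1 : n - (i : ℤ) = 2 * D.wt - s := by omega
      have e2 : t - s • dir σ + (i : ℤ) • dir σ = t + (n - 2 * D.wt) • dir σ := by
        rw [show (i : ℤ) = n - 2 * D.wt + s by omega]; module
      rw [e1, e2]
      simp only [w, δ]
      rw [if_pos (by omega), mul_one]
    · have : D.e' s (n - i) = 0 := by
        by_contra hne
        exact hi (hD.e'_ne _ _ hne)
      rw [this]
      simp only [δ]
      rw [if_neg (by omega), zero_mul, mul_zero]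
  have hE2 : ∀ i : ℕ, D.e' s i * u (vop hD (t - s • dir σ + (n - i) • dir σ) B v) =
      D.e' s (2 * D.wt - s) * w * δ (s + i) := by
    intro i
    by_cases hi : s + i = 2 * D.wt
    · have e1 : (i : ℤ) = 2 * D.wt - s := by omega
      have e2 : t - s • dir σ + (n - (2 * D.wt - s)) • dir σ = t + (n - 2 * D.wt) • dir σ := by
        module
      rw [e1, e2]
      simp only [w, δ]
      rw [if_pos (by omega), mul_one]
    · have : D.e' s i = 0 := by
        by_contra hne
        exact hi (hD.e'_ne _ _ hne)
      rw [this]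
      simp only [δ]
      rw [if_neg (by omega), zero_mul, mul_zero]
  have hL : ∀ i : ℕ, u (D.act σ s a (D.act σ (n - i) b
        (vop hD (t - s • dir σ + (i : ℤ) • dir σ) B v)) -
      D.act σ (n - i) b (D.act σ s a (vop hD (t - s • dir σ + (i : ℤ) • dir σ) B v))) =
      (A₀ + B₀ * (s - (n - i))) * H (s - D.wt + n - i) +
        D.form a b * (D.e' s (2 * D.wt - s) * w * δ (s + n - i)) := by
    intro i
    rw [act_same, map_add, map_smul, map_smul, hAB, ← hE1]
    simp only [H, smul_eq_mul]
    have e1 : s + (n - i) - D.wt = s - D.wt + n - i := by ring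
    have e2 : t0 - (s - D.wt + n - i) • dir σ = t - s • dir σ + (i : ℤ) • dir σ := by
      simp only [t0]; module
    rw [e1, e2]
    push_cast
    ring
  have hR : ∀ i : ℕ, u (vop hD (t - s • dir σ + (n - i) • dir σ) B (D.act σ s a (D.act σ i b v) -
          D.act σ i b (D.act σ s a v))) =
      (A₀ + B₀ * (s - i)) * H' (s - D.wt + i) +
        D.form a b * (D.e' s (2 * D.wt - s) * w * δ (s + i)) := by
    intro i
    rw [act_same, map_add, map_add, map_smul, map_smul, map_smul, map_smul, hAB, ← hE2]
    simp only [H', smul_eq_mul]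
    have e1 : s + i - D.wt = s - D.wt + i := by ring
    have e2 : t0 - (s - D.wt + i) • dir σ = t - s • dir σ + (n - i) • dir σ := by
      simp only [t0]; module
    rw [e1, e2]
    push_cast
    ring
  simp only [hL, hR]
  have hal := alt_affine hH hH' n (s - D.wt) A₀ B₀ s
  obtain ⟨K1, h1, h2⟩ := exists_alt_bound (-(N : ℤ)) M n (s - D.wt)
  obtain ⟨K2, h3, h4⟩ := exists_alt_bound (2 * D.wt) (2 * D.wt + 1) n s
  obtain ⟨K, l1, l2⟩ : ∃ K, K1 ≤ K ∧ K2 ≤ K := ⟨K1 + K2, by omega, by omega⟩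
  have k1 : ∀ i : ℕ, K ≤ i → H (s - D.wt + n - i) = 0 := fun i hi => hH _ (by omega)
  have k2 : ∀ i : ℕ, K ≤ i → H' (s - D.wt + i) = 0 := fun i hi => hH' _ (by omega)
  have k3 : ∀ i : ℕ, K ≤ i → δ (s + n - i) = 0 := fun i hi => hδ _ (by omega)
  have k4 : ∀ i : ℕ, K ≤ i → δ (s + i) = 0 := fun i hi => hδ' _ (by omega)
  rw [finsum_eq_sum_range (N := K) fun i hi => by rw [k1 i hi, mul_zero, mul_zero],
    finsum_eq_sum_range (N := K) fun i hi => by rw [k2 i hi, mul_zero, mul_zero]] at hal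
  rw [finsum_eq_sum_range (N := K) fun i hi => by rw [k1 i hi, k3 i hi]; ring,
    finsum_eq_sum_range (N := K) fun i hi => by rw [k2 i hi, k4 i hi]; ring]
  have hd := alt_eq hδ hδ' (n := n) (r := s) (K := K) (by omega) (by omega)
  simp only [mul_add, Finset.sum_add_distrib]
  have q : ∀ f : ℕ → ℂ, ∑ i ∈ Finset.range K, (-1 : ℂ) ^ i * bin n i *
      (D.form a b * (D.e' s (2 * D.wt - s) * w * f i)) =
      D.form a b * (D.e' s (2 * D.wt - s) * w) * ∑ i ∈ Finset.range K, (-1 : ℂ) ^ i * bin n i * f i := by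
    intro f
    rw [Finset.mul_sum]
    refine Finset.sum_congr rfl fun i _ => ?_
    ring
  rw [q, q]
  simp only [Pi.add_apply, Pi.sub_apply, Pi.smul_apply, smul_eq_mul]
  rw [hd, show s + -(D.wt : ℤ) = s - D.wt by ring, show s + (-(D.wt : ℤ) + 1) = s - D.wt + 1 by ring]
  linear_combination hal

theorem isPoly_comm (σ : Bool) (a : 𝔞) (B : D.State) (t : ℤ × ℤ) (v : D.State)
    (u : D.State →ₗ[ℂ] ℂ) : IsPoly (comm hD σ a B t v u) := by
  induction B using state_induction hD generalizing σ a t v u with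
  | hv =>
    convert IsPoly.const 0 using 1
    funext s
    rw [comm, vop_vacuum]
    split_ifs <;> simp
  | ha B C hB hC =>
    convert (hB σ a t v u).add (hC σ a t v u) using 1
    funext s
    simp only [comm, map_add, LinearMap.add_apply, Pi.add_apply]; ring
  | hs c B hB =>
    convert (hB σ a t v u).smul c using 1
    funext s
    simp only [comm, map_smul, LinearMap.smul_apply, Pi.smul_apply, smul_eq_mul]; ring
  | hm τ m b B hB =>
    have e := funext (comm_act (hD := hD) σ τ (-m - 1) a b B t v u)
    rw [e]
    refine IsPoly.add (IsPoly.sub ?_ ?_) ?_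
    · obtain ⟨J, hJ⟩ := smooth hD B
      choose N hN using fun j : ℕ => vop_bound_dir hD (D.act σ j a B) v (t - (j : ℤ) • dir σ) τ
      have h0 : ∀ i : ℕ, ∑ j ∈ Finset.range J, N j ≤ i → ∀ s, comm hD σ a B (t + (i : ℤ) • dir τ) v
          (u ∘ₗ D.act τ (-m - 1 - i) b) s = 0 := by
        intro i hi s
        rw [comm_eq_of_isPoly σ a B _ v _ (hB _ _ _ _ _) (J := J) fun j hj => hJ σ j (by omega) a]
        refine Finset.sum_eq_zero fun j hj => ?_
        have := Finset.single_le_sum (f := N) (fun _ _ => Nat.zero_le _) hj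
        rw [add_sub_right_comm, hN j _ (by omega), map_zero, mul_zero]
      have := IsPoly.sum (Finset.range (∑ j ∈ Finset.range J, N j)) fun i _ =>
        (hB σ a (t + (i : ℤ) • dir τ) v (u ∘ₗ D.act τ (-m - 1 - i) b)).smul
          ((-1) ^ i * bin (-m - 1) i)
      convert this using 1
      funext s
      rw [finsum_eq_sum_range fun i hi => by rw [h0 i hi, mul_zero], Finset.sum_apply]
      rfl
    · obtain ⟨K, hK⟩ := smooth hD v
      have := (IsPoly.sum (Finset.range K) fun i _ =>
        (hB σ a (t + (-m - 1 - i : ℤ) • dir τ) (D.act τ i b v) u).smul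
          ((-1) ^ i * bin (-m - 1) i)).smul ((-1) ^ (-m - 1 : ℤ))
      convert this using 1
      funext s
      rw [finsum_eq_sum_range (N := K) fun i hi => by
        rw [hK τ i (by omega), comm_zero_of_act_eq_zero, mul_zero], Pi.smul_apply, Finset.sum_apply]
      rfl
    · by_cases hστ : σ = τ
      · subst hστ
        exact isPoly_comm_act_same σ m a b B t v u (fun a t => hB σ a t v u) rfl
      · convert IsPoly.const 0 using 1
        funext s
        simp only [D.act_diff hστ, sub_self, map_zero, mul_zero, finsum_zero]

variable (hD) in
/-- The commutator formula. -/
theorem commutator_formula (σ : Bool) (a : 𝔞) (B v : D.State) (x : ℤ × ℤ) (s : ℤ) {J : ℕ}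
    (hJ : ∀ j : ℕ, J ≤ j → D.act σ j a B = 0) :
    D.act σ s a (vop hD x B v) = vop hD x B (D.act σ s a v) +
      ∑ j ∈ Finset.range J, bin s j • vop hD (x + (s - j) • dir σ) (D.act σ j a B) v := by
  rw [← sub_eq_zero, ← Module.forall_dual_apply_eq_zero_iff ℂ]
  intro u
  have h := comm_eq_of_isPoly σ a B (x + s • dir σ) v u (isPoly_comm (hD := hD) _ _ _ _ _ _) hJ s
  have e : ∀ j : ℕ, x + (s - j) • dir σ = x + s • dir σ - (j : ℤ) • dir σ := fun j => by module
  rw [comm, add_sub_cancel_right] at h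
  simp only [map_sub, map_add, map_sum, map_smul, smul_eq_mul, e]
  linear_combination h

end Datum

end SphereVA

end

noncomputable section

namespace SphereVA

/-! ### Convolutions and binomial series -/

theorem hasSum_of_eq {ι : Type*} {f g : ι → ℂ} {a b : ℂ} (h : HasSum f a) (e : ∀ i, g i = f i)
    (e' : b = a) : HasSum g b := by
  rw [e', funext e]; exact h

theorem hasSum_conv {ι G : Type*} [AddCommGroup G] {b ξ : ι → ℂ} {s : ι → G} {f χ F : G → ℂ}
    {g μ : ℂ} (hχ : ∀ k w, χ (w + s k) = ξ k * χ w) (hg : HasSum (fun k => b k * ξ k) g)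
    (hf : HasSum (fun w => f w * χ w) μ) (hF : ∀ w, HasSum (fun k => b k * f (w - s k)) (F w)) :
    HasSum (fun w => F w * χ w) (g * μ) := by
  have h2 := summable_mul_of_summable_norm (R := ℂ) (f := fun k => b k * ξ k)
    (g := fun w => f w * χ w) (summable_norm_iff.2 hg.summable) (summable_norm_iff.2 hf.summable)
  have h1 := HasSum.mul hg hf h2
  let e : G × ι ≃ ι × G :=
    { toFun := fun x => (x.2, x.1 - s x.2)
      invFun := fun x => (x.2 + s x.1, x.1)
      left_inv := fun x => by simp
      right_inv := fun x => by simp }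
  have h3 := (Equiv.hasSum_iff e).2 h1
  refine HasSum.prod_fiberwise h3 fun w => ?_
  refine hasSum_of_eq ((hF w).mul_right (χ w)) (fun k => ?_) rfl
  have := hχ k (w - s k)
  rw [sub_add_cancel] at this
  simp only [Function.comp_apply, e, Equiv.coe_fn_mk]
  rw [this]; ring

theorem hasSum_shift {G : Type*} [AddCommGroup G] {f χ : G → ℂ} {ξ : ℂ} {s : G} {μ : ℂ}
    (hχ : ∀ w, χ (w + s) = ξ * χ w) (hf : HasSum (fun w => f w * χ w) μ) :
    HasSum (fun w => f (w - s) * χ w) (ξ * μ) := by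
  refine hasSum_conv (ι := Unit) (b := fun _ => 1) (ξ := fun _ => ξ) (s := fun _ => s)
    (fun _ w => hχ w) ?_ hf fun w => ?_
  · exact hasSum_of_eq (hasSum_fintype (fun _ : Unit => ξ)) (fun _ => one_mul _) (by simp)
  · exact hasSum_of_eq (hasSum_fintype (fun _ : Unit => f (w - s))) (fun _ => one_mul _) (by simp)

theorem hasSum_finsum_of_bound {f : ℕ → ℂ} {N : ℕ} (h : ∀ i, N ≤ i → f i = 0) :
    HasSum f (∑ᶠ i, f i) := by
  rw [finsum_eq_sum_range h]
  exact hasSum_sum_of_ne_finset_zero fun i hi => h i (by simpa using hi)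

theorem hasSum_choose_zpow {p q : ℂ} (n : ℕ) (h : ‖q‖ < ‖p‖) :
    HasSum (fun i : ℕ => ((i + n).choose n : ℂ) * (p ^ (-(i + n + 1) : ℤ) * q ^ i))
      ((p - q) ^ (-(n + 1) : ℤ)) := by
  have hp : p ≠ 0 := fun h0 => by
    rw [h0, norm_zero] at h; exact absurd h (not_lt.2 (norm_nonneg q))
  have hr : ‖q / p‖ < 1 := by
    rw [norm_div, div_lt_one (norm_pos_iff.2 hp)]; exact h
  have h1 : (1 : ℂ) - q / p ≠ 0 := fun h0 => by
    rw [sub_eq_zero] at h0; rw [← h0, norm_one] at hr; exact lt_irrefl _ hr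
  have hpq : p - q = p * (1 - q / p) := by field_simp
  have := (hasSum_choose_mul_geometric_of_norm_lt_one (𝕜 := ℂ) n hr).mul_left (p ^ (-(n + 1) : ℤ))
  refine hasSum_of_eq this (fun i => ?_) ?_
  · rw [div_pow, show (-(i + n + 1) : ℤ) = -(n + 1) - i by ring, zpow_sub₀ hp, zpow_natCast]
    field_simp
  · rw [hpq, mul_zpow, one_div]
    congr 1

theorem choose_mul_choose_add (k m j : ℕ) (h : j ≤ k) :
    (k + m).choose m * k.choose j = (m + j).choose m * (k + m).choose (m + j) := by
  obtain ⟨i, rfl⟩ := Nat.exists_eq_add_of_le h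
  have h1 := Nat.choose_mul (n := j + i + m) (k := m + j) (s := m) (by omega)
  rw [show j + i + m - m = j + i by omega, show m + j - m = j by omega] at h1
  linarith

theorem bin_neg_sub_one (k m : ℕ) : bin (-k - 1) m = (-1) ^ m * ((k + m).choose m : ℂ) :=
  bin_neg k m

/-- The expansion of a negative power of `p - q` in powers of `q`, with shifted indices. -/
theorem hasSum_bin_zpow_right {p q : ℂ} (m j : ℕ) (h : ‖q‖ < ‖p‖) :
    HasSum (fun k : ℕ => bin (-k - 1) m * bin k j * (p ^ (-(k + m + 1) : ℤ) * q ^ (k - j : ℤ)))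
      (bin (-j - 1) m * (p - q) ^ (-(m + j + 1) : ℤ)) := by
  rw [← (add_left_injective j).hasSum_iff]
  · refine hasSum_of_eq ((hasSum_choose_zpow (m + j) h).mul_left (bin (-j - 1) m)) (fun i => ?_) ?_
    · have hc : ((i + j + m).choose m : ℂ) * ((i + j).choose j : ℂ) =
          ((m + j).choose m : ℂ) * ((i + j + m).choose (m + j) : ℂ) := by
        exact_mod_cast choose_mul_choose_add (i + j) m j (by omega)
      simp only [Function.comp_apply, bin_neg_sub_one, bin_natCast]
      rw [show ((i + j : ℕ) : ℤ) - j = i by push_cast; ring, zpow_natCast,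
        show -(((i + j : ℕ) : ℤ) + m + 1) = -(i + (m + j : ℕ) + 1) by push_cast; ring,
        add_comm j m, show i + (m + j) = i + j + m by omega]
      linear_combination (-1) ^ m * (p ^ (-((i : ℤ) + ((m + j : ℕ) : ℤ) + 1)) * q ^ i) * hc
    · push_cast; rfl
  · intro k hk
    have : k < j := by
      by_contra hn
      exact hk ⟨k - j, by simp; omega⟩
    rw [bin_natCast, Nat.choose_eq_zero_of_lt this]; simp

theorem hasSum_bin_zpow_left {p q : ℂ} (m j : ℕ) (h : ‖p‖ < ‖q‖) :
    HasSum (fun k : ℕ => -((k.choose m : ℂ) * bin (-k - 1) j) *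
      (p ^ (k - m : ℤ) * q ^ (-(k + j + 1) : ℤ)))
      (bin (-j - 1) m * (p - q) ^ (-(m + j + 1) : ℤ)) := by
  rw [← (add_left_injective m).hasSum_iff]
  · refine hasSum_of_eq ((hasSum_choose_zpow (m + j) h).mul_left
      (-(-1) ^ j * ((m + j).choose m : ℂ))) (fun i => ?_) ?_
    · have hc : ((i + m + j).choose j : ℂ) * ((i + m).choose m : ℂ) =
          ((j + m).choose j : ℂ) * ((i + m + j).choose (j + m) : ℂ) := by
        exact_mod_cast choose_mul_choose_add (i + m) j m (by omega)
      have hs : ((j + m).choose j : ℂ) = ((m + j).choose m : ℂ) := by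
        rw [add_comm j m, Nat.choose_symm_add]
      simp only [Function.comp_apply, bin_neg_sub_one]
      rw [show ((i + m : ℕ) : ℤ) - m = i by push_cast; ring, zpow_natCast,
        show -(((i + m : ℕ) : ℤ) + j + 1) = -(i + (m + j : ℕ) + 1) by push_cast; ring,
        show i + (m + j) = i + m + j by omega]
      rw [hs, add_comm j m] at hc
      linear_combination (-(-1) ^ j) * (q ^ (-((i : ℤ) + ((m + j : ℕ) : ℤ) + 1)) * p ^ i) * hc
    · rw [← neg_sub q p, bin_neg_sub_one, neg_eq_neg_one_mul (q - p), mul_zpow, add_comm j m]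
      have e : (-1 : ℂ) ^ (-(m + j + 1) : ℤ) = -((-1) ^ m * (-1) ^ j) := by
        rw [zpow_neg, zpow_add₀ (by norm_num), zpow_add₀ (by norm_num), zpow_natCast, zpow_natCast,
          zpow_one]
        rcases Nat.even_or_odd m with hm | hm <;> rcases Nat.even_or_odd j with hj | hj <;>
          norm_num [hm.neg_one_pow, hj.neg_one_pow]
      rw [e]
      have h1 : ((-1 : ℂ) ^ m) * (-1) ^ m = 1 := by rw [← mul_pow]; simp
      push_cast
      linear_combination -(-1) ^ j * ((m + j).choose m : ℂ) * (q - p) ^ (-(m + j + 1) : ℤ) * h1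
  · intro k hk
    have : k < m := by
      by_contra hn
      exact hk ⟨k - m, by simp; omega⟩
    rw [Nat.choose_eq_zero_of_lt this]; simp

theorem hasSum_choose_mul_bin_zpow {p q : ℂ} (m l : ℕ) (h : ‖p‖ < ‖q‖) :
    HasSum (fun k : ℕ => (k.choose m : ℂ) * bin (-l - 1) k *
      (p ^ (k - m : ℤ) * q ^ (-(l + k + 1) : ℤ)))
      (bin (-l - 1) m * (p + q) ^ (-(l + m + 1) : ℤ)) := by
  rw [← (add_left_injective m).hasSum_iff]
  · have h' : ‖-p‖ < ‖q‖ := by rwa [norm_neg]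
    refine hasSum_of_eq ((hasSum_choose_zpow (l + m) h').mul_left (bin (-l - 1) m))
      (fun i => ?_) ?_
    · have hc : (i + m + l).choose (i + m) * (i + m).choose m =
          (l + m).choose m * (i + (l + m)).choose (l + m) := by
        have h2 := choose_mul_choose_add (i + m) l m (by omega)
        rw [Nat.choose_symm_add, h2, add_comm l m, Nat.choose_symm_add, ← add_assoc,
          add_right_comm]
      simp only [Function.comp_apply]
      rw [show ((i + m : ℕ) : ℤ) - m = i by push_cast; ring, zpow_natCast,
        show -((l : ℤ) + ((i + m : ℕ) : ℤ) + 1) = -(i + (l + m : ℕ) + 1) by push_cast; ring,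
        bin_neg_sub_one, bin_neg_sub_one, neg_pow p]
      have hc' : ((l + (i + m)).choose (i + m) : ℂ) * ((i + m).choose m : ℂ) =
          ((l + m).choose m : ℂ) * ((i + (l + m)).choose (l + m) : ℂ) := by
        rw [add_comm l (i + m)]; exact_mod_cast hc
      rw [pow_add]
      linear_combination (-1) ^ i * (-1) ^ m * (q ^ (-((i : ℤ) + ((l + m : ℕ) : ℤ) + 1)) * p ^ i) * hc'
    · push_cast
      rw [sub_neg_eq_add, add_comm q p]
  · intro k hk
    have : k < m := by
      by_contra hn
      exact hk ⟨k - m, by simp; omega⟩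
    rw [Nat.choose_eq_zero_of_lt this]; simp

theorem hasSum_choose_mul_choose_zpow (p q : ℂ) (m l : ℕ) :
    HasSum (fun k : ℕ => (k.choose m : ℂ) * (l.choose k : ℂ) *
      (p ^ (k - m : ℤ) * q ^ (l - k : ℤ))) ((l.choose m : ℂ) * (p + q) ^ (l - m : ℤ)) := by
  rcases lt_or_ge l m with hlm | hlm
  · rw [Nat.choose_eq_zero_of_lt hlm, Nat.cast_zero, zero_mul]
    refine hasSum_of_eq hasSum_zero (fun k => ?_) rfl
    rcases lt_or_ge k m with h | h
    · rw [Nat.choose_eq_zero_of_lt h]; simp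
    · rw [Nat.choose_eq_zero_of_lt (show l < k by omega)]; simp
  obtain ⟨n, rfl⟩ := Nat.exists_eq_add_of_le hlm
  rw [← (add_left_injective m).hasSum_iff]
  · rw [show ((m + n : ℕ) : ℤ) - m = n by push_cast; ring, zpow_natCast, add_pow, Finset.mul_sum]
    have : ∀ i, (fun k : ℕ => (k.choose m : ℂ) * ((m + n).choose k : ℂ) *
      (p ^ (k - m : ℤ) * q ^ (((m + n : ℕ) : ℤ) - k : ℤ))) (i + m) =
      if i < n + 1 then ((m + n).choose m : ℂ) * (p ^ i * q ^ (n - i) * (n.choose i : ℂ)) else 0 := by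
      intro i
      dsimp only
      split_ifs with hi
      · have hc := Nat.choose_mul (n := m + n) (k := i + m) (s := m) (by omega)
        rw [show m + n - m = n by omega, show i + m - m = i by omega] at hc
        have hc' : ((m + n).choose (i + m) : ℂ) * ((i + m).choose m : ℂ) =
          ((m + n).choose m : ℂ) * (n.choose i : ℂ) := by exact_mod_cast hc
        rw [show ((i + m : ℕ) : ℤ) - m = i by push_cast; ring, zpow_natCast,
          show ((m + n : ℕ) : ℤ) - ((i + m : ℕ) : ℤ) = ((n - i : ℕ) : ℤ) by omega, zpow_natCast]
        linear_combination p ^ i * q ^ (n - i) * hc'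
      · rw [Nat.choose_eq_zero_of_lt (show m + n < i + m by omega)]; simp
    rw [show (fun k : ℕ => (k.choose m : ℂ) * ((m + n).choose k : ℂ) *
      (p ^ (k - m : ℤ) * q ^ (((m + n : ℕ) : ℤ) - k : ℤ))) ∘ (fun x => x + m) = _ from funext this]
    refine hasSum_of_eq (hasSum_sum_of_ne_finset_zero (s := Finset.range (n + 1)) ?_)
      (fun _ => rfl) ?_
    · intro i hi
      rw [if_neg (by simpa using hi)]
    · refine Finset.sum_congr rfl fun i hi => ?_
      rw [if_pos (Finset.mem_range.1 hi)]
  · intro k hk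
    have : k < m := by
      by_contra hn
      exact hk ⟨k - m, by simp; omega⟩
    rw [Nat.choose_eq_zero_of_lt this]; simp

end SphereVA

end

noncomputable section

namespace SphereVA

/-! ### Correlation functions -/

open Datum (dir co co_add_smul_dir)

/-- The coordinate `z` or its conjugate. -/
def ev (σ : Bool) (z : ℂ) : ℂ :=
  match σ with
  | true => z
  | false => conj z

theorem ev_sub (σ : Bool) (z w : ℂ) : ev σ (z - w) = ev σ z - ev σ w := by
  cases σ <;> simp [ev]

theorem norm_ev (σ : Bool) (z : ℂ) : ‖ev σ z‖ = ‖z‖ := by cases σ <;> simp [ev]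

theorem ev_ne_zero (σ : Bool) {z : ℂ} (hz : z ≠ 0) : ev σ z ≠ 0 := by
  rw [← norm_ne_zero_iff, norm_ev]; exact norm_ne_zero_iff.2 hz

/-- The monomial which accompanies the mode with index `x`. -/
def charac (z : ℂ) (x : ℤ × ℤ) : ℂ := z ^ (-x.1 - 1) * conj z ^ (-x.2 - 1)

theorem charac_add {z : ℂ} (hz : z ≠ 0) (σ : Bool) (x : ℤ × ℤ) (k : ℤ) :
    charac z (x + k • dir σ) = ev σ z ^ (-k) * charac z x := by
  have hz' : conj z ≠ 0 := (map_ne_zero _).2 hz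
  cases σ
  · have e : ∀ i : ℤ, i * 0 = 0 := mul_zero
    simp only [charac, dir, ev, Prod.fst_add, Prod.snd_add, Prod.smul_mk, smul_eq_mul, mul_one, e,
      add_zero]
    rw [show -(x.2 + k) - 1 = -k + (-x.2 - 1) by ring, zpow_add₀ hz']; ring
  · have e : ∀ i : ℤ, i * 0 = 0 := mul_zero
    simp only [charac, dir, ev, Prod.fst_add, Prod.snd_add, Prod.smul_mk, smul_eq_mul, mul_one, e,
      add_zero]
    rw [show -(x.1 + k) - 1 = -k + (-x.1 - 1) by ring, zpow_add₀ hz]; ring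

theorem charac_neg_one (z : ℂ) : charac z (-1, -1) = 1 := by simp [charac]

theorem analyticAt_ev (σ : Bool) (z : ℂ) : AnalyticAt ℝ (ev σ) z := by
  cases σ
  · exact Complex.conjCLE.toContinuousLinearMap.analyticAt z
  · exact analyticAt_id

theorem analyticAt_ev_zpow {f : ℂ × ℂ → ℂ} {z : ℂ × ℂ} (hf : AnalyticAt ℝ f z) (h : f z ≠ 0)
    (σ : Bool) (n : ℤ) : AnalyticAt ℝ (fun z => ev σ (f z) ^ n) z :=
  (AnalyticAt.comp (g := ev σ) (analyticAt_ev σ (f z)) hf).zpow (ev_ne_zero σ h)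

section

variable {𝔞 V : Type*} [AddCommGroup 𝔞] [Module ℂ 𝔞] [AddCommGroup V] [Module ℂ V]

/-- The properties of the modes and of the vertex operators, together with a class of functionals,
from which correlation functions are constructed. -/
structure ModeAlgebra (act : Bool → ℤ → 𝔞 →ₗ[ℂ] V →ₗ[ℂ] V) (Y : ℤ × ℤ → V →ₗ[ℂ] V →ₗ[ℂ] V)
    (vac : V) (Fin : (V →ₗ[ℂ] ℂ) → Prop) : Prop where
  smooth : ∀ v, ∃ K : ℕ, ∀ σ (n : ℤ), K ≤ n → ∀ a, act σ n a v = 0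
  bound : ∀ A v, ∃ N : ℤ, ∀ x σ, N ≤ co σ x → Y x A v = 0
  vacuum : ∀ x, x ≠ (-1, -1) → Y x vac = 0
  vacuum' : Y (-1, -1) vac = LinearMap.id
  create : ∀ σ (m : ℕ) a A v x, Y x (act σ (-m - 1) a A) v =
      (∑ᶠ k : ℕ, (k.choose m : ℂ) • act σ (-k - 1) a (Y (x + (k - m : ℤ) • dir σ) A v)) +
      ∑ᶠ k : ℕ, bin (-k - 1) m • Y (x - (k + m + 1 : ℤ) • dir σ) A (act σ k a v)
  commutator : ∀ σ a B v x (s : ℤ) (J : ℕ), (∀ j : ℕ, J ≤ j → act σ j a B = 0) →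
    act σ s a (Y x B v) = Y x B (act σ s a v) +
      ∑ j ∈ Finset.range J, bin s j • Y (x + (s - j) • dir σ) (act σ j a B) v
  induction : ∀ P : V → Prop, P vac → (∀ s t, P s → P t → P (s + t)) →
    (∀ (c : ℂ) s, P s → P (c • s)) → (∀ σ (m : ℕ) a s, P s → P (act σ (-m - 1) a s)) → ∀ s, P s
  fin_act : ∀ u, Fin u → ∀ σ n a, Fin (u ∘ₗ act σ n a)
  fin_bound : ∀ u, Fin u → ∃ L : ℕ, ∀ l : ℕ, L ≤ l → ∀ σ a v, u (act σ (-l - 1) a v) = 0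
  fin_finite : ∀ u, Fin u → ∀ B C, {y | u (Y y B C) ≠ 0}.Finite

namespace ModeAlgebra

variable {act : Bool → ℤ → 𝔞 →ₗ[ℂ] V →ₗ[ℂ] V} {Y : ℤ × ℤ → V →ₗ[ℂ] V →ₗ[ℂ] V} {vac : V}
  {Fin : (V →ₗ[ℂ] ℂ) → Prop} (M : ModeAlgebra act Y vac Fin)

/-- A correlation function with its three expansions. -/
structure IsCorrelator (Y : ℤ × ℤ → V →ₗ[ℂ] V →ₗ[ℂ] V) (A B C : V) (u : V →ₗ[ℂ] ℂ)
    (μ : ℂ × ℂ → ℂ) : Prop where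
  analytic : AnalyticOnNhd ℝ μ {z | z.1 ≠ 0 ∧ z.2 ≠ 0 ∧ z.1 ≠ z.2}
  left : ∀ z w : ℂ, z ≠ 0 → w ≠ 0 → ‖w‖ < ‖z‖ →
    HasSum (fun x : (ℤ × ℤ) × (ℤ × ℤ) => u (Y x.1 A (Y x.2 B C)) * (charac z x.1 * charac w x.2))
      (μ (z, w))
  right : ∀ z w : ℂ, z ≠ 0 → w ≠ 0 → ‖z‖ < ‖w‖ →
    HasSum (fun x : (ℤ × ℤ) × (ℤ × ℤ) => u (Y x.2 B (Y x.1 A C)) * (charac z x.1 * charac w x.2))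
      (μ (z, w))
  nested : ∀ z w : ℂ, z ≠ 0 → w ≠ 0 → z ≠ w → ‖z - w‖ < ‖w‖ →
    HasSum (fun x : (ℤ × ℤ) × (ℤ × ℤ) =>
      u (Y x.2 (Y x.1 A B) C) * (charac (z - w) x.1 * charac w x.2)) (μ (z, w))

theorem hasSum_ite_charac {c : ℤ × ℤ → ℂ} (S : Finset (ℤ × ℤ)) (hS : ∀ y, y ∉ S → c y = 0)
    (z w : ℂ) {f : (ℤ × ℤ) × (ℤ × ℤ) → ℂ} (hf : ∀ x y, x ≠ (-1, -1) → f (x, y) = 0)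
    (hf' : ∀ y, f ((-1, -1), y) = c y) :
    HasSum (fun x => f x * (charac z x.1 * charac w x.2)) (∑ y ∈ S, c y * charac w y) := by
  have hi : Function.Injective fun y : ℤ × ℤ => (((-1, -1) : ℤ × ℤ), y) := fun _ _ h => by
    simpa using h
  rw [← hi.hasSum_iff]
  · refine hasSum_of_eq (hasSum_sum_of_ne_finset_zero (s := S) fun y hy => ?_) (fun y => ?_) rfl
    · rw [hS y hy, zero_mul]
    · simp only [Function.comp_apply, hf', charac_neg_one, one_mul]
  · rintro ⟨x, y⟩ hx
    rw [hf x y, zero_mul]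
    rintro rfl
    exact hx ⟨y, rfl⟩

theorem isCorrelator_vacuum (M : ModeAlgebra act Y vac Fin) (B C : V) {u : V →ₗ[ℂ] ℂ}
    (hu : Fin u) : ∃ μ, IsCorrelator Y vac B C u μ := by
  have hS := M.fin_finite u hu B C
  have h0 : ∀ y, y ∉ hS.toFinset → u (Y y B C) = 0 := fun y hy => by simpa using hy
  refine ⟨fun z => ∑ y ∈ hS.toFinset, u (Y y B C) * charac z.2 y, ?_, fun z w hz hw h => ?_,
    fun z w hz hw h => ?_, fun z w hz hw _ h => ?_⟩
  · rintro z ⟨-, hz, -⟩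
    refine Finset.analyticAt_fun_sum _ fun y _ => analyticAt_const.mul ?_
    exact (analyticAt_ev_zpow analyticAt_snd hz true _).mul
      (analyticAt_ev_zpow analyticAt_snd hz false _)
  · exact hasSum_ite_charac _ h0 z w (fun x y hx => by simp [M.vacuum x hx])
      (fun y => by simp [M.vacuum'])
  · exact hasSum_ite_charac _ h0 z w (fun x y hx => by simp [M.vacuum x hx])
      (fun y => by simp [M.vacuum'])
  · exact hasSum_ite_charac _ h0 (z - w) w (fun x y hx => by simp [M.vacuum x hx])
      (fun y => by simp [M.vacuum'])

theorem charac_pair_add {z w : ℂ} (hz : z ≠ 0) (hw : w ≠ 0) (σ : Bool) (i j : ℤ)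
    (x : (ℤ × ℤ) × (ℤ × ℤ)) :
    charac z (x + (i • dir σ, j • dir σ)).1 * charac w (x + (i • dir σ, j • dir σ)).2 =
      ev σ z ^ (-i) * ev σ w ^ (-j) * (charac z x.1 * charac w x.2) := by
  rw [Prod.fst_add, Prod.snd_add, charac_add hz, charac_add hw]; ring

/-- Convolution of an expansion with a series of shifts in one direction. -/
theorem hasSum_shifts {z w : ℂ} (hz : z ≠ 0) (hw : w ≠ 0) (σ : Bool) {b : ℕ → ℂ} {i j : ℕ → ℤ}
    {f : (ℤ × ℤ) × (ℤ × ℤ) → ℂ} {g μ : ℂ}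
    (hg : HasSum (fun k => b k * (ev σ z ^ (-i k) * ev σ w ^ (-j k))) g)
    (hf : HasSum (fun x => f x * (charac z x.1 * charac w x.2)) μ)
    (hF : ∀ x : (ℤ × ℤ) × (ℤ × ℤ), ∃ N, ∀ k, N ≤ k → b k * f (x.1 - i k • dir σ, x.2 - j k • dir σ) = 0) :
    HasSum (fun x : (ℤ × ℤ) × (ℤ × ℤ) =>
      (∑ᶠ k, b k * f (x.1 - i k • dir σ, x.2 - j k • dir σ)) * (charac z x.1 * charac w x.2))
      (g * μ) := by
  refine hasSum_conv (b := b) (s := fun k => (i k • dir σ, j k • dir σ))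
    (χ := fun x => charac z x.1 * charac w x.2)
    (ξ := fun k => ev σ z ^ (-i k) * ev σ w ^ (-j k)) (fun k x => charac_pair_add hz hw σ _ _ x)
    hg hf fun x => ?_
  obtain ⟨N, hN⟩ := hF x
  exact hasSum_finsum_of_bound hN

theorem hasSum_single_shift {z w : ℂ} (hz : z ≠ 0) (hw : w ≠ 0) (σ : Bool) (b : ℂ) (i : ℤ)
    {f : (ℤ × ℤ) × (ℤ × ℤ) → ℂ} {μ : ℂ}
    (hf : HasSum (fun x => f x * (charac z x.1 * charac w x.2)) μ) :
    HasSum (fun x : (ℤ × ℤ) × (ℤ × ℤ) =>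
      b * f (x.1 - i • dir σ, x.2) * (charac z x.1 * charac w x.2))
      (b * ev σ z ^ (-i) * μ) := by
  have h := (hasSum_shift (s := (i • dir σ, (0 : ℤ) • dir σ))
    (χ := fun x => charac z x.1 * charac w x.2)
    (fun x => charac_pair_add hz hw σ i 0 x) hf).mul_left b
  refine hasSum_of_eq h (fun x => ?_) ?_
  · rw [zero_smul]
    have : x - (i • dir σ, (0 : ℤ × ℤ)) = (x.1 - i • dir σ, x.2) := by
      ext <;> simp
    rw [this]; ring
  · simp; ring

theorem bound_dir (M : ModeAlgebra act Y vac Fin) (A v : V) (x : ℤ × ℤ) (σ : Bool) (c : ℤ) :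
    ∃ N : ℕ, ∀ k : ℕ, N ≤ k → Y (x + (k - c : ℤ) • dir σ) A v = 0 := by
  obtain ⟨N, hN⟩ := M.bound A v
  refine ⟨(N - co σ x + c).toNat, fun k hk => hN _ σ ?_⟩
  rw [co_add_smul_dir]; omega

/-- Coefficients of the operator `a_(-m-1) A` on the left of `B`. -/
theorem create_left (M : ModeAlgebra act Y vac Fin) (σ : Bool) (m : ℕ) (a : 𝔞) (A B C : V)
    (u : V →ₗ[ℂ] ℂ) {L K J : ℕ} (hL : ∀ l : ℕ, L ≤ l → ∀ v, u (act σ (-l - 1) a v) = 0)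
    (hK : ∀ l : ℕ, K ≤ l → act σ l a C = 0) (hJ : ∀ j : ℕ, J ≤ j → act σ j a B = 0)
    (x y : ℤ × ℤ) : u (Y x (act σ (-m - 1) a A) (Y y B C)) =
      ∑ l ∈ Finset.range L, (l.choose m : ℂ) *
        (u ∘ₗ act σ (-l - 1) a) (Y (x - (m - l : ℤ) • dir σ) A (Y y B C)) +
      ∑ l ∈ Finset.range K, bin (-l - 1) m *
        u (Y (x - (l + m + 1 : ℤ) • dir σ) A (Y y B (act σ l a C))) +
      ∑ j ∈ Finset.range J, ∑ᶠ k : ℕ, bin (-k - 1) m * bin k j *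
        u (Y (x - (k + m + 1 : ℤ) • dir σ) A (Y (y - (j - k : ℤ) • dir σ) (act σ j a B) C)) := by
  have e1 : ∀ (x : ℤ × ℤ) (i j : ℤ), x + (i - j) • dir σ = x - (j - i) • dir σ :=
    fun x i j => by module
  obtain ⟨N₁, hN₁⟩ := M.bound_dir A (Y y B C) x σ m
  obtain ⟨N₂, hN₂⟩ := M.smooth (Y y B C)
  choose N₃ hN₃ using fun j : ℕ => M.bound_dir (act σ j a B) C y σ j
  set N := N₁ + N₂ + K + ∑ j ∈ Finset.range J, N₃ j with hN
  have hj : ∀ j ∈ Finset.range J, N₃ j ≤ N := fun j hj =>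
    (Finset.single_le_sum (fun _ _ => Nat.zero_le _) hj).trans (by omega)
  rw [M.create, finsum_eq_sum_range (N := N), finsum_eq_sum_range (N := N), map_add, map_sum,
    map_sum, add_assoc]
  · congr 1
    · rw [← finsum_eq_sum_range, ← finsum_eq_sum_range]
      · simp only [map_smul, smul_eq_mul, LinearMap.comp_apply, e1]
      · intro l hl
        rw [LinearMap.comp_apply, hL l hl, mul_zero]
      · intro k hk
        rw [hN₁ k (by omega)]; simp
    · have h2 : ∑ l ∈ Finset.range K, bin (-l - 1) m *
          u (Y (x - (l + m + 1 : ℤ) • dir σ) A (Y y B (act σ l a C))) =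
          ∑ l ∈ Finset.range N, bin (-l - 1) m *
          u (Y (x - (l + m + 1 : ℤ) • dir σ) A (Y y B (act σ l a C))) := by
        rw [← finsum_eq_sum_range, ← finsum_eq_sum_range]
        · intro k hk
          rw [hK k (by omega)]; simp
        · intro k hk
          rw [hK k (by omega)]; simp
      have h3 : ∑ j ∈ Finset.range J, ∑ᶠ k : ℕ, bin (-k - 1) m * bin k j *
          u (Y (x - (k + m + 1 : ℤ) • dir σ) A (Y (y - (j - k : ℤ) • dir σ) (act σ j a B) C)) =
          ∑ k ∈ Finset.range N, ∑ j ∈ Finset.range J, bin (-k - 1) m * bin k j *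
          u (Y (x - (k + m + 1 : ℤ) • dir σ) A
            (Y (y - (j - k : ℤ) • dir σ) (act σ j a B) C)) := by
        rw [Finset.sum_comm]
        refine Finset.sum_congr rfl fun j hj' => finsum_eq_sum_range fun k hk => ?_
        rw [← e1, hN₃ j k ((hj j hj').trans hk)]; simp
      rw [h2, h3, ← Finset.sum_add_distrib]
      refine Finset.sum_congr rfl fun k _ => ?_
      rw [M.commutator σ a B C y k J hJ, map_add, map_smul, map_add, map_sum, map_sum,
        smul_eq_mul, mul_add, Finset.mul_sum]
      refine congrArg _ (Finset.sum_congr rfl fun j _ => ?_)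
      rw [map_smul, map_smul, smul_eq_mul, e1, mul_assoc]
  · intro k hk
    rw [hN₂ σ k (by omega)]; simp
  · intro k hk
    rw [hN₁ k (by omega)]; simp

/-- Coefficients of the operator `a_(-m-1) A` on the right of `B`. -/
theorem create_right (M : ModeAlgebra act Y vac Fin) (σ : Bool) (m : ℕ) (a : 𝔞) (A B C : V)
    (u : V →ₗ[ℂ] ℂ) {L K J : ℕ} (hL : ∀ l : ℕ, L ≤ l → ∀ v, u (act σ (-l - 1) a v) = 0)
    (hK : ∀ l : ℕ, K ≤ l → act σ l a C = 0) (hJ : ∀ j : ℕ, J ≤ j → act σ j a B = 0)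
    (x y : ℤ × ℤ) : u (Y y B (Y x (act σ (-m - 1) a A) C)) =
      ∑ l ∈ Finset.range L, (l.choose m : ℂ) *
        (u ∘ₗ act σ (-l - 1) a) (Y y B (Y (x - (m - l : ℤ) • dir σ) A C)) +
      ∑ l ∈ Finset.range K, bin (-l - 1) m *
        u (Y y B (Y (x - (l + m + 1 : ℤ) • dir σ) A (act σ l a C))) +
      ∑ j ∈ Finset.range J, ∑ᶠ k : ℕ, -((k.choose m : ℂ) * bin (-k - 1) j) *
        u (Y (y - (k + j + 1 : ℤ) • dir σ) (act σ j a B) (Y (x - (m - k : ℤ) • dir σ) A C)) := by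
  have e1 : ∀ (x : ℤ × ℤ) (i j : ℤ), x + (i - j) • dir σ = x - (j - i) • dir σ :=
    fun x i j => by module
  have e2 : ∀ (k j : ℕ), y + (-k - 1 - j : ℤ) • dir σ = y - (k + j + 1 : ℤ) • dir σ :=
    fun k j => by module
  obtain ⟨N₁, hN₁⟩ := M.bound_dir A C x σ m
  set N := N₁ + K + L with hN
  rw [M.create, finsum_eq_sum_range (N := N), finsum_eq_sum_range (N := K), map_add, map_add,
    map_sum, map_sum, map_sum, map_sum, add_right_comm]
  · congr 1
    · have h2 : ∑ l ∈ Finset.range L, (l.choose m : ℂ) *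
          (u ∘ₗ act σ (-l - 1) a) (Y y B (Y (x - (m - l : ℤ) • dir σ) A C)) =
          ∑ l ∈ Finset.range N, (l.choose m : ℂ) *
          (u ∘ₗ act σ (-l - 1) a) (Y y B (Y (x - (m - l : ℤ) • dir σ) A C)) := by
        rw [← finsum_eq_sum_range, ← finsum_eq_sum_range]
        · intro k hk
          rw [LinearMap.comp_apply, hL k (by omega), mul_zero]
        · intro k hk
          rw [LinearMap.comp_apply, hL k (by omega), mul_zero]
      have h3 : ∑ j ∈ Finset.range J, ∑ᶠ k : ℕ, -((k.choose m : ℂ) * bin (-k - 1) j) *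
          u (Y (y - (k + j + 1 : ℤ) • dir σ) (act σ j a B) (Y (x - (m - k : ℤ) • dir σ) A C)) =
          ∑ k ∈ Finset.range N, ∑ j ∈ Finset.range J, -((k.choose m : ℂ) * bin (-k - 1) j) *
          u (Y (y - (k + j + 1 : ℤ) • dir σ) (act σ j a B)
            (Y (x - (m - k : ℤ) • dir σ) A C)) := by
        rw [Finset.sum_comm]
        refine Finset.sum_congr rfl fun j hj' => finsum_eq_sum_range fun k hk => ?_
        rw [← e1, hN₁ k (by omega)]; simp
      rw [h2, h3, ← Finset.sum_add_distrib]
      refine Finset.sum_congr rfl fun k _ => ?_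
      rw [LinearMap.comp_apply, M.commutator σ a B _ y (-k - 1) J hJ, map_smul, map_smul, map_add,
        map_sum, smul_eq_mul, mul_add, Finset.mul_sum, add_assoc, ← Finset.sum_add_distrib, e1]
      rw [Finset.sum_eq_zero, add_zero]
      intro j _
      rw [map_smul, smul_eq_mul, e2]
      ring
    · refine Finset.sum_congr rfl fun k _ => ?_
      rw [map_smul, map_smul, smul_eq_mul]
  · intro k hk
    rw [hK k (by omega)]; simp
  · intro k hk
    rw [hN₁ k (by omega)]; simp

/-- Coefficients of the iterate of the operator `a_(-m-1) A`. -/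
theorem create_nested (M : ModeAlgebra act Y vac Fin) (σ : Bool) (m : ℕ) (a : 𝔞) (A B C : V)
    (u : V →ₗ[ℂ] ℂ) {L K J : ℕ} (hL : ∀ l : ℕ, L ≤ l → ∀ v, u (act σ (-l - 1) a v) = 0)
    (hK : ∀ l : ℕ, K ≤ l → act σ l a C = 0) (hJ : ∀ j : ℕ, J ≤ j → act σ j a B = 0)
    (x y : ℤ × ℤ) : u (Y y (Y x (act σ (-m - 1) a A) B) C) =
      ∑ l ∈ Finset.range L, ∑ᶠ k : ℕ, (k.choose m : ℂ) * (l.choose k : ℂ) *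
        (u ∘ₗ act σ (-l - 1) a) (Y (y - (k - l : ℤ) • dir σ) (Y (x - (m - k : ℤ) • dir σ) A B) C) +
      ∑ l ∈ Finset.range K, ∑ᶠ k : ℕ, (k.choose m : ℂ) * bin (-l - 1) k *
        u (Y (y - (l + k + 1 : ℤ) • dir σ) (Y (x - (m - k : ℤ) • dir σ) A B) (act σ l a C)) +
      ∑ j ∈ Finset.range J, bin (-j - 1) m *
        u (Y y (Y (x - (j + m + 1 : ℤ) • dir σ) A (act σ j a B)) C) := by
  have e1 : ∀ (x : ℤ × ℤ) (i j : ℤ), x + (i - j) • dir σ = x - (j - i) • dir σ :=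
    fun x i j => by module
  obtain ⟨N, hN⟩ := M.bound_dir A B x σ m
  rw [M.create, finsum_eq_sum_range (N := N), finsum_eq_sum_range (N := J), map_add,
    LinearMap.add_apply, map_add, map_sum, map_sum, LinearMap.sum_apply, LinearMap.sum_apply,
    map_sum, map_sum]
  · congr 1
    · have h1 : ∑ l ∈ Finset.range L, ∑ᶠ k : ℕ, (k.choose m : ℂ) * (l.choose k : ℂ) *
          (u ∘ₗ act σ (-l - 1) a)
            (Y (y - (k - l : ℤ) • dir σ) (Y (x - (m - k : ℤ) • dir σ) A B) C) =
          ∑ k ∈ Finset.range N, ∑ l ∈ Finset.range L, (k.choose m : ℂ) * (l.choose k : ℂ) *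
          (u ∘ₗ act σ (-l - 1) a)
            (Y (y - (k - l : ℤ) • dir σ) (Y (x - (m - k : ℤ) • dir σ) A B) C) := by
        rw [Finset.sum_comm]
        refine Finset.sum_congr rfl fun j hj' => finsum_eq_sum_range fun k hk => ?_
        rw [← e1 x, hN k hk]; simp
      have h2 : ∑ l ∈ Finset.range K, ∑ᶠ k : ℕ, (k.choose m : ℂ) * bin (-l - 1) k *
          u (Y (y - (l + k + 1 : ℤ) • dir σ) (Y (x - (m - k : ℤ) • dir σ) A B) (act σ l a C)) =
          ∑ k ∈ Finset.range N, ∑ l ∈ Finset.range K, (k.choose m : ℂ) * bin (-l - 1) k *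
          u (Y (y - (l + k + 1 : ℤ) • dir σ) (Y (x - (m - k : ℤ) • dir σ) A B)
            (act σ l a C)) := by
        rw [Finset.sum_comm]
        refine Finset.sum_congr rfl fun j hj' => finsum_eq_sum_range fun k hk => ?_
        rw [← e1 x, hN k hk]; simp
      rw [h1, h2, ← Finset.sum_add_distrib]
      refine Finset.sum_congr rfl fun k _ => ?_
      obtain ⟨N', hN'⟩ := M.bound_dir (Y (x - (m - k : ℤ) • dir σ) A B) C y σ k
      rw [map_smul, LinearMap.smul_apply, map_smul, e1, M.create,
        finsum_eq_sum_range (N := N' + L), finsum_eq_sum_range (N := K), map_add, map_sum,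
        map_sum, smul_eq_mul, mul_add, Finset.mul_sum, Finset.mul_sum]
      · congr 1
        · rw [← finsum_eq_sum_range, ← finsum_eq_sum_range]
          · simp only [map_smul, smul_eq_mul, LinearMap.comp_apply, e1, mul_assoc]
          · intro l hl
            rw [LinearMap.comp_apply, hL l hl, mul_zero]
          · intro l hl
            rw [map_smul, hL l (by omega)]; simp
        · refine Finset.sum_congr rfl fun l _ => ?_
          rw [map_smul, smul_eq_mul, mul_assoc]
      · intro l hl
        rw [hK l hl]; simp
      · intro l hl
        rw [hN' l (by omega)]; simp
    · refine Finset.sum_congr rfl fun k _ => ?_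
      rw [map_smul, LinearMap.smul_apply, map_smul, smul_eq_mul]
  · intro k hk
    rw [hJ k hk]; simp
  · intro k hk
    rw [hN k hk]; simp

theorem isCorrelator_create (M : ModeAlgebra act Y vac Fin) (σ : Bool) (m : ℕ) (a : 𝔞) {A : V}
    (hA : ∀ B C u, Fin u → ∃ μ, IsCorrelator Y A B C u μ) (B C : V) {u : V →ₗ[ℂ] ℂ}
    (hu : Fin u) : ∃ μ, IsCorrelator Y (act σ (-m - 1) a A) B C u μ := by
  obtain ⟨L, hL⟩ := M.fin_bound u hu
  obtain ⟨K, hK⟩ := M.smooth C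
  obtain ⟨J, hJ⟩ := M.smooth B
  have hL' : ∀ l : ℕ, L ≤ l → ∀ v, u (act σ (-l - 1) a v) = 0 := fun l hl v => hL l hl σ a v
  have hK' : ∀ l : ℕ, K ≤ l → act σ l a C = 0 := fun l hl => hK σ l (by omega) a
  have hJ' : ∀ l : ℕ, J ≤ l → act σ l a B = 0 := fun l hl => hJ σ l (by omega) a
  choose μ₁ h₁ using fun l : ℕ => hA B C _ (M.fin_act u hu σ (-l - 1) a)
  choose μ₂ h₂ using fun l : ℕ => hA B (act σ l a C) u hu
  choose μ₃ h₃ using fun j : ℕ => hA (act σ j a B) C u hu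
  refine ⟨fun z => ∑ l ∈ Finset.range L, (l.choose m : ℂ) * ev σ z.1 ^ (l - m : ℤ) * μ₁ l z +
    ∑ l ∈ Finset.range K, bin (-l - 1) m * ev σ z.1 ^ (-(l + m + 1) : ℤ) * μ₂ l z +
    ∑ j ∈ Finset.range J, bin (-j - 1) m * ev σ (z.1 - z.2) ^ (-(m + j + 1) : ℤ) * μ₃ j z,
    ?_, fun z w hz hw h => ?_, fun z w hz hw h => ?_, fun z w hz hw hzw h => ?_⟩
  · intro z hz
    refine ((Finset.analyticAt_fun_sum _ fun l _ => ?_).add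
      (Finset.analyticAt_fun_sum _ fun l _ => ?_)).add (Finset.analyticAt_fun_sum _ fun l _ => ?_)
    · exact (analyticAt_const.mul (analyticAt_ev_zpow analyticAt_fst hz.1 σ _)).mul
        ((h₁ l).analytic z hz)
    · exact (analyticAt_const.mul (analyticAt_ev_zpow analyticAt_fst hz.1 σ _)).mul
        ((h₂ l).analytic z hz)
    · exact (analyticAt_const.mul (analyticAt_ev_zpow (analyticAt_fst.sub analyticAt_snd)
        (sub_ne_zero.2 hz.2.2) σ _)).mul ((h₃ l).analytic z hz)
  · have e₁ := hasSum_sum (s := Finset.range L) fun (l : ℕ) _ =>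
      hasSum_single_shift hz hw σ (l.choose m : ℂ) (m - l) ((h₁ l).left z w hz hw h)
    have e₂ := hasSum_sum (s := Finset.range K) fun (l : ℕ) _ =>
      hasSum_single_shift hz hw σ (bin (-l - 1) m) (l + m + 1) ((h₂ l).left z w hz hw h)
    have e₃ := hasSum_sum (s := Finset.range J) fun (j : ℕ) _ =>
      hasSum_shifts (b := fun k : ℕ => bin (-k - 1) m * bin k j)
        (i := fun k => k + m + 1) (j := fun k => j - k)
        (g := bin (-j - 1) m * ev σ (z - w) ^ (-(m + j + 1) : ℤ)) hz hw σ
        (by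
          rw [ev_sub]
          refine hasSum_of_eq (hasSum_bin_zpow_right m j (by rwa [norm_ev, norm_ev])) (fun k => ?_) rfl
          rw [neg_sub])
        ((h₃ j).left z w hz hw h)
        (fun x => by
          obtain ⟨N, hN⟩ := M.bound_dir (act σ j a B) C x.2 σ j
          refine ⟨N, fun k hk => ?_⟩
          dsimp only
          rw [show x.2 - (j - k : ℤ) • dir σ = x.2 + (k - j : ℤ) • dir σ by module, hN k hk]; simp)
    refine hasSum_of_eq ((e₁.add e₂).add e₃) (fun x => ?_) ?_
    · rw [M.create_left σ m a A B C u hL' hK' hJ', add_mul, add_mul, Finset.sum_mul,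
        Finset.sum_mul, Finset.sum_mul]
    · simp only [neg_sub]
  · have e₁ := hasSum_sum (s := Finset.range L) fun (l : ℕ) _ =>
      hasSum_single_shift hz hw σ (l.choose m : ℂ) (m - l) ((h₁ l).right z w hz hw h)
    have e₂ := hasSum_sum (s := Finset.range K) fun (l : ℕ) _ =>
      hasSum_single_shift hz hw σ (bin (-l - 1) m) (l + m + 1) ((h₂ l).right z w hz hw h)
    have e₃ := hasSum_sum (s := Finset.range J) fun (j : ℕ) _ =>
      hasSum_shifts (b := fun k : ℕ => -((k.choose m : ℂ) * bin (-k - 1) j))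
        (i := fun k => m - k) (j := fun k => k + j + 1)
        (g := bin (-j - 1) m * ev σ (z - w) ^ (-(m + j + 1) : ℤ)) hz hw σ
        (by
          rw [ev_sub]
          refine hasSum_of_eq (hasSum_bin_zpow_left m j (by rwa [norm_ev, norm_ev])) (fun k => ?_) rfl
          rw [neg_sub])
        ((h₃ j).right z w hz hw h)
        (fun x => by
          obtain ⟨N, hN⟩ := M.bound_dir A C x.1 σ m
          refine ⟨N, fun k hk => ?_⟩
          dsimp only
          rw [show x.1 - (m - k : ℤ) • dir σ = x.1 + (k - m : ℤ) • dir σ by module, hN k hk]; simp)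
    refine hasSum_of_eq ((e₁.add e₂).add e₃) (fun x => ?_) ?_
    · rw [M.create_right σ m a A B C u hL' hK' hJ', add_mul, add_mul, Finset.sum_mul,
        Finset.sum_mul, Finset.sum_mul]
    · simp only [neg_sub]
  · have hd : z - w ≠ 0 := sub_ne_zero.2 hzw
    have h' : ‖ev σ (z - w)‖ < ‖ev σ w‖ := by rwa [norm_ev, norm_ev]
    have he : ev σ (z - w) + ev σ w = ev σ z := by rw [ev_sub]; ring
    have hb : ∀ x : (ℤ × ℤ) × (ℤ × ℤ), ∃ N : ℕ, ∀ k : ℕ, N ≤ k →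
        Y (x.1 - (m - k : ℤ) • dir σ) A B = 0 := fun x => by
      obtain ⟨N, hN⟩ := M.bound_dir A B x.1 σ m
      refine ⟨N, fun k hk => ?_⟩
      rw [show x.1 - (m - k : ℤ) • dir σ = x.1 + (k - m : ℤ) • dir σ by module, hN k hk]
    have e₁ := hasSum_sum (s := Finset.range L) fun (l : ℕ) _ =>
      hasSum_shifts (b := fun k : ℕ => (k.choose m : ℂ) * (l.choose k : ℂ))
        (i := fun k => m - k) (j := fun k => k - l)
        (g := (l.choose m : ℂ) * ev σ z ^ (l - m : ℤ)) hd hw σ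
        (by
          rw [← he]
          refine hasSum_of_eq (hasSum_choose_mul_choose_zpow _ _ m l) (fun k => ?_) rfl
          rw [neg_sub, neg_sub])
        ((h₁ l).nested z w hz hw hzw h)
        (fun x => by
          obtain ⟨N, hN⟩ := hb x
          refine ⟨N, fun k hk => ?_⟩
          dsimp only
          rw [hN k hk]; simp)
    have e₂ := hasSum_sum (s := Finset.range K) fun (l : ℕ) _ =>
      hasSum_shifts (b := fun k : ℕ => (k.choose m : ℂ) * bin (-l - 1) k)
        (i := fun k => m - k) (j := fun k => l + k + 1)
        (g := bin (-l - 1) m * ev σ z ^ (-(l + m + 1) : ℤ)) hd hw σ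
        (by
          rw [← he]
          refine hasSum_of_eq (hasSum_choose_mul_bin_zpow m l h') (fun k => ?_) rfl
          rw [neg_sub])
        ((h₂ l).nested z w hz hw hzw h)
        (fun x => by
          obtain ⟨N, hN⟩ := hb x
          refine ⟨N, fun k hk => ?_⟩
          dsimp only
          rw [hN k hk]; simp)
    have e₃ := hasSum_sum (s := Finset.range J) fun (j : ℕ) _ =>
      hasSum_single_shift hd hw σ (bin (-j - 1) m) (j + m + 1) ((h₃ j).nested z w hz hw hzw h)
    refine hasSum_of_eq ((e₁.add e₂).add e₃) (fun x => ?_) ?_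
    · rw [M.create_nested σ m a A B C u hL' hK' hJ', add_mul, add_mul, Finset.sum_mul,
        Finset.sum_mul, Finset.sum_mul]
    · simp only [add_comm (m : ℤ)]

theorem exists_isCorrelator (M : ModeAlgebra act Y vac Fin) (A B C : V) {u : V →ₗ[ℂ] ℂ}
    (hu : Fin u) : ∃ μ, IsCorrelator Y A B C u μ := by
  refine M.induction (fun A => ∀ B C u, Fin u → ∃ μ, IsCorrelator Y A B C u μ)
    (fun B C u hu => M.isCorrelator_vacuum B C hu) (fun A A' h h' B C u hu => ?_)
    (fun c A h B C u hu => ?_) (fun σ m a A h B C u hu => M.isCorrelator_create σ m a h B C hu)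
    A B C u hu
  · obtain ⟨μ, hμ⟩ := h B C u hu
    obtain ⟨μ', hμ'⟩ := h' B C u hu
    refine ⟨μ + μ', hμ.analytic.add hμ'.analytic, fun z w hz hw hh => ?_, fun z w hz hw hh => ?_,
      fun z w hz hw hzw hh => ?_⟩
    · exact hasSum_of_eq ((hμ.left z w hz hw hh).add (hμ'.left z w hz hw hh))
        (fun x => by simp only [map_add, LinearMap.add_apply, add_mul]) rfl
    · exact hasSum_of_eq ((hμ.right z w hz hw hh).add (hμ'.right z w hz hw hh))
        (fun x => by simp only [map_add, LinearMap.add_apply, add_mul]) rfl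
    · exact hasSum_of_eq ((hμ.nested z w hz hw hzw hh).add (hμ'.nested z w hz hw hzw hh))
        (fun x => by simp only [map_add, LinearMap.add_apply, add_mul]) rfl
  · obtain ⟨μ, hμ⟩ := h B C u hu
    refine ⟨fun z => c * μ z, analyticOnNhd_const.mul hμ.analytic, fun z w hz hw hh => ?_,
      fun z w hz hw hh => ?_, fun z w hz hw hzw hh => ?_⟩
    · exact hasSum_of_eq ((hμ.left z w hz hw hh).mul_left c)
        (fun x => by simp only [map_smul, LinearMap.smul_apply, smul_eq_mul, mul_assoc]) rfl
    · exact hasSum_of_eq ((hμ.right z w hz hw hh).mul_left c)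
        (fun x => by simp only [map_smul, LinearMap.smul_apply, smul_eq_mul, mul_assoc]) rfl
    · exact hasSum_of_eq ((hμ.nested z w hz hw hzw hh).mul_left c)
        (fun x => by simp only [map_smul, LinearMap.smul_apply, smul_eq_mul, mul_assoc]) rfl

end ModeAlgebra

end

end SphereVA

end

noncomputable section

namespace SphereVA

/-! ### The full vertex algebra -/

theorem twoPow_eq_charac {z : ℂ} (hz : z ≠ 0) (x : ℤ × ℤ) :
    twoPow z (-(x.1 : ℝ) - 1) (-(x.2 : ℝ) - 1) = charac z x := by
  have hz' : conj z ≠ 0 := (map_ne_zero _).2 hz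
  have hf : ⌊(-(x.1 : ℝ) - 1) - (-(x.2 : ℝ) - 1)⌋ = x.2 - x.1 := by
    rw [show (-(x.1 : ℝ) - 1) - (-(x.2 : ℝ) - 1) = ((x.2 - x.1 : ℤ) : ℝ) by push_cast; ring,
      Int.floor_intCast]
  have hn : ((‖z‖ ^ (2 * (-(x.2 : ℝ) - 1)) : ℝ) : ℂ) = (z * conj z) ^ (-x.2 - 1) := by
    rw [Real.rpow_mul (norm_nonneg z), show (-(x.2 : ℝ) - 1) = ((-x.2 - 1 : ℤ) : ℝ) by push_cast; ring,
      Real.rpow_intCast, Complex.ofReal_zpow, Complex.mul_conj, Complex.normSq_eq_norm_sq]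
    norm_num
  rw [twoPow, hf, hn, charac, mul_zpow, show -x.1 - 1 = (-x.2 - 1) + (x.2 - x.1) by ring,
    zpow_add₀ hz]
  ring

section

variable {F : Type*} [AddCommGroup F] [Module ℂ F] (Y : ℤ → ℤ → F →ₗ[ℂ] F →ₗ[ℂ] F)

theorem realModes_intCast (m n : ℤ) : realModes Y m n = Y m n := by
  simp [realModes]

theorem realModes_of_ne {r s : ℝ} (h : ¬∃ x : ℤ × ℤ, r = x.1 ∧ s = x.2) : realModes Y r s = 0 :=
  if_neg fun h' => h ⟨(⌊r⌋, ⌊s⌋), h'⟩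

theorem intCast_prod_injective :
    Function.Injective fun x : ℤ × ℤ => ((x.1 : ℝ), (x.2 : ℝ)) := by
  rintro ⟨a, b⟩ ⟨c, d⟩ h
  simpa using h

/-- Sums over pairs of real indices are sums over pairs of integral indices. -/
theorem hasSum_realModes {f : (ℝ × ℝ) × (ℝ × ℝ) → ℂ} {a : ℂ}
    (hf : ∀ x y : ℝ × ℝ, (¬∃ k : ℤ × ℤ, x = ((k.1 : ℝ), (k.2 : ℝ))) ∨
      (¬∃ k : ℤ × ℤ, y = ((k.1 : ℝ), (k.2 : ℝ))) → f (x, y) = 0)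
    (h : HasSum (fun x : (ℤ × ℤ) × (ℤ × ℤ) =>
      f (((x.1.1 : ℝ), (x.1.2 : ℝ)), ((x.2.1 : ℝ), (x.2.2 : ℝ)))) a) : HasSum f a := by
  have hi := intCast_prod_injective.prodMap intCast_prod_injective
  rw [← hi.hasSum_iff]
  · exact h
  · rintro ⟨x, y⟩ hx
    refine hf x y ?_
    by_contra! hn
    obtain ⟨⟨k, rfl⟩, ⟨l, rfl⟩⟩ := hn
    exact hx ⟨(k, l), rfl⟩

end

section

variable {𝔞 : Type*} [AddCommGroup 𝔞] [Module ℂ 𝔞]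

namespace Datum

variable {D : Datum 𝔞}

/-- Functionals which are supported in finitely many degrees. -/
def FinDual (D : Datum 𝔞) (u : D.State →ₗ[ℂ] ℂ) : Prop :=
  {h | ∃ v ∈ D.grading h, u v ≠ 0}.Finite

theorem mem_iSup_grading (hD : D.Admissible) (v : D.State) : v ∈ ⨆ h, D.grading h := by
  rw [iSup_grading hD]; trivial

theorem FinDual.act (hD : D.Admissible) {u : D.State →ₗ[ℂ] ℂ} (hu : D.FinDual u) (σ : Bool) (n : ℤ)
    (a : 𝔞) : D.FinDual (u ∘ₗ D.act σ n a) := by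
  refine (hu.preimage (f := (· + ((D.wt : ℝ) - n) • rdir σ))
    (add_left_injective _).injOn).subset ?_
  rintro h ⟨v, hv, hne⟩
  exact ⟨_, act_mem hD σ n a hv, hne⟩

theorem FinDual.bound (hD : D.Admissible) {u : D.State →ₗ[ℂ] ℂ} (hu : D.FinDual u) :
    ∃ L : ℕ, ∀ l : ℕ, L ≤ l → ∀ σ a v, u (D.act σ (-l - 1) a v) = 0 := by
  obtain ⟨c, hc⟩ := (hu.image fun h => max h.1 h.2).bddAbove
  obtain ⟨L, hL⟩ := exists_nat_gt c
  refine ⟨L, fun l hl σ a v => ?_⟩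
  have hv := mem_iSup_grading hD v
  induction hv using Submodule.iSup_induction' with
  | mem h v hv =>
    by_contra hne
    have h0 : D.grading h ≠ ⊥ := fun h0 => by
      rw [h0, Submodule.mem_bot] at hv
      rw [hv] at hne; simp at hne
    obtain ⟨m, n, rfl⟩ := exists_nat_of_ne_bot h0
    have h1 := hc ⟨_, ⟨_, act_mem hD σ (-l - 1) a hv, hne⟩, rfl⟩
    have hl' : (L : ℝ) ≤ l := by exact_mod_cast hl
    have hm := Nat.cast_nonneg (α := ℝ) m
    have hn := Nat.cast_nonneg (α := ℝ) n
    have hw := Nat.cast_nonneg (α := ℝ) D.wt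
    rw [max_le_iff] at h1
    cases σ
    · have := h1.2; simp [rdir] at this; linarith
    · have := h1.1; simp [rdir] at this; linarith
  | zero => simp
  | add v w _ _ hv hw => rw [map_add, map_add, hv, hw, add_zero]

theorem FinDual.finite (hD : D.Admissible) {u : D.State →ₗ[ℂ] ℂ} (hu : D.FinDual u)
    (B C : D.State) : {y | u (vop hD y B C) ≠ 0}.Finite := by
  have hB := mem_iSup_grading hD B
  induction hB using Submodule.iSup_induction' with
  | zero => simp
  | add v w _ _ hv hw =>
    refine (hv.union hw).subset fun y hy => ?_
    by_contra hn
    simp only [Set.mem_union, Set.mem_ofPred_eq, not_or, not_not] at hn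
    exact hy (by rw [map_add, LinearMap.add_apply, map_add, hn.1, hn.2, add_zero])
  | mem h B hB =>
    have hC := mem_iSup_grading hD C
    induction hC using Submodule.iSup_induction' with
    | zero => simp
    | add v w _ _ hv hw =>
      refine (hv.union hw).subset fun y hy => ?_
      by_contra hn
      simp only [Set.mem_union, Set.mem_ofPred_eq, not_or, not_not] at hn
      exact hy (by rw [map_add, map_add, hn.1, hn.2, add_zero])
    | mem k C hC =>
      refine (hu.preimage (f := fun x : ℤ × ℤ => h + k - ((x.1 : ℝ), (x.2 : ℝ)) - (1, 1))
        fun x _ y _ hxy => ?_).subset ?_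
      · exact intCast_prod_injective (sub_right_injective (sub_left_injective hxy))
      · exact fun x hx => ⟨_, vop_mem hD hB hC x, hx⟩

theorem modeAlgebra (hD : D.Admissible) : ModeAlgebra D.act (vop hD) D.vacuum D.FinDual where
  smooth := smooth hD
  bound := vop_bound hD
  vacuum x hx := by rw [vop_vacuum, if_neg hx]
  vacuum' := by rw [vop_vacuum, if_pos rfl]
  create := vop_create hD
  commutator σ a B v x s J hJ := commutator_formula hD σ a B v x s hJ
  induction _ hv ha hs hm s := state_induction hD hv ha hs hm s
  fin_act _ hu σ n a := hu.act hD σ n a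
  fin_bound _ hu := hu.bound hD
  fin_finite _ hu := hu.finite hD

/-- The vertex operator map. -/
def vertexOperator (hD : D.Admissible) (n n' : ℤ) : D.State →ₗ[ℂ] D.State →ₗ[ℂ] D.State :=
  vop hD (n, n')

theorem isFullVertexAlgebra (hD : D.Admissible) :
    IsFullVertexAlgebra D.grading (realModes (vertexOperator hD)) D.vacuum := by
  have hne : ∀ {r s : ℝ} {A B : D.State}, realModes (vertexOperator hD) r s A B ≠ 0 →
      ∃ x : ℤ × ℤ, r = x.1 ∧ s = x.2 ∧ vop hD x A B ≠ 0 := fun {r s A B} h => by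
    by_cases h' : ∃ x : ℤ × ℤ, r = x.1 ∧ s = x.2
    · obtain ⟨x, rfl, rfl⟩ := h'
      rw [realModes_intCast] at h
      exact ⟨x, rfl, rfl, h⟩
    · rw [realModes_of_ne _ h'] at h; exact absurd rfl h
  have hz : ∀ x : ℝ × ℝ, (¬∃ k : ℤ × ℤ, x = ((k.1 : ℝ), (k.2 : ℝ))) →
      realModes (vertexOperator hD) x.1 x.2 = 0 := fun x h =>
    realModes_of_ne _ fun ⟨k, h1, h2⟩ => h ⟨k, Prod.ext h1 h2⟩
  refine ⟨grading_internal hD, fun r s h => ?_, vacuum_ne_zero hD, vacuum_mem_grading,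
    fun A B => ?_, fun A B H => ?_, fun h h' hh => ?_, fun A r s h => ?_, fun A => ?_,
    fun r s => ?_, fun A B C u hu => ?_, fun h h' k k' r s A hA B hB => ?_⟩
  · exact realModes_of_ne _ fun ⟨x, hr, hs⟩ => h ⟨x.1 - x.2, by rw [hr, hs]; push_cast; rfl⟩
  · obtain ⟨N, hN⟩ := vop_bound hD A B
    refine ⟨N, fun r s h => ?_⟩
    by_contra hn
    obtain ⟨x, rfl, rfl, hx⟩ := hne hn
    rcases h with h | h
    · exact hx (hN x true (by exact_mod_cast h))
    · exact hx (hN x false (by exact_mod_cast h))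
  · obtain ⟨N, hN⟩ := vop_bound hD A B
    refine (((Set.finite_Icc (⌊H⌋ - N) N).prod (Set.finite_Icc (⌊H⌋ - N) N)).image
      fun x : ℤ × ℤ => ((x.1 : ℝ), (x.2 : ℝ))).subset ?_
    rintro ⟨r, s⟩ ⟨h, hH⟩
    obtain ⟨x, hr, hs, hx⟩ := hne h
    dsimp only at hr hs hH
    subst hr hs
    have h1 : x.1 < N := lt_of_not_ge fun h => hx (hN x true h)
    have h2 : x.2 < N := lt_of_not_ge fun h => hx (hN x false h)
    have h3 : ⌊H⌋ ≤ x.1 + x.2 := by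
      rw [Int.floor_le_iff]; push_cast; linarith
    exact ⟨x, ⟨⟨by omega, by omega⟩, ⟨by omega, by omega⟩⟩, rfl⟩
  · obtain ⟨m, n, hmn⟩ := exists_nat_of_ne_bot hh
    rw [Prod.mk.injEq] at hmn
    exact ⟨m - n, by rw [hmn.1, hmn.2]; push_cast; rfl⟩
  · obtain ⟨x, rfl, rfl, hx⟩ := hne h
    have h1 := (vop_apply_vacuum hD A).1 x hx
    refine ⟨(-x.1 - 1).toNat, (-x.2 - 1).toNat, ?_, ?_⟩
    · have : ((-x.1 - 1).toNat : ℤ) = -x.1 - 1 := Int.toNat_of_nonneg (by omega)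
      exact_mod_cast this.symm
    · have : ((-x.2 - 1).toNat : ℤ) = -x.2 - 1 := Int.toNat_of_nonneg (by omega)
      exact_mod_cast this.symm
  · have := realModes_intCast (vertexOperator hD) (-1) (-1)
    push_cast at this
    rw [this]; exact (vop_apply_vacuum hD A).2
  · by_cases h' : ∃ x : ℤ × ℤ, r = x.1 ∧ s = x.2
    · obtain ⟨x, rfl, rfl⟩ := h'
      rw [realModes_intCast, vertexOperator, vop_vacuum]
      have : x = (-1, -1) ↔ ((x.1 : ℝ) = -1 ∧ (x.2 : ℝ) = -1) := by
        rw [Prod.ext_iff]; norm_cast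
      simp only [Prod.mk.eta, this]
    · rw [realModes_of_ne _ h', if_neg fun h => h' ⟨(-1, -1), by simp [h.1, h.2]⟩]
      rfl
  · obtain ⟨μ, hμ⟩ := (modeAlgebra hD).exists_isCorrelator A B C hu
    refine ⟨μ, hμ.analytic, fun z w hz₀ hw hzw => ⟨fun h => ?_, fun h => ?_, fun h => ?_⟩⟩
    · refine hasSum_realModes (fun x y hxy => ?_) (hasSum_of_eq (hμ.left z w hz₀ hw h)
        (fun x => ?_) rfl)
      · rcases hxy with h | h
        · simp [hz x h]
        · simp [hz y h]
      · simp only [realModes_intCast, twoPow_eq_charac hz₀, twoPow_eq_charac hw]; rfl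
    · refine hasSum_realModes (fun x y hxy => ?_) (hasSum_of_eq (hμ.right z w hz₀ hw h)
        (fun x => ?_) rfl)
      · rcases hxy with h | h
        · simp [hz x h]
        · simp [hz y h]
      · simp only [realModes_intCast, twoPow_eq_charac hz₀, twoPow_eq_charac hw]; rfl
    · refine hasSum_realModes (fun x y hxy => ?_) (hasSum_of_eq (hμ.nested z w hz₀ hw hzw h)
        (fun x => ?_) rfl)
      · rcases hxy with h | h
        · simp [hz x h]
        · simp [hz y h]
      · simp only [realModes_intCast, twoPow_eq_charac (sub_ne_zero.2 hzw), twoPow_eq_charac hw]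
        rfl
  · by_cases h' : ∃ x : ℤ × ℤ, r = x.1 ∧ s = x.2
    · obtain ⟨x, rfl, rfl⟩ := h'
      rw [realModes_intCast]
      have := vop_mem hD hA hB x
      simpa [vertexOperator] using this
    · rw [realModes_of_ne _ h']; exact Submodule.zero_mem _

end Datum

end

end SphereVA

end

noncomputable section

namespace SphereVA

/-! ### Cutoff functions and their shells -/

/-- The set where a function is not locally constant. -/
def crit (ρ : ℂ → ℂ) : Set ℂ := tsupport (fderiv ℝ ρ)

/-- The form `-h ∂̄ρ`. -/
def sh (h ρ : ℂ → ℂ) (z : ℂ) : ℂ := -(h z * dbar ρ z)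

section

variable {h ρ χ : ℂ → ℂ} {z p : ℂ}

theorem crit_subset : crit ρ ⊆ tsupport ρ := tsupport_fderiv_subset ℝ

theorem eventually_fderiv_eq_zero (hz : z ∉ crit ρ) : fderiv ℝ ρ =ᶠ[𝓝 z] 0 :=
  notMem_tsupport_iff_eventuallyEq.1 hz

theorem dbar_eq_zero_of_notMem_crit (hz : z ∉ crit ρ) : dbar ρ z = 0 := by
  simp [dbar, (eventually_fderiv_eq_zero hz).eq_of_nhds]

theorem dz_eq_zero_of_notMem_crit (hz : z ∉ crit ρ) : dz ρ z = 0 := by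
  simp [dz, (eventually_fderiv_eq_zero hz).eq_of_nhds]

theorem notMem_crit_of_eventuallyEq {c : ℂ} (h : ρ =ᶠ[𝓝 z] fun _ => c) : z ∉ crit ρ := by
  rw [crit, notMem_tsupport_iff_eventuallyEq]
  exact (h.fderiv).trans (Filter.Eventually.of_forall fun y => by simp)

theorem tsupport_dbar_subset_crit : tsupport (dbar ρ) ⊆ crit ρ :=
  closure_minimal (fun _ hz => by_contra fun hn => hz (dbar_eq_zero_of_notMem_crit hn))
    (isClosed_tsupport _)

theorem tsupport_dz_subset_crit : tsupport (dz ρ) ⊆ crit ρ :=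
  closure_minimal (fun _ hz => by_contra fun hn => hz (dz_eq_zero_of_notMem_crit hn))
    (isClosed_tsupport _)

theorem tsupport_mul_subset_of_right {f g : ℂ → ℂ} : tsupport (fun z => f z * g z) ⊆ tsupport g :=
  closure_mono fun _ hz => right_ne_zero_of_mul hz

theorem tsupport_neg_mul_subset {f g : ℂ → ℂ} : tsupport (fun z => -(f z * g z)) ⊆ tsupport g :=
  closure_mono fun z hz => right_ne_zero_of_mul (a := f z) fun h => hz (by simp [h])

theorem contDiff_of_tsupport {f : ℂ → ℂ} (h : ∀ z ∈ tsupport f, ContDiffAt ℝ ∞ f z) :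
    ContDiff ℝ ∞ f := by
  rw [contDiff_iff_contDiffAt]
  intro z
  by_cases hz : z ∈ tsupport f
  · exact h z hz
  · exact contDiffAt_const.congr_of_eventuallyEq (notMem_tsupport_iff_eventuallyEq.1 hz)

theorem contDiff_hol_mul (hχ : ContDiff ℝ ∞ χ) (hh : ∀ z ∈ tsupport χ, AnalyticAt ℂ h z) :
    ContDiff ℝ ∞ fun z => h z * χ z :=
  contDiff_of_tsupport fun z hz =>
    ((hh z (tsupport_mul_subset_of_right hz)).contDiffAt.restrict_scalars ℝ).mul hχ.contDiffAt

theorem dbar_hol_mul (hχ : ContDiff ℝ ∞ χ) (hh : ∀ z ∈ tsupport χ, AnalyticAt ℂ h z) (z : ℂ) :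
    dbar (fun z => h z * χ z) z = h z * dbar χ z := by
  by_cases hz : z ∈ tsupport χ
  · have hd := (hh z hz).differentiableAt
    rw [dbar_mul (hd.restrictScalars ℝ) (hχ.differentiable (by simp) z),
      dbar_of_hasDerivAt hd.hasDerivAt, zero_mul, zero_add]
  · rw [dbar_eq_zero_of_notMem_crit fun h => hz (crit_subset h), mul_zero]
    exact dbar_eq_zero_of_notMem_crit fun h => hz (tsupport_mul_subset_of_right (crit_subset h))

theorem contDiff_sh (hρ : ContDiff ℝ ∞ ρ) (hh : ∀ z ∈ crit ρ, AnalyticAt ℂ h z) :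
    ContDiff ℝ ∞ (sh h ρ) :=
  (contDiff_hol_mul (dbar_smooth hρ) fun z hz => hh z (tsupport_dbar_subset_crit hz)).neg

theorem tsupport_sh : tsupport (sh h ρ) ⊆ crit ρ :=
  tsupport_neg_mul_subset.trans tsupport_dbar_subset_crit

theorem HasCompactSupport.of_subset {f g : ℂ → ℂ} (hg : HasCompactSupport g)
    (h : tsupport f ⊆ tsupport g) : HasCompactSupport f :=
  hg.mono' (subset_closure.trans h)

theorem sh_mem_form {w : ℕ} {A : Opens Sphere} (hρ : ContDiff ℝ ∞ ρ) (hc : HasCompactSupport ρ)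
    (hh : ∀ z ∈ crit ρ, AnalyticAt ℂ h z ∧ (z : Sphere) ∈ A) : sh h ρ ∈ Form w 1 A :=
  mem_form_of_compact (contDiff_sh hρ fun z hz => (hh z hz).1)
    (HasCompactSupport.of_subset hc (tsupport_sh.trans crit_subset))
    fun z hz => (hh z (tsupport_sh hz)).2

theorem sh_sub {ρ' : ℂ → ℂ} (hρ : ContDiff ℝ ∞ ρ) (hρ' : ContDiff ℝ ∞ ρ') :
    sh h (ρ - ρ') = sh h ρ - sh h ρ' := by
  funext z
  have hd := hρ'.differentiable (by simp) z
  have e : ρ - ρ' = ρ + (-1 : ℂ) • ρ' := by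
    funext z; simp [sub_eq_add_neg]
  rw [sh, e, dbar_add (hρ.differentiable (by simp) z) (hd.const_smul _), dbar_smul _ hd,
    Pi.sub_apply, sh, sh]
  ring

theorem hasDerivAt_zpow_sub (n : ℤ) (hz : z ≠ p) :
    HasDerivAt (fun z => (z - p) ^ n) (n * (z - p) ^ (n - 1)) z :=
  HasDerivAt.comp_sub_const z p (hasDerivAt_zpow n (z - p) (Or.inl (sub_ne_zero.2 hz)))

theorem analyticAt_zpow_sub (n : ℤ) (hz : z ≠ p) : AnalyticAt ℂ (fun z => (z - p) ^ n) z :=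
  (analyticAt_id.sub analyticAt_const).zpow (sub_ne_zero.2 hz)

end

/-! ### The residue integral -/

theorem integral_fderiv_eq_zero {f : ℂ → ℂ} (hf : ContDiff ℝ ∞ f) (hc : HasCompactSupport f)
    (v : ℂ) : ∫ z, fderiv ℝ f z v = 0 := by
  have hd : Continuous fun z => fderiv ℝ f z v :=
    (hf.continuous_fderiv (by simp)).clm_apply continuous_const
  have hi : Integrable fun z => fderiv ℝ f z v :=
    hd.integrable_of_hasCompactSupport (hc.fderiv_apply ℝ v)
  have := integral_bilinear_hasLineDerivAt_right_eq_neg_left_of_integrable (μ := volume)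
    (f := fun _ : ℂ => (1 : ℂ)) (f' := fun _ => 0) (g := f) (g' := fun z => fderiv ℝ f z v)
    (v := v) (B := ContinuousLinearMap.mul ℝ ℂ) (by simp) (by simpa using hi)
    (by simpa using hf.continuous.integrable_of_hasCompactSupport hc)
    (fun x _ => by simpa using (hasFDerivAt_const (1 : ℂ) x).hasLineDerivAt v)
    (fun x _ => (hf.differentiable (by simp) x).hasFDerivAt.hasLineDerivAt v)
  simpa using this

theorem integral_dbar_eq_zero {f : ℂ → ℂ} (hf : ContDiff ℝ ∞ f) (hc : HasCompactSupport f) :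
    ∫ z, dbar f z = 0 := by
  have hi : ∀ v, Integrable fun z => fderiv ℝ f z v := fun v =>
    ((hf.continuous_fderiv (by simp)).clm_apply
      continuous_const).integrable_of_hasCompactSupport (hc.fderiv_apply ℝ v)
  simp only [dbar]
  rw [integral_div, integral_add (hi 1) ((hi Complex.I).const_mul _), integral_const_mul,
    integral_fderiv_eq_zero hf hc, integral_fderiv_eq_zero hf hc]
  simp

/-- A rotationally invariant cutoff function. -/
def radialCut (p z : ℂ) : ℂ := (Real.smoothTransition (2 - Complex.normSq (z - p)) : ℝ)

theorem contDiff_radialCut (p : ℂ) : ContDiff ℝ ∞ (radialCut p) := by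
  have h : ContDiff ℝ ∞ fun z : ℂ => Complex.normSq (z - p) := by
    simp only [Complex.normSq_apply, Complex.sub_re, Complex.sub_im]
    have h1 : ContDiff ℝ ∞ Complex.re := Complex.reCLM.contDiff
    have h2 : ContDiff ℝ ∞ Complex.im := Complex.imCLM.contDiff
    fun_prop
  exact Complex.ofRealCLM.contDiff.comp (Real.smoothTransition.contDiff.comp (contDiff_const.sub h))

theorem radialCut_eventuallyEq (p : ℂ) : radialCut p =ᶠ[𝓝 p] fun _ => 1 := by
  filter_upwards [Metric.ball_mem_nhds p one_pos] with z hz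
  rw [Metric.mem_ball, dist_eq_norm] at hz
  rw [radialCut, Real.smoothTransition.one_of_one_le, Complex.ofReal_one]
  rw [Complex.normSq_eq_norm_sq]
  nlinarith [norm_nonneg (z - p)]

theorem hasCompactSupport_radialCut (p : ℂ) : HasCompactSupport (radialCut p) := by
  refine HasCompactSupport.of_support_subset_isCompact (isCompact_closedBall p 2) fun z hz => ?_
  by_contra hn
  apply hz
  rw [Metric.mem_closedBall, dist_eq_norm, not_le] at hn
  rw [radialCut, Real.smoothTransition.zero_of_nonpos, Complex.ofReal_zero]
  rw [Complex.normSq_eq_norm_sq]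
  nlinarith

theorem dbar_radialCut (p z : ℂ) : dbar (radialCut p) z =
    -((deriv Real.smoothTransition (2 - ‖z - p‖ ^ 2) : ℝ) * (z - p)) := by
  have h1 : HasFDerivAt (fun z : ℂ => Complex.normSq (z - p))
      ((2 * (z - p).re) • Complex.reCLM + (2 * (z - p).im) • Complex.imCLM) z := by
    have hr : HasFDerivAt (fun z : ℂ => (z - p).re) Complex.reCLM z := by
      simpa using (Complex.reCLM.hasFDerivAt (x := z)).sub_const p.re
    have hi : HasFDerivAt (fun z : ℂ => (z - p).im) Complex.imCLM z := by
      simpa using (Complex.imCLM.hasFDerivAt (x := z)).sub_const p.im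
    have := (hr.mul hr).add (hi.mul hi)
    refine (this.congr_fderiv ?_)
    ext
    simp; ring
  have h2 : HasFDerivAt (radialCut p) _ z := Complex.ofRealCLM.hasFDerivAt.comp z
    (((Real.smoothTransition.contDiff (n := 1)).differentiable (by simp) _).hasDerivAt.comp_hasFDerivAt z
      (h1.const_sub 2))
  rw [dbar, h2.fderiv, ← Complex.normSq_eq_norm_sq]
  simp
  apply Complex.ext <;> simp <;> ring

theorem integral_deriv_smoothTransition :
    ∫ z : ℂ, deriv Real.smoothTransition (2 - ‖z‖ ^ 2) = Real.pi := by
  have hs : ContDiff ℝ ∞ Real.smoothTransition := Real.smoothTransition.contDiff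
  have hder : ∀ r : ℝ, HasDerivAt (fun r : ℝ => -(Real.smoothTransition (2 - r ^ 2) / 2))
      (r * deriv Real.smoothTransition (2 - r ^ 2)) r := fun r => by
    have h1 : HasDerivAt (fun r : ℝ => 2 - r ^ 2) (-(2 * r)) r := by
      simpa using (hasDerivAt_pow 2 r).const_sub 2
    have h2 := (((hs.differentiable (by simp) (2 - r ^ 2)).hasDerivAt.comp r h1).div_const 2).neg
    refine h2.congr_deriv ?_
    ring
  have hcomp : HasCompactSupport fun r : ℝ => -(Real.smoothTransition (2 - r ^ 2) / 2) := by
    refine HasCompactSupport.of_support_subset_isCompact (isCompact_Icc (a := -2) (b := 2))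
      fun r hr => ?_
    by_contra hn
    apply hr
    rw [Set.mem_Icc, not_and_or, not_le, not_le] at hn
    have h0 : Real.smoothTransition (2 - r ^ 2) = 0 :=
      Real.smoothTransition.zero_of_nonpos (by rcases hn with h | h <;> nlinarith)
    simp [h0]
  have hsm : ContDiff ℝ 1 fun r : ℝ => -(Real.smoothTransition (2 - r ^ 2) / 2) :=
    ((((hs.of_le (by simp)).comp (contDiff_const.sub (contDiff_id.pow 2))).div_const 2).neg)
  have h1 := hcomp.integral_Ioi_deriv_eq hsm 0
  rw [show deriv (fun r : ℝ => -(Real.smoothTransition (2 - r ^ 2) / 2)) =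
    fun r => r * deriv Real.smoothTransition (2 - r ^ 2) from funext fun r => (hder r).deriv] at h1
  rw [integral_fun_norm_addHaar volume (fun r => deriv Real.smoothTransition (2 - r ^ 2))]
  have h3 : (2 : ℝ) - 0 ^ 2 = 2 := by norm_num
  simp only [Complex.finrank_real_complex, pow_one, smul_eq_mul, Nat.add_one_sub_one] at h1 ⊢
  rw [h1, h3, Real.smoothTransition.one_of_one_le (by norm_num), Measure.real, Complex.volume_ball]
  simp
  ring

theorem integral_zpow_dbar_radialCut (p : ℂ) (k : ℤ) :
    ∫ z, (z - p) ^ k * dbar (radialCut p) z = if k = -1 then -(Real.pi : ℂ) else 0 := by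
  simp only [dbar_radialCut]
  set F : ℂ → ℂ := fun z => z ^ k * -((deriv Real.smoothTransition (2 - ‖z‖ ^ 2) : ℝ) * z) with hF
  have hs : ∫ z, (z - p) ^ k * -((deriv Real.smoothTransition (2 - ‖z - p‖ ^ 2) : ℝ) * (z - p)) =
      ∫ z, F z := integral_sub_right_eq_self F p
  rw [hs]
  split_ifs with hk
  · have : ∀ᵐ z : ℂ, F z = ((-(deriv Real.smoothTransition (2 - ‖z‖ ^ 2)) : ℝ) : ℂ) := by
      filter_upwards [Measure.ae_ne volume (0 : ℂ)] with z hz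
      simp only [hF, hk, zpow_neg_one]
      push_cast
      field_simp
    rw [integral_congr_ae this, integral_complex_ofReal, integral_neg, integral_deriv_smoothTransition]
    simp
  · have hk' : (k : ℂ) + 1 ≠ 0 := by
      intro h
      exact hk (by have : k + 1 = 0 := by exact_mod_cast h
                   omega)
    set θ : ℝ := Real.pi / (k + 1) with hθ
    set u : Circle := Circle.exp θ with hu
    have hu1 : (u : ℂ) ^ (k + 1) = -1 := by
      rw [hu, Circle.coe_exp, ← Complex.exp_int_mul, hθ, ← Complex.exp_pi_mul_I]
      congr 1
      push_cast
      field_simp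
    have h0 : (u : ℂ) ≠ 0 := Circle.coe_ne_zero u
    have h1 : ∫ z, F ((u : ℂ) * z) = ∫ z, F z :=
      (LinearIsometryEquiv.measurePreserving (rotation u)).integral_comp
        (rotation u).toHomeomorph.measurableEmbedding F
    have h2 : ∀ z, F ((u : ℂ) * z) = -F z := fun z => by
      have : ‖(u : ℂ) * z‖ = ‖z‖ := by rw [norm_mul, Circle.norm_coe, one_mul]
      simp only [hF, this, mul_zpow]
      have h3 : (u : ℂ) ^ k * u = -1 := by rw [← zpow_add_one₀ h0, hu1]
      linear_combination (-(z ^ k * z * (deriv Real.smoothTransition (2 - ‖z‖ ^ 2) : ℝ))) * h3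
    simp only [h2, integral_neg] at h1
    have h4 : (2 : ℂ) * ∫ z, F z = 0 := by linear_combination -h1
    simpa using h4

/-- The residue of `(z - p)^k`, computed with a cutoff function. -/
theorem integral_zpow_dbar {p : ℂ} (k : ℤ) {ρ : ℂ → ℂ} (hρ : ContDiff ℝ ∞ ρ)
    (hc : HasCompactSupport ρ) (h1 : ρ =ᶠ[𝓝 p] fun _ => 1) :
    ∫ z, (z - p) ^ k * dbar ρ z = if k = -1 then -(Real.pi : ℂ) else 0 := by
  rw [← integral_zpow_dbar_radialCut p k, ← sub_eq_zero]
  have key : ∀ {ρ : ℂ → ℂ}, ContDiff ℝ ∞ ρ → HasCompactSupport ρ → (ρ =ᶠ[𝓝 p] fun _ => 1) →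
      Integrable fun z => (z - p) ^ k * dbar ρ z := fun {ρ} hρ hc h1 => by
    have h2 : ∀ z ∈ crit ρ, AnalyticAt ℂ (fun z => (z - p) ^ k) z := fun z hz =>
      analyticAt_zpow_sub k fun h => by
        subst h; exact notMem_crit_of_eventuallyEq h1 hz
    have h3 := (contDiff_sh hρ h2).continuous.integrable_of_hasCompactSupport (μ := volume)
      (HasCompactSupport.of_subset hc (tsupport_sh.trans crit_subset))
    refine h3.neg.congr (Filter.Eventually.of_forall fun z => ?_)
    simp [sh]
  have hr := contDiff_radialCut p
  have hrc := hasCompactSupport_radialCut p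
  rw [← integral_sub (key hρ hc h1) (key hr hrc (radialCut_eventuallyEq p))]
  have hχ : ContDiff ℝ ∞ (ρ - radialCut p) := hρ.sub hr
  have hp : p ∉ tsupport (ρ - radialCut p) := by
    rw [notMem_tsupport_iff_eventuallyEq]
    filter_upwards [h1, radialCut_eventuallyEq p] with z h h'
    simp [h, h']
  have ha : ∀ z ∈ tsupport (ρ - radialCut p), AnalyticAt ℂ (fun z => (z - p) ^ k) z := fun z hz =>
    analyticAt_zpow_sub k fun h => hp (h ▸ hz)
  have h4 := integral_dbar_eq_zero (contDiff_hol_mul hχ ha)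
    ((hc.sub hrc).mono' (subset_closure.trans tsupport_mul_subset_of_right))
  rw [← h4]
  congr 1
  funext z
  rw [dbar_hol_mul hχ ha]
  have := congrFun (sh_sub (h := fun z => (z - p) ^ k) hρ hr) z
  simp only [sh, Pi.sub_apply] at this
  linear_combination this

/-! ### The bracket of a section with a shell -/

theorem dz_of_eventuallyEq_zpow {f : ℂ → ℂ} {p z : ℂ} {m : ℤ} (hz : z ≠ p)
    (hf : f =ᶠ[𝓝 z] fun z => -(z - p) ^ m) : dz f =ᶠ[𝓝 z] fun z => -(m * (z - p) ^ (m - 1)) := by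
  filter_upwards [hf.eventuallyEq_nhds, isOpen_ne.mem_nhds hz] with y hy hyp
  rw [dz_congr hy]
  refine dz_of_hasDerivAt ?_
  exact (hasDerivAt_zpow_sub m hyp).fun_neg

theorem dz_three_of_eventuallyEq_zpow {f : ℂ → ℂ} {p z : ℂ} {m : ℤ} (hz : z ≠ p)
    (hf : f =ᶠ[𝓝 z] fun z => -(z - p) ^ m) :
    dz (dz (dz f)) z = -(m * (m - 1) * (m - 2) * (z - p) ^ (m - 3)) := by
  have step : ∀ {g : ℂ → ℂ} {c : ℂ} {k : ℤ}, (g =ᶠ[𝓝 z] fun z => -(c * (z - p) ^ k)) →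
      dz g =ᶠ[𝓝 z] fun z => -(c * k * (z - p) ^ (k - 1)) := fun {g c k} hg => by
    filter_upwards [hg.eventuallyEq_nhds, isOpen_ne.mem_nhds hz] with y hy hyp
    rw [dz_congr hy]
    refine dz_of_hasDerivAt ?_
    rw [mul_assoc]
    exact ((hasDerivAt_zpow_sub k hyp).const_mul c).fun_neg
  have h1 := step (step (dz_of_eventuallyEq_zpow hz hf))
  rw [h1.eq_of_nhds, show m - 1 - 1 - 1 = m - 3 by ring]
  push_cast; ring

section

variable {𝔞 : Type*} [AddCommGroup 𝔞] [Module ℂ 𝔞]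

/-- The bracket of a section equal to `-(z - p)^m` near a shell `-(z - p)^n ∂̄ρ` is a multiple of
another shell, up to exact forms, and the pairing is a residue. -/
structure Datum.Geometric (D : Datum 𝔞) : Prop where
  op_shell : ∀ (A : Opens Sphere) (p : ℂ) (m n : ℤ) (ρ : ℂ → ℂ), ContDiff ℝ ∞ ρ →
    HasCompactSupport ρ → (ρ =ᶠ[𝓝 p] fun _ => 1) → (∀ z ∈ crit ρ, (z : Sphere) ∈ A) →
    ∀ (f : Form D.wt 0 A) (η : Form D.wt 1 A), (η : ℂ → ℂ) = sh (fun z => (z - p) ^ n) ρ →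
    (∀ z ∈ crit ρ, (f : ℂ → ℂ) =ᶠ[𝓝 z] fun z => -(z - p) ^ m) →
    ∃ g : Form D.wt 0 A, (D.op A f η : ℂ → ℂ) =
      (-D.e m n) • sh (fun z => (z - p) ^ (m + n - D.wt)) ρ + (dolbeault D.wt A g : ℂ → ℂ)
  pair_shell : ∀ (A : Opens Sphere) (p : ℂ) (m n : ℤ) (ρ : ℂ → ℂ), ContDiff ℝ ∞ ρ →
    HasCompactSupport ρ → (ρ =ᶠ[𝓝 p] fun _ => 1) → (∀ z ∈ crit ρ, (z : Sphere) ∈ A) →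
    ∀ (f : Form D.wt 0 A) (η : Form D.wt 1 A), (η : ℂ → ℂ) = sh (fun z => (z - p) ^ n) ρ →
    (∀ z ∈ crit ρ, (f : ℂ → ℂ) =ᶠ[𝓝 z] fun z => -(z - p) ^ m) → D.pair A f η = -D.e' m n

end

theorem ne_of_mem_crit {p z : ℂ} {ρ : ℂ → ℂ} (h1 : ρ =ᶠ[𝓝 p] fun _ => 1) (hz : z ∈ crit ρ) :
    z ≠ p := fun h => by
  subst h; exact notMem_crit_of_eventuallyEq h1 hz

theorem kacMoody_geometric (𝔤 : Type*) [LieRing 𝔤] [LieAlgebra ℂ 𝔤] (κ : LinearMap.BilinForm ℂ 𝔤)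
    (hsymm : ∀ x y, κ x y = κ y x) (hinv : ∀ x y z, κ ⁅x, y⁆ z = κ x ⁅y, z⁆) :
    (kacMoody 𝔤 κ hsymm hinv).Geometric where
  op_shell A p m n ρ hρ hc h1 hA f η hη hf := by
    refine ⟨0, ?_⟩
    rw [map_zero]
    funext z
    change (f : ℂ → ℂ) z * (η : ℂ → ℂ) z = (-(1 : ℂ)) * sh _ ρ z + 0
    rw [hη, sh, sh]
    by_cases hz : z ∈ crit ρ
    · rw [(hf z hz).eq_of_nhds, show m + n - ((kacMoody 𝔤 κ hsymm hinv).wt : ℤ) = m + n from sub_zero _,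
        zpow_add₀ (sub_ne_zero.2 (ne_of_mem_crit h1 hz))]
      ring
    · rw [dbar_eq_zero_of_notMem_crit hz]; simp
  pair_shell A p m n ρ hρ hc h1 hA f η hη hf := by
    change (1 / Real.pi : ℂ) * ∫ z, dz f z * (η : ℂ → ℂ) z = -(if m + n = 0 then (m : ℂ) else 0)
    have : ∀ z, dz f z * (η : ℂ → ℂ) z = m * ((z - p) ^ (m + n - 1) * dbar ρ z) := fun z => by
      rw [hη, sh]
      by_cases hz : z ∈ crit ρ
      · have hne := ne_of_mem_crit h1 hz
        rw [(dz_of_eventuallyEq_zpow hne (hf z hz)).eq_of_nhds,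
          show m + n - 1 = (m - 1) + n by ring, zpow_add₀ (sub_ne_zero.2 hne)]
        ring
      · rw [dbar_eq_zero_of_notMem_crit hz]; simp
    simp only [this]
    have hp : (Real.pi : ℂ) ≠ 0 := by exact_mod_cast Real.pi_ne_zero
    rw [integral_const_mul, integral_zpow_dbar _ hρ hc h1]
    by_cases hmn : m + n = 0
    · rw [if_pos (by omega), if_pos hmn]; field_simp
    · rw [if_neg (by omega), if_neg hmn]; simp

theorem virasoro_geometric (c : ℝ) : (virasoro c).Geometric where
  op_shell A p m n ρ hρ hc h1 hA f η hη hf := by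
    have ha : ∀ z ∈ tsupport (dz ρ), AnalyticAt ℂ (fun z => -(z - p) ^ (m + n)) z := fun z hz =>
      (analyticAt_zpow_sub _ (ne_of_mem_crit h1 (tsupport_dz_subset_crit hz))).neg
    have hg := contDiff_hol_mul (dz_smooth hρ) ha
    have hts : tsupport (fun z => -(z - p) ^ (m + n) * dz ρ z) ⊆ crit ρ :=
      tsupport_mul_subset_of_right.trans tsupport_dz_subset_crit
    refine ⟨⟨_, mem_form_of_compact hg (HasCompactSupport.of_subset hc (hts.trans crit_subset))
      fun z hz => hA z (hts hz)⟩, ?_⟩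
    funext z
    change (η : ℂ → ℂ) z * dz f z - (f : ℂ → ℂ) z * dz η z =
      (-((m : ℂ) - n)) * sh _ ρ z + dbar (fun z => -(z - p) ^ (m + n) * dz ρ z) z
    rw [dbar_hol_mul (dz_smooth hρ) ha, hη]
    by_cases hz : z ∈ crit ρ
    · have hne := ne_of_mem_crit h1 hz
      have hne' := sub_ne_zero.2 hne
      have hzp := hasDerivAt_zpow_sub n hne
      have hdd := (dbar_smooth hρ).differentiable (by simp) z
      have hsh : dz (sh (fun z => (z - p) ^ n) ρ) z =
          -(n * (z - p) ^ (n - 1) * dbar ρ z + (z - p) ^ n * dz (dbar ρ) z) := by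
        have e : sh (fun z => (z - p) ^ n) ρ =
            (-1 : ℂ) • fun z => (z - p) ^ n * dbar ρ z := by
          funext z; simp [sh]
        have hd : DifferentiableAt ℝ (fun z : ℂ => (z - p) ^ n) z :=
          hzp.differentiableAt.restrictScalars ℝ
        rw [e, dz_smul _ (hd.fun_mul hdd), dz_mul hd hdd, dz_of_hasDerivAt hzp]
        ring
      have hsym : dz (dbar ρ) z = dbar (dz ρ) z := by
        have hfd : DifferentiableAt ℝ (fderiv ℝ ρ) z :=
          ((hρ.fderiv_right (m := ∞) (by simp)).differentiable (by simp)) z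
        have hs : IsSymmSndFDerivAt ℝ ρ z := (hρ.contDiffAt (x := z)).isSymmSndFDerivAt
          (by simp only [minSmoothness_of_isRCLikeNormedField]; exact WithTop.coe_le_coe.2 le_top)
        have hap : ∀ v : ℂ, HasFDerivAt (fun y => fderiv ℝ ρ y v)
            ((ContinuousLinearMap.apply ℝ ℂ v).comp (fderiv ℝ (fderiv ℝ ρ) z)) z := fun v =>
          (ContinuousLinearMap.apply ℝ ℂ v).hasFDerivAt.comp z hfd.hasFDerivAt
        have e1 : HasFDerivAt (dbar ρ) _ z :=
          ((hap 1).add ((hap Complex.I).const_mul Complex.I)).mul_const (2⁻¹ : ℂ)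
        have e2 : HasFDerivAt (dz ρ) _ z :=
          ((hap 1).sub ((hap Complex.I).const_mul Complex.I)).mul_const (2⁻¹ : ℂ)
        rw [dz, dbar, e1.fderiv, e2.fderiv]
        simp only [add_apply, sub_apply, smul_apply, ContinuousLinearMap.comp_apply,
          ContinuousLinearMap.apply_apply, smul_eq_mul]
        have := hs 1 Complex.I
        rw [this]
        ring
      rw [hsh, (dz_of_eventuallyEq_zpow hne (hf z hz)).eq_of_nhds, (hf z hz).eq_of_nhds, sh, sh,
        hsym, show m + n - (((virasoro c).wt : ℕ) : ℤ) = m + n - 1 from rfl, zpow_sub_one₀ hne',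
        zpow_sub_one₀ hne', zpow_sub_one₀ hne', zpow_add₀ hne']
      ring
    · have h0 : dz (sh (fun z => (z - p) ^ n) ρ) z = 0 :=
        dz_eq_zero fun h => hz (tsupport_sh h)
      have h2 : dbar (dz ρ) z = 0 := dbar_eq_zero_of_notMem_crit
        fun h => hz (tsupport_dz_subset_crit (crit_subset h))
      rw [h0, h2, sh, sh, dbar_eq_zero_of_notMem_crit hz]; simp
  pair_shell A p m n ρ hρ hc h1 hA f η hη hf := by
    change (1 / (12 * Real.pi) : ℂ) * ∫ z, dz (dz (dz f)) z * (η : ℂ → ℂ) z =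
      -(if m + n = 2 then (m : ℂ) * (m - 1) * (m - 2) / 12 else 0)
    have : ∀ z, dz (dz (dz f)) z * (η : ℂ → ℂ) z =
        m * (m - 1) * (m - 2) * ((z - p) ^ (m + n - 3) * dbar ρ z) := fun z => by
      rw [hη, sh]
      by_cases hz : z ∈ crit ρ
      · have hne := ne_of_mem_crit h1 hz
        rw [dz_three_of_eventuallyEq_zpow hne (hf z hz),
          show m + n - 3 = (m - 3) + n by ring, zpow_add₀ (sub_ne_zero.2 hne)]
        ring
      · rw [dbar_eq_zero_of_notMem_crit hz]; simp
    simp only [this]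
    have hp : (Real.pi : ℂ) ≠ 0 := by exact_mod_cast Real.pi_ne_zero
    rw [integral_const_mul, integral_zpow_dbar _ hρ hc h1]
    by_cases hmn : m + n = 2
    · rw [if_pos (by omega), if_pos hmn]; field_simp
    · rw [if_neg (by omega), if_neg hmn]; simp

end SphereVA

end

noncomputable section

namespace SphereVA

/-! ### Sections of one chirality -/

/-- The open subset over which sections of one chirality are described. -/
def sOpen (σ : Bool) (U : Opens Sphere) : Opens Sphere :=
  match σ with
  | true => U
  | false => conjOpen U

section

variable {σ τ : Bool} {U V W : Opens Sphere} {w i : ℕ}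

theorem sOpen_mono (σ : Bool) (h : U ≤ V) : sOpen σ U ≤ sOpen σ V := by
  cases σ
  · exact conjOpen_mono h
  · exact h

theorem conjSphere_coe (z : ℂ) : conjSphere (z : Sphere) = ((conj z : ℂ) : Sphere) := rfl

theorem mem_sOpen (z : ℂ) : (z : Sphere) ∈ sOpen σ U ↔ ((ev σ z : ℂ) : Sphere) ∈ U := by
  cases σ
  · change (z : Sphere) ∈ conjSphere.opensCongr U ↔ _
    have e : (z : Sphere) = conjSphere ((conj z : ℂ) : Sphere) := by
      rw [conjSphere_coe, Complex.conj_conj]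
    constructor
    · intro h
      have h' : conjSphere.symm (z : Sphere) ∈ U := by simpa [Homeomorph.opensCongr] using h
      rwa [e, Homeomorph.symm_apply_apply] at h'
    · intro h
      change (conj z : ℂ) ∈ ((↑) : ℂ → Sphere) ⁻¹' (U : Set Sphere) at h
      have h' : conjSphere.symm (z : Sphere) ∈ U := by rw [e, Homeomorph.symm_apply_apply]; exact h
      simpa [Homeomorph.opensCongr] using h'
  · rfl

theorem ev_ev (σ : Bool) (z : ℂ) : ev σ (ev σ z) = z := by cases σ <;> simp [ev]

theorem Form.mono {f : ℂ → ℂ} (hf : f ∈ Form w i U) (h : U ≤ V) : f ∈ Form w i V :=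
  ⟨hf.1, hf.2.1, hf.2.2.trans h⟩

/-- The part of `W` which lies outside of the closure of `V`. -/
def rim (V W : Opens Sphere) : Opens Sphere := W ⊓ ⟨(closure (V : Set Sphere))ᶜ, isClosed_closure.isOpen_compl⟩

theorem rim_le : rim V W ≤ W := inf_le_left

theorem rim_disjoint : Disjoint (rim V W) V := by
  rw [disjoint_iff_inf_le]
  rintro x ⟨⟨-, h⟩, h'⟩
  exact h (subset_closure h')

theorem rim_mono {V' W' : Opens Sphere} (hV : V' ≤ V) (hW : W ≤ W') : rim V W ≤ rim V' W' := by
  rintro x ⟨h, h'⟩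
  exact ⟨hW h, fun hn => h' (closure_mono hV hn)⟩

end

section

variable {𝔞 : Type*} [AddCommGroup 𝔞] [Module ℂ 𝔞]

namespace Datum

variable (D : Datum 𝔞) {σ τ : Bool} {U V W : Opens Sphere}

/-- Degree `0` sections of one chirality. -/
def zer (σ : Bool) (U : Opens Sphere) : 𝔞 ⊗[ℂ] Form D.wt 0 (sOpen σ U) →ₗ[ℂ] D.L0 U :=
  match σ with
  | true => LinearMap.inl ℂ _ _
  | false => LinearMap.inr ℂ _ _

/-- Degree `1` sections of one chirality. -/
def one (σ : Bool) (U : Opens Sphere) : 𝔞 ⊗[ℂ] Form D.wt 1 (sOpen σ U) →ₗ[ℂ] D.L1 U :=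
  match σ with
  | true => LinearMap.inl ℂ _ ℂ ∘ₗ LinearMap.inl ℂ _ _
  | false => LinearMap.inl ℂ _ ℂ ∘ₗ LinearMap.inr ℂ _ _

theorem diffL_zer (t : 𝔞 ⊗[ℂ] Form D.wt 0 (sOpen σ U)) : D.diffL U (D.zer σ U t) =
    D.one σ U (TensorProduct.map LinearMap.id (dolbeault D.wt (sOpen σ U)) t) := by
  cases σ <;> simp [diffL, zer, one] <;> rfl

theorem bracketL_zer_one (s : 𝔞 ⊗[ℂ] Form D.wt 0 (sOpen σ U))
    (t : 𝔞 ⊗[ℂ] Form D.wt 1 (sOpen σ U)) : D.bracketL U (D.zer σ U s) (D.one σ U t) =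
    D.one σ U (D.secBracket _ s t) + (0, D.secCocycle _ s t) := by
  cases σ
  · change D.bracketL U (0, s) ((0, t), 0) =
      ((0, D.secBracket (conjOpen U) s t), 0) + (0, D.secCocycle (conjOpen U) s t)
    simp [bracketL]
  · change D.bracketL U (s, 0) ((t, 0), 0) = ((D.secBracket U s t, 0), 0) + (0, D.secCocycle U s t)
    simp [bracketL]

theorem bracketL_zer_one_ne (h : σ ≠ τ) (s : 𝔞 ⊗[ℂ] Form D.wt 0 (sOpen σ U))
    (t : 𝔞 ⊗[ℂ] Form D.wt 1 (sOpen τ U)) : D.bracketL U (D.zer σ U s) (D.one τ U t) = 0 := by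
  cases σ <;> cases τ
  · exact absurd rfl h
  · change D.bracketL U (0, s) ((t, 0), 0) = 0
    simp [bracketL]
    exact ⟨rfl, rfl⟩
  · change D.bracketL U (s, 0) ((0, t), 0) = 0
    simp [bracketL]
    exact ⟨rfl, rfl⟩
  · exact absurd rfl h

theorem extL1_one_section (h : U ≤ V) (t : 𝔞 ⊗[ℂ] Form D.wt 1 (sOpen σ U)) :
    D.extL1 h (D.one σ U t) =
      D.one σ V (TensorProduct.map LinearMap.id (Form.ext (sOpen_mono σ h)) t) := by
  cases σ <;> simp [extL1, one] <;> rfl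

theorem extL1_extL1 (h : U ≤ V) (h' : V ≤ W) (x : D.L1 U) :
    D.extL1 h' (D.extL1 h x) = D.extL1 (h.trans h') x := by
  have key : ∀ {U V W : Opens Sphere} (h : U ≤ V) (h' : V ≤ W) (t : 𝔞 ⊗[ℂ] Form D.wt 1 U),
      TensorProduct.map LinearMap.id (Form.ext h') (TensorProduct.map LinearMap.id (Form.ext h) t)
        = TensorProduct.map (LinearMap.id : 𝔞 →ₗ[ℂ] 𝔞) (Form.ext (h.trans h')) t := by
    intro U V W h h' t
    rw [← LinearMap.comp_apply, ← TensorProduct.map_comp]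
    rfl
  simp only [extL1, LinearMap.prodMap_apply, key, LinearMap.id_apply]

theorem extCE_extCE (h : U ≤ V) (h' : V ≤ W) (P : D.CE U) :
    D.extCE h' (D.extCE h P) = D.extCE (h.trans h') P := by
  rw [← AlgHom.comp_apply]
  congr 1
  refine SymmetricAlgebra.algHom_ext (LinearMap.ext fun x => ?_)
  change D.extCE h' (D.extCE h (D.sus U x)) = D.extCE (h.trans h') (D.sus U x)
  rw [D.extCE_sus, D.extCE_sus, D.extCE_sus, extL1_extL1]

/-- The class of a chain. -/
def cls (U : Opens Sphere) : D.CE U →ₗ[ℂ] D.UL U := (D.boundaries U).mkQ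

theorem cls_surjective (x : D.UL U) : ∃ P, D.cls U P = x := Submodule.mkQ_surjective _ x

theorem extUL_cls (h : U ≤ V) (P : D.CE U) : D.extUL h (D.cls U P) = D.cls V (D.extCE h P) := rfl

theorem facProd_cls (hU : U ≤ W) (hV : V ≤ W) (h : Disjoint U V) (P : D.CE U) (Q : D.CE V) :
    D.facProd hU hV h (D.cls U P) (D.cls V Q) = D.cls W (D.extCE hU P * D.extCE hV Q) := rfl

theorem cls_mul_sus_central (P : D.CE U) (c : ℂ) :
    D.cls U (P * D.sus U (0, c)) = c • D.cls U P := by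
  have h : D.cls U (P * D.sus U (0, 1) - P) = 0 :=
    (Submodule.Quotient.mk_eq_zero _).2 (Submodule.subset_span (Or.inr ⟨P, rfl⟩))
  rw [map_sub, sub_eq_zero] at h
  rw [show ((0, c) : D.L1 U) = c • (0, 1) by simp, map_smul, mul_smul_comm, map_smul, h]

/-- Exact elements vanish in cohomology. -/
theorem cls_boundary (f : D.L0 U) (l : List (D.L1 U)) :
    D.cls U (D.sus U (D.diffL U f) * (l.map (D.sus U)).prod) = -D.cls U (D.bracketTerm U f l) := by
  rw [eq_neg_iff_add_eq_zero, ← map_add]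
  exact (Submodule.Quotient.mk_eq_zero _).2 (Submodule.subset_span (Or.inl ⟨f, l, rfl⟩))

theorem bracketTerm_eq_zero (f : D.L0 U) (l : List (D.L1 U)) (h : ∀ η ∈ l, D.bracketL U f η = 0) :
    D.bracketTerm U f l = 0 := by
  induction l with
  | nil => rfl
  | cons η l ih =>
    rw [bracketTerm, ih fun η hη => h η (List.mem_cons_of_mem _ hη), h η List.mem_cons_self]
    simp

open Classical in
/-- The suspended form `s(a ⊗ F)` of one chirality, for a coefficient function `F` which defines a
section with compact support in `U`. -/
def ins (σ : Bool) (U : Opens Sphere) (a : 𝔞) (F : ℂ → ℂ) : D.CE U :=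
  if h : F ∈ Form D.wt 1 (sOpen σ U) then D.sus U (D.one σ U (a ⊗ₜ ⟨F, h⟩)) else 0

theorem ins_coe (a : 𝔞) (F : Form D.wt 1 (sOpen σ U)) :
    D.ins σ U a F = D.sus U (D.one σ U (a ⊗ₜ F)) := dif_pos F.2

theorem ins_of_mem (a : 𝔞) {F : ℂ → ℂ} (h : F ∈ Form D.wt 1 (sOpen σ U)) :
    D.ins σ U a F = D.sus U (D.one σ U (a ⊗ₜ ⟨F, h⟩)) := dif_pos h

theorem chiralForm_eq (a : 𝔞) (η : Form D.wt 1 U) : D.chiralForm a η = D.ins true U a η :=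
  (D.ins_coe (σ := true) a η).symm

theorem antiForm_eq (a : 𝔞) (η : Form D.wt 1 (conjOpen U)) :
    D.antiForm a η = D.ins false U a η :=
  (D.ins_coe (σ := false) a η).symm

theorem ins_add_left (a b : 𝔞) (F : ℂ → ℂ) :
    D.ins σ U (a + b) F = D.ins σ U a F + D.ins σ U b F := by
  rw [ins, ins, ins]
  split_ifs
  · rw [TensorProduct.add_tmul, map_add, map_add]
  · simp

theorem ins_smul_left (c : ℂ) (a : 𝔞) (F : ℂ → ℂ) :
    D.ins σ U (c • a) F = c • D.ins σ U a F := by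
  rw [ins, ins]
  split_ifs
  · rw [← TensorProduct.smul_tmul', map_smul, map_smul]
  · simp

theorem ins_add (a : 𝔞) {F G : ℂ → ℂ} (hF : F ∈ Form D.wt 1 (sOpen σ U))
    (hG : G ∈ Form D.wt 1 (sOpen σ U)) :
    D.ins σ U a (F + G) = D.ins σ U a F + D.ins σ U a G := by
  rw [ins_of_mem D a hF, ins_of_mem D a hG, ins_of_mem D a (Submodule.add_mem _ hF hG), ← map_add,
    ← map_add, ← TensorProduct.tmul_add]
  rfl

theorem ins_smul (a : 𝔞) (c : ℂ) {F : ℂ → ℂ} (hF : F ∈ Form D.wt 1 (sOpen σ U)) :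
    D.ins σ U a (c • F) = c • D.ins σ U a F := by
  rw [ins_of_mem D a hF, ins_of_mem D a (Submodule.smul_mem _ c hF), ← map_smul,
    ← map_smul, ← TensorProduct.tmul_smul]
  rfl

theorem ins_sub (a : 𝔞) {F G : ℂ → ℂ} (hF : F ∈ Form D.wt 1 (sOpen σ U))
    (hG : G ∈ Form D.wt 1 (sOpen σ U)) :
    D.ins σ U a (F - G) = D.ins σ U a F - D.ins σ U a G := by
  have := ins_add D a (Submodule.sub_mem _ hF hG) hG
  rw [sub_add_cancel] at this
  rw [this, add_sub_cancel_right]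

theorem extCE_ins (h : U ≤ V) (a : 𝔞) {F : ℂ → ℂ} (hF : F ∈ Form D.wt 1 (sOpen σ U)) :
    D.extCE h (D.ins σ U a F) = D.ins σ V a F := by
  rw [ins_of_mem D a hF, ins_of_mem D a (Form.mono hF (sOpen_mono σ h)), extCE_sus,
    extL1_one_section]
  rfl

theorem ins_dbar (a : 𝔞) (f : Form D.wt 0 (sOpen σ U)) :
    D.ins σ U a (dolbeault D.wt (sOpen σ U) f) = D.sus U (D.diffL U (D.zer σ U (a ⊗ₜ f))) := by
  rw [ins_coe, diffL_zer]
  rfl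

theorem cls_ins_dbar (a : 𝔞) (f : Form D.wt 0 (sOpen σ U)) :
    D.cls U (D.ins σ U a (dolbeault D.wt (sOpen σ U) f)) = 0 := by
  have := D.cls_boundary (D.zer σ U (a ⊗ₜ f)) []
  rw [← ins_dbar] at this
  simpa [bracketTerm] using this

theorem cls_ins_dbar_mul (a b : 𝔞) (f : Form D.wt 0 (sOpen σ U)) (G : Form D.wt 1 (sOpen σ U)) :
    D.cls U (D.ins σ U a (dolbeault D.wt (sOpen σ U) f) * D.ins σ U b G) =
      -(D.cls U (D.ins σ U (D.bracket a b) (D.op _ f G)) +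
        (D.form a b * D.pair _ f G) • D.cls U 1) := by
  have := D.cls_boundary (D.zer σ U (a ⊗ₜ f)) [D.one σ U (b ⊗ₜ G)]
  rw [← ins_dbar] at this
  simp only [List.map_cons, List.map_nil, List.prod_cons, List.prod_nil, mul_one, bracketTerm,
    mul_zero, add_zero] at this
  rw [ins_coe D b G, this, bracketL_zer_one, map_add, map_add]
  have h1 : D.secBracket _ (a ⊗ₜ[ℂ] f) (b ⊗ₜ[ℂ] G) = D.bracket a b ⊗ₜ D.op _ f G := rfl
  have h2 : D.secCocycle _ (a ⊗ₜ[ℂ] f) (b ⊗ₜ[ℂ] G) = D.form a b * D.pair _ f G := by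
    simp [secCocycle]
  have h3 := D.cls_mul_sus_central (U := U) 1 (D.form a b * D.pair _ f G)
  rw [one_mul] at h3
  rw [h1, h2, h3, ← ins_coe]

theorem cls_ins_dbar_mul_of_ne (h : σ ≠ τ) (a b : 𝔞) (f : Form D.wt 0 (sOpen σ U))
    (G : Form D.wt 1 (sOpen τ U)) :
    D.cls U (D.ins σ U a (dolbeault D.wt (sOpen σ U) f) * D.ins τ U b G) = 0 := by
  have := D.cls_boundary (D.zer σ U (a ⊗ₜ f)) [D.one τ U (b ⊗ₜ G)]
  rw [← ins_dbar, bracketTerm_eq_zero] at this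
  · simpa [ins_coe] using this
  · intro η hη
    rw [List.mem_singleton.1 hη, bracketL_zer_one_ne D h]

/-! ### Insertions around open sets -/

/-- Multiplication of classes over `V` with the form `a ⊗ F`, supported in the complement of the
closure of `V`. -/
def opn (σ : Bool) (a : 𝔞) (h : V ≤ W) (F : ℂ → ℂ) : D.UL V →ₗ[ℂ] D.UL W :=
  D.facProd rim_le h rim_disjoint (D.cls _ (D.ins σ (rim V W) a F))

theorem opn_cls (a : 𝔞) (h : V ≤ W) {F : ℂ → ℂ} (hF : F ∈ Form D.wt 1 (sOpen σ (rim V W)))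
    (P : D.CE V) : D.opn σ a h F (D.cls V P) = D.cls W (D.ins σ W a F * D.extCE h P) := by
  rw [opn, facProd_cls, extCE_ins D rim_le a hF]

theorem opn_add_left (a b : 𝔞) (h : V ≤ W) (F : ℂ → ℂ) (x : D.UL V) :
    D.opn σ (a + b) h F x = D.opn σ a h F x + D.opn σ b h F x := by
  rw [opn, ins_add_left, map_add, map_add]; rfl

theorem opn_smul_left (c : ℂ) (a : 𝔞) (h : V ≤ W) (F : ℂ → ℂ) (x : D.UL V) :
    D.opn σ (c • a) h F x = c • D.opn σ a h F x := by
  rw [opn, ins_smul_left, map_smul, map_smul]; rfl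

theorem opn_sub (a : 𝔞) (h : V ≤ W) {F G : ℂ → ℂ} (hF : F ∈ Form D.wt 1 (sOpen σ (rim V W)))
    (hG : G ∈ Form D.wt 1 (sOpen σ (rim V W))) (x : D.UL V) :
    D.opn σ a h (F - G) x = D.opn σ a h F x - D.opn σ a h G x := by
  rw [opn, ins_sub D a hF hG, map_sub, map_sub]; rfl

theorem opn_extUL (a : 𝔞) (h' : U ≤ V) (h : V ≤ W) {F : ℂ → ℂ}
    (hF : F ∈ Form D.wt 1 (sOpen σ (rim V W))) (x : D.UL U) :
    D.opn σ a h F (D.extUL h' x) = D.opn σ a (h'.trans h) F x := by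
  obtain ⟨P, rfl⟩ := D.cls_surjective x
  rw [extUL_cls, opn_cls D a h hF, extCE_extCE,
    opn_cls D a _ (Form.mono hF (sOpen_mono σ (rim_mono h' le_rfl)))]

theorem extUL_opn (a : 𝔞) (h' : U ≤ V) (h : V ≤ W) {F : ℂ → ℂ}
    (hF : F ∈ Form D.wt 1 (sOpen σ (rim U V))) (x : D.UL U) :
    D.extUL h (D.opn σ a h' F x) = D.opn σ a (h'.trans h) F x := by
  obtain ⟨P, rfl⟩ := D.cls_surjective x
  rw [opn_cls D a h' hF, extUL_cls, map_mul, extCE_extCE,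
    extCE_ins D h a (Form.mono hF (sOpen_mono σ rim_le)),
    opn_cls D a _ (Form.mono hF (sOpen_mono σ (rim_mono le_rfl h)))]

theorem opn_dolbeault (a : 𝔞) (h : V ≤ W) (f : Form D.wt 0 (sOpen σ (rim V W))) (x : D.UL V) :
    D.opn σ a h (dolbeault D.wt _ f) x = 0 := by
  rw [opn, cls_ins_dbar, map_zero]; rfl

theorem opn_opn (a b : 𝔞) (h : U ≤ V) (h' : V ≤ W) {F G : ℂ → ℂ}
    (hF : F ∈ Form D.wt 1 (sOpen σ (rim V W))) (hG : G ∈ Form D.wt 1 (sOpen τ (rim U V)))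
    (x : D.UL U) : D.opn σ a h' F (D.opn τ b h G x) =
      D.facProd rim_le (h.trans h') rim_disjoint
        (D.cls _ (D.ins σ (rim U W) a F * D.ins τ (rim U W) b G)) x := by
  obtain ⟨P, rfl⟩ := D.cls_surjective x
  rw [opn_cls D b h hG, opn_cls D a h' hF, facProd_cls, map_mul (D.extCE h'),
    map_mul (D.extCE rim_le), extCE_extCE,
    extCE_ins D h' b (Form.mono hG (sOpen_mono τ rim_le)),
    extCE_ins D rim_le a (Form.mono hF (sOpen_mono σ (rim_mono h le_rfl))),
    extCE_ins D rim_le b (Form.mono hG (sOpen_mono τ (rim_mono le_rfl h'))), mul_assoc]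

end Datum

end

end SphereVA

end

noncomputable section

namespace SphereVA

open Datum

/-! ### Cutoff functions -/

theorem exists_cut (P : ℂ) {r s : ℝ} (hr : 0 < r) (hs : r < s) : ∃ ρ : ℂ → ℂ, ContDiff ℝ ∞ ρ ∧
    HasCompactSupport ρ ∧ tsupport ρ ⊆ Metric.closedBall P s ∧
    ∀ z ∈ Metric.closedBall P r, ρ =ᶠ[𝓝 z] fun _ => 1 := by
  let f : ContDiffBump P := ⟨(r + s) / 2, s, by linarith, by linarith⟩
  have hf : ContDiff ℝ ∞ fun z => ((f z : ℝ) : ℂ) := Complex.ofRealCLM.contDiff.comp f.contDiff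
  have hts : tsupport (fun z => ((f z : ℝ) : ℂ)) ⊆ Metric.closedBall P s := by
    refine closure_minimal (fun z hz => ?_) Metric.isClosed_closedBall
    have : z ∈ Function.support f := fun h => hz (by simp [h])
    rw [f.support_eq] at this
    exact Metric.ball_subset_closedBall this
  refine ⟨_, hf, ?_, hts, fun z hz => ?_⟩
  · exact (isCompact_closedBall P s).of_isClosed_subset (isClosed_tsupport _) hts
  · have hz' : z ∈ Metric.ball P ((r + s) / 2) := by
      rw [Metric.mem_closedBall] at hz
      rw [Metric.mem_ball]
      linarith
    filter_upwards [Metric.isOpen_ball.mem_nhds hz'] with y hy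
    rw [f.one_of_mem_closedBall (Metric.ball_subset_closedBall hy), Complex.ofReal_one]

theorem closure_disc_subset (p : ℂ) (r : ℝ) :
    closure (disc p r : Set Sphere) ⊆ (↑) '' Metric.closedBall p r := by
  refine closure_minimal (Set.image_mono Metric.ball_subset_closedBall) ?_
  exact ((isCompact_closedBall p r).image OnePoint.continuous_coe).isClosed

theorem mem_disc_iff {p z : ℂ} {R : ℝ} : (z : Sphere) ∈ disc p R ↔ ‖z - p‖ < R := by
  rw [← dist_eq_norm]
  constructor
  · rintro ⟨y, hy, e⟩
    rwa [← OnePoint.coe_injective e]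
  · exact fun h => ⟨z, h, rfl⟩

theorem norm_le_of_mem_closure_disc {p z : ℂ} {r : ℝ}
    (h : (z : Sphere) ∈ closure (disc p r : Set Sphere)) : ‖z - p‖ ≤ r := by
  obtain ⟨y, hy, e⟩ := closure_disc_subset p r h
  rw [← OnePoint.coe_injective e, ← dist_eq_norm]
  exact hy

theorem exists_closedBall_subset {p : ℂ} {U : Opens Sphere} (hp : (p : Sphere) ∈ U) :
    ∃ s : ℝ, 0 < s ∧ ∀ z : ℂ, ‖z - p‖ ≤ s → (z : Sphere) ∈ U := by
  have h : ((↑) : ℂ → Sphere) ⁻¹' U ∈ 𝓝 p :=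
    (U.isOpen.preimage OnePoint.continuous_coe).mem_nhds hp
  obtain ⟨s, hs, h⟩ := Metric.nhds_basis_closedBall.mem_iff.1 h
  exact ⟨s, hs, fun z hz => h (by rwa [Metric.mem_closedBall, dist_eq_norm])⟩

theorem norm_ev_sub_ev (σ : Bool) (z w : ℂ) : ‖ev σ z - ev σ w‖ = ‖z - w‖ := by
  rw [← ev_sub, norm_ev]

/-- A cutoff function with compact support over `U`, which equals `1` near the closure of `V`. -/
structure Fits (σ : Bool) (V U : Opens Sphere) (ρ : ℂ → ℂ) : Prop where
  smooth : ContDiff ℝ ∞ ρ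
  compact : HasCompactSupport ρ
  subset : ∀ z ∈ tsupport ρ, ((ev σ z : ℂ) : Sphere) ∈ U
  eq_one : ∀ z : ℂ, ((ev σ z : ℂ) : Sphere) ∈ closure (V : Set Sphere) → ρ =ᶠ[𝓝 z] fun _ => 1

section

variable {σ τ : Bool} {U V W U' V' : Opens Sphere} {ρ ρ' h χ : ℂ → ℂ} {p : ℂ}

theorem exists_fits_of_closedBall {s r : ℝ} (hr : 0 < r) (hs : r < s)
    (hU : ∀ z : ℂ, ‖z - p‖ ≤ s → (z : Sphere) ∈ U) : ∃ ρ, Fits σ (disc p r) U ρ := by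
  obtain ⟨ρ, h1, h2, h3, h4⟩ := exists_cut (ev σ p) hr hs
  refine ⟨ρ, h1, h2, fun z hz => hU _ ?_, fun z hz => h4 z ?_⟩
  · have := h3 hz
    rwa [Metric.mem_closedBall, dist_eq_norm, ← norm_ev_sub_ev σ, ev_ev] at this
  · rw [Metric.mem_closedBall, dist_eq_norm, ← norm_ev_sub_ev σ, ev_ev]
    exact norm_le_of_mem_closure_disc hz

theorem exists_fits (σ : Bool) (hp : (p : Sphere) ∈ U) : ∃ V ρ, (p : Sphere) ∈ V ∧ V ≤ U ∧ Fits σ V U ρ := by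
  obtain ⟨s, hs, h⟩ := exists_closedBall_subset hp
  obtain ⟨ρ, hρ⟩ := exists_fits_of_closedBall (σ := σ) (half_pos hs) (half_lt_self hs) h
  refine ⟨_, ρ, mem_disc (half_pos hs), ?_, hρ⟩
  rintro _ ⟨z, hz, rfl⟩
  refine h z ?_
  rw [Metric.mem_ball, dist_eq_norm] at hz
  linarith

namespace Fits

theorem mono (hρ : Fits σ V U ρ) (hV : V' ≤ V) (hU : U ≤ U') : Fits σ V' U' ρ :=
  ⟨hρ.smooth, hρ.compact, fun z hz => hU (hρ.subset z hz),
    fun z hz => hρ.eq_one z (closure_mono hV hz)⟩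

theorem mem_rim (hρ : Fits σ V U ρ) {z : ℂ} (hz : z ∈ crit ρ) : (z : Sphere) ∈ sOpen σ (rim V U) :=
  (mem_sOpen z).2 ⟨hρ.subset z (crit_subset hz), fun hn =>
    notMem_crit_of_eventuallyEq (hρ.eq_one z hn) hz⟩

theorem sh_mem (hρ : Fits σ V U ρ) (hh : ∀ z ∈ crit ρ, AnalyticAt ℂ h z) (w : ℕ) :
    sh h ρ ∈ Form w 1 (sOpen σ (rim V U)) :=
  sh_mem_form hρ.smooth hρ.compact fun z hz => ⟨hh z hz, hρ.mem_rim hz⟩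

theorem eq_one_center (hρ : Fits σ V U ρ) (hp : (p : Sphere) ∈ V) : ρ =ᶠ[𝓝 (ev σ p)] fun _ => 1 :=
  hρ.eq_one _ (by rw [ev_ev]; exact subset_closure hp)

theorem analyticAt_zpow (hρ : Fits σ V U ρ) (hp : (p : Sphere) ∈ V) (n : ℤ) {z : ℂ}
    (hz : z ∈ crit ρ) : AnalyticAt ℂ (fun z => (z - ev σ p) ^ n) z :=
  analyticAt_zpow_sub n (ne_of_mem_crit (hρ.eq_one_center hp) hz)

theorem zpow_mem (hρ : Fits σ V U ρ) (hp : (p : Sphere) ∈ V) (n : ℤ) (w : ℕ) :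
    sh (fun z => (z - ev σ p) ^ n) ρ ∈ Form w 1 (sOpen σ (rim V U)) :=
  hρ.sh_mem (fun _ => hρ.analyticAt_zpow hp n) w

theorem sub_mem_rim (hρ : Fits σ V U ρ) (hρ' : Fits σ V U ρ') {z : ℂ} (hz : z ∈ tsupport (ρ - ρ')) :
    ((ev σ z : ℂ) : Sphere) ∈ rim V U := by
  refine ⟨?_, fun hn => ?_⟩
  · rcases tsupport_sub ρ ρ' hz with h | h
    · exact hρ.subset z h
    · exact hρ'.subset z h
  · have : ρ - ρ' =ᶠ[𝓝 z] 0 := by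
      filter_upwards [hρ.eq_one z hn, hρ'.eq_one z hn] with y h1 h2
      simp [h1, h2]
    exact notMem_tsupport_iff_eventuallyEq.2 this hz

theorem ne_center (hp : (p : Sphere) ∈ V) {z : ℂ} (hz : ((ev σ z : ℂ) : Sphere) ∈ rim V U) :
    z ≠ ev σ p := by
  rintro rfl
  rw [ev_ev] at hz
  exact hz.2 (subset_closure hp)

end Fits

/-- The primitive `-h χ` of the form `-h ∂̄χ`. -/
def primitive {A : Opens Sphere} (w : ℕ) (hχ : ContDiff ℝ ∞ χ) (hc : HasCompactSupport χ)
    (hh : ∀ z ∈ tsupport χ, AnalyticAt ℂ h z ∧ (z : Sphere) ∈ A) : Form w 0 A :=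
  ⟨fun z => -h z * χ z, mem_form_of_compact
    (contDiff_hol_mul hχ fun z hz => (hh z hz).1.neg)
    (HasCompactSupport.of_subset hc tsupport_mul_subset_of_right)
    fun z hz => (hh z (tsupport_mul_subset_of_right hz)).2⟩

theorem dolbeault_primitive {A : Opens Sphere} (w : ℕ) (hχ : ContDiff ℝ ∞ χ)
    (hc : HasCompactSupport χ) (hh : ∀ z ∈ tsupport χ, AnalyticAt ℂ h z ∧ (z : Sphere) ∈ A) :
    (dolbeault w A (primitive w hχ hc hh) : ℂ → ℂ) = sh h χ := by
  funext z
  change dbar (fun z => (-h) z * χ z) z = _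
  rw [dbar_hol_mul hχ (fun z hz => (hh z hz).1.neg), sh, Pi.neg_apply, neg_mul]

variable {𝔞 : Type*} [AddCommGroup 𝔞] [Module ℂ 𝔞] (D : Datum 𝔞)

theorem opn_sh_eq_zero (a : 𝔞) (hVU : V ≤ U) (hχ : ContDiff ℝ ∞ χ) (hc : HasCompactSupport χ)
    (hh : ∀ z ∈ tsupport χ, AnalyticAt ℂ h z ∧ ((ev σ z : ℂ) : Sphere) ∈ rim V U) (x : D.UL V) :
    D.opn σ a hVU (sh h χ) x = 0 := by
  have hh' : ∀ z ∈ tsupport χ, AnalyticAt ℂ h z ∧ (z : Sphere) ∈ sOpen σ (rim V U) :=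
    fun z hz => ⟨(hh z hz).1, (mem_sOpen z).2 (hh z hz).2⟩
  rw [← dolbeault_primitive D.wt hχ hc hh', opn_dolbeault]

theorem opn_sh_congr (a : 𝔞) (hVU : V ≤ U) (hρ : Fits σ V U ρ) (hρ' : Fits σ V U ρ')
    (hh : ∀ z : ℂ, ((ev σ z : ℂ) : Sphere) ∈ rim V U → AnalyticAt ℂ h z) (x : D.UL V) :
    D.opn σ a hVU (sh h ρ) x = D.opn σ a hVU (sh h ρ') x := by
  have key : ∀ {ρ}, Fits σ V U ρ → sh h ρ ∈ Form D.wt 1 (sOpen σ (rim V U)) := fun hρ =>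
    hρ.sh_mem (fun z hz => hh z ((mem_sOpen z).1 (hρ.mem_rim hz))) _
  rw [← sub_eq_zero, ← opn_sub D a hVU (key hρ) (key hρ'), ← sh_sub hρ.smooth hρ'.smooth]
  exact opn_sh_eq_zero D a hVU (hρ.smooth.sub hρ'.smooth) (hρ.compact.sub hρ'.compact)
    (fun z hz => ⟨hh z (hρ.sub_mem_rim hρ' hz), hρ.sub_mem_rim hρ' hz⟩) x

/-! ### Germs of observables at a point -/

/-- Compatible families of elements of a system of modules. -/
def compatible {I : Type*} {E : I → Type*} [∀ i, AddCommGroup (E i)] [∀ i, Module ℂ (E i)]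
    (r : I → I → Prop) (f : ∀ i j, r i j → E i →ₗ[ℂ] E j) : Submodule ℂ (∀ i, E i) where
  carrier := {x | ∀ i j h, f i j h (x i) = x j}
  zero_mem' i j h := map_zero _
  add_mem' hx hy i j h := by rw [Pi.add_apply, map_add, hx i j h, hy i j h]; rfl
  smul_mem' c x hx i j h := by rw [Pi.smul_apply, map_smul, hx i j h]; rfl

/-- The components of compatible families. -/
def compatibleProj {I : Type*} {E : I → Type*} [∀ i, AddCommGroup (E i)] [∀ i, Module ℂ (E i)]
    (r : I → I → Prop) (f : ∀ i j, r i j → E i →ₗ[ℂ] E j) (i : I) : compatible r f →ₗ[ℂ] E i :=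
  LinearMap.proj i ∘ₗ (compatible r f).subtype

namespace Datum

/-- Compatible families of classes over the neighbourhoods of a point. -/
def Germ (p : ℂ) : Type _ :=
  compatible (E := fun U : {U : Opens Sphere // (p : Sphere) ∈ U} => D.UL U.1)
    (fun U V => U.1 ≤ V.1) fun _ _ h => D.extUL h

instance : AddCommGroup (D.Germ p) := inferInstanceAs (AddCommGroup (compatible _ _))

instance : Module ℂ (D.Germ p) := inferInstanceAs (Module ℂ (compatible _ _))

variable {D}

/-- The value of a germ over a neighbourhood. -/
def Germ.val (U : Opens Sphere) (hp : (p : Sphere) ∈ U) : D.Germ p →ₗ[ℂ] D.UL U :=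
  compatibleProj (E := fun U : {U : Opens Sphere // (p : Sphere) ∈ U} => D.UL U.1)
    (fun U V => U.1 ≤ V.1) (fun _ _ h => D.extUL h) ⟨U, hp⟩

theorem Germ.extUL_val (x : D.Germ p) (hp : (p : Sphere) ∈ U) (h : U ≤ V) :
    D.extUL h (val U hp x) = val V (h hp) x := x.2 ⟨U, hp⟩ ⟨V, h hp⟩ h

theorem Germ.ext_val {x y : D.Germ p} (h : ∀ U hp, val U hp x = val U hp y) : x = y :=
  Subtype.ext (funext fun U => h U.1 U.2)

/-- The germ with given values. -/
def Germ.mk (y : ∀ (U : Opens Sphere), (p : Sphere) ∈ U → D.UL U)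
    (hy : ∀ (U V : Opens Sphere) (hp : (p : Sphere) ∈ U) (h : U ≤ V),
      D.extUL h (y U hp) = y V (h hp)) : D.Germ p :=
  ⟨fun U => y U.1 U.2, fun U V h => hy U.1 V.1 U.2 h⟩

theorem Germ.val_mk (y : ∀ (U : Opens Sphere), (p : Sphere) ∈ U → D.UL U)
    (hy : ∀ (U V : Opens Sphere) (hp : (p : Sphere) ∈ U) (h : U ≤ V),
      D.extUL h (y U hp) = y V (h hp)) (hp : (p : Sphere) ∈ U) :
    Germ.val U hp (Germ.mk y hy : D.Germ p) = y U hp := rfl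

theorem opn_val_congr (n : ℤ) (a : 𝔞) (x : D.Germ p) {V' : Opens Sphere} (hp : (p : Sphere) ∈ V)
    (hp' : (p : Sphere) ∈ V') (hV : V ≤ U) (hV' : V' ≤ U) (hρ : Fits σ V U ρ) (hρ' : Fits σ V' U ρ') :
    D.opn σ a hV (sh (fun z => (z - ev σ p) ^ n) ρ) (Germ.val V hp x) =
      D.opn σ a hV' (sh (fun z => (z - ev σ p) ^ n) ρ') (Germ.val V' hp' x) := by
  have hp'' : (p : Sphere) ∈ V ⊓ V' := ⟨hp, hp'⟩
  rw [← x.extUL_val hp'' inf_le_left, ← x.extUL_val hp'' inf_le_right,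
    opn_extUL D a _ _ (hρ.zpow_mem hp n _), opn_extUL D a _ _ (hρ'.zpow_mem hp' n _)]
  exact opn_sh_congr D a _ (hρ.mono inf_le_left le_rfl) (hρ'.mono inf_le_right le_rfl)
    (fun z hz => analyticAt_zpow_sub n (Fits.ne_center hp'' hz)) _

/-- A choice of an inner neighbourhood and of a cutoff function. -/
def innerOpen (σ : Bool) (hp : (p : Sphere) ∈ U) : Opens Sphere := (exists_fits σ hp).choose

def innerCut (σ : Bool) (hp : (p : Sphere) ∈ U) : ℂ → ℂ := (exists_fits σ hp).choose_spec.choose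

theorem mem_innerOpen (σ : Bool) (hp : (p : Sphere) ∈ U) : (p : Sphere) ∈ innerOpen σ hp :=
  (exists_fits σ hp).choose_spec.choose_spec.1

theorem innerOpen_le (σ : Bool) (hp : (p : Sphere) ∈ U) : innerOpen σ hp ≤ U :=
  (exists_fits σ hp).choose_spec.choose_spec.2.1

theorem fits_innerCut (σ : Bool) (hp : (p : Sphere) ∈ U) :
    Fits σ (innerOpen σ hp) U (innerCut σ hp) :=
  (exists_fits σ hp).choose_spec.choose_spec.2.2

/-- The action of a mode on germs: surround the germ by a shell. -/
def germApply (σ : Bool) (n : ℤ) (a : 𝔞) (x : D.Germ p) : D.Germ p :=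
  Germ.mk (fun U hp => D.opn σ a (innerOpen_le σ hp)
      (sh (fun z => (z - ev σ p) ^ n) (innerCut σ hp)) (Germ.val _ (mem_innerOpen σ hp) x))
    fun U V hp h => by
      rw [extUL_opn D a _ _ ((fits_innerCut σ hp).zpow_mem (mem_innerOpen σ hp) n _)]
      exact opn_val_congr n a x _ _ _ _ ((fits_innerCut σ hp).mono le_rfl h)
        (fits_innerCut σ (h hp))

/-- The action of a mode on germs, as a bilinear map. -/
def germOp (σ : Bool) (n : ℤ) : 𝔞 →ₗ[ℂ] D.Germ p →ₗ[ℂ] D.Germ p :=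
  LinearMap.mk₂ ℂ (germApply σ n)
    (fun a b x => Germ.ext_val fun U hp => by
      rw [map_add]; exact opn_add_left D a b _ _ _)
    (fun c a x => Germ.ext_val fun U hp => by
      rw [map_smul]; exact opn_smul_left D c a _ _ _)
    (fun a x y => Germ.ext_val fun U hp => by
      rw [map_add, germApply, Germ.val_mk, map_add, map_add]; rfl)
    (fun c a x => Germ.ext_val fun U hp => by
      rw [map_smul, germApply, Germ.val_mk, map_smul, map_smul]; rfl)

theorem germOp_val (n : ℤ) (a : 𝔞) (x : D.Germ p) (hp : (p : Sphere) ∈ V) (hV : V ≤ U)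
    (hρ : Fits σ V U ρ) : Germ.val U (hV hp) (germOp σ n a x) =
      D.opn σ a hV (sh (fun z => (z - ev σ p) ^ n) ρ) (Germ.val V hp x) :=
  opn_val_congr n a x _ _ _ _ (fits_innerCut σ (hV hp)) hρ

/-- Two successive modes, as one product. -/
theorem germOp_germOp_val (m n : ℤ) (a b : 𝔞) (x : D.Germ p) (hp : (p : Sphere) ∈ V) (hV : V ≤ W)
    (hW : W ≤ U) (hρ : Fits τ V W ρ) (hρ' : Fits σ W U ρ') :
    Germ.val U (hW (hV hp)) (germOp σ m a (germOp τ n b x)) =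
      D.facProd rim_le (hV.trans hW) rim_disjoint
        (D.cls _ (D.ins σ (rim V U) a (sh (fun z => (z - ev σ p) ^ m) ρ') *
          D.ins τ (rim V U) b (sh (fun z => (z - ev τ p) ^ n) ρ))) (Germ.val V hp x) := by
  rw [germOp_val m a _ (hV hp) hW hρ', germOp_val n b x hp hV hρ,
    opn_opn D a b hV hW (hρ'.zpow_mem (hV hp) m _) (hρ.zpow_mem hp n _)]

theorem facProd_cls_one (hV : V ≤ U) (x : D.UL V) :
    D.facProd rim_le hV rim_disjoint (D.cls (rim V U) 1) x = D.extUL hV x := by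
  obtain ⟨P, rfl⟩ := D.cls_surjective x
  rw [facProd_cls, extUL_cls, map_one (D.extCE rim_le), one_mul]

theorem exists_fits_three (σ τ : Bool) (hp : (p : Sphere) ∈ U) : ∃ V₁ V₂ V₃ ρ₁ ρ₂ ρ₃,
    (p : Sphere) ∈ V₁ ∧ V₁ ≤ V₂ ∧ V₂ ≤ V₃ ∧ V₃ ≤ U ∧
    Fits σ V₁ V₂ ρ₁ ∧ Fits τ V₂ V₃ ρ₂ ∧ Fits σ V₃ U ρ₃ := by
  obtain ⟨V₃, ρ₃, h3, l3, f3⟩ := exists_fits σ hp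
  obtain ⟨V₂, ρ₂, h2, l2, f2⟩ := exists_fits τ h3
  obtain ⟨V₁, ρ₁, h1, l1, f1⟩ := exists_fits σ h2
  exact ⟨V₁, V₂, V₃, ρ₁, ρ₂, ρ₃, h1, l1, l2, l3, f1, f2, f3⟩

theorem cls_ins_sub_mul (a : 𝔞) {F G : ℂ → ℂ} (hF : F ∈ Form D.wt 1 (sOpen σ U))
    (hG : G ∈ Form D.wt 1 (sOpen σ U)) (Q : D.CE U) :
    D.cls U (D.ins σ U a F * Q) - D.cls U (Q * D.ins σ U a G) =
      D.cls U (D.ins σ U a (F - G) * Q) := by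
  rw [ins_sub D a hF hG, sub_mul, map_sub, mul_comm Q]

theorem facProd_sub_left (hU : U ≤ W) (hV : V ≤ W) (h : Disjoint U V) (x y : D.UL U) (v : D.UL V) :
    D.facProd hU hV h x v - D.facProd hU hV h y v = D.facProd hU hV h (x - y) v := by
  rw [map_sub]; rfl

theorem facProd_add_smul_left (hU : U ≤ W) (hV : V ≤ W) (h : Disjoint U V) (c d : ℂ)
    (x y : D.UL U) (v : D.UL V) : D.facProd hU hV h (c • x + d • y) v =
      c • D.facProd hU hV h x v + d • D.facProd hU hV h y v := by
  rw [map_add, map_smul, map_smul]; rfl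

/-- The difference of the actions of two modes in opposite orders: the shell of the first mode is
moved across the shell of the second mode. -/
theorem germOp_commutator (m n : ℤ) (a b : 𝔞) (x : D.Germ p) {V₁ V₂ V₃ : Opens Sphere}
    {ρ₁ ρ₂ ρ₃ : ℂ → ℂ} (hp : (p : Sphere) ∈ V₁) (l1 : V₁ ≤ V₂) (l2 : V₂ ≤ V₃) (l3 : V₃ ≤ U)
    (f1 : Fits σ V₁ V₂ ρ₁) (f2 : Fits τ V₂ V₃ ρ₂) (f3 : Fits σ V₃ U ρ₃) :
    Germ.val U (l3 (l2 (l1 hp))) (germOp σ m a (germOp τ n b x)) -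
      Germ.val U (l3 (l2 (l1 hp))) (germOp τ n b (germOp σ m a x)) =
      D.facProd rim_le (l1.trans (l2.trans l3)) rim_disjoint
        (D.cls _ (D.ins σ (rim V₁ U) a (sh (fun z => (z - ev σ p) ^ m) (ρ₃ - ρ₁)) *
          D.ins τ (rim V₁ U) b (sh (fun z => (z - ev τ p) ^ n) ρ₂))) (Germ.val V₁ hp x) := by
  have hl : V₁ ≤ V₃ := l1.trans l2
  rw [germOp_germOp_val m n a b x hp hl l3 (f2.mono l1 le_rfl) f3,
    germOp_germOp_val n m b a x hp l1 (l2.trans l3) f1 (f2.mono le_rfl l3),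
    facProd_sub_left, cls_ins_sub_mul a ((f3.mono hl le_rfl).zpow_mem hp m _)
      ((f1.mono le_rfl (l2.trans l3)).zpow_mem hp m _), sh_sub f3.smooth f1.smooth]

theorem tsupport_sub_crossing {V₁ V₂ V₃ : Opens Sphere} {ρ₁ ρ₃ : ℂ → ℂ} (m : ℤ)
    (hp : (p : Sphere) ∈ V₁) (l1 : V₁ ≤ V₂) (l2 : V₂ ≤ V₃) (l3 : V₃ ≤ U)
    (f1 : Fits σ V₁ V₂ ρ₁) (f3 : Fits σ V₃ U ρ₃) :
    ∀ z ∈ tsupport (ρ₃ - ρ₁), AnalyticAt ℂ (fun z => (z - ev σ p) ^ m) z ∧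
      (z : Sphere) ∈ sOpen σ (rim V₁ U) := fun z hz => by
  have := (f3.mono (l1.trans l2) le_rfl).sub_mem_rim (f1.mono le_rfl (l2.trans l3)) hz
  exact ⟨analyticAt_zpow_sub m (Fits.ne_center hp this), (mem_sOpen z).2 this⟩

theorem cls_crossing (hG : D.Geometric) (m n : ℤ) (a b : 𝔞) {V₁ V₂ V₃ : Opens Sphere}
    {ρ₁ ρ₂ ρ₃ : ℂ → ℂ} (hp : (p : Sphere) ∈ V₁) (l1 : V₁ ≤ V₂) (l2 : V₂ ≤ V₃) (l3 : V₃ ≤ U)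
    (f1 : Fits σ V₁ V₂ ρ₁) (f2 : Fits σ V₂ V₃ ρ₂) (f3 : Fits σ V₃ U ρ₃) :
    D.cls (rim V₁ U) (D.ins σ (rim V₁ U) a (sh (fun z => (z - ev σ p) ^ m) (ρ₃ - ρ₁)) *
        D.ins σ (rim V₁ U) b (sh (fun z => (z - ev σ p) ^ n) ρ₂)) =
      D.e m n • D.cls (rim V₁ U) (D.ins σ (rim V₁ U) (D.bracket a b)
        (sh (fun z => (z - ev σ p) ^ (m + n - D.wt)) ρ₂)) +
      (D.e' m n * D.form a b) • D.cls (rim V₁ U) 1 := by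
  have hc := tsupport_sub_crossing m hp l1 l2 l3 f1 f3
  have hs : ContDiff ℝ ∞ (ρ₃ - ρ₁) := f3.smooth.sub f1.smooth
  have hcp := f3.compact.sub f1.compact
  have f2' : Fits σ V₁ U ρ₂ := f2.mono l1 l3
  rw [← dolbeault_primitive D.wt hs hcp hc]
  set f := primitive D.wt hs hcp hc with hfdef
  have hcrit : ∀ z ∈ crit ρ₂, (f : ℂ → ℂ) =ᶠ[𝓝 z] fun z => -(z - ev σ p) ^ m := by
    intro z hz
    have e3 := f3.eq_one z (subset_closure (f2.subset z (crit_subset hz)))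
    have e1 : ρ₁ =ᶠ[𝓝 z] 0 := by
      refine notMem_tsupport_iff_eventuallyEq.1 fun hn => ?_
      exact notMem_crit_of_eventuallyEq (f2.eq_one z (subset_closure (f1.subset z hn))) hz
    filter_upwards [e3, e1] with y h3 h1
    change -(y - ev σ p) ^ m * (ρ₃ y - ρ₁ y) = _
    rw [h3, h1]
    simp
  have hone := f2'.eq_one_center hp
  obtain ⟨η, hη⟩ : ∃ η : Form D.wt 1 (sOpen σ (rim V₁ U)),
      (η : ℂ → ℂ) = sh (fun z => (z - ev σ p) ^ n) ρ₂ := ⟨⟨_, f2'.zpow_mem hp n D.wt⟩, rfl⟩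
  obtain ⟨g, hg⟩ := hG.op_shell _ _ m n ρ₂ f2'.smooth f2'.compact hone
    (fun z hz => f2'.mem_rim hz) f η hη hcrit
  have hpair := hG.pair_shell _ _ m n ρ₂ f2'.smooth f2'.compact hone
    (fun z hz => f2'.mem_rim hz) f η hη hcrit
  have key := cls_ins_dbar_mul D a b f η
  rw [hpair, hg, ins_add D _ (Submodule.smul_mem _ _ (f2'.zpow_mem hp _ _)) (Subtype.prop _),
    ins_smul D _ _ (f2'.zpow_mem hp _ _), map_add, cls_ins_dbar, add_zero, map_smul, hη] at key
  rw [key]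
  module

theorem germOp_same (hG : D.Geometric) (σ : Bool) (m n : ℤ) (a b : 𝔞) (x : D.Germ p)
    (hp : (p : Sphere) ∈ U) :
    Germ.val U hp (germOp σ m a (germOp σ n b x)) - Germ.val U hp (germOp σ n b (germOp σ m a x)) =
      D.e m n • Germ.val U hp (germOp σ (m + n - D.wt) (D.bracket a b) x) +
        (D.e' m n * D.form a b) • Germ.val U hp x := by
  obtain ⟨V₁, V₂, V₃, ρ₁, ρ₂, ρ₃, h1, l1, l2, l3, f1, f2, f3⟩ := exists_fits_three σ σ hp
  rw [germOp_commutator m n a b x h1 l1 l2 l3 f1 f2 f3,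
    cls_crossing hG m n a b h1 l1 l2 l3 f1 f2 f3, facProd_add_smul_left, facProd_cls_one,
    x.extUL_val, germOp_val _ _ x h1 (l1.trans (l2.trans l3)) (f2.mono l1 l3), opn]

theorem germOp_diff (hστ : σ ≠ τ) (m n : ℤ) (a b : 𝔞) (x : D.Germ p) (hp : (p : Sphere) ∈ U) :
    Germ.val U hp (germOp σ m a (germOp τ n b x)) =
      Germ.val U hp (germOp τ n b (germOp σ m a x)) := by
  obtain ⟨V₁, V₂, V₃, ρ₁, ρ₂, ρ₃, h1, l1, l2, l3, f1, f2, f3⟩ := exists_fits_three σ τ hp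
  have hc := tsupport_sub_crossing m h1 l1 l2 l3 f1 f3
  have hs : ContDiff ℝ ∞ (ρ₃ - ρ₁) := f3.smooth.sub f1.smooth
  have hcp := f3.compact.sub f1.compact
  have key := cls_ins_dbar_mul_of_ne D hστ a b (primitive D.wt hs hcp hc)
    ⟨_, (f2.mono l1 l3).zpow_mem h1 n D.wt⟩
  rw [← sub_eq_zero, germOp_commutator m n a b x h1 l1 l2 l3 f1 f2 f3,
    ← dolbeault_primitive D.wt hs hcp hc, key, map_zero]
  rfl

/-- The germs at a point are a representation of the Lie algebras of modes. -/
def germRep (hG : D.Geometric) (p : ℂ) : D.ModeRep (D.Germ p) where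
  op := germOp
  same σ m n a b x := Germ.ext_val fun U hp => by
    rw [(Germ.val U hp).map_sub, germOp_same hG σ m n a b x hp, (Germ.val U hp).map_add,
      (Germ.val U hp).map_smul, (Germ.val U hp).map_smul]
  diff _ _ h m n a b x := Germ.ext_val fun _ hp => germOp_diff h m n a b x hp

/-- The germ of the empty product. -/
def germVac (p : ℂ) : D.Germ p := Germ.mk (fun U _ => D.cls U 1) fun U V _ h => by
  rw [extUL_cls, map_one (D.extCE h)]

theorem germOp_germVac (n : ℕ) (a : 𝔞) : germOp σ n a (germVac p : D.Germ p) = 0 := by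
  refine Germ.ext_val fun U hp => ?_
  obtain ⟨V, ρ, h1, l1, f1⟩ := exists_fits σ hp
  have ha : ∀ z, AnalyticAt ℂ (fun z => (z - ev σ p) ^ (n : ℤ)) z := fun z => by
    simp only [zpow_natCast]
    fun_prop
  have hc : ∀ z ∈ tsupport ρ, AnalyticAt ℂ (fun z => (z - ev σ p) ^ (n : ℤ)) z ∧
      (z : Sphere) ∈ sOpen σ U := fun z hz => ⟨ha z, (mem_sOpen z).2 (f1.subset z hz)⟩
  rw [germOp_val _ a _ h1 l1 f1]
  change D.opn σ a l1 _ (D.cls V 1) = 0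
  rw [opn_cls D a l1 (f1.zpow_mem h1 _ _), map_one (D.extCE l1), mul_one,
    ← dolbeault_primitive D.wt f1.smooth f1.compact hc, cls_ins_dbar]

theorem exists_germMap (hG : D.Geometric) (p : ℂ) : ∃ F : D.State →ₗ[ℂ] D.Germ p,
    F D.vacuum = germVac p ∧ ∀ σ n a s, F (D.act σ n a s) = germOp σ n a (F s) :=
  exists_equivariant D (germRep hG p) fun _ n a => germOp_germVac n a

/-- The germ of a state at a point. -/
def germMap (hG : D.Geometric) (p : ℂ) : D.State →ₗ[ℂ] D.Germ p := (exists_germMap hG p).choose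

/-- The preparation of states at points. -/
def prepare (hG : D.Geometric) : D.Preparation := fun _ U hp => Germ.val U hp ∘ₗ germMap hG _

section

variable (hG : D.Geometric)

theorem prepare_eq (hp : (p : Sphere) ∈ U) (A : D.State) :
    prepare hG p U hp A = Germ.val U hp (germMap hG p A) := rfl

theorem prepare_vacuum (hp : (p : Sphere) ∈ U) : prepare hG p U hp D.vacuum = D.cls U 1 := by
  rw [prepare_eq, germMap, (exists_germMap hG p).choose_spec.1]
  rfl

theorem extUL_prepare (hp : (p : Sphere) ∈ U) (h : U ≤ V) (A : D.State) :
    D.extUL h (prepare hG p U hp A) = prepare hG p V (h hp) A :=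
  (germMap hG p A).extUL_val hp h

theorem prepare_act (n : ℤ) (a : 𝔞) (A : D.State) (hp : (p : Sphere) ∈ V) (hV : V ≤ U)
    (hρ : Fits σ V U ρ) : prepare hG p U (hV hp) (D.act σ n a A) =
      D.opn σ a hV (sh (fun z => (z - ev σ p) ^ n) ρ) (prepare hG p V hp A) := by
  rw [prepare_eq, germMap, (exists_germMap hG p).choose_spec.2, germOp_val n a _ hp hV hρ]
  rfl

end

end Datum

end

end SphereVA

end

noncomputable section

namespace SphereVA

open Datum

theorem norm_sub_ev (σ : Bool) (z p : ℂ) : ‖ev σ z - p‖ = ‖z - ev σ p‖ := by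
  rw [← norm_ev_sub_ev σ, ev_ev]

/-- Nested lists of cutoff functions around `P`, starting inside of `S`. -/
def NestIn {X : Type*} (P : ℂ) : Set ℂ → List (X × (ℂ → ℂ)) → Prop
  | _, [] => True
  | S, x :: L => ContDiff ℝ ∞ x.2 ∧ HasCompactSupport x.2 ∧ (x.2 =ᶠ[𝓝 P] fun _ => 1) ∧
      tsupport x.2 ⊆ S ∧ NestIn P (interior {z | x.2 z = 1}) L

namespace NestIn

variable {X : Type*} {P : ℂ} {S S' : Set ℂ} {L : List (X × (ℂ → ℂ))}

theorem mono (hL : NestIn P S L) (h : S ⊆ S') : NestIn P S' L := by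
  cases L with
  | nil => trivial
  | cons x L => exact ⟨hL.1, hL.2.1, hL.2.2.1, hL.2.2.2.1.trans h, hL.2.2.2.2⟩

theorem interior_subset (ρ : ℂ → ℂ) : interior {z | ρ z = 1} ⊆ tsupport ρ := fun z hz =>
  subset_closure (by
    have h : z ∈ {z | ρ z = 1} := _root_.interior_subset hz
    simp [show ρ z = 1 from h])

theorem smooth_of_mem (hL : NestIn P S L) {x : X × (ℂ → ℂ)} (hx : x ∈ L) :
    ContDiff ℝ ∞ x.2 ∧ HasCompactSupport x.2 ∧ (x.2 =ᶠ[𝓝 P] fun _ => 1) ∧ tsupport x.2 ⊆ S := by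
  induction L generalizing S with
  | nil => exact absurd hx List.not_mem_nil
  | cons y L ih =>
    rcases List.mem_cons.1 hx with rfl | hx
    · exact ⟨hL.1, hL.2.1, hL.2.2.1, hL.2.2.2.1⟩
    · have := ih hL.2.2.2.2 hx
      exact ⟨this.1, this.2.1, this.2.2.1, this.2.2.2.trans
        ((interior_subset y.2).trans hL.2.2.2.1)⟩

theorem exists_ball (hL : NestIn P S L) :
    ∃ r : ℝ, 0 < r ∧ ∀ x ∈ L, Metric.closedBall P r ⊆ interior {z | x.2 z = 1} := by
  have h : (⋂ x ∈ {x | x ∈ L}, interior {z | x.2 z = 1}) ∈ 𝓝 P := by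
    refine (Filter.biInter_mem (List.finite_toSet L)).2 fun x hx => ?_
    exact interior_mem_nhds.2 (hL.smooth_of_mem hx).2.2.1
  obtain ⟨r, hr, h⟩ := Metric.nhds_basis_closedBall.mem_iff.1 h
  exact ⟨r, hr, fun x hx => h.trans (Set.biInter_subset_of_mem hx)⟩

theorem exists_list (P : ℂ) (l : List X) {r : ℝ} (hr : 0 < r) :
    ∃ L : List (X × (ℂ → ℂ)), L.map Prod.fst = l ∧ NestIn P (Metric.ball P r) L := by
  induction l generalizing r with
  | nil => exact ⟨[], rfl, trivial⟩
  | cons a l ih =>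
    obtain ⟨L, h1, h2⟩ := ih (r := r / 4) (by linarith)
    obtain ⟨ρ, c1, c2, c3, c4⟩ := exists_cut P (r := r / 4) (s := r / 2) (by linarith) (by linarith)
    refine ⟨(a, ρ) :: L, by rw [List.map_cons, h1], c1, c2,
      c4 P (Metric.mem_closedBall_self (by linarith)),
      c3.trans (Metric.closedBall_subset_ball (by linarith)), h2.mono fun z hz => ?_⟩
    exact mem_interior_iff_mem_nhds.2 (c4 z (Metric.ball_subset_closedBall hz))

end NestIn

theorem exists_open_between (σ : Bool) {K T : Set ℂ} (hK : IsCompact K) (hT : IsOpen T) (h : K ⊆ T) :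
    ∃ W : Opens Sphere, (∀ z ∈ K, ((ev σ z : ℂ) : Sphere) ∈ W) ∧
      ((W : Set Sphere) ⊆ (↑) '' (ev σ ⁻¹' T)) ∧
      ∀ z : ℂ, ((ev σ z : ℂ) : Sphere) ∈ closure (W : Set Sphere) → z ∈ T := by
  obtain ⟨O, hO, h1, h2, h3⟩ := exists_open_between_and_isCompact_closure hK hT h
  have hc : Continuous (ev σ) := by
    cases σ
    · exact Complex.continuous_conj
    · exact continuous_id
  have hcl : IsClosed ((↑) '' (ev σ '' closure O) : Set Sphere) :=
    ((h3.image hc).image OnePoint.continuous_coe).isClosed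
  have hsub : ((↑) '' (ev σ ⁻¹' O) : Set Sphere) ⊆ (↑) '' (ev σ '' closure O) :=
    Set.image_mono fun z hz => ⟨ev σ z, subset_closure hz, ev_ev σ z⟩
  refine ⟨⟨(↑) '' (ev σ ⁻¹' O), OnePoint.isOpenEmbedding_coe.isOpenMap _ (hO.preimage hc)⟩,
    fun z hz => ⟨ev σ z, ?_, rfl⟩, ?_, fun z hz => ?_⟩
  · change ev σ (ev σ z) ∈ O
    rw [ev_ev]; exact h1 hz
  · rintro _ ⟨z, hz, rfl⟩
    exact ⟨z, h2 (subset_closure hz), rfl⟩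
  · obtain ⟨_, ⟨y, hy, rfl⟩, e⟩ := closure_minimal hsub hcl hz
    have e' := congrArg (ev σ) (OnePoint.coe_injective e)
    rw [ev_ev, ev_ev] at e'
    exact h2 (e' ▸ hy)

section

variable {𝔞 : Type*} [AddCommGroup 𝔞] [Module ℂ 𝔞] {D : Datum 𝔞}
  {σ τ : Bool} {U V W A : Opens Sphere} {p : ℂ}

namespace Datum

/-! ### Locality of the brackets -/

theorem exists_disjoint_opens {w i w' i' : ℕ} (f : Form w i A) (η : Form w' i' A)
    (hf : HasCompactSupport (f : ℂ → ℂ)) (hη : HasCompactSupport (η : ℂ → ℂ))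
    (h : Disjoint (tsupport (f : ℂ → ℂ)) (tsupport (η : ℂ → ℂ))) :
    ∃ (O O' : Opens Sphere) (f' : Form w i O) (η' : Form w' i' O') (hO : O ≤ A) (hO' : O' ≤ A),
      Disjoint O O' ∧ Form.ext hO f' = f ∧ Form.ext hO' η' = η := by
  have key : ∀ {g : ℂ → ℂ}, HasCompactSupport g →
      sphereSupport g ⊆ (↑) '' tsupport g ∧ IsCompact ((↑) '' tsupport g : Set Sphere) := by
    intro g hg
    have hc := hg.isCompact.image OnePoint.continuous_coe
    exact ⟨closure_minimal (Set.image_mono subset_closure) hc.isClosed, hc⟩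
  obtain ⟨f1, f2⟩ := key hf
  obtain ⟨η1, η2⟩ := key hη
  obtain ⟨O, O', hO, hO', s1, s2, hd⟩ := SeparatedNhds.of_isCompact_isCompact f2 η2
    ((Set.disjoint_image_iff OnePoint.coe_injective).2 h)
  refine ⟨⟨O, hO⟩ ⊓ A, ⟨O', hO'⟩ ⊓ A, ⟨f, f.2.1, f.2.2.1, ?_⟩, ⟨η, η.2.1, η.2.2.1, ?_⟩,
    inf_le_right, inf_le_right, ?_, rfl, rfl⟩
  · exact fun x hx => ⟨s1 (f1 hx), f.2.2.2 hx⟩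
  · exact fun x hx => ⟨s2 (η1 hx), η.2.2.2 hx⟩
  · rw [disjoint_iff_inf_le]
    rintro x ⟨⟨hx, -⟩, hx', -⟩
    exact Set.disjoint_left.1 hd hx hx'

theorem op_eq_zero (f : Form D.wt 0 A) (η : Form D.wt 1 A)
    (hf : HasCompactSupport (f : ℂ → ℂ)) (hη : HasCompactSupport (η : ℂ → ℂ))
    (h : Disjoint (tsupport (f : ℂ → ℂ)) (tsupport (η : ℂ → ℂ))) :
    D.op A f η = 0 ∧ D.pair A f η = 0 := by
  obtain ⟨O, O', f', η', hO, hO', hd, rfl, rfl⟩ := exists_disjoint_opens f η hf hη h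
  exact ⟨D.op_local hO hO' f' η' hd, D.pair_local hO hO' f' η' hd⟩

theorem bracketL_section_eq_zero (a b : 𝔞) (f : Form D.wt 0 (sOpen σ U))
    (η : Form D.wt 1 (sOpen τ U)) (hf : HasCompactSupport (f : ℂ → ℂ))
    (hη : HasCompactSupport (η : ℂ → ℂ))
    (h : σ = τ → Disjoint (tsupport (f : ℂ → ℂ)) (tsupport (η : ℂ → ℂ))) :
    D.bracketL U (D.zer σ U (a ⊗ₜ f)) (D.one τ U (b ⊗ₜ η)) = 0 := by
  by_cases e : σ = τ
  · subst e
    have := op_eq_zero f η hf hη (h rfl)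
    have h1 : D.secBracket _ (a ⊗ₜ[ℂ] f) (b ⊗ₜ[ℂ] η) = D.bracket a b ⊗ₜ D.op _ f η := rfl
    have h2 : D.secCocycle _ (a ⊗ₜ[ℂ] f) (b ⊗ₜ[ℂ] η) = D.form a b * D.pair _ f η := by
      simp [secCocycle]
    rw [bracketL_zer_one, h1, h2, this.1, this.2]
    simp
  · exact bracketL_zer_one_ne D e _ _

/-! ### Products of nested shells -/

variable (D) in
open Classical in
/-- The section `a_(-m-1)` with a cutoff function, as an element of the local Lie algebra. -/
def shellSec (σ : Bool) (U : Opens Sphere) (P : ℂ) (x : (𝔞 × ℕ) × (ℂ → ℂ)) : D.L1 U :=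
  if h : sh (fun z => (z - P) ^ (-x.1.2 - 1 : ℤ)) x.2 ∈ Form D.wt 1 (sOpen σ U) then
    D.one σ U (x.1.1 ⊗ₜ ⟨_, h⟩) else 0

variable (D) in
/-- The insertion of a section `a_(-m-1)` with a cutoff function. -/
def shellIns (σ : Bool) (U : Opens Sphere) (P : ℂ) (x : (𝔞 × ℕ) × (ℂ → ℂ)) : D.CE U :=
  D.ins σ U x.1.1 (sh (fun z => (z - P) ^ (-x.1.2 - 1 : ℤ)) x.2)

theorem shellIns_eq_sus (P : ℂ) (x : (𝔞 × ℕ) × (ℂ → ℂ)) :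
    D.shellIns σ U P x = D.sus U (D.shellSec σ U P x) := by
  rw [shellIns, shellSec, ins]
  split_ifs
  · rfl
  · rw [map_zero]

theorem shellIns_prod (P : ℂ) (L : List ((𝔞 × ℕ) × (ℂ → ℂ))) :
    (L.map (D.shellIns σ U P)).prod = ((L.map (D.shellSec σ U P)).map (D.sus U)).prod := by
  rw [List.map_map]
  congr 2
  funext x
  exact shellIns_eq_sus P x

theorem bracketL_shellSec (a : 𝔞) (P : ℂ) (f : Form D.wt 0 (sOpen σ U))
    (hf : HasCompactSupport (f : ℂ → ℂ)) (x : (𝔞 × ℕ) × (ℂ → ℂ)) (hx : HasCompactSupport x.2)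
    (h : σ = τ → Disjoint (tsupport (f : ℂ → ℂ)) (crit x.2)) :
    D.bracketL U (D.zer σ U (a ⊗ₜ f)) (D.shellSec τ U P x) = 0 := by
  rw [shellSec]
  split_ifs with hm
  · exact bracketL_section_eq_zero a _ f ⟨_, hm⟩ hf
      (HasCompactSupport.of_subset hx (tsupport_sh.trans crit_subset))
      fun e => (h e).mono_right tsupport_sh
  · rw [map_zero]

/-- A shell can be replaced by another shell of the same kind, if there are no other sections in
the region between them. -/
theorem cls_swap {ρ ρ' h : ℂ → ℂ} (a : 𝔞) (hρ : ContDiff ℝ ∞ ρ) (hρ' : ContDiff ℝ ∞ ρ')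
    (hc : HasCompactSupport ρ) (hc' : HasCompactSupport ρ')
    (hm : sh h ρ ∈ Form D.wt 1 (sOpen σ U)) (hm' : sh h ρ' ∈ Form D.wt 1 (sOpen σ U))
    (hh : ∀ z ∈ tsupport (ρ - ρ'), AnalyticAt ℂ h z ∧ (z : Sphere) ∈ sOpen σ U)
    (l : List (D.L1 U))
    (hl : ∀ η ∈ l, ∀ f : Form D.wt 0 (sOpen σ U), HasCompactSupport (f : ℂ → ℂ) →
      tsupport (f : ℂ → ℂ) ⊆ tsupport (ρ - ρ') → D.bracketL U (D.zer σ U (a ⊗ₜ f)) η = 0) :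
    D.cls U (D.ins σ U a (sh h ρ) * (l.map (D.sus U)).prod) =
      D.cls U (D.ins σ U a (sh h ρ') * (l.map (D.sus U)).prod) := by
  have hs : ContDiff ℝ ∞ (ρ - ρ') := hρ.sub hρ'
  have hcp : HasCompactSupport (ρ - ρ') := hc.sub hc'
  have ht : tsupport (primitive D.wt hs hcp hh : ℂ → ℂ) ⊆ tsupport (ρ - ρ') :=
    tsupport_mul_subset_of_right
  have := D.cls_boundary (D.zer σ U (a ⊗ₜ primitive D.wt hs hcp hh)) l
  rw [← ins_dbar, dolbeault_primitive D.wt hs hcp hh, bracketTerm_eq_zero _ _ _ fun η hη =>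
    hl η hη _ (HasCompactSupport.of_subset hcp ht) ht, map_zero, neg_zero, sh_sub hρ hρ',
    ins_sub D a hm hm', sub_mul, map_sub, sub_eq_zero] at this
  exact this

theorem shellIns_mem {P : ℂ} {ρ : ℂ → ℂ} (n : ℤ) (w : ℕ) (hρ : ContDiff ℝ ∞ ρ)
    (hc : HasCompactSupport ρ) (h1 : ρ =ᶠ[𝓝 P] fun _ => 1)
    (hU : tsupport ρ ⊆ {z | ((ev σ z : ℂ) : Sphere) ∈ U}) :
    sh (fun z => (z - P) ^ n) ρ ∈ Form w 1 (sOpen σ U) :=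
  sh_mem_form hρ hc fun _ hz => ⟨analyticAt_zpow_sub n (ne_of_mem_crit h1 hz),
    (mem_sOpen _).2 (hU (crit_subset hz))⟩

/-- The class of a nested product of shells does not change if the shells are shrunk towards the
centre. -/
theorem cls_shrink {P : ℂ} {S S' : Set ℂ} (L L' : List ((𝔞 × ℕ) × (ℂ → ℂ)))
    (hlab : L.map Prod.fst = L'.map Prod.fst) (hL : NestIn P S L) (hL' : NestIn P S' L')
    (hS : S ⊆ {z | ((ev σ z : ℂ) : Sphere) ∈ U}) (hS' : S' ⊆ S)
    (hcore : ∀ x ∈ L, S' ⊆ interior {z | x.2 z = 1}) (R : List (D.L1 U))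
    (hR : ∀ η ∈ R, ∀ (a : 𝔞) (f : Form D.wt 0 (sOpen σ U)), HasCompactSupport (f : ℂ → ℂ) →
      tsupport (f : ℂ → ℂ) ⊆ S → D.bracketL U (D.zer σ U (a ⊗ₜ f)) η = 0) :
    D.cls U ((R.map (D.sus U)).prod * (L.map (D.shellIns σ U P)).prod) =
      D.cls U ((R.map (D.sus U)).prod * (L'.map (D.shellIns σ U P)).prod) := by
  induction L generalizing L' S S' R with
  | nil =>
    rw [List.map_nil, eq_comm, List.map_eq_nil_iff] at hlab
    rw [hlab]
  | cons x L ih =>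
    cases L' with
    | nil => simp at hlab
    | cons x' L' =>
      rw [List.map_cons, List.map_cons, List.cons.injEq] at hlab
      obtain ⟨hx, hlab⟩ := hlab
      obtain ⟨a1, a2, a3, a4, a5⟩ := hL
      obtain ⟨b1, b2, b3, b4, b5⟩ := hL'
      have i1 := NestIn.interior_subset x.2
      have i2 := NestIn.interior_subset x'.2
      have hxc := hcore x List.mem_cons_self
      have step := ih L' hlab a5 b5 ((i1.trans a4).trans hS) ((i2.trans b4).trans hxc)
        (fun y hy => (i2.trans b4).trans (hcore y (List.mem_cons_of_mem _ hy)))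
        (D.shellSec σ U P x :: R) fun η hη a f hf hf' => by
          rcases List.mem_cons.1 hη with rfl | hη
          · refine bracketL_shellSec a P f hf x a2 fun _ => ?_
            refine Set.disjoint_left.2 fun z hz hzc => ?_
            refine notMem_crit_of_eventuallyEq (c := 1) ?_ hzc
            exact mem_interior_iff_mem_nhds.1 (hf' hz)
          · exact hR η hη a f hf (hf'.trans (i1.trans a4))
      rw [List.map_cons, List.prod_cons, ← shellIns_eq_sus] at step
      have hsub : tsupport (x.2 - x'.2) ⊆ S :=
        (tsupport_sub x.2 x'.2).trans (Set.union_subset a4 (b4.trans hS'))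
      have hm := shellIns_mem (σ := σ) (-x.1.2 - 1) D.wt a1 a2 a3 (a4.trans hS)
      have hm' := shellIns_mem (σ := σ) (-x.1.2 - 1) D.wt b1 b2 b3 (b4.trans (hS'.trans hS))
      have hne : ∀ y : ℂ, y ∈ interior {z | x'.2 z = 1} → y ∉ tsupport (x.2 - x'.2) := by
        intro y hy
        rw [notMem_tsupport_iff_eventuallyEq]
        have e1 : x.2 =ᶠ[𝓝 y] fun _ => 1 :=
          mem_interior_iff_mem_nhds.1 (hxc (b4 (i2 hy)))
        have e2 : x'.2 =ᶠ[𝓝 y] fun _ => 1 := mem_interior_iff_mem_nhds.1 hy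
        filter_upwards [e1, e2] with z h1 h2
        simp [h1, h2]
      have swap := cls_swap (D := D) (σ := σ) (U := U) x.1.1 a1 b1 a2 b2 hm hm'
        (fun z hz => ⟨analyticAt_zpow_sub _ fun e =>
          hne P (mem_interior_iff_mem_nhds.2 b3) (e ▸ hz), (mem_sOpen z).2 (hS (hsub hz))⟩)
        (R ++ L'.map (D.shellSec σ U P)) fun η hη f hf hf' => by
          rcases List.mem_append.1 hη with hη | hη
          · exact hR η hη _ f hf (hf'.trans hsub)
          · obtain ⟨y, hy, rfl⟩ := List.mem_map.1 hη
            obtain ⟨-, c2, -, c4⟩ := b5.smooth_of_mem hy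
            refine bracketL_shellSec _ P f hf y c2 fun _ => ?_
            exact Set.disjoint_left.2 fun z hz hzc => hne z (c4 (crit_subset hzc)) (hf' hz)
      rw [List.map_append, List.prod_append, ← shellIns_prod] at swap
      rw [List.map_cons, List.prod_cons, List.map_cons, List.prod_cons,
        mul_left_comm, ← mul_assoc, step, mul_assoc]
      change D.cls U (D.shellIns σ U P x * _) = _
      rw [mul_left_comm ((R.map (D.sus U)).prod), shellIns, shellIns, swap, hx]

/-! ### The preparation of monomials -/

variable (D) in
/-- Successive creation operators of one chirality. -/
def word (σ : Bool) (L : List ((𝔞 × ℕ) × (ℂ → ℂ))) (v : D.State) : D.State :=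
  L.foldr (fun x v => D.act σ (-x.1.2 - 1) x.1.1 v) v

theorem word_true (L : List ((𝔞 × ℕ) × (ℂ → ℂ))) (la lb : List (𝔞 × ℕ)) :
    D.word true L (D.monomial la lb) = D.monomial (L.map Prod.fst ++ la) lb := by
  induction L with
  | nil => rfl
  | cons x L ih =>
    rw [word, List.foldr_cons, ← word, ih, act_monomial_true]
    rfl

theorem word_false (L : List ((𝔞 × ℕ) × (ℂ → ℂ))) (la lb : List (𝔞 × ℕ)) :
    D.word false L (D.monomial la lb) = D.monomial la (L.map Prod.fst ++ lb) := by
  induction L with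
  | nil => rfl
  | cons x L ih =>
    rw [word, List.foldr_cons, ← word, ih, act_monomial_false]
    rfl

theorem extCE_shellIns_prod (h : U ≤ V) {P : ℂ} {S : Set ℂ} (L : List ((𝔞 × ℕ) × (ℂ → ℂ)))
    (hL : NestIn P S L) (hS : S ⊆ {z | ((ev σ z : ℂ) : Sphere) ∈ U}) :
    D.extCE h (L.map (D.shellIns σ U P)).prod = (L.map (D.shellIns σ V P)).prod := by
  rw [map_list_prod, List.map_map]
  congr 1
  refine List.map_congr_left fun x hx => ?_
  obtain ⟨a1, a2, a3, a4⟩ := hL.smooth_of_mem hx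
  exact extCE_ins D h _ (shellIns_mem _ _ a1 a2 a3 (a4.trans hS))

/-- Preparation of a state obtained by creation operators. -/
theorem prepare_word (hG : D.Geometric) (L : List ((𝔞 × ℕ) × (ℂ → ℂ))) {S : Set ℂ}
    (hL : NestIn (ev σ p) S L) (hS : S ⊆ {z | ((ev σ z : ℂ) : Sphere) ∈ U}) {r : ℝ} (hr : 0 < r)
    (hrL : ∀ x ∈ L, Metric.closedBall (ev σ p) r ⊆ interior {z | x.2 z = 1})
    (hrU : disc p r ≤ U) (v : D.State) (Q : D.CE (disc p r))
    (hQ : prepare hG p (disc p r) (mem_disc hr) v = D.cls _ Q) :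
    prepare hG p U (hrU (mem_disc hr)) (D.word σ L v) =
      D.cls U ((L.map (D.shellIns σ U (ev σ p))).prod * D.extCE hrU Q) := by
  induction L generalizing U S with
  | nil =>
    rw [List.map_nil, List.prod_nil, one_mul, ← extUL_cls, ← hQ, extUL_prepare]
    rfl
  | cons x L ih =>
    obtain ⟨a1, a2, a3, a4, a5⟩ := hL
    have hx := hrL x List.mem_cons_self
    obtain ⟨K, hK, hK1, hK2⟩ : ∃ K, IsCompact K ∧ K ⊆ interior {z | x.2 z = 1} ∧
        ∀ y ∈ L, tsupport y.2 ⊆ K := by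
      cases L with
      | nil => exact ⟨∅, isCompact_empty, Set.empty_subset _, fun y hy => absurd hy List.not_mem_nil⟩
      | cons y L =>
        refine ⟨tsupport y.2, a5.2.1.isCompact, a5.2.2.2.1, fun z hz => ?_⟩
        rcases List.mem_cons.1 hz with rfl | hz
        · exact subset_rfl
        · exact (a5.2.2.2.2.smooth_of_mem hz).2.2.2.trans (NestIn.interior_subset _)
    obtain ⟨W, w1, w2, w3⟩ := exists_open_between σ (hK.union (isCompact_closedBall (ev σ p) r))
      isOpen_interior (Set.union_subset hK1 hx)
    have hW : W ≤ U := by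
      intro y hy
      obtain ⟨z, hz, rfl⟩ := w2 hy
      have := hS (a4 (NestIn.interior_subset _ hz))
      rwa [Set.mem_ofPred_eq, ev_ev] at this
    have hrW : disc p r ≤ W := by
      rintro _ ⟨z, hz, rfl⟩
      have := w1 (ev σ z) (Or.inr ?_)
      · rwa [ev_ev] at this
      · rw [Metric.mem_closedBall, dist_eq_norm, norm_ev_sub_ev, ← dist_eq_norm]
        exact (Metric.mem_ball.1 hz).le
    have hL' : NestIn (ev σ p) (interior {z | x.2 z = 1} ∩ {z | ((ev σ z : ℂ) : Sphere) ∈ W}) L := by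
      cases L with
      | nil => trivial
      | cons y L =>
        exact ⟨a5.1, a5.2.1, a5.2.2.1, Set.subset_inter a5.2.2.2.1 fun z hz =>
          w1 z (Or.inl (hK2 y List.mem_cons_self hz)), a5.2.2.2.2⟩
    have step := ih hL' Set.inter_subset_right (fun y hy => hrL y (List.mem_cons_of_mem _ hy)) hrW
    have hfit : Fits σ W U x.2 := ⟨a1, a2, fun z hz => hS (a4 hz), fun z hz =>
      mem_interior_iff_mem_nhds.1 (w3 z hz)⟩
    have hpW := hrW (mem_disc hr)
    change prepare hG p U (hW hpW) (D.act σ (-x.1.2 - 1) x.1.1 (D.word σ L v)) = _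
    rw [prepare_act hG _ _ _ hpW hW hfit, step, opn_cls D _ hW (hfit.zpow_mem hpW _ _),
      map_mul (D.extCE hW), extCE_shellIns_prod hW L hL' Set.inter_subset_right, extCE_extCE,
      List.map_cons, List.prod_cons, mul_assoc]
    rfl

/-- Preparation of a monomial by nested shells. -/
theorem prepare_monomial (hG : D.Geometric) (hp : (p : Sphere) ∈ U)
    (L M : List ((𝔞 × ℕ) × (ℂ → ℂ)))
    (hL : NestIn (ev true p) {z | ((ev true z : ℂ) : Sphere) ∈ U} L)
    (hM : NestIn (ev false p) {z | ((ev false z : ℂ) : Sphere) ∈ U} M) :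
    prepare hG p U hp (D.monomial (L.map Prod.fst) (M.map Prod.fst)) =
      D.cls U ((L.map (D.shellIns true U (ev true p))).prod *
        (M.map (D.shellIns false U (ev false p))).prod) := by
  obtain ⟨r1, hr1, h1⟩ := hL.exists_ball
  obtain ⟨r2, hr2, h2⟩ := hM.exists_ball
  obtain ⟨r3, hr3, h3⟩ := exists_closedBall_subset hp
  set r := min r1 (min r2 r3) with hrdef
  have hr : 0 < r := lt_min hr1 (lt_min hr2 hr3)
  have hrU : disc p r ≤ U := by
    rintro _ ⟨z, hz, rfl⟩
    refine h3 z ?_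
    rw [Metric.mem_ball, dist_eq_norm] at hz
    exact hz.le.trans ((min_le_right _ _).trans (min_le_right _ _))
  obtain ⟨M', m1, m2⟩ := NestIn.exists_list (ev false p) (M.map Prod.fst) hr
  have hball : Metric.ball (ev false p) r ⊆ {z | ((ev false z : ℂ) : Sphere) ∈ disc p r} := by
    intro z hz
    rw [Metric.mem_ball, dist_eq_norm, ← norm_sub_ev] at hz
    exact mem_disc_iff.2 hz
  obtain ⟨r', hr', h'⟩ := m2.exists_ball
  set s := min r r' with hsdef
  have hs : 0 < s := lt_min hr hr'
  have hsr : disc p s ≤ disc p r := by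
    rintro _ ⟨z, hz, rfl⟩
    exact ⟨z, Metric.ball_subset_ball (min_le_left _ _) hz, rfl⟩
  have e1 := prepare_word hG M' m2 hball hs (fun x hx =>
    (Metric.closedBall_subset_closedBall (min_le_right _ _)).trans (h' x hx)) hsr D.vacuum 1
    (prepare_vacuum hG _)
  rw [map_one (D.extCE hsr), mul_one] at e1
  have e2 := prepare_word hG L hL subset_rfl hr (fun x hx =>
    (Metric.closedBall_subset_closedBall (min_le_left _ _)).trans (h1 x hx)) hrU _ _ e1
  rw [extCE_shellIns_prod hrU M' m2 hball, ← monomial_nil, word_false, word_true, m1,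
    List.append_nil, List.append_nil] at e2
  rw [e2, shellIns_prod (σ := true)]
  refine (cls_shrink (D := D) M M' m1.symm hM m2 subset_rfl
    (hball.trans fun z hz => hrU hz) (fun x hx => ?_) _ ?_).symm
  · exact (Metric.ball_subset_closedBall.trans (Metric.closedBall_subset_closedBall
      ((min_le_right _ _).trans (min_le_left _ _)))).trans (h2 x hx)
  · intro η hη a f hf _
    obtain ⟨x, hx, rfl⟩ := List.mem_map.1 hη
    exact bracketL_shellSec a _ f hf x (hL.smooth_of_mem hx).2.1 fun e => absurd e (by decide)

/-- The cutoff functions of a list of bumps. -/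
def bumpList {X : Type*} {p : ℂ} {U : Opens Sphere} (l : List (X × Bump p U)) :
    List (X × (ℂ → ℂ)) := l.map fun x => (x.1, x.2.toFun)

theorem nestIn_bumpList {X : Type*} {p : ℂ} {U : Opens Sphere} (l : List (X × Bump p U))
    (h : Nested (l.map Prod.snd)) : NestIn p {z | (z : Sphere) ∈ U} (bumpList l) := by
  have key : ∀ (l : List (X × Bump p U)) (S : Set ℂ), Nested (l.map Prod.snd) →
      (∀ x ∈ l.head?, tsupport x.2.toFun ⊆ S) → NestIn p S (bumpList l) := by
    intro l
    induction l with
    | nil => intro S _ _; trivial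
    | cons x l ih =>
      intro S hl hS
      refine ⟨x.2.smooth, x.2.compact, x.2.eq_one, hS x rfl, ih _ ?_ ?_⟩
      · exact List.IsChain.tail hl
      · intro y hy
        cases l with
        | nil => simp at hy
        | cons z l =>
          obtain rfl : z = y := by simpa using hy
          exact (List.isChain_cons_cons.1 hl).1
  exact key l _ h fun x _ => x.2.subset

theorem exists_bumpList {X : Type*} {p : ℂ} {U : Opens Sphere} (L : List (X × (ℂ → ℂ)))
    (hL : NestIn p {z | (z : Sphere) ∈ U} L) :
    ∃ l : List (X × Bump p U), l.map Prod.fst = L.map Prod.fst ∧ Nested (l.map Prod.snd) := by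
  have key : ∀ (L : List (X × (ℂ → ℂ))) (S : Set ℂ), S ⊆ {z | (z : Sphere) ∈ U} → NestIn p S L →
      ∃ l : List (X × Bump p U), l.map Prod.fst = L.map Prod.fst ∧ Nested (l.map Prod.snd) ∧
        ∀ x ∈ (l.map Prod.snd).head?, tsupport x.toFun ⊆ S := by
    intro L
    induction L with
    | nil => exact fun S _ _ => ⟨[], rfl, List.isChain_nil, by simp⟩
    | cons x L ih =>
      rintro S hS ⟨a1, a2, a3, a4, a5⟩
      obtain ⟨l, h1, h2, h3⟩ := ih _ (((NestIn.interior_subset _).trans a4).trans hS) a5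
      refine ⟨(x.1, ⟨x.2, a1, a2, fun z hz => hS (a4 hz), a3⟩) :: l, by simp [h1], ?_, ?_⟩
      · refine List.isChain_cons.2 ⟨h3, h2⟩
      · intro y hy
        obtain rfl : _ = y := by simpa using hy
        exact a4
  obtain ⟨l, h1, h2, -⟩ := key L _ subset_rfl hL
  exact ⟨l, h1, h2⟩

theorem exists_nested {X : Type*} {p : ℂ} {U : Opens Sphere} (hp : (p : Sphere) ∈ U) (l : List X) :
    ∃ l' : List (X × Bump p U), l'.map Prod.fst = l ∧ Nested (l'.map Prod.snd) := by
  obtain ⟨r, hr, h⟩ := exists_closedBall_subset hp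
  obtain ⟨L, h1, h2⟩ := NestIn.exists_list p l hr
  obtain ⟨l', h3, h4⟩ := exists_bumpList (U := U) L (h2.mono fun z hz => h z (by
    rw [Metric.mem_ball, dist_eq_norm] at hz; exact hz.le))
  exact ⟨l', h3.trans h1, h4⟩

theorem isPreparation_prepare (hG : D.Geometric) : D.IsPreparation (prepare hG) := by
  intro p U hp la lb hla hlb
  have h1 := nestIn_bumpList la hla
  have h2 : NestIn (ev false p) {z | ((ev false z : ℂ) : Sphere) ∈ U} (bumpList lb) :=
    (nestIn_bumpList lb hlb).mono fun z hz => (mem_sOpen (σ := false) z).1 hz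
  have := prepare_monomial hG hp (bumpList la) (bumpList lb) h1 h2
  have e : ∀ {p : ℂ} {U : Opens Sphere} (l : List ((𝔞 × ℕ) × Bump p U)),
      (bumpList l).map Prod.fst = l.map Prod.fst := fun l => by
    rw [bumpList, List.map_map]; rfl
  rw [e, e] at this
  rw [this, bumpList, bumpList, List.map_map, List.map_map]
  have e1 : (D.shellIns true U (ev true p) ∘ fun x : (𝔞 × ℕ) × Bump p U => (x.1, x.2.toFun)) =
      fun x => D.chiralForm x.1.1 (shell D.wt p (-x.1.2 - 1) x.2) := by
    funext x
    rw [chiralForm_eq]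
    rfl
  have e2 : (D.shellIns false U (ev false p) ∘
      fun x : (𝔞 × ℕ) × Bump (conj p) (conjOpen U) => (x.1, x.2.toFun)) =
      fun x => D.antiForm x.1.1 (shell D.wt (conj p) (-x.1.2 - 1) x.2) := by
    funext x
    rw [antiForm_eq]
    rfl
  rw [e1, e2]
  rfl

theorem isPreparation_unique (hD : D.Admissible) {prep prep' : D.Preparation}
    (h : D.IsPreparation prep) (h' : D.IsPreparation prep') : prep' = prep := by
  funext p U hp
  refine LinearMap.ext_on (span_monomial hD) ?_
  rintro _ ⟨la, lb, rfl⟩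
  obtain ⟨la', rfl, hla⟩ := exists_nested hp la
  have hp' : ((conj p : ℂ) : Sphere) ∈ conjOpen U :=
    (mem_sOpen (σ := false) _).2 (by rw [ev, Complex.conj_conj]; exact hp)
  obtain ⟨lb', rfl, hlb⟩ := exists_nested hp' lb
  rw [h p U hp la' lb' hla hlb, h' p U hp la' lb' hla hlb]

end Datum

end

end SphereVA

end

noncomputable section

namespace SphereVA

open Filter

/-! ### Estimates for derivatives -/

theorem succ_mul_pow_le {r : ℝ} (h0 : 0 ≤ r) (h1 : r < 1) (k : ℕ) :
    (k + 1 : ℝ) * r ^ k ≤ (1 - r)⁻¹ := by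
  calc (k + 1 : ℝ) * r ^ k = ∑ _i ∈ Finset.range (k + 1), r ^ k := by simp
    _ ≤ ∑ i ∈ Finset.range (k + 1), r ^ i := Finset.sum_le_sum fun i hi =>
        pow_le_pow_of_le_one h0 h1.le (by simpa [Nat.lt_succ_iff] using hi)
    _ ≤ ∑' i, r ^ i := (summable_geometric_of_lt_one h0 h1).sum_le_tsum _ fun i _ => pow_nonneg h0 i
    _ = (1 - r)⁻¹ := tsum_geometric_of_lt_one h0 h1

section

variable {E : Type} [NormedAddCommGroup E] [NormedSpace ℝ E] [NormedSpace ℂ E]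
  [IsScalarTower ℝ ℂ E] {g : ℂ → ℂ} {G : ℂ → E}

theorem contDiff_smul_of_tsupport {u : ℂ → ℂ} (hG : ContDiff ℝ ∞ G)
    (hu : ∀ z ∈ tsupport G, ContDiffAt ℝ ∞ u z) : ContDiff ℝ ∞ fun z => u z • G z := by
  rw [contDiff_iff_contDiffAt]
  intro z
  by_cases hz : z ∈ tsupport G
  · exact (hu z hz).smul hG.contDiffAt
  · refine contDiffAt_const (c := 0).congr_of_eventuallyEq ?_
    filter_upwards [notMem_tsupport_iff_eventuallyEq.1 hz] with y hy
    rw [hy, Pi.zero_apply, smul_zero]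

theorem contDiff_smulRight_of_tsupport (hG : ContDiff ℝ ∞ G)
    (hg : ∀ z ∈ tsupport G, ContDiffAt ℝ ∞ g z) :
    ContDiff ℝ ∞ fun z => (fderiv ℝ g z).smulRight (G z) := by
  rw [contDiff_iff_contDiffAt]
  intro z
  by_cases hz : z ∈ tsupport G
  · have h1 : ContDiffAt ℝ ∞ (fun z => (ContinuousLinearMap.lsmul ℝ ℂ).flip (G z)) z :=
      ((ContinuousLinearMap.contDiff
        (ContinuousLinearMap.lsmul ℝ ℂ : ℂ →L[ℝ] E →L[ℝ] E).flip).comp hG).contDiffAt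
    exact h1.clm_comp ((hg z hz).fderiv_right (m := ∞) (by simp))
  · refine contDiffAt_const (c := 0).congr_of_eventuallyEq ?_
    filter_upwards [notMem_tsupport_iff_eventuallyEq.1 hz] with y hy
    rw [hy, Pi.zero_apply, ContinuousLinearMap.smulRight_zero]

theorem tsupport_smulRight_subset : tsupport (fun z => (fderiv ℝ g z).smulRight (G z)) ⊆ tsupport G :=
  closure_mono fun z hz (hn : G z = 0) => hz (by
    change (fderiv ℝ g z).smulRight (G z) = 0
    rw [hn, ContinuousLinearMap.smulRight_zero])

theorem fderiv_pow_smul (hG : ContDiff ℝ ∞ G) (hg : ∀ z ∈ tsupport G, ContDiffAt ℝ ∞ g z) (k : ℕ) :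
    fderiv ℝ (fun z => g z ^ (k + 1) • G z) = (fun z => g z ^ (k + 1) • fderiv ℝ G z) +
      (k + 1 : ℂ) • fun z => g z ^ k • (fderiv ℝ g z).smulRight (G z) := by
  funext z
  by_cases hz : z ∈ tsupport G
  · have h1 : HasFDerivAt g (fderiv ℝ g z) z := ((hg z hz).differentiableAt (by simp)).hasFDerivAt
    have h2 : HasFDerivAt G (fderiv ℝ G z) z := (hG.differentiable (by simp) z).hasFDerivAt
    change fderiv ℝ ((fun x => g x ^ (k + 1)) • G) z = _
    rw [((h1.pow (k + 1)).smul h2).fderiv]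
    ext v
    simp only [Pi.add_apply, Pi.smul_apply, add_apply,
      smul_apply, ContinuousLinearMap.smulRight_apply, smul_smul, nsmul_eq_mul,
      smul_eq_mul, Nat.add_sub_cancel]
    push_cast
    congr 2
  · have h0 := notMem_tsupport_iff_eventuallyEq.1 hz
    have h1 : (fun z => g z ^ (k + 1) • G z) =ᶠ[𝓝 z] fun _ => 0 := by
      filter_upwards [h0] with y hy
      rw [hy, Pi.zero_apply, smul_zero]
    have h2 : fderiv ℝ G z = 0 := by
      rw [h0.fderiv_eq]; exact fderiv_const_apply 0
    rw [h1.fderiv_eq, Pi.add_apply, Pi.smul_apply, h2, h0.eq_of_nhds]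
    simp

end

theorem exists_pow_smul_bound (j : ℕ) : ∀ {E : Type} [NormedAddCommGroup E] [NormedSpace ℝ E]
    [NormedSpace ℂ E] [IsScalarTower ℝ ℂ E] {g : ℂ → ℂ} {G : ℂ → E} {x y : ℝ}, ContDiff ℝ ∞ G →
    HasCompactSupport G → (∀ z ∈ tsupport G, ContDiffAt ℝ ∞ g z) → 0 ≤ x → x < y →
    (∀ z ∈ tsupport G, ‖g z‖ ≤ x) →
    ∃ C, 0 ≤ C ∧ ∀ (k : ℕ) z, ‖iteratedFDeriv ℝ j (fun z => g z ^ k • G z) z‖ ≤ C * y ^ k := by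
  induction j with
  | zero =>
    intro E _ _ _ _ g G x y hG hc hg hx hxy hgx
    obtain ⟨C, hC⟩ := hG.continuous.bounded_above_of_compact_support hc
    have hC0 : 0 ≤ C := (norm_nonneg _).trans (hC 0)
    refine ⟨C, hC0, fun k z => ?_⟩
    rw [norm_iteratedFDeriv_zero, norm_smul, norm_pow, mul_comm]
    by_cases hz : z ∈ tsupport G
    · have : ‖g z‖ ≤ y := (hgx z hz).trans hxy.le
      gcongr
      exact hC z
    · rw [image_eq_zero_of_notMem_tsupport hz, norm_zero, zero_mul]
      have := hx.trans hxy.le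
      positivity
  | succ j ih =>
    intro E _ _ _ _ g G x y hG hc hg hx hxy hgx
    have hG' : ContDiff ℝ ∞ (fderiv ℝ G) := hG.fderiv_right (by simp)
    have ht' : tsupport (fderiv ℝ G) ⊆ tsupport G := tsupport_fderiv_subset ℝ
    have ht2 := tsupport_smulRight_subset (g := g) (G := G)
    have hG2 := contDiff_smulRight_of_tsupport hG hg
    have hc2 : HasCompactSupport fun z => (fderiv ℝ g z).smulRight (G z) :=
      hc.mono' (subset_closure.trans ht2)
    set w := (x + y) / 2 with hw
    have hxw : x < w := by rw [hw]; linarith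
    have hwy : w < y := by rw [hw]; linarith
    clear_value w
    have hw0 : 0 < w := hx.trans_lt hxw
    have hy0 : 0 < y := hw0.trans hwy
    obtain ⟨C1, hC1, h1⟩ := ih hG' (hc.fderiv ℝ) (fun z hz => hg z (ht' hz)) hx hxy
      fun z hz => hgx z (ht' hz)
    obtain ⟨C2, hC2, h2⟩ := ih hG2 hc2 (fun z hz => hg z (ht2 hz)) hx hxw
      fun z hz => hgx z (ht2 hz)
    have hr : w / y < 1 := (div_lt_one hy0).2 hwy
    have hr1 : 0 < 1 - w / y := by linarith
    refine ⟨C1 + C2 * (1 - w / y)⁻¹ * y⁻¹, by positivity, fun k z => ?_⟩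
    rw [← norm_iteratedFDeriv_fderiv]
    cases k with
    | zero =>
      have := h1 0 z
      simp only [pow_zero, one_smul, mul_one] at this ⊢
      exact this.trans (le_add_of_nonneg_right (by positivity))
    | succ k =>
      have e1 : ContDiff ℝ ∞ fun z => g z ^ (k + 1) • fderiv ℝ G z :=
        contDiff_smul_of_tsupport hG' fun z hz => (hg z (ht' hz)).pow _
      have e2 : ContDiff ℝ ∞ fun z => g z ^ k • (fderiv ℝ g z).smulRight (G z) :=
        contDiff_smul_of_tsupport hG2 fun z hz => (hg z (ht2 hz)).pow _
      have hj : (j : WithTop ℕ∞) ≤ ∞ := by exact_mod_cast le_top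
      have e3 : ContDiff ℝ ∞ ((k + 1 : ℂ) • fun z => g z ^ k • (fderiv ℝ g z).smulRight (G z)) :=
        e2.const_smul (k + 1 : ℂ)
      rw [fderiv_pow_smul hG hg, iteratedFDeriv_add_apply ((e1.of_le hj).contDiffAt)
        (e3.of_le hj).contDiffAt,
        iteratedFDeriv_const_smul_apply (e2.of_le hj).contDiffAt]
      refine (norm_add_le _ _).trans ?_
      rw [add_mul]
      refine add_le_add (h1 (k + 1) z) ?_
      have hk : ‖(k + 1 : ℂ)‖ = k + 1 := by
        have : ((k : ℂ) + 1) = ((k + 1 : ℝ) : ℂ) := by push_cast; rfl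
        rw [this, Complex.norm_real, Real.norm_of_nonneg (by positivity)]
      rw [norm_smul, hk]
      calc (k + 1 : ℝ) * ‖iteratedFDeriv ℝ j (fun z => g z ^ k • (fderiv ℝ g z).smulRight (G z)) z‖
          ≤ (k + 1 : ℝ) * (C2 * w ^ k) := by gcongr; exact h2 k z
        _ = C2 * ((k + 1 : ℝ) * (w / y) ^ k) * y ^ k := by rw [div_pow]; field_simp
        _ ≤ C2 * (1 - w / y)⁻¹ * y ^ k := by
          gcongr
          exact succ_mul_pow_le (by positivity) hr k
        _ = C2 * (1 - w / y)⁻¹ * y⁻¹ * y ^ (k + 1) := by rw [pow_succ]; field_simp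

/-- A family of functions whose derivatives are uniformly summable. -/
def Rapid {κ : Type} (F : κ → ℂ → ℂ) : Prop :=
  ∀ s : ℕ, ∃ c : κ → ℝ, Summable c ∧ ∀ k, ∀ j ≤ s, ∀ z, ‖iteratedFDeriv ℝ j (F k) z‖ ≤ c k

theorem rapid_pow {g G : ℂ → ℂ} {x : ℝ} (hG : ContDiff ℝ ∞ G) (hc : HasCompactSupport G)
    (hg : ∀ z ∈ tsupport G, ContDiffAt ℝ ∞ g z) (hx : 0 ≤ x) (hx1 : x < 1)
    (hgx : ∀ z ∈ tsupport G, ‖g z‖ ≤ x) (m : ℕ) :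
    Rapid fun (k : ℕ) z => ((k + m).choose m : ℂ) * (g z ^ k * G z) := by
  intro s
  set y := (x + 1) / 2 with hy
  have hxy : x < y := by rw [hy]; linarith
  have hy1 : y < 1 := by rw [hy]; linarith
  have hy0 : 0 < y := hx.trans_lt hxy
  choose C hC h using fun j => exists_pow_smul_bound j hG hc hg hx hxy hgx
  have hsum := (summable_choose_mul_geometric_of_norm_lt_one (R := ℝ) m
    (r := y) (by rwa [Real.norm_of_nonneg hy0.le])).mul_right (∑ j ∈ Finset.range (s + 1), C j)
  refine ⟨_, hsum, fun k j hj z => ?_⟩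
  have e : (fun z => ((k + m).choose m : ℂ) * (g z ^ k * G z)) =
      ((k + m).choose m : ℂ) • fun z => g z ^ k • G z := by
    funext z; simp
  have hs : ContDiff ℝ ∞ fun z => g z ^ k • G z :=
    contDiff_smul_of_tsupport hG fun z hz => (hg z hz).pow _
  have hj' : (j : WithTop ℕ∞) ≤ ∞ := by exact_mod_cast le_top
  change ‖iteratedFDeriv ℝ j (fun z => ((k + m).choose m : ℂ) * (g z ^ k * G z)) z‖ ≤ _
  rw [e, iteratedFDeriv_const_smul_apply (hs.of_le hj').contDiffAt, norm_smul, Complex.norm_natCast]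
  have h1 : C j ≤ ∑ j ∈ Finset.range (s + 1), C j :=
    Finset.single_le_sum (fun i _ => hC i) (Finset.mem_range.2 (Nat.lt_succ_of_le hj))
  calc ((k + m).choose m : ℝ) * ‖iteratedFDeriv ℝ j (fun z => g z ^ k • G z) z‖
      ≤ ((k + m).choose m : ℝ) * (C j * y ^ k) := by gcongr; exact h j k z
    _ ≤ ((k + m).choose m : ℝ) * ((∑ j ∈ Finset.range (s + 1), C j) * y ^ k) := by gcongr
    _ = _ := by ring

theorem Rapid.tail {κ : Type} {F : κ → ℂ → ℂ} {f : ℂ → ℂ} (hF : Rapid F)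
    (hs : ∀ k, ContDiff ℝ ∞ (F k)) (hf : ContDiff ℝ ∞ f) (h : ∀ z, HasSum (fun k => F k z) (f z))
    (s : ℕ) : ∃ e : Finset κ → ℝ, Tendsto e atTop (𝓝 0) ∧
      ∀ T, ∀ j ≤ s, ∀ z, ‖iteratedFDeriv ℝ j (f - ∑ k ∈ T, F k) z‖ ≤ e T := by
  obtain ⟨c, hc, hb⟩ := hF s
  have hlim : Tendsto (fun T : Finset κ => (∑' k, c k) - ∑ k ∈ T, c k) atTop (𝓝 0) := by
    have := (tendsto_const_nhds (x := ∑' k, c k)).sub hc.hasSum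
    rwa [sub_self] at this
  refine ⟨_, hlim, fun T j hj z => ?_⟩
  have hj' : (j : WithTop ℕ∞) ≤ ∞ := by exact_mod_cast le_top
  have hfe : f = fun z => ∑' k, F k z := funext fun z => (h z).tsum_eq.symm
  have hD : HasSum (fun k => iteratedFDeriv ℝ j (F k) z) (iteratedFDeriv ℝ j f z) := by
    have h1 := iteratedFDeriv_tsum_apply (𝕜 := ℝ) (N := (s : ℕ∞)) (f := F) (v := fun _ => c)
      (fun k => (hs k).of_le (by exact_mod_cast le_top)) (fun _ _ => hc)
      (fun i k z hi => hb k i (by exact_mod_cast hi) z) (k := j) (by exact_mod_cast hj) z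
    rw [hfe, h1]
    exact (Summable.of_norm_bounded hc fun k => hb k j hj z).hasSum
  have e1 : iteratedFDeriv ℝ j (f - ∑ k ∈ T, F k) z =
      iteratedFDeriv ℝ j f z - ∑ k ∈ T, iteratedFDeriv ℝ j (F k) z := by
    have hsum : ContDiff ℝ ∞ (∑ k ∈ T, F k) := by
      have : (∑ k ∈ T, F k) = fun z => ∑ k ∈ T, F k z := by funext z; simp
      rw [this]
      exact ContDiff.sum fun k _ => hs k
    rw [iteratedFDeriv_sub_apply (hf.of_le hj').contDiffAt (hsum.of_le hj').contDiffAt,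
      iteratedFDeriv_sum_apply fun k _ => ((hs k).of_le hj').contDiffAt]
  rw [e1]
  have h2 : HasSum (fun k : {k // k ∉ T} => iteratedFDeriv ℝ j (F k) z)
      (iteratedFDeriv ℝ j f z - ∑ k ∈ T, iteratedFDeriv ℝ j (F k) z) :=
    (Finset.hasSum_compl_iff (f := fun k => iteratedFDeriv ℝ j (F k) z) T).2
      (by rwa [sub_add_cancel])
  have h3 : HasSum (fun k : {k // k ∉ T} => c k) ((∑' k, c k) - ∑ k ∈ T, c k) :=
    (Finset.hasSum_compl_iff (f := c) T).2 (by rw [sub_add_cancel]; exact hc.hasSum)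
  exact h2.norm_le_of_bounded h3 fun k => hb k j hj z

end SphereVA

end

noncomputable section

namespace SphereVA

open Filter

/-! ### Families of continuous functionals -/

theorem continuous_ev (σ : Bool) : Continuous (ev σ) := by
  cases σ
  · exact Complex.continuous_conj
  · exact continuous_id

theorem exists_iteratedFDeriv_bound {f : ℂ → ℂ} (hf : ContDiff ℝ ∞ f) (hc : HasCompactSupport f)
    (s : ℕ) : ∃ M, ∀ j ≤ s, ∀ z, ‖iteratedFDeriv ℝ j f z‖ ≤ M := by
  have h : ∀ j : ℕ, ∃ M, ∀ z, ‖iteratedFDeriv ℝ j f z‖ ≤ M := fun j =>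
    (hf.continuous_iteratedFDeriv (by exact_mod_cast le_top)).bounded_above_of_compact_support
      (hc.iteratedFDeriv j)
  choose M hM using h
  have hM0 : ∀ j, 0 ≤ M j := fun j => (norm_nonneg _).trans (hM j 0)
  exact ⟨∑ j ∈ Finset.range (s + 1), M j, fun j hj z => (hM j z).trans
    (Finset.single_le_sum (fun i _ => hM0 i) (Finset.mem_range.2 (Nat.lt_succ_of_le hj)))⟩

section

variable {𝔞 : Type*} [AddCommGroup 𝔞] [Module ℂ 𝔞] {D : Datum 𝔞}
  {σ : Bool} {U V W : Opens Sphere}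

theorem Form.exists_compact {w i : ℕ} (hU : (OnePoint.infty : Sphere) ∉ U) {F : ℂ → ℂ}
    (hF : F ∈ Form w i (sOpen σ U)) : HasCompactSupport F ∧ ∃ K : Set ℂ, IsCompact K ∧
      (∀ z ∈ K, (z : Sphere) ∈ U) ∧ ∀ z ∉ K, F (ev σ z) = 0 := by
  have hinf : (OnePoint.infty : Sphere) ∉ sOpen σ U := by
    cases σ
    · intro h
      have h' : conjSphere.symm OnePoint.infty ∈ U := by simpa [sOpen, conjOpen, Homeomorph.opensCongr] using h
      have e : conjSphere.symm OnePoint.infty = OnePoint.infty := by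
        rw [Homeomorph.symm_apply_eq]; rfl
      exact hU (e ▸ h')
    · exact hU
  have hsub : sphereSupport F ⊆ Set.range ((↑) : ℂ → Sphere) := by
    intro x hx
    induction x using OnePoint.rec with
    | infty => exact absurd (hF.2.2 hx) hinf
    | coe z => exact ⟨z, rfl⟩
  have hK : IsCompact (((↑) : ℂ → Sphere) ⁻¹' sphereSupport F) :=
    OnePoint.isOpenEmbedding_coe.isInducing.isCompact_preimage_iff hsub |>.2 isClosed_closure.isCompact
  have hs : Function.support F ⊆ ((↑) : ℂ → Sphere) ⁻¹' sphereSupport F := fun z hz =>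
    subset_closure ⟨z, hz, rfl⟩
  refine ⟨HasCompactSupport.of_support_subset_isCompact hK hs,
    ev σ '' (((↑) : ℂ → Sphere) ⁻¹' sphereSupport F), hK.image (continuous_ev σ), ?_, ?_⟩
  · rintro _ ⟨z, hz, rfl⟩
    exact (mem_sOpen z).1 (hF.2.2 hz)
  · intro z hz
    by_contra hn
    exact hz ⟨ev σ z, hs hn, ev_ev σ z⟩

namespace Datum

variable (D) in
/-- A product of forms, with a given sequence of chiralities. -/
def sgnProd (U : Opens Sphere) {J : Type} [Fintype J] (s : J → Bool) (a : J → 𝔞) (η : J → ℂ → ℂ) :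
    D.CE U := ∏ j, D.ins (s j) U (a j) (η j)

theorem ins_mul_sgnProd (a : 𝔞) (F : ℂ → ℂ) {J : Type} [Fintype J] (s : J → Bool) (b : J → 𝔞)
    (η : J → ℂ → ℂ) : D.ins σ U a F * D.sgnProd U s b η =
      D.sgnProd U (fun j : Option J => j.elim σ s) (fun j => j.elim a b) fun j => j.elim F η := by
  rw [sgnProd, sgnProd, Fintype.prod_option]
  rfl

theorem extCE_sgnProd (h : V ≤ W) {J : Type} [Fintype J] (s : J → Bool) (a : J → 𝔞)
    {η : J → ℂ → ℂ} (hη : ∀ j, η j ∈ Form D.wt 1 (sOpen (s j) V)) :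
    D.extCE h (D.sgnProd V s a η) = D.sgnProd W s a η := by
  rw [sgnProd, sgnProd, map_prod (D.extCE h)]
  exact Finset.prod_congr rfl fun j _ => extCE_ins D h (a j) (hη j)

variable (D) in
/-- The products of forms. -/
def productSet (U : Opens Sphere) : Set (D.CE U) :=
  {P | ∃ (J : Type) (_ : Fintype J) (s : J → Bool) (a : J → 𝔞) (η : J → ℂ → ℂ),
    (∀ j, η j ∈ Form D.wt 1 (sOpen (s j) U)) ∧ P = D.sgnProd U s a η}

theorem ins_mul_mem_productSet (a : 𝔞) {F : ℂ → ℂ} (hF : F ∈ Form D.wt 1 (sOpen σ U)) {P : D.CE U}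
    (hP : P ∈ D.productSet U) : D.ins σ U a F * P ∈ D.productSet U := by
  obtain ⟨J, _, s, b, η, hη, rfl⟩ := hP
  refine ⟨Option J, inferInstance, _, _, _, fun j => ?_, ins_mul_sgnProd a F s b η⟩
  cases j with
  | none => exact hF
  | some j => exact hη j

theorem mem_span_products (P : D.CE U) : P ∈ Submodule.span ℂ (D.productSet U) ⊔
    LinearMap.range (LinearMap.mulRight ℂ (D.sus U (0, 1) - 1)) := by
  set T := Submodule.span ℂ (D.productSet U) ⊔
    LinearMap.range (LinearMap.mulRight ℂ (D.sus U (0, 1) - 1)) with hT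
  have hr : ∀ Z : D.CE U, Z * (D.sus U (0, 1) - 1) ∈ T := fun Z =>
    Submodule.mem_sup_right ⟨Z, rfl⟩
  have hmul : ∀ X : D.CE U, (∀ Z ∈ D.productSet U, X * Z ∈ T) → ∀ Z ∈ T, X * Z ∈ T := by
    intro X hX Z hZ
    obtain ⟨Y, hY, _, ⟨Y', rfl⟩, rfl⟩ := Submodule.mem_sup.1 hZ
    clear hZ
    rw [mul_add]
    refine T.add_mem ?_ ?_
    · induction hY using Submodule.span_induction with
      | mem Z hZ => exact hX Z hZ
      | zero => rw [mul_zero]; exact T.zero_mem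
      | add x y _ _ hx hy => rw [mul_add]; exact T.add_mem hx hy
      | smul c x _ hx => rw [mul_smul_comm]; exact T.smul_mem c hx
    · rw [LinearMap.mulRight_apply, ← mul_assoc]; exact hr _
  have hsec : ∀ (σ : Bool) (t : 𝔞 ⊗[ℂ] Form D.wt 1 (sOpen σ U)), ∀ Z ∈ T,
      D.sus U (D.one σ U t) * Z ∈ T := by
    intro σ t
    induction t using TensorProduct.induction_on with
    | zero => intro Z _; rw [map_zero, map_zero, zero_mul]; exact T.zero_mem
    | add x y hx hy =>
      intro Z hZ
      rw [map_add, map_add, add_mul]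
      exact T.add_mem (hx Z hZ) (hy Z hZ)
    | tmul a F =>
      rw [← ins_coe D a F]
      exact hmul _ fun Z hZ => Submodule.mem_sup_left
        (Submodule.subset_span (ins_mul_mem_productSet a F.2 hZ))
  have hcent : ∀ (c : ℂ), ∀ Z ∈ T, D.sus U (0, c) * Z ∈ T := by
    intro c Z hZ
    have e : D.sus U (0, c) * Z = c • (Z * (D.sus U (0, 1) - 1) + Z) := by
      rw [show ((0, c) : D.L1 U) = c • (0, 1) by simp, map_smul, smul_mul_assoc, mul_sub, mul_one,
        sub_add_cancel, mul_comm]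
    rw [e]
    exact T.smul_mem c (T.add_mem (hr Z) hZ)
  have key : ∀ P : D.CE U, ∀ Z ∈ T, P * Z ∈ T := by
    intro P
    induction P using SymmetricAlgebra.induction with
    | algebraMap c =>
      intro Z hZ
      rw [Algebra.algebraMap_eq_smul_one, smul_mul_assoc, one_mul]
      exact T.smul_mem c hZ
    | ι x =>
      intro Z hZ
      obtain ⟨⟨t, t'⟩, c⟩ := x
      have e : (((t, t'), c) : D.L1 U) = D.one true U t + D.one false U t' + (0, c) := by
        change _ = (((t, 0), 0) : D.L1 U) + ((0, t'), 0) + (0, c)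
        simp
      change D.sus U ((t, t'), c) * Z ∈ T
      rw [e, map_add, map_add, add_mul, add_mul]
      exact T.add_mem (T.add_mem (hsec true t Z hZ) (hsec false t' Z hZ)) (hcent c Z hZ)
    | add x y hx hy =>
      intro Z hZ
      rw [add_mul]
      exact T.add_mem (hx Z hZ) (hy Z hZ)
    | mul x y hx hy =>
      intro Z hZ
      rw [mul_assoc]
      exact hx _ (hy Z hZ)
  have h1 : (1 : D.CE U) ∈ T := Submodule.mem_sup_left (Submodule.subset_span
    ⟨Empty, inferInstance, Empty.elim, Empty.elim, Empty.elim, fun j => j.elim, by simp [sgnProd]⟩)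
  simpa using key P 1 h1

/-- Classes are linear combinations of classes of products of forms. -/
theorem span_cls_products (U : Opens Sphere) :
    Submodule.span ℂ (D.cls U '' D.productSet U) = ⊤ := by
  rw [eq_top_iff]
  rintro x -
  obtain ⟨P, rfl⟩ := D.cls_surjective x
  obtain ⟨Y, hY, _, ⟨Z, rfl⟩, rfl⟩ := Submodule.mem_sup.1 (mem_span_products P)
  have : D.cls U (Z * (D.sus U (0, 1) - 1)) = 0 := by
    rw [mul_sub, mul_one, map_sub, cls_mul_sus_central, one_smul, sub_self]
  rw [LinearMap.mulRight_apply, map_add, this, add_zero, ← Submodule.map_span]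
  exact Submodule.mem_map_of_mem hY

/-- A family of functionals with summable bounds in terms of derivatives. -/
def Equi {ι : Type} (φ : ι → D.UL U →ₗ[ℂ] ℂ) : Prop :=
  ∀ K : Set ℂ, IsCompact K → (∀ z ∈ K, (z : Sphere) ∈ U) → ∀ (J : Type) [Fintype J] (s : J → Bool)
    (a : J → 𝔞), ∃ (C : ι → ℝ) (k : ℕ), Summable C ∧ (∀ i, 0 ≤ C i) ∧
    ∀ i (η : J → ℂ → ℂ) (M : J → ℝ), (∀ j, η j ∈ Form D.wt 1 (sOpen (s j) U)) →
      (∀ j, ∀ z ∉ K, η j (ev (s j) z) = 0) →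
      (∀ j, ∀ l ≤ k, ∀ z, ‖iteratedFDeriv ℝ l (η j) z‖ ≤ M j) →
      ‖φ i (D.cls U (D.sgnProd U s a η))‖ ≤ C i * ∏ j, M j

theorem equi_of_isContinuousFunctional {φ : D.UL U →ₗ[ℂ] ℂ} (hφ : D.IsContinuousFunctional φ) :
    Equi fun _ : Unit => φ := by
  intro K hK hKU J _ s a
  let e := (Fintype.equivFin {j // s j = true}).symm
  let e' := (Fintype.equivFin {j // ¬ s j = true}).symm
  obtain ⟨C, k, h⟩ := hφ K hK hKU _ _ (fun i => a (e i)) (fun i => a (e' i))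
  refine ⟨fun _ => |C|, k, (hasSum_fintype _).summable, fun _ => abs_nonneg C,
    fun _ η M h1 h2 h3 => ?_⟩
  have hs' : ∀ i, s (e' i) = false := fun i => by simpa using (e' i).2
  have m1 : ∀ i, η (e i) ∈ Form D.wt 1 U := fun i => by
    have := h1 (e i)
    rwa [(e i).2] at this
  have m2 : ∀ i, η (e' i) ∈ Form D.wt 1 (conjOpen U) := fun i => by
    have := h1 (e' i)
    rwa [hs' i] at this
  have key := h (fun i => ⟨_, m1 i⟩) (fun i => ⟨_, m2 i⟩) (fun i => M (e i)) (fun i => M (e' i))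
    (fun i z hz => by have := h2 (e i) z hz; rwa [(e i).2] at this)
    (fun i z hz => by have := h2 (e' i) z hz; rwa [hs' i] at this)
    (fun i => h3 (e i)) (fun i => h3 (e' i))
  have hM : (∏ i, M (e i)) * ∏ i, M (e' i) = ∏ j, M j := by
    rw [Equiv.prod_comp e fun j => M j, Equiv.prod_comp e' fun j => M j,
      Fintype.prod_subtype_mul_prod_subtype]
  have hM0 : 0 ≤ ∏ j, M j := Finset.prod_nonneg fun j _ => (norm_nonneg _).trans (h3 j 0 (Nat.zero_le _) 0)
  have hP : D.sgnProd U s a η = (∏ i, D.chiralForm (a (e i)) ⟨_, m1 i⟩) *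
      ∏ i, D.antiForm (a (e' i)) ⟨_, m2 i⟩ := by
    rw [sgnProd, ← Fintype.prod_subtype_mul_prod_subtype (fun j => s j = true),
      ← Equiv.prod_comp e, ← Equiv.prod_comp e']
    congr 1
    · refine Finset.prod_congr rfl fun i _ => ?_
      rw [chiralForm_eq, (e i).2]
    · refine Finset.prod_congr rfl fun i _ => ?_
      rw [antiForm_eq, hs' i]
  rw [hP]
  refine le_trans key ?_
  rw [mul_assoc, hM]
  exact mul_le_mul_of_nonneg_right (le_abs_self C) hM0

theorem exists_common_bound (hU : (OnePoint.infty : Sphere) ∉ U) {J : Type} [Fintype J]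
    {s : J → Bool} {η : J → ℂ → ℂ} (hη : ∀ j, η j ∈ Form D.wt 1 (sOpen (s j) U)) :
    ∃ K : Set ℂ, IsCompact K ∧ (∀ z ∈ K, (z : Sphere) ∈ U) ∧
      (∀ j, ∀ z ∉ K, η j (ev (s j) z) = 0) ∧
      ∀ k, ∃ M : J → ℝ, ∀ j, ∀ l ≤ k, ∀ z, ‖iteratedFDeriv ℝ l (η j) z‖ ≤ M j := by
  choose h1 K h2 h3 h4 using fun j => Form.exists_compact hU (hη j)
  refine ⟨⋃ j, K j, isCompact_iUnion h2, fun z hz => ?_, fun j z hz => ?_, fun k => ?_⟩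
  · obtain ⟨j, hj⟩ := Set.mem_iUnion.1 hz
    exact h3 j z hj
  · exact h4 j z fun hn => hz (Set.mem_iUnion.2 ⟨j, hn⟩)
  · choose M hM using fun j => exists_iteratedFDeriv_bound (hη j).1 (h1 j) k
    exact ⟨M, hM⟩

theorem Equi.summable {ι : Type} {φ : ι → D.UL U →ₗ[ℂ] ℂ} (hφ : Equi φ)
    (hU : (OnePoint.infty : Sphere) ∉ U) (x : D.UL U) : Summable fun i => φ i x := by
  have hx : x ∈ Submodule.span ℂ (D.cls U '' D.productSet U) := by
    rw [span_cls_products]; trivial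
  induction hx using Submodule.span_induction with
  | mem x hx =>
    obtain ⟨_, ⟨J, _, s, a, η, hη, rfl⟩, rfl⟩ := hx
    obtain ⟨K, h1, h2, h3, h4⟩ := exists_common_bound hU hη
    obtain ⟨C, k, hC, -, h⟩ := hφ K h1 h2 J s a
    obtain ⟨M, hM⟩ := h4 k
    exact Summable.of_norm_bounded (hC.mul_right _) fun i => h i η M hη h3 hM
  | zero => simpa only [map_zero] using summable_zero
  | add x y _ _ hx hy => simpa only [map_add] using hx.add hy
  | smul c x _ hx => simpa only [map_smul, smul_eq_mul] using hx.mul_left c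

variable (D) in
/-- A family of forms outside of the closure of `V`, with rapidly decreasing derivatives. -/
structure RapidForms (σ : Bool) (V W : Opens Sphere) {κ : Type} (F : κ → ℂ → ℂ) (K : Set ℂ) :
    Prop where
  mem : ∀ k, F k ∈ Form D.wt 1 (sOpen σ (rim V W))
  compact : IsCompact K
  subset : ∀ z ∈ K, (z : Sphere) ∈ W
  eq_zero : ∀ k, ∀ z ∉ K, F k (ev σ z) = 0
  rapid : Rapid F

theorem norm_opn_sgnProd_le {ι : Type} {φ : ι → D.UL W →ₗ[ℂ] ℂ} (hφ : Equi φ) (a : 𝔞) (h : V ≤ W)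
    {K K' : Set ℂ} (hK : IsCompact K) (hKV : ∀ z ∈ K, (z : Sphere) ∈ V) (hK' : IsCompact K')
    (hKW : ∀ z ∈ K', (z : Sphere) ∈ W) {J : Type} [Fintype J] (s : J → Bool) (b : J → 𝔞) :
    ∃ (C : ι → ℝ) (k : ℕ), Summable C ∧ (∀ i, 0 ≤ C i) ∧ ∀ i (η : J → ℂ → ℂ) (M : J → ℝ) (F : ℂ → ℂ)
      (e : ℝ), (∀ j, η j ∈ Form D.wt 1 (sOpen (s j) V)) →
      (∀ j, ∀ z ∉ K, η j (ev (s j) z) = 0) →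
      (∀ j, ∀ l ≤ k, ∀ z, ‖iteratedFDeriv ℝ l (η j) z‖ ≤ M j) →
      F ∈ Form D.wt 1 (sOpen σ (rim V W)) → (∀ z ∉ K', F (ev σ z) = 0) →
      (∀ l ≤ k, ∀ z, ‖iteratedFDeriv ℝ l F z‖ ≤ e) →
      ‖φ i (D.opn σ a h F (D.cls V (D.sgnProd V s b η)))‖ ≤ C i * (e * ∏ j, M j) := by
  obtain ⟨C, k, hC, hC0, hb⟩ := hφ (K ∪ K') (hK.union hK')
    (fun z hz => hz.elim (fun hz => h (hKV z hz)) (hKW z)) (Option J) (fun j => j.elim σ s)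
    fun j => j.elim a b
  refine ⟨C, k, hC, hC0, fun i η M F e h1 h2 h3 h4 h5 h6 => ?_⟩
  rw [opn_cls D a h h4, extCE_sgnProd h s b h1, ins_mul_sgnProd]
  refine (hb i _ (fun j => j.elim e M) (fun j => ?_) (fun j z hz => ?_) fun j l hl z => ?_).trans ?_
  · cases j with
    | none => exact Form.mono h4 (sOpen_mono σ rim_le)
    | some j => exact Form.mono (h1 j) (sOpen_mono _ h)
  · cases j with
    | none => exact h5 z fun hn => hz (Or.inr hn)
    | some j => exact h2 j z fun hn => hz (Or.inl hn)
  · cases j with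
    | none => exact h6 l hl z
    | some j => exact h3 j l hl z
  · rw [Fintype.prod_option]
    exact le_rfl

theorem Equi.comp_opn {ι κ : Type} {φ : ι → D.UL W →ₗ[ℂ] ℂ} (hφ : Equi φ) (a : 𝔞) (h : V ≤ W)
    {F : κ → ℂ → ℂ} {K' : Set ℂ} (hF : D.RapidForms σ V W F K') :
    Equi fun x : ι × κ => φ x.1 ∘ₗ D.opn σ a h (F x.2) := by
  intro K hK hKV J _ s b
  obtain ⟨C, k, hC, hC0, hb⟩ := norm_opn_sgnProd_le (σ := σ) hφ a h hK hKV hF.compact hF.subset s b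
  obtain ⟨c, hc, hcF⟩ := hF.rapid k
  have hc0 : ∀ x, 0 ≤ c x := fun x => (norm_nonneg _).trans (hcF x 0 (Nat.zero_le _) 0)
  refine ⟨fun x => C x.1 * c x.2, k, hC.mul_of_nonneg hc hC0 hc0,
    fun x => mul_nonneg (hC0 _) (hc0 _), fun x η M h1 h2 h3 => ?_⟩
  rw [mul_assoc]
  exact hb x.1 η M (F x.2) (c x.2) h1 h2 h3 (hF.mem _) (hF.eq_zero _) (hcF _)

theorem opn_sub_sum (a : 𝔞) (h : V ≤ W) {κ : Type} {F : κ → ℂ → ℂ} {f : ℂ → ℂ}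
    (hF : ∀ k, F k ∈ Form D.wt 1 (sOpen σ (rim V W))) (hf : f ∈ Form D.wt 1 (sOpen σ (rim V W)))
    (x : D.UL V) (T : Finset κ) : D.opn σ a h (f - ∑ k ∈ T, F k) x =
      D.opn σ a h f x - ∑ k ∈ T, D.opn σ a h (F k) x := by
  classical
  induction T using Finset.induction_on with
  | empty => simp
  | insert k T hk ih =>
    rw [Finset.sum_insert hk, Finset.sum_insert hk, add_comm, ← sub_sub, opn_sub D a h
      (Submodule.sub_mem _ hf (Submodule.sum_mem _ fun k _ => hF k)) (hF k), ih, add_comm, sub_sub]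

/-- Insertions of series of forms can be computed term by term. -/
theorem Equi.hasSum_opn {ι κ : Type} {φ : ι → D.UL W →ₗ[ℂ] ℂ} (hφ : Equi φ) (a : 𝔞) (h : V ≤ W)
    (hV : (OnePoint.infty : Sphere) ∉ V) {F : κ → ℂ → ℂ} {K' : Set ℂ}
    (hF : D.RapidForms σ V W F K') {f : ℂ → ℂ} (hf : f ∈ Form D.wt 1 (sOpen σ (rim V W)))
    (hs : ∀ z, HasSum (fun k => F k z) (f z)) (i : ι) (x : D.UL V) :
    HasSum (fun k => φ i (D.opn σ a h (F k) x)) (φ i (D.opn σ a h f x)) := by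
  have hx : x ∈ Submodule.span ℂ (D.cls V '' D.productSet V) := by
    rw [span_cls_products]; trivial
  induction hx using Submodule.span_induction with
  | mem x hx =>
    obtain ⟨_, ⟨J, _, s, b, η, hη, rfl⟩, rfl⟩ := hx
    obtain ⟨K, h1, h2, h3, h4⟩ := exists_common_bound hV hη
    obtain ⟨C, k, hC, -, hb⟩ :=
      norm_opn_sgnProd_le (σ := σ) hφ a h h1 h2 hF.compact hF.subset s b
    obtain ⟨M, hM⟩ := h4 k
    obtain ⟨e, he, hb'⟩ := hF.rapid.tail (fun k => (hF.mem k).1) hf.1 hs k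
    have hf0 : ∀ z ∉ K', f (ev σ z) = 0 := fun z hz => by
      rw [← (hs (ev σ z)).tsum_eq]
      simp only [hF.eq_zero _ z hz, tsum_zero]
    rw [HasSum, SummationFilter.unconditional_filter, tendsto_iff_norm_sub_tendsto_zero]
    have hlim : Tendsto (fun T => C i * (e T * ∏ j, M j)) atTop (𝓝 0) := by
      have := (he.mul_const (∏ j, M j)).const_mul (C i)
      rwa [zero_mul, mul_zero] at this
    refine squeeze_zero (fun _ => norm_nonneg _) (fun T => ?_) hlim
    have := hb i η M (f - ∑ k ∈ T, F k) (e T) hη h3 hM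
      (Submodule.sub_mem _ hf (Submodule.sum_mem _ fun k _ => hF.mem k))
      (fun z hz => by
        rw [Pi.sub_apply, hf0 z hz, Finset.sum_apply,
          Finset.sum_eq_zero fun k _ => hF.eq_zero k z hz, sub_zero]) (hb' T)
    rw [opn_sub_sum a h hF.mem hf, map_sub, map_sum] at this
    rwa [norm_sub_rev]
  | zero => simpa only [map_zero] using hasSum_zero
  | add x y _ _ hx hy => simpa only [map_add] using hx.add hy
  | smul c x _ hx => simpa only [map_smul, smul_eq_mul] using hx.mul_left c

end Datum

end

end SphereVA

end

noncomputable section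

namespace SphereVA

open Filter
open Datum (dir)

/-! ### Expansions of families -/

/-- The numbers `v i` are the sums of the series `f i`, which are jointly summable. -/
def Expands {ι X : Type} (f : ι → X → ℂ) (v : ι → ℂ) : Prop :=
  (Summable fun y : ι × X => f y.1 y.2) ∧ ∀ i, HasSum (f i) (v i)

namespace Expands

variable {ι X : Type} {f g : ι → X → ℂ} {v w : ι → ℂ}

theorem of_eq (h : Expands f v) (e : ∀ i x, g i x = f i x) (e' : ∀ i, w i = v i) : Expands g w := by
  rw [funext e', funext fun i => funext (e i)]; exact h

theorem add (h : Expands f v) (h' : Expands g w) :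
    Expands (fun i x => f i x + g i x) fun i => v i + w i :=
  ⟨h.1.add h'.1, fun i => (h.2 i).add (h'.2 i)⟩

theorem const_mul (c : ℂ) (h : Expands f v) :
    Expands (fun i x => c * f i x) fun i => c * v i :=
  ⟨h.1.mul_left c, fun i => (h.2 i).mul_left c⟩

theorem sum {K : Type} {T : Finset K} {f : K → ι → X → ℂ} {v : K → ι → ℂ}
    (h : ∀ k ∈ T, Expands (f k) (v k)) :
    Expands (fun i x => ∑ k ∈ T, f k i x) fun i => ∑ k ∈ T, v k i :=
  ⟨summable_sum fun k hk => (h k hk).1, fun i => hasSum_sum fun k hk => (h k hk).2 i⟩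

theorem reindex (e : X ≃ X) (h : Expands f v) : Expands (fun i x => f i (e x)) v :=
  ⟨h.1.comp_injective (i := fun y : ι × X => (y.1, e y.2))
    (Function.injective_id.prodMap e.injective), fun i => (Equiv.hasSum_iff e (f := f i)).2 (h.2 i)⟩

/-- Summation over an additional index, with a shift of the arguments. -/
theorem tsum {K : Type} {f : ι × K → X → ℂ} {v : ι × K → ℂ} (h : Expands f v) (e : K → X ≃ X)
    (hw : ∀ i, HasSum (fun k => v (i, k)) (w i)) :
    Expands (fun i x => ∑' k, f (i, k) (e k x)) w := by
  have hE : Function.Injective fun y : (ι × X) × K => ((y.1.1, y.2), e y.2 y.1.2) := by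
    rintro ⟨⟨i, x⟩, k⟩ ⟨⟨i', x'⟩, k'⟩ hh
    simp only [Prod.mk.injEq] at hh
    obtain ⟨⟨rfl, rfl⟩, hx⟩ := hh
    rw [(e k).injective hx]
  have h1 : Summable fun y : (ι × X) × K => f (y.1.1, y.2) (e y.2 y.1.2) := h.1.comp_injective hE
  have h1' : Summable fun y : ι × X => ∑' k, f (y.1, k) (e k y.2) :=
    Summable.prod (f := fun y : (ι × X) × K => f (y.1.1, y.2) (e y.2 y.1.2)) h1
  refine ⟨h1', fun i => ?_⟩
  have h2 : Summable fun y : X × K => f (i, y.2) (e y.2 y.1) := by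
    have hi : Function.Injective fun y : X × K => (((i, y.1), y.2) : (ι × X) × K) := by
      rintro ⟨a, b⟩ ⟨c, d⟩ hh
      simpa using hh
    exact Summable.comp_injective (f := fun y : (ι × X) × K => f (y.1.1, y.2) (e y.2 y.1.2)) h1 hi
  have h3 : HasSum (fun y : K × X => f (i, y.1) (e y.1 y.2)) (∑' y : X × K, f (i, y.2) (e y.2 y.1)) :=
    (Equiv.hasSum_iff (Equiv.prodComm K X)
      (f := fun y : X × K => f (i, y.2) (e y.2 y.1))).2 h2.hasSum
  have h4 : HasSum (fun k => v (i, k)) (∑' y : X × K, f (i, y.2) (e y.2 y.1)) :=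
    h3.prod_fiberwise fun k => ((e k).hasSum_iff (f := f (i, k))).2 (h.2 (i, k))
  rw [(hw i).unique h4]
  exact HasSum.prod_fiberwise (f := fun y : X × K => f (i, y.2) (e y.2 y.1)) h2.hasSum
    fun x => (h2.prod_factor x).hasSum

end Expands

section

variable {𝔞 : Type*} [AddCommGroup 𝔞] [Module ℂ 𝔞] {D : Datum 𝔞}
  {σ : Bool} {U V W : Opens Sphere} {p q : ℂ} {ρ : ℂ → ℂ}

namespace Datum

/-! ### Creation operators and linear functionals -/

theorem apply_vop_create (hD : D.Admissible) (L : D.State →ₗ[ℂ] ℂ) (σ : Bool) (m : ℕ) (a : 𝔞)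
    (A v : D.State) (x : ℤ × ℤ) (N : ℕ) (hN : ∀ k : ℕ, N ≤ k → D.act σ k a v = 0) :
    L (vop hD x (D.act σ (-m - 1) a A) v) =
      (∑' k : ℕ, ((k + m).choose m : ℂ) *
        L (D.act σ (-(k + m : ℕ) - 1) a (vop hD (x + (k : ℤ) • dir σ) A v))) +
      ∑ k ∈ Finset.range N,
        bin (-k - 1) m * L (vop hD (x - (k + m + 1 : ℤ) • dir σ) A (D.act σ k a v)) := by
  obtain ⟨N', hN'⟩ := vop_create_bound hD σ m A v x
  have e1 : ∀ k : ℕ, N' ≤ k → (k.choose m : ℂ) •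
      D.act σ (-k - 1) a (vop hD (x + (k - m : ℤ) • dir σ) A v) = 0 := fun k hk => by
    rw [(hN' k hk).1, map_zero, smul_zero]
  have e2 : ∀ k : ℕ, N ≤ k → bin (-k - 1) m •
      vop hD (x - (k + m + 1 : ℤ) • dir σ) A (D.act σ k a v) = 0 := fun k hk => by
    rw [hN k hk, map_zero, smul_zero]
  rw [vop_create, map_add, finsum_eq_sum_range e1, finsum_eq_sum_range e2, map_sum, map_sum]
  congr 1
  · have h : HasSum (fun k : ℕ => L ((k.choose m : ℂ) •
        D.act σ (-k - 1) a (vop hD (x + (k - m : ℤ) • dir σ) A v)))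
        (∑ k ∈ Finset.range N', L ((k.choose m : ℂ) •
          D.act σ (-k - 1) a (vop hD (x + (k - m : ℤ) • dir σ) A v))) :=
      hasSum_sum_of_ne_finset_zero fun k hk => by
        rw [e1 k (by simpa using hk), map_zero]
    rw [← (add_left_injective m).hasSum_iff] at h
    · rw [← h.tsum_eq]
      refine tsum_congr fun k => ?_
      simp only [Function.comp_apply]
      rw [map_smul, smul_eq_mul, show (((k + m : ℕ) : ℤ) - m : ℤ) = k by push_cast; ring]
    · intro k hk
      have : k < m := by
        by_contra hn
        exact hk ⟨k - m, by simp only; omega⟩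
      rw [Nat.choose_eq_zero_of_lt this, Nat.cast_zero, zero_smul, map_zero]
  · exact Finset.sum_congr rfl fun k _ => by rw [map_smul, smul_eq_mul]

/-! ### Expansions of shells -/

theorem norm_sub_le_of_mem_crit {r : ℝ} (hρ : Fits σ (disc p r) U ρ) {z : ℂ} (hz : z ∈ crit ρ) :
    r ≤ ‖z - ev σ p‖ := by
  by_contra! hn
  have : ((ev σ z : ℂ) : Sphere) ∈ disc p r := by
    rw [mem_disc_iff, norm_sub_ev]; exact hn
  exact notMem_crit_of_eventuallyEq (hρ.eq_one z (subset_closure this)) hz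

theorem rapidForms_of_fits {κ : Type} {V₁ : Opens Sphere} {h : κ → ℂ → ℂ} {c : κ → ℂ} (hρ : Fits σ V₁ U ρ)
    (hm : ∀ k, sh (h k) ρ ∈ Form D.wt 1 (sOpen σ (rim V W)))
    (hU : U ≤ W) (hr : Rapid fun k => c k • sh (h k) ρ) :
    D.RapidForms σ V W (fun k => c k • sh (h k) ρ) (ev σ '' tsupport ρ) where
  mem k := Submodule.smul_mem _ _ (hm k)
  compact := hρ.compact.isCompact.image (continuous_ev σ)
  subset := by
    rintro _ ⟨z, hz, rfl⟩
    exact hU (hρ.subset z hz)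
  eq_zero k z hz := by
    have : ev σ z ∉ tsupport ρ := fun hn => hz ⟨ev σ z, hn, ev_ev σ z⟩
    rw [Pi.smul_apply, sh, dbar_eq_zero_of_notMem_crit fun h => this (crit_subset h), mul_zero,
      neg_zero, smul_zero]
  rapid := hr

theorem rapid_outer {r : ℝ} (hr : 0 < r) (hρ : Fits σ (disc p r) U ρ) {t : ℂ} (ht : ‖t‖ < r) (m : ℕ) :
    Rapid fun k : ℕ => (((k + m).choose m : ℂ) * t ^ k) •
      sh (fun z => (z - ev σ p) ^ (-(k + m : ℕ) - 1 : ℤ)) ρ := by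
  have hp := mem_disc (p := p) hr
  have hsm : ContDiff ℝ ∞ (sh (fun z => (z - ev σ p) ^ (-(m : ℤ) - 1)) ρ) :=
    contDiff_sh hρ.smooth fun z hz => hρ.analyticAt_zpow hp _ hz
  have hg : ∀ z ∈ crit ρ, ContDiffAt ℝ ∞ (fun z => t / (z - ev σ p)) z := fun z hz => by
    have hne : z ≠ ev σ p := ne_of_mem_crit (hρ.eq_one_center hp) hz
    have : AnalyticAt ℂ (fun z => t / (z - ev σ p)) z :=
      analyticAt_const.div (analyticAt_id.sub analyticAt_const) (sub_ne_zero.2 hne)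
    exact this.contDiffAt.restrict_scalars ℝ
  have := rapid_pow (x := ‖t‖ / r) hsm (HasCompactSupport.of_subset hρ.compact
    (tsupport_sh.trans crit_subset)) (fun z hz => hg z (tsupport_sh hz)) (by positivity)
    ((div_lt_one hr).2 ht) (fun z hz => by
      rw [norm_div]
      gcongr
      exact norm_sub_le_of_mem_crit hρ (tsupport_sh hz)) m
  convert this using 1
  funext k z
  simp only [Pi.smul_apply, smul_eq_mul, sh]
  by_cases hz : z ∈ crit ρ
  · have hne : z - ev σ p ≠ 0 := sub_ne_zero.2 (ne_of_mem_crit (hρ.eq_one_center hp) hz)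
    rw [show (-(k + m : ℕ) - 1 : ℤ) = (-(m : ℤ) - 1) - k by push_cast; ring, zpow_sub₀ hne,
      zpow_natCast, div_pow]
    ring
  · rw [dbar_eq_zero_of_notMem_crit hz]; ring

theorem hasSum_outer {r : ℝ} (hρ : Fits σ (disc p r) U ρ) {t : ℂ} (ht : ‖t‖ < r)
    (m : ℕ) (z : ℂ) : HasSum (fun k : ℕ => ((((k + m).choose m : ℂ) * t ^ k) •
      sh (fun z => (z - ev σ p) ^ (-(k + m : ℕ) - 1 : ℤ)) ρ) z)
      (sh (fun z => (z - (ev σ p + t)) ^ (-m - 1 : ℤ)) ρ z) := by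
  by_cases hz : z ∈ crit ρ
  · have := (hasSum_choose_zpow m (ht.trans_le (norm_sub_le_of_mem_crit hρ hz))).mul_right
      (-dbar ρ z)
    refine hasSum_of_eq this (fun k => ?_) ?_
    · simp only [Pi.smul_apply, smul_eq_mul, sh]
      rw [show (-(k + m : ℕ) - 1 : ℤ) = -(k + m + 1) by push_cast; ring]
      ring
    · rw [sh, show (-m - 1 : ℤ) = -(m + 1) by ring, sub_sub]
      ring
  · simp only [Pi.smul_apply, sh, dbar_eq_zero_of_notMem_crit hz, mul_zero, neg_zero, smul_zero]
    exact hasSum_zero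

theorem rapid_inner {x : ℝ} (hx : 0 ≤ x) (hx1 : x < 1) (hρ : Fits σ V U ρ) {t : ℂ} (ht : t ≠ 0)
    (hb : ∀ z ∈ tsupport ρ, ‖z - ev σ p‖ ≤ x * ‖t‖) (m : ℕ) :
    Rapid fun k : ℕ => (-(bin (-k - 1) m * t ^ (-(k + m + 1) : ℤ))) •
      sh (fun z => (z - ev σ p) ^ (k : ℤ)) ρ := by
  have hsm : ContDiff ℝ ∞ (sh (fun _ => -((-1) ^ m * t ^ (-(m + 1) : ℤ))) ρ) :=
    contDiff_sh hρ.smooth fun z hz => analyticAt_const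
  have hg : ∀ z, ContDiffAt ℝ ∞ (fun z => (z - ev σ p) / t) z := fun z => by
    fun_prop
  have := rapid_pow (x := x) hsm (HasCompactSupport.of_subset hρ.compact
    (tsupport_sh.trans crit_subset)) (fun z hz => hg z) hx hx1 (fun z hz => by
      rw [norm_div, div_le_iff₀ (norm_pos_iff.2 ht)]
      exact hb z (crit_subset (tsupport_sh hz))) m
  convert this using 1
  funext k z
  simp only [Pi.smul_apply, smul_eq_mul, sh]
  rw [bin_neg_sub_one, show (-(k + m + 1) : ℤ) = -(m + 1) - k by ring, zpow_sub₀ ht, zpow_natCast,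
    zpow_natCast, div_pow]
  ring

theorem hasSum_inner {x : ℝ} (hx1 : x < 1) {t : ℂ} (ht : t ≠ 0)
    (hb : ∀ z ∈ tsupport ρ, ‖z - ev σ p‖ ≤ x * ‖t‖) (m : ℕ) (z : ℂ) :
    HasSum (fun k : ℕ => ((-(bin (-k - 1) m * t ^ (-(k + m + 1) : ℤ))) •
      sh (fun z => (z - ev σ p) ^ (k : ℤ)) ρ) z)
      (sh (fun z => (z - (ev σ p + t)) ^ (-m - 1 : ℤ)) ρ z) := by
  by_cases hz : z ∈ crit ρ
  · have hlt : ‖z - ev σ p‖ < ‖t‖ := (hb z (crit_subset hz)).trans_lt (by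
      have := norm_pos_iff.2 ht
      nlinarith)
    have := (hasSum_choose_zpow m hlt).mul_right ((-1) ^ m * dbar ρ z)
    refine hasSum_of_eq this (fun k => ?_) ?_
    · simp only [Pi.smul_apply, smul_eq_mul, sh]
      rw [bin_neg_sub_one, zpow_natCast]
      ring
    · rw [sh, show (-m - 1 : ℤ) = -(m + 1) by ring, show z - (ev σ p + t) =
        -1 * (t - (z - ev σ p)) by ring, mul_zpow, show ((-1 : ℂ)) ^ (-(m + 1 : ℤ)) = -(-1) ^ m by
          rw [zpow_neg, ← inv_zpow, inv_neg, inv_one, zpow_add_one₀ (by norm_num), zpow_natCast]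
          ring]
      ring
  · simp only [Pi.smul_apply, sh, dbar_eq_zero_of_notMem_crit hz, mul_zero, neg_zero, smul_zero]
    exact hasSum_zero

/-! ### Factorisation products and insertions -/

section

variable {Vq Vp Vq' Vp' V₁ : Opens Sphere}

theorem extCE_mul_ins (a : 𝔞) (hVq : Vq ≤ W) (hVp : Vp ≤ W)
    (lq : Vq' ≤ Vq) (lp : Vp' ≤ Vp) (hs : Vq' ⊔ Vp' ≤ W) {F : ℂ → ℂ}
    (hF : F ∈ Form D.wt 1 (sOpen σ Vq)) (P : D.CE Vq') (Q : D.CE Vp') :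
    D.extCE hVq (D.ins σ Vq a F * D.extCE lq P) * D.extCE hVp (D.extCE lp Q) =
      D.ins σ W a F * D.extCE hs
        (D.extCE (le_sup_left : Vq' ≤ Vq' ⊔ Vp') P * D.extCE (le_sup_right : Vp' ≤ Vq' ⊔ Vp') Q) := by
  rw [map_mul (D.extCE hVq), map_mul (D.extCE hs), extCE_ins D hVq a hF, extCE_extCE, extCE_extCE,
    extCE_extCE, extCE_extCE, mul_assoc]

theorem extCE_mul_ins' (a : 𝔞) (hVq : Vq ≤ W) (hVp : Vp ≤ W)
    (lq : Vq' ≤ Vq) (lp : Vp' ≤ Vp) (hs : Vq' ⊔ Vp' ≤ W) {F : ℂ → ℂ}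
    (hF : F ∈ Form D.wt 1 (sOpen σ Vp)) (P : D.CE Vq') (Q : D.CE Vp') :
    D.extCE hVq (D.extCE lq P) * D.extCE hVp (D.ins σ Vp a F * D.extCE lp Q) =
      D.ins σ W a F * D.extCE hs
        (D.extCE (le_sup_left : Vq' ≤ Vq' ⊔ Vp') P * D.extCE (le_sup_right : Vp' ≤ Vq' ⊔ Vp') Q) := by
  rw [map_mul (D.extCE hVp), map_mul (D.extCE hs), extCE_ins D hVp a hF, extCE_extCE, extCE_extCE,
    extCE_extCE, extCE_extCE, mul_left_comm]

theorem facProd_opn_left_cls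
    (a : 𝔞) (hVq : Vq ≤ W) (hVp : Vp ≤ W) (hd : Disjoint Vq Vp)
    (lq : Vq' ≤ Vq) (lp : Vp' ≤ Vp) (hs : Vq' ⊔ Vp' ≤ W) {F : ℂ → ℂ}
    (hF : F ∈ Form D.wt 1 (sOpen σ (rim Vq' Vq)))
    (hF' : F ∈ Form D.wt 1 (sOpen σ (rim (Vq' ⊔ Vp') W))) (P : D.CE Vq') (Q : D.CE Vp') :
    D.facProd hVq hVp hd (D.opn σ a lq F (D.cls Vq' P)) (D.extUL lp (D.cls Vp' Q)) =
      D.opn σ a hs F (D.cls _ (D.extCE (le_sup_left : Vq' ≤ Vq' ⊔ Vp') P *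
      D.extCE (le_sup_right : Vp' ≤ Vq' ⊔ Vp') Q)) := by
  have h1 := opn_cls D a lq hF P
  have h2 := extUL_cls D lp Q
  have h3 := opn_cls D a hs hF' (D.extCE (le_sup_left : Vq' ≤ Vq' ⊔ Vp') P *
      D.extCE (le_sup_right : Vp' ≤ Vq' ⊔ Vp') Q)
  have h4 := extCE_mul_ins a hVq hVp lq lp hs (Form.mono hF (sOpen_mono σ rim_le)) P Q
  have h5 := facProd_cls D hVq hVp hd (D.ins σ Vq a F * D.extCE lq P) (D.extCE lp Q)
  rw [h1, h2, h3]
  exact h5.trans (congrArg (D.cls W) h4)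

theorem facProd_opn_left
    (a : 𝔞) (hVq : Vq ≤ W) (hVp : Vp ≤ W) (hd : Disjoint Vq Vp)
    (lq : Vq' ≤ Vq) (lp : Vp' ≤ Vp) (hs : Vq' ⊔ Vp' ≤ W) {F : ℂ → ℂ}
    (hF : F ∈ Form D.wt 1 (sOpen σ (rim Vq' Vq)))
    (hF' : F ∈ Form D.wt 1 (sOpen σ (rim (Vq' ⊔ Vp') W))) (hd' : Disjoint Vq' Vp') (x : D.UL Vq') (y : D.UL Vp') :
    D.facProd hVq hVp hd (D.opn σ a lq F x) (D.extUL lp y) =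
      D.opn σ a hs F
        (D.facProd (le_sup_left : Vq' ≤ Vq' ⊔ Vp') (le_sup_right : Vp' ≤ Vq' ⊔ Vp') hd' x y) := by
  obtain ⟨P, hP⟩ := D.cls_surjective x
  obtain ⟨Q, hQ⟩ := D.cls_surjective y
  rw [← hP, ← hQ, facProd_cls D (le_sup_left : Vq' ≤ Vq' ⊔ Vp') (le_sup_right : Vp' ≤ Vq' ⊔ Vp') hd']
  exact facProd_opn_left_cls a hVq hVp hd lq lp hs hF hF' P Q

theorem facProd_opn_right_cls
    (a : 𝔞) (hVq : Vq ≤ W) (hVp : Vp ≤ W) (hd : Disjoint Vq Vp)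
    (lq : Vq' ≤ Vq) (lp : Vp' ≤ Vp) (hs : Vq' ⊔ Vp' ≤ W) {F : ℂ → ℂ}
    (hF : F ∈ Form D.wt 1 (sOpen σ (rim Vp' Vp)))
    (hF' : F ∈ Form D.wt 1 (sOpen σ (rim (Vq' ⊔ Vp') W))) (P : D.CE Vq') (Q : D.CE Vp') :
    D.facProd hVq hVp hd (D.extUL lq (D.cls Vq' P)) (D.opn σ a lp F (D.cls Vp' Q)) =
      D.opn σ a hs F (D.cls _ (D.extCE (le_sup_left : Vq' ≤ Vq' ⊔ Vp') P *
      D.extCE (le_sup_right : Vp' ≤ Vq' ⊔ Vp') Q)) := by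
  have h1 := opn_cls D a lp hF Q
  have h2 := extUL_cls D lq P
  have h3 := opn_cls D a hs hF' (D.extCE (le_sup_left : Vq' ≤ Vq' ⊔ Vp') P *
      D.extCE (le_sup_right : Vp' ≤ Vq' ⊔ Vp') Q)
  have h4 := extCE_mul_ins' a hVq hVp lq lp hs (Form.mono hF (sOpen_mono σ rim_le)) P Q
  have h5 := facProd_cls D hVq hVp hd (D.extCE lq P) (D.ins σ Vp a F * D.extCE lp Q)
  rw [h1, h2, h3]
  exact h5.trans (congrArg (D.cls W) h4)

theorem facProd_opn_right
    (a : 𝔞) (hVq : Vq ≤ W) (hVp : Vp ≤ W) (hd : Disjoint Vq Vp)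
    (lq : Vq' ≤ Vq) (lp : Vp' ≤ Vp) (hs : Vq' ⊔ Vp' ≤ W) {F : ℂ → ℂ}
    (hF : F ∈ Form D.wt 1 (sOpen σ (rim Vp' Vp)))
    (hF' : F ∈ Form D.wt 1 (sOpen σ (rim (Vq' ⊔ Vp') W))) (hd' : Disjoint Vq' Vp') (x : D.UL Vq') (y : D.UL Vp') :
    D.facProd hVq hVp hd (D.extUL lq x) (D.opn σ a lp F y) =
      D.opn σ a hs F
        (D.facProd (le_sup_left : Vq' ≤ Vq' ⊔ Vp') (le_sup_right : Vp' ≤ Vq' ⊔ Vp') hd' x y) := by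
  obtain ⟨P, hP⟩ := D.cls_surjective x
  obtain ⟨Q, hQ⟩ := D.cls_surjective y
  rw [← hP, ← hQ, facProd_cls D (le_sup_left : Vq' ≤ Vq' ⊔ Vp') (le_sup_right : Vp' ≤ Vq' ⊔ Vp') hd']
  exact facProd_opn_right_cls a hVq hVp hd lq lp hs hF hF' P Q

theorem extUL_facProd (h : V ≤ W) (hq : Vq ≤ V) (hp : Vp ≤ V) (hd : Disjoint Vq Vp) (x : D.UL Vq)
    (y : D.UL Vp) : D.extUL h (D.facProd hq hp hd x y) =
      D.facProd (hq.trans h) (hp.trans h) hd x y := by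
  obtain ⟨P, rfl⟩ := D.cls_surjective x
  obtain ⟨Q, rfl⟩ := D.cls_surjective y
  rw [facProd_cls, facProd_cls, extUL_cls, map_mul (D.extCE h), extCE_extCE, extCE_extCE]

theorem closure_sup (V V' : Opens Sphere) : closure ((V ⊔ V' : Opens Sphere) : Set Sphere) =
    closure (V : Set Sphere) ∪ closure (V' : Set Sphere) := by
  rw [Opens.coe_sup, closure_union]

theorem mem_rim_sup_left (hVq : Vq ≤ W) (hd : Disjoint Vq Vp) (lp : Vp' ≤ Vp) {x : Sphere}
    (hx : x ∈ rim Vq' Vq) : x ∈ rim (Vq' ⊔ Vp') W := by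
  refine ⟨hVq hx.1, ?_⟩
  change x ∉ closure _
  rw [closure_sup]
  rintro (h | h)
  · exact hx.2 h
  · have hd'' : Disjoint (Vq : Set Sphere) (closure (Vp : Set Sphere)) :=
      (Opens.coe_disjoint.2 hd).closure_right Vq.isOpen
    exact Set.disjoint_left.1 hd'' hx.1 (closure_mono lp h)

theorem mem_rim_sup_right (hVp : Vp ≤ W) (hd : Disjoint Vq Vp) (lq : Vq' ≤ Vq) {x : Sphere}
    (hx : x ∈ rim Vp' Vp) : x ∈ rim (Vq' ⊔ Vp') W := by
  rw [sup_comm]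
  exact mem_rim_sup_left hVp hd.symm lq hx

/-- A shell around one of two points is the difference of a shell around both points and of a
shell around the other point. -/
theorem opn_split (a : 𝔞) (hVq : Vq ≤ W) (hVp : Vp ≤ W) (hd : Disjoint Vq Vp) (lq : Vq' ≤ Vq)
    (lp : Vp' ≤ Vp) (hs : Vq' ⊔ Vp' ≤ W) {ρq ρp : ℂ → ℂ} (fq : Fits σ Vq' Vq ρq)
    (fp : Fits σ Vp' Vp ρp) (f : Fits σ V₁ W ρ) (hV₁ : Vq' ⊔ Vp' ≤ V₁) {h : ℂ → ℂ}
    (hh : ∀ z : ℂ, ((ev σ z : ℂ) : Sphere) ∉ closure (Vq' : Set Sphere) → AnalyticAt ℂ h z)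
    (x : D.UL (Vq' ⊔ Vp')) :
    D.opn σ a hs (sh h ρq) x = D.opn σ a hs (sh h ρ) x - D.opn σ a hs (sh h ρp) x := by
  have hrim : ∀ z : ℂ, ((ev σ z : ℂ) : Sphere) ∈ rim (Vq' ⊔ Vp') W → AnalyticAt ℂ h z :=
    fun z hz => hh z fun hn => hz.2 (closure_mono le_sup_left hn)
  have cq : ∀ {z}, z ∈ tsupport ρq → ((ev σ z : ℂ) : Sphere) ∈ W := fun hz => hVq (fq.subset _ hz)
  have cp : ∀ {z}, z ∈ tsupport ρp → ((ev σ z : ℂ) : Sphere) ∈ W := fun hz => hVp (fp.subset _ hz)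
  have mem : ∀ {χ : ℂ → ℂ}, ContDiff ℝ ∞ χ → HasCompactSupport χ →
      (∀ z ∈ crit χ, ((ev σ z : ℂ) : Sphere) ∈ rim (Vq' ⊔ Vp') W) →
      sh h χ ∈ Form D.wt 1 (sOpen σ (rim (Vq' ⊔ Vp') W)) := fun h1 h2 h3 =>
    sh_mem_form h1 h2 fun z hz => ⟨hrim z (h3 z hz), (mem_sOpen z).2 (h3 z hz)⟩
  have mq := mem fq.smooth fq.compact fun z hz =>
    mem_rim_sup_left hVq hd lp ((mem_sOpen z).1 (fq.mem_rim hz))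
  have mp := mem fp.smooth fp.compact fun z hz =>
    mem_rim_sup_right hVp hd lq ((mem_sOpen z).1 (fp.mem_rim hz))
  have mb := mem f.smooth f.compact fun z hz =>
    rim_mono hV₁ le_rfl ((mem_sOpen z).1 (f.mem_rim hz))
  have s1 : ContDiff ℝ ∞ (ρ - ρp) := f.smooth.sub fp.smooth
  have hc1 : HasCompactSupport (ρ - ρp) := f.compact.sub fp.compact
  rw [← opn_sub D a hs mb mp, ← sh_sub f.smooth fp.smooth, ← sub_eq_zero, ← opn_sub D a hs mq
    (by rw [sh_sub f.smooth fp.smooth]; exact Submodule.sub_mem _ mb mp), ← sh_sub fq.smooth s1]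
  refine opn_sh_eq_zero D a hs (fq.smooth.sub s1) (fq.compact.sub hc1) (fun z hz => ?_) x
  have key : ((ev σ z : ℂ) : Sphere) ∈ rim (Vq' ⊔ Vp') W := by
    refine ⟨?_, ?_⟩
    · rcases tsupport_sub _ _ hz with hz | hz
      · exact cq hz
      · rcases tsupport_sub _ _ hz with hz | hz
        · exact f.subset z hz
        · exact cp hz
    · change _ ∉ closure _
      intro hn
      have hdis : ∀ {ρ' : ℂ → ℂ} {V V' V'' : Opens Sphere}, Fits σ V'' V ρ' → Disjoint V V' →
          ((ev σ z : ℂ) : Sphere) ∈ closure (V' : Set Sphere) → ρ' =ᶠ[𝓝 z] 0 := by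
        intro ρ' V V' V'' hf hdj hz'
        refine notMem_tsupport_iff_eventuallyEq.1 fun ht => ?_
        have : Disjoint (V : Set Sphere) (closure (V' : Set Sphere)) :=
          (Opens.coe_disjoint.2 hdj).closure_right V.isOpen
        exact Set.disjoint_left.1 this (hf.subset z ht) hz'
      have e1 := f.eq_one z (closure_mono hV₁ hn)
      rw [closure_sup] at hn
      refine notMem_tsupport_iff_eventuallyEq.2 ?_ hz
      rcases hn with hn | hn
      · filter_upwards [e1, fq.eq_one z hn, hdis fp hd.symm (closure_mono lq hn)] with y h1 h2 h3
        simp [h1, h2, h3]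
      · filter_upwards [e1, fp.eq_one z hn, hdis fq hd (closure_mono lp hn)] with y h1 h2 h3
        simp [h1, h2, h3]
  exact ⟨hrim z key, key⟩

end

end Datum

end

end SphereVA

end

noncomputable section

namespace SphereVA

open Filter
open Datum (dir)

section

variable {𝔞 : Type*} [AddCommGroup 𝔞] [Module ℂ 𝔞] {D : Datum 𝔞}
  {σ : Bool} {U V W : Opens Sphere} {p q : ℂ} {ρ : ℂ → ℂ}

theorem disc_mono (p : ℂ) {r R : ℝ} (h : r ≤ R) : disc p r ≤ disc p R := by
  rintro _ ⟨z, hz, rfl⟩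
  exact ⟨z, Metric.ball_subset_ball h hz, rfl⟩

theorem infty_notMem_disc (p : ℂ) (R : ℝ) : (OnePoint.infty : Sphere) ∉ disc p R := by
  rintro ⟨z, -, hz⟩
  exact OnePoint.coe_ne_infty z hz

namespace Datum

theorem opn_smul (a : 𝔞) (h : V ≤ W) (c : ℂ) {F : ℂ → ℂ}
    (hF : F ∈ Form D.wt 1 (sOpen σ (rim V W))) (x : D.UL V) :
    D.opn σ a h (c • F) x = c • D.opn σ a h F x := by
  rw [opn, ins_smul D a c hF, map_smul, map_smul]; rfl

/-- The factorisation products of `A` at `q` with states at `p` have the expansion which is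
described by the modes of `A`, and this is uniform over families of functionals. -/
def HasExpansion (hD : D.Admissible) (hG : D.Geometric) (p q : ℂ) (A : D.State) : Prop :=
  ∀ (R : ℝ) (hR : 0 < R), ‖q - p‖ < R → ∀ (ι : Type) (φ : ι → D.UL (disc p R) →ₗ[ℂ] ℂ), Equi φ →
    ∀ (Vq Vp : Opens Sphere) (hq : (q : Sphere) ∈ Vq) (hp : (p : Sphere) ∈ Vp)
      (hVq : Vq ≤ disc p R) (hVp : Vp ≤ disc p R) (hV : Disjoint Vq Vp) (B : D.State),
      Expands (fun i x => charac (q - p) x *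
          φ i (prepare hG p (disc p R) (mem_disc hR) (vop hD x A B)))
        fun i => φ i (D.facProd hVq hVp hV (prepare hG q Vq hq A) (prepare hG p Vp hp B))

variable {hD : D.Admissible} {hG : D.Geometric}

theorem HasExpansion.vacuum : HasExpansion hD hG p q D.vacuum := by
  intro R hR _ ι φ hφ Vq Vp hq hp hVq hVp hV B
  have e : D.facProd hVq hVp hV (prepare hG q Vq hq D.vacuum) (prepare hG p Vp hp B) =
      prepare hG p (disc p R) (mem_disc hR) B := by
    rw [prepare_vacuum, ← extUL_prepare hG hp hVp]
    obtain ⟨P, hP⟩ := D.cls_surjective (prepare hG p Vp hp B)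
    rw [← hP, facProd_cls, extUL_cls, map_one (D.extCE hVq), one_mul]
  have h1 : ∀ i (x : ℤ × ℤ), x ≠ (-1, -1) → charac (q - p) x *
      φ i (prepare hG p (disc p R) (mem_disc hR) (vop hD x D.vacuum B)) = 0 := fun i x hx => by
    rw [vop_vacuum, if_neg hx, LinearMap.zero_apply, map_zero, map_zero, mul_zero]
  have h2 : ∀ i, charac (q - p) (-1, -1) *
      φ i (prepare hG p (disc p R) (mem_disc hR) (vop hD (-1, -1) D.vacuum B)) =
      φ i (prepare hG p (disc p R) (mem_disc hR) B) := fun i => by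
    rw [vop_vacuum, if_pos rfl, LinearMap.id_apply, charac_neg_one, one_mul]
  refine ⟨?_, fun i => ?_⟩
  · have hi : Function.Injective fun i : ι => ((i, (-1, -1)) : ι × (ℤ × ℤ)) := fun i j h => by
      simpa using h
    rw [← hi.summable_iff fun x hx => h1 _ _ fun h => hx ⟨x.1, by rw [← h]⟩]
    refine (hφ.summable (infty_notMem_disc p R) (prepare hG p (disc p R) (mem_disc hR) B)).congr ?_
    exact fun i => (h2 i).symm
  · rw [e]
    change HasSum _ (φ i _)
    rw [← h2]
    exact hasSum_single _ fun x hx => h1 i x hx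

theorem facProd_add_left (hU : U ≤ W) (hV : V ≤ W) (h : Disjoint U V) (x y : D.UL U) (v : D.UL V) :
    D.facProd hU hV h (x + y) v = D.facProd hU hV h x v + D.facProd hU hV h y v := by
  rw [map_add]; rfl

theorem facProd_smul_left (hU : U ≤ W) (hV : V ≤ W) (h : Disjoint U V) (c : ℂ) (x : D.UL U)
    (v : D.UL V) : D.facProd hU hV h (c • x) v = c • D.facProd hU hV h x v := by
  rw [map_smul]; rfl

theorem HasExpansion.add {A A' : D.State} (h : HasExpansion hD hG p q A)
    (h' : HasExpansion hD hG p q A') : HasExpansion hD hG p q (A + A') := by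
  intro R hR hlt ι φ hφ Vq Vp hq hp hVq hVp hV B
  refine ((h R hR hlt ι φ hφ Vq Vp hq hp hVq hVp hV B).add
    (h' R hR hlt ι φ hφ Vq Vp hq hp hVq hVp hV B)).of_eq (fun i x => ?_) fun i => ?_
  · rw [map_add (vop hD x), LinearMap.add_apply, map_add, map_add, mul_add]
  · rw [map_add (prepare hG q Vq hq), facProd_add_left, map_add]

theorem HasExpansion.smul {A : D.State} (h : HasExpansion hD hG p q A) (c : ℂ) :
    HasExpansion hD hG p q (c • A) := by
  intro R hR hlt ι φ hφ Vq Vp hq hp hVq hVp hV B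
  refine ((h R hR hlt ι φ hφ Vq Vp hq hp hVq hVp hV B).const_mul c).of_eq (fun i x => ?_) fun i => ?_
  · rw [map_smul (vop hD x), LinearMap.smul_apply, map_smul, map_smul, smul_eq_mul, mul_left_comm]
  · rw [map_smul (prepare hG q Vq hq), facProd_smul_left, map_smul, smul_eq_mul]

section create

variable {Vq Vp Vq' Vp' : Opens Sphere} {A : D.State} {ι : Type} {R : ℝ}

/-- The expansion of a large shell around both points. -/
theorem HasExpansion.outer (h : HasExpansion hD hG p q A) (hne : q ≠ p) (hR : 0 < R)
    {φ : ι → D.UL (disc p R) →ₗ[ℂ] ℂ} (hφ : Equi φ) {r : ℝ} (hr : 0 < r) (hqr : ‖q - p‖ < r)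
    (hrR : r ≤ R) (fr : Fits σ (disc p r) (disc p R) ρ) (hq : (q : Sphere) ∈ Vq')
    (hp : (p : Sphere) ∈ Vp') (lq : Vq' ≤ disc p r) (lp : Vp' ≤ disc p r) (hd : Disjoint Vq' Vp')
    (hs : Vq' ⊔ Vp' ≤ disc p R) (m : ℕ) (a : 𝔞) (B : D.State) :
    Expands (fun i x => charac (q - p) x * ∑' k : ℕ, ((k + m).choose m : ℂ) *
        φ i (prepare hG p (disc p R) (mem_disc hR)
          (D.act σ (-(k + m : ℕ) - 1) a (vop hD (x + (k : ℤ) • dir σ) A B))))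
      fun i => φ i (D.opn σ a hs (sh (fun z => (z - ev σ q) ^ (-m - 1 : ℤ)) ρ)
        (D.facProd (le_sup_left : Vq' ≤ Vq' ⊔ Vp') (le_sup_right : Vp' ≤ Vq' ⊔ Vp') hd
          (prepare hG q Vq' hq A) (prepare hG p Vp' hp B))) := by
  set t := ev σ (q - p) with ht
  have ht0 : t ≠ 0 := ev_ne_zero σ (sub_ne_zero.2 hne)
  have htr : ‖t‖ < r := by rwa [ht, norm_ev]
  have hQ : ev σ q = ev σ p + t := by rw [ht, ev_sub]; ring
  have hl := disc_mono p hrR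
  have hm : ∀ k : ℕ, sh (fun z => (z - ev σ p) ^ (-(k + m : ℕ) - 1 : ℤ)) ρ ∈
      Form D.wt 1 (sOpen σ (rim (disc p r) (disc p R))) := fun k => fr.zpow_mem (mem_disc hr) _ _
  have hF := rapidForms_of_fits (D := D) fr hm le_rfl (rapid_outer hr fr htr m)
  have hf : sh (fun z => (z - ev σ q) ^ (-m - 1 : ℤ)) ρ ∈
      Form D.wt 1 (sOpen σ (rim (disc p r) (disc p R))) := fr.zpow_mem (mem_disc_iff.2 hqr) _ _
  have hsum := fun i x => hφ.hasSum_opn a hl (infty_notMem_disc p r) hF hf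
    (fun z => by rw [hQ]; exact hasSum_outer fr htr m z) i x
  have key := (h r hr hqr _ _ (hφ.comp_opn a hl hF) Vq' Vp' hq hp lq lp hd B).tsum
    (fun k => Equiv.addRight ((k : ℤ) • dir σ)) fun i => hsum i _
  refine key.of_eq (fun i x => ?_) fun i => ?_
  · rw [← tsum_mul_left]
    refine tsum_congr fun k => ?_
    rw [Equiv.coe_addRight, LinearMap.comp_apply, opn_smul a hl _ (hm k),
      ← prepare_act hG _ a _ (mem_disc hr) hl fr, map_smul, smul_eq_mul,
      charac_add (sub_ne_zero.2 hne), ← ht, zpow_neg, zpow_natCast]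
    field_simp
  · rw [← opn_extUL D a (sup_le lq lp) hl hf, extUL_facProd]

theorem facProd_prepare_act (hq : (q : Sphere) ∈ Vq') (hp : (p : Sphere) ∈ Vp') (hVq : Vq ≤ W)
    (hVp : Vp ≤ W) (hV : Disjoint Vq Vp) (lq : Vq' ≤ Vq) (lp : Vp' ≤ Vp) (hd : Disjoint Vq' Vp')
    (hs : Vq' ⊔ Vp' ≤ W) (fp : Fits σ Vp' Vp ρ) (n : ℤ) (a : 𝔞) (A B : D.State) :
    D.facProd hVq hVp hV (prepare hG q Vq (lq hq) A) (prepare hG p Vp (lp hp) (D.act σ n a B)) =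
      D.opn σ a hs (sh (fun z => (z - ev σ p) ^ n) ρ) (D.facProd (le_sup_left : Vq' ≤ Vq' ⊔ Vp')
        (le_sup_right : Vp' ≤ Vq' ⊔ Vp') hd (prepare hG q Vq' hq A) (prepare hG p Vp' hp B)) := by
  have h1 := prepare_act hG n a B hp lp fp
  have h2 := extUL_prepare hG hq lq A
  have h3 : sh (fun z => (z - ev σ p) ^ n) ρ ∈ Form D.wt 1 (sOpen σ (rim (Vq' ⊔ Vp') W)) :=
    sh_mem_form fp.smooth fp.compact fun z hz => ⟨fp.analyticAt_zpow hp _ hz,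
      (mem_sOpen z).2 (mem_rim_sup_right hVp hV lq ((mem_sOpen z).1 (fp.mem_rim hz)))⟩
  rw [h1, ← h2]
  exact facProd_opn_right a hVq hVp hV lq lp hs (fp.zpow_mem hp n _) h3 hd _ _

theorem facProd_prepare_act_left (hq : (q : Sphere) ∈ Vq') (hp : (p : Sphere) ∈ Vp') (hVq : Vq ≤ W)
    (hVp : Vp ≤ W) (hV : Disjoint Vq Vp) (lq : Vq' ≤ Vq) (lp : Vp' ≤ Vp) (hd : Disjoint Vq' Vp')
    (hs : Vq' ⊔ Vp' ≤ W) (fq : Fits σ Vq' Vq ρ) (n : ℤ) (a : 𝔞) (A B : D.State) :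
    D.facProd hVq hVp hV (prepare hG q Vq (lq hq) (D.act σ n a A)) (prepare hG p Vp (lp hp) B) =
      D.opn σ a hs (sh (fun z => (z - ev σ q) ^ n) ρ) (D.facProd (le_sup_left : Vq' ≤ Vq' ⊔ Vp')
        (le_sup_right : Vp' ≤ Vq' ⊔ Vp') hd (prepare hG q Vq' hq A) (prepare hG p Vp' hp B)) := by
  have h1 := prepare_act hG n a A hq lq fq
  have h2 := extUL_prepare hG hp lp B
  have h3 : sh (fun z => (z - ev σ q) ^ n) ρ ∈ Form D.wt 1 (sOpen σ (rim (Vq' ⊔ Vp') W)) :=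
    sh_mem_form fq.smooth fq.compact fun z hz => ⟨fq.analyticAt_zpow hq _ hz,
      (mem_sOpen z).2 (mem_rim_sup_left hVq hV lp ((mem_sOpen z).1 (fq.mem_rim hz)))⟩
  rw [h1, ← h2]
  exact facProd_opn_left a hVq hVp hV lq lp hs (fq.zpow_mem hq n _) h3 hd _ _

/-- The insertion of a shell around the point `p`, as a finite sum of states at `p`. -/
theorem apply_opn_inner {φ : ι → D.UL W →ₗ[ℂ] ℂ} (hφ : Equi φ) (hne : q ≠ p)
    (hinf : (OnePoint.infty : Sphere) ∉ W) (hq : (q : Sphere) ∈ Vq')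
    (hp : (p : Sphere) ∈ Vp') (hVp : Vp ≤ W) (hV : Disjoint Vq Vp)
    (lq : Vq' ≤ Vq) (hs : Vq' ⊔ Vp' ≤ W)
    (fp : Fits σ Vp' Vp ρ) {y : ℝ} (hy : 0 ≤ y) (hy1 : y < 1)
    (hb : ∀ z ∈ tsupport ρ, ‖z - ev σ p‖ ≤ y * ‖ev σ (q - p)‖) (m : ℕ) (a : 𝔞) (i : ι)
    (X : D.UL (Vq' ⊔ Vp')) {N : ℕ} {X' : ℕ → D.UL W}
    (hX : ∀ k : ℕ, X' k = D.opn σ a hs (sh (fun z => (z - ev σ p) ^ (k : ℤ)) ρ) X)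
    (hN : ∀ k : ℕ, N ≤ k → X' k = 0) :
    φ i (D.opn σ a hs (sh (fun z => (z - ev σ q) ^ (-m - 1 : ℤ)) ρ) X) = ∑ k ∈ Finset.range N,
      -(bin (-k - 1) m * ev σ (q - p) ^ (-(k + m + 1) : ℤ)) * φ i (X' k) := by
  set t := ev σ (q - p) with ht
  have ht0 : t ≠ 0 := ev_ne_zero σ (sub_ne_zero.2 hne)
  have hQ : ev σ q = ev σ p + t := by rw [ht, ev_sub]; ring
  have hrim : ∀ z ∈ crit ρ, (z : Sphere) ∈ sOpen σ (rim (Vq' ⊔ Vp') W) := fun z hz =>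
    (mem_sOpen z).2 (mem_rim_sup_right hVp hV lq ((mem_sOpen z).1 (fp.mem_rim hz)))
  have hm : ∀ k : ℕ, sh (fun z => (z - ev σ p) ^ (k : ℤ)) ρ ∈
      Form D.wt 1 (sOpen σ (rim (Vq' ⊔ Vp') W)) := fun k =>
    sh_mem_form fp.smooth fp.compact fun z hz => ⟨fp.analyticAt_zpow hp _ hz, hrim z hz⟩
  have hF := rapidForms_of_fits (D := D) fp hm hVp (rapid_inner hy hy1 fp ht0 hb m)
  have hq' : (q : Sphere) ∈ Vq' ⊔ Vp' := (le_sup_left : Vq' ≤ Vq' ⊔ Vp') hq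
  have hf : sh (fun z => (z - ev σ q) ^ (-m - 1 : ℤ)) ρ ∈
      Form D.wt 1 (sOpen σ (rim (Vq' ⊔ Vp') W)) :=
    sh_mem_form fp.smooth fp.compact fun z hz => ⟨analyticAt_zpow_sub _
      (Fits.ne_center hq' ((mem_sOpen z).1 (hrim z hz))), hrim z hz⟩
  refine (hφ.hasSum_opn a hs (fun hn => hinf (hs hn)) hF hf
    (fun z => by rw [hQ]; exact hasSum_inner hy1 ht0 hb m z) i X).unique ?_
  have hterm : ∀ k : ℕ, φ i (D.opn σ a hs ((-(bin (-k - 1) m * t ^ (-(k + m + 1) : ℤ))) •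
      sh (fun z => (z - ev σ p) ^ (k : ℤ)) ρ) X) =
      -(bin (-k - 1) m * t ^ (-(k + m + 1) : ℤ)) * φ i (X' k) := fun k => by
    rw [opn_smul a hs _ (hm k), map_smul, smul_eq_mul, hX]
  simp only [hterm]
  refine hasSum_sum_of_ne_finset_zero fun k hk => ?_
  rw [hN k (by simpa using hk), map_zero, mul_zero]

/-- The expansion of a small shell around the point `p`. -/
theorem HasExpansion.inner (h : HasExpansion hD hG p q A) (hne : q ≠ p) (hR : 0 < R)
    (hqR : ‖q - p‖ < R) {φ : ι → D.UL (disc p R) →ₗ[ℂ] ℂ} (hφ : Equi φ) (hq : (q : Sphere) ∈ Vq')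
    (hp : (p : Sphere) ∈ Vp') (hVq : Vq ≤ disc p R) (hVp : Vp ≤ disc p R) (hV : Disjoint Vq Vp)
    (lq : Vq' ≤ Vq) (lp : Vp' ≤ Vp) (hd : Disjoint Vq' Vp') (hs : Vq' ⊔ Vp' ≤ disc p R)
    (fp : Fits σ Vp' Vp ρ) {y : ℝ} (hy : 0 ≤ y) (hy1 : y < 1)
    (hb : ∀ z ∈ tsupport ρ, ‖z - ev σ p‖ ≤ y * ‖ev σ (q - p)‖) (m : ℕ) (a : 𝔞) (B : D.State)
    {N : ℕ} (hN : ∀ k : ℕ, N ≤ k → D.act σ k a B = 0) :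
    Expands (fun i x => charac (q - p) x * ∑ k ∈ Finset.range N, bin (-k - 1) m *
        φ i (prepare hG p (disc p R) (mem_disc hR)
          (vop hD (x - (k + m + 1 : ℤ) • dir σ) A (D.act σ k a B))))
      fun i => -φ i (D.opn σ a hs (sh (fun z => (z - ev σ q) ^ (-m - 1 : ℤ)) ρ)
        (D.facProd (le_sup_left : Vq' ≤ Vq' ⊔ Vp') (le_sup_right : Vp' ≤ Vq' ⊔ Vp') hd
          (prepare hG q Vq' hq A) (prepare hG p Vp' hp B))) := by
  have hval := fun i => apply_opn_inner (i := i) hφ hne (infty_notMem_disc p R) hq hp hVp hV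
    lq hs fp hy hy1 hb m a _
    (fun k => facProd_prepare_act (hG := hG) hq hp hVq hVp hV lq lp hd hs fp (k : ℤ) a A B)
    fun k hk => by rw [hN k hk, map_zero, map_zero]
  have key := Expands.sum (T := Finset.range N) fun k _ =>
    ((h R hR hqR _ _ hφ Vq Vp (lq hq) (lp hp) hVq hVp hV (D.act σ k a B)).reindex
      (Equiv.addRight (-(k + m + 1 : ℤ) • dir σ))).const_mul (bin (-k - 1) m * ev σ (q - p) ^ (-(k + m + 1) : ℤ))
  refine key.of_eq (fun i x => ?_) fun i => ?_
  · rw [Finset.mul_sum]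
    refine Finset.sum_congr rfl fun k _ => ?_
    have ht0 := zpow_ne_zero (k + m + 1 : ℤ) (ev_ne_zero σ (sub_ne_zero.2 hne))
    rw [Equiv.coe_addRight, charac_add (sub_ne_zero.2 hne), neg_neg, zpow_neg]
    beta_reduce
    rw [neg_smul, ← sub_eq_add_neg]
    field_simp
  · rw [hval, ← Finset.sum_neg_distrib]
    exact Finset.sum_congr rfl fun k _ => by rw [neg_mul, neg_neg]

theorem HasExpansion.create (hne : q ≠ p) (h : HasExpansion hD hG p q A) (σ : Bool) (m : ℕ) (a : 𝔞) :
    HasExpansion hD hG p q (D.act σ (-m - 1) a A) := by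
  intro R hR hqR ι φ hφ Vq Vp hq hp hVq hVp hV B
  have h0 : 0 < ‖q - p‖ := norm_pos_iff.2 (sub_ne_zero.2 hne)
  obtain ⟨s₁, hs₁, b₁⟩ := exists_closedBall_subset hq
  obtain ⟨s₂, hs₂, b₂⟩ := exists_closedBall_subset hp
  set s := min (min s₁ s₂) (min ((R - ‖q - p‖) / 4) (‖q - p‖ / 2)) with hs
  have i1 : s ≤ s₁ := (min_le_left _ _).trans (min_le_left _ _)
  have i2 : s ≤ s₂ := (min_le_left _ _).trans (min_le_right _ _)
  have i3 : s ≤ (R - ‖q - p‖) / 4 := (min_le_right _ _).trans (min_le_left _ _)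
  have i4 : s ≤ ‖q - p‖ / 2 := (min_le_right _ _).trans (min_le_right _ _)
  have hs0 : 0 < s := lt_min (lt_min hs₁ hs₂) (lt_min (by linarith) (by linarith))
  clear_value s
  obtain ⟨ρq, fq⟩ := exists_fits_of_closedBall (σ := σ) (half_pos hs0) (half_lt_self hs0)
    (U := Vq) fun z hz => b₁ z (hz.trans i1)
  obtain ⟨ρp, fp'⟩ := exists_fits_of_closedBall (σ := σ) (p := p) (half_pos hs0) (s := 3 / 4 * s)
    (by linarith) (U := Vp ⊓ disc p s)
    fun z hz => ⟨b₂ z (by linarith), mem_disc_iff.2 (by linarith)⟩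
  have fp : Fits σ (disc p (s / 2)) Vp ρp := fp'.mono le_rfl inf_le_left
  set r := (‖q - p‖ + R) / 2 with hr
  obtain ⟨ρ, f⟩ := exists_fits_of_closedBall (σ := σ) (p := p) (r := r) (s := (r + R) / 2)
    (U := disc p R) (by linarith) (by linarith) fun z hz => mem_disc_iff.2 (by linarith)
  have lq : disc q (s / 2) ≤ Vq := by
    rintro _ ⟨z, hz, rfl⟩
    rw [Metric.mem_ball, dist_eq_norm] at hz
    exact b₁ z (by linarith)
  have lp : disc p (s / 2) ≤ Vp := by
    rintro _ ⟨z, hz, rfl⟩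
    rw [Metric.mem_ball, dist_eq_norm] at hz
    exact b₂ z (by linarith)
  have lqr : disc q (s / 2) ≤ disc p r := by
    rintro _ ⟨z, hz, rfl⟩
    rw [Metric.mem_ball, dist_eq_norm] at hz
    refine mem_disc_iff.2 ?_
    have := norm_add_le (z - q) (q - p)
    rw [sub_add_sub_cancel] at this
    linarith
  have lpr : disc p (s / 2) ≤ disc p r := disc_mono p (by linarith)
  have hd : Disjoint (disc q (s / 2)) (disc p (s / 2)) := hV.mono lq lp
  have hrR : r ≤ R := by linarith
  have hle : disc q (s / 2) ⊔ disc p (s / 2) ≤ disc p R := (sup_le lqr lpr).trans (disc_mono p hrR)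
  have mq := mem_disc (p := q) (half_pos hs0)
  have mp := mem_disc (p := p) (half_pos hs0)
  obtain ⟨N, hN⟩ := smooth hD B
  have hN' : ∀ k : ℕ, N ≤ k → D.act σ k a B = 0 := fun k hk => hN σ k (by exact_mod_cast hk) a
  have e1 := h.outer hne hR hφ (r := r) (by linarith) (by linarith) hrR f mq mp lqr lpr hd hle m a B
  have e2 := h.inner hne hR hqR hφ mq mp hVq hVp hV lq lp hd hle fp (y := 1 / 2) (by norm_num)
    (by norm_num) (fun z hz => by
      have := mem_disc_iff.1 (fp'.subset z hz).2
      rw [norm_sub_ev] at this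
      rw [norm_ev]
      linarith) m a B hN'
  refine (e1.add e2).of_eq (fun i x => ?_) fun i => ?_
  · have := apply_vop_create hD (φ i ∘ₗ prepare hG p (disc p R) (mem_disc hR)) σ m a A B x N hN'
    rw [← mul_add]
    exact congrArg _ this
  · have e := facProd_prepare_act_left (hG := hG) mq mp hVq hVp hV lq lp hd hle fq (-m - 1) a A B
    have e' := fun X => opn_split (D := D) a hVq hVp hV lq lp hle fq fp f (sup_le lqr lpr)
      (h := fun z => (z - ev σ q) ^ (-m - 1 : ℤ))
      (fun z hz => analyticAt_zpow_sub _ fun e => hz (by rw [e, ev_ev]; exact subset_closure mq)) X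
    have e'' : ∀ x y, φ i (x - y) = φ i x + -φ i y := fun x y => by rw [map_sub, sub_eq_add_neg]
    exact (congrArg (φ i) (e.trans (e' _))).trans (e'' _ _)

end create

theorem hasExpansion (hD : D.Admissible) (hG : D.Geometric) (hne : q ≠ p) (A : D.State) :
    HasExpansion hD hG p q A := by
  induction A using state_induction hD with
  | hv => exact .vacuum
  | ha s t h h' => exact h.add h'
  | hs c s h => exact h.smul c
  | hm σ m a s h => exact h.create hne σ m a

end Datum

end

end SphereVA

end

noncomputable section

namespace SphereVA

namespace Datum

variable {𝔞 : Type*} [AddCommGroup 𝔞] [Module ℂ 𝔞] {D : Datum 𝔞}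

theorem isVertexOperator_vertexOperator (hD : D.Admissible) (hG : D.Geometric) :
    D.IsVertexOperator (prepare hG) (vertexOperator hD) where
  normal_ordering n n' la lb B := normalOrdered_eq hD la lb n n' B
  factorisation _ _ R hR hne hqR Vq Vp hq hp hVq hVp hV A B φ hφ :=
    (hasExpansion hD hG hne A R hR hqR Unit (fun _ => φ) (equi_of_isContinuousFunctional hφ)
      Vq Vp hq hp hVq hVp hV B).2 ()

theorem isVertexOperator_unique (hD : D.Admissible) {prep : D.Preparation}
    {Y Y' : ℤ → ℤ → D.State →ₗ[ℂ] D.State →ₗ[ℂ] D.State} (h : D.IsVertexOperator prep Y)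
    (h' : D.IsVertexOperator prep Y') : Y' = Y := by
  funext n n'
  refine LinearMap.ext_on (span_monomial hD) ?_
  rintro _ ⟨la, lb, rfl⟩
  refine LinearMap.ext fun B => ?_
  rw [h.normal_ordering, h'.normal_ordering]

theorem exists_fullVertexAlgebra (hD : D.Admissible) (hG : D.Geometric) :
    ∃ prep : D.Preparation, D.IsPreparation prep ∧
      (∀ prep', D.IsPreparation prep' → prep' = prep) ∧
      ∃ Y, D.IsVertexOperator prep Y ∧ (∀ Y', D.IsVertexOperator prep Y' → Y' = Y) ∧
        IsFullVertexAlgebra D.grading (realModes Y) D.vacuum :=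
  ⟨prepare hG, isPreparation_prepare hG,
    fun _ h => isPreparation_unique hD (isPreparation_prepare hG) h,
    vertexOperator hD, isVertexOperator_vertexOperator hD hG,
    fun _ h => isVertexOperator_unique hD (isVertexOperator_vertexOperator hD hG) h,
    isFullVertexAlgebra hD⟩

end Datum

end SphereVA

end

theorem theorem3 (𝔤 : Type*) [LieRing 𝔤] [LieAlgebra ℂ 𝔤] [FiniteDimensional ℂ 𝔤]
    (κ : LinearMap.BilinForm ℂ 𝔤) (hsymm : ∀ x y, κ x y = κ y x)
    (hinv : ∀ x y z, κ ⁅x, y⁆ z = κ x ⁅y, z⁆) (c : ℝ) :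
    (∃ prep : (SphereVA.kacMoody 𝔤 κ hsymm hinv).Preparation,
      (SphereVA.kacMoody 𝔤 κ hsymm hinv).IsPreparation prep ∧
      (∀ prep', (SphereVA.kacMoody 𝔤 κ hsymm hinv).IsPreparation prep' → prep' = prep) ∧
      ∃ Y, (SphereVA.kacMoody 𝔤 κ hsymm hinv).IsVertexOperator prep Y ∧
        (∀ Y', (SphereVA.kacMoody 𝔤 κ hsymm hinv).IsVertexOperator prep Y' → Y' = Y) ∧
        IsFullVertexAlgebra (SphereVA.kacMoody 𝔤 κ hsymm hinv).grading (realModes Y)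
          (SphereVA.kacMoody 𝔤 κ hsymm hinv).vacuum) ∧
    (∃ prep : (SphereVA.virasoro c).Preparation,
      (SphereVA.virasoro c).IsPreparation prep ∧
      (∀ prep', (SphereVA.virasoro c).IsPreparation prep' → prep' = prep) ∧
      ∃ Y, (SphereVA.virasoro c).IsVertexOperator prep Y ∧
        (∀ Y', (SphereVA.virasoro c).IsVertexOperator prep Y' → Y' = Y) ∧
        IsFullVertexAlgebra (SphereVA.virasoro c).grading (realModes Y)
          (SphereVA.virasoro c).vacuum) :=
  ⟨SphereVA.Datum.exists_fullVertexAlgebra (SphereVA.kacMoody_admissible κ hsymm hinv)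
      (SphereVA.kacMoody_geometric 𝔤 κ hsymm hinv),
    SphereVA.Datum.exists_fullVertexAlgebra (SphereVA.virasoro_admissible c)
      (SphereVA.virasoro_geometric c)⟩
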